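/- **Conventions.** Let $g\ge 2$. $\mathbb M_g$ denotes the moduli space of metric graphs of genus $g$: the disjoint union of the closed orthants $\mathbb R_{\ge 0}^{E(G)}$ over all connected stable vertex-weighted multigraphs $G$ of genus $g$ (genus $=\#E-\#V+1+\sum_v w(v)$; stable means $2w(v)-2+\mathrm{val}(v)>0$ at every vertex $v$), where two points are identified if they become isomorphic after contracting all edges of length $0$ (a contracted connected subgraph becomes a vertex whose weight is the genus of that subgraph), with the quotient topology. The dimension of a subset of $\mathbb M_g$ is the maximum of the dimensions of its preimages in the orthants $\mathbb R_{\ge0}^{E(G)}$. For a lattice polygon $P$ with exactly $g$ interior lattice points (a polygon of genus $g$) and a height function $h:P\cap\mathbb Z^2\to\mathbb R$, the tropical curve $C_h$ is the set of $(x,y)\in\mathbb R^2$ at which $\min_{(i,j)\in P\cap\mathbb Z^2}(ix+jy+h(i,j))$ is attained at least twice. It is smooth if the regular subdivision of $P\cap\mathbb Z^2$ induced by $h$ is a unimodular triangulation. The skeleton of a smooth $C_h$ is the unique metric graph of genus $g$ with all valences at least $3$ (and no vertex weights) that has a subdivision contained in $C_h$, with lengths measured by lattice length. Let $\mathbb M_P^\circ\subseteq\mathbb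 M_g$ be the set of skeletons of smooth tropical curves with Newton polygon $P$, and let $\mathbb M_P$ be its closure in $\mathbb M_g$. Put $\mathbb M_g^{\rm planar}=\bigcup_P\mathbb M_P$ over all lattice polygons $P$ of genus $g$, and $\mathbb M^{\rm planar}_{g,\rm hyp}=\bigcup_P\mathbb M_P$ over all hyperelliptic ones, i.e. those for which the convex hull of the interior lattice points is a line segment of lattice length $g-1$. Let $E^{(g)}_k=\mathrm{conv}\{(0,0),(0,2),(g+k,0),(g+2-k,2)\}$, so that $E^{(g)}_{g+2}=\mathrm{conv}\{(0,0),(0,2),(2g+2,0)\}$ is the hyperelliptic triangle. A chain of genus $g$ is a metric graph obtained as follows. Take a path on $g-1$ nodes whose $g-2$ edges have arbitrary lengths $\ge 0$, replace each edge by two parallel edges of the same length, and attach two loops of arbitrary lengths $\ge0$, one at each endpoint of the path (both at the single node if $g=2$), so that every node becomes $4$-valent. Then split each node into two nodes joined by a new edge of arbitrary length $\ge 0$, in one of two ways: either the two half-edges on the left side of the node are separated from the two on its right side, or the two upper half-edges are separated from the two lower ones. Let $\mathbb M_g^{\rm chain}\subseteq\mathbb M_g$ be the set of all chains. **Theorem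 6.1.** For each $g\ge 2$, $$\mathbb M_{E^{(g)}_{g+2}}\;=\;\mathbb M^{\rm planar}_{g,\rm hyp}\;\subseteq\;\mathbb M_g^{\rm chain}\cap\mathbb M_g^{\rm planar}.$$ The equality holds even before taking closures: $\mathbb M^\circ_{E^{(g)}_{g+2}}=\bigcup_P\mathbb M^\circ_P$, where $P$ runs over all hyperelliptic polygons of genus $g$. Both $\mathbb M^{\rm planar}_{g,\rm hyp}$ and $\mathbb M_g^{\rm chain}\cap\mathbb M_g^{\rm planar}$ have dimension $2g-1$. -/

import Mathlib

open scoped NNReal ENNReal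

noncomputable section

namespace TropicalModuli

/-! ### Weighted graphs and the moduli space of metric graphs -/

/-- A finite multigraph (loops and parallel edges allowed) with a natural number attached to each
vertex. -/
structure WeightedGraph : Type 1 where
  V : Type
  E : Type
  [fintypeV : Fintype V]
  [fintypeE : Fintype E]
  ends : E → Sym2 V
  weight : V → ℕ

attribute [instance] WeightedGraph.fintypeV WeightedGraph.fintypeE

namespace WeightedGraph

/-- The simple graph joining two distinct vertices when an edge belonging to `S` joins them. -/
def span (G : WeightedGraph) (S : Set G.E) : SimpleGraph G.V :=
  SimpleGraph.fromRel fun u v => ∃ e ∈ S, G.ends e = s(u, v)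

def Connected (G : WeightedGraph) : Prop := (G.span Set.univ).Connected

/-- The genus of a connected weighted graph is its first Betti number `#E - #V + 1` plus the sum
of the vertex weights. -/
def HasGenus (G : WeightedGraph) (g : ℕ) : Prop :=
  (∑ v, G.weight v) + Fintype.card G.E + 1 = g + Fintype.card G.V

open Classical in
/-- The number of half-edges at `v`; a loop counts twice. -/
def valence (G : WeightedGraph) (v : G.V) : ℕ :=
  (Finset.univ.filter fun e => v ∈ G.ends e).card +
    (Finset.univ.filter fun e => G.ends e = s(v, v)).card

/-- Stability: `2 w(v) - 2 + val(v) > 0` for each vertex. -/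
def Stable (G : WeightedGraph) : Prop := ∀ v, 2 < 2 * G.weight v + G.valence v

/-- Isomorphism of weighted graphs with edge lengths. -/
def Isometric (G : WeightedGraph) (ℓ : G.E → ℝ≥0) (G' : WeightedGraph) (ℓ' : G'.E → ℝ≥0) : Prop :=
  ∃ (f : G.V ≃ G'.V) (k : G.E ≃ G'.E), (∀ e, G'.ends (k e) = (G.ends e).map f) ∧
    (∀ v, G'.weight (f v) = G.weight v) ∧ ∀ e, ℓ' (k e) = ℓ e

open Classical in
/-- The graph obtained by contracting all edges of length zero.  A connected component `c` of the
subgraph of zero length edges becomes a vertex, whose weight is the genus of that component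
(as `c` is connected, the natural number subtraction does not truncate). -/
def contract (G : WeightedGraph) (ℓ : G.E → ℝ≥0) : WeightedGraph where
  V := (G.span {e | ℓ e = 0}).ConnectedComponent
  E := {e : G.E // ℓ e ≠ 0}
  fintypeV := Fintype.ofFinite _
  fintypeE := Fintype.ofFinite _
  ends e := (G.ends e.1).map (G.span {e | ℓ e = 0}).connectedComponentMk
  weight c :=
    (∑ v ∈ Finset.univ.filter (fun v => (G.span {e | ℓ e = 0}).connectedComponentMk v = c),
        G.weight v) +
      (Finset.univ.filter fun e => ℓ e = 0 ∧
        ∃ v ∈ G.ends e, (G.span {e | ℓ e = 0}).connectedComponentMk v = c).card + 1 -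
      (Finset.univ.filter fun v => (G.span {e | ℓ e = 0}).connectedComponentMk v = c).card

end WeightedGraph

/-- Combinatorial types of genus `g`: connected stable weighted graphs of genus `g`. -/
def StableGraph (g : ℕ) : Type 1 :=
  {G : WeightedGraph // G.Connected ∧ G.HasGenus g ∧ G.Stable}

/-- The disjoint union of the closed orthants of edge lengths, over all combinatorial types. -/
abbrev Orthants (g : ℕ) : Type 1 := Σ G : StableGraph g, (G.1.E → ℝ≥0)

/-- Two points of the orthants are identified when they become isomorphic after contraction of
the edges of length zero. -/
instance gluing (g : ℕ) : Setoid (Orthants g) where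
  r x y := (x.1.1.contract x.2).Isometric (fun e => x.2 e.1)
    (y.1.1.contract y.2) (fun e => y.2 e.1)
  iseqv :=
    { refl := fun x => ⟨Equiv.refl _, Equiv.refl _, by simp, by simp, by simp⟩
      symm := by
        rintro x y ⟨f, k, h1, h2, h3⟩
        refine ⟨f.symm, k.symm, fun e => ?_, fun v => ?_, fun e => ?_⟩
        · obtain ⟨e, rfl⟩ := k.surjective e
          rw [h1, Sym2.map_map]
          simp
        · obtain ⟨v, rfl⟩ := f.surjective v
          simp [h2]
        · obtain ⟨e, rfl⟩ := k.surjective e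
          simpa using (h3 e).symm
      trans := by
        rintro x y z ⟨f, k, h1, h2, h3⟩ ⟨f', k', h1', h2', h3'⟩
        refine ⟨f.trans f', k.trans k', fun e => ?_, fun v => ?_, fun e => ?_⟩
        · simp [h1, h1', Sym2.map_map]
        · simp [h2, h2']
        · simpa [h3] using h3' (k e) }

/-- The moduli space of metric graphs of genus `g`: the closed orthants glued along the
identifications above, with the quotient topology. -/
def Moduli (g : ℕ) : Type 1 := Quotient (gluing g)

instance (g : ℕ) : TopologicalSpace (Moduli g) :=
  inferInstanceAs (TopologicalSpace (Quotient (gluing g)))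

def Moduli.mk {g : ℕ} (G : StableGraph g) (ℓ : G.1.E → ℝ≥0) : Moduli g :=
  Quotient.mk (gluing g) ⟨G, ℓ⟩

/-- The dimension of a subset of the moduli space: the largest (Hausdorff) dimension of the
corresponding subsets of the orthants.  For a stacky fan, whose preimage in each orthant is a
finite union of convex polyhedral cones, this is the maximal dimension of these cones. -/
def dimension {g : ℕ} (S : Set (Moduli g)) : ℝ≥0∞ :=
  ⨆ G : StableGraph g, dimH {ℓ : G.1.E → ℝ≥0 | Moduli.mk G ℓ ∈ S}

/-! ### Lattice polygons -/

def toPlane (a : ℤ × ℤ) : ℝ × ℝ := ((a.1 : ℝ), (a.2 : ℝ))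

def IsLatticePolygon (P : Set (ℝ × ℝ)) : Prop :=
  (∃ s : Finset (ℤ × ℤ), P = convexHull ℝ (toPlane '' (s : Set (ℤ × ℤ)))) ∧ (interior P).Nonempty

def latticePoints (P : Set (ℝ × ℝ)) : Set (ℤ × ℤ) := {a | toPlane a ∈ P}

def interiorLatticePoints (P : Set (ℝ × ℝ)) : Set (ℤ × ℤ) := {a | toPlane a ∈ interior P}

/-- `P` is a lattice polygon of genus `g`. -/
def IsPolygonOfGenus (g : ℕ) (P : Set (ℝ × ℝ)) : Prop :=
  IsLatticePolygon P ∧ (interiorLatticePoints P).ncard = g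

/-- The convex hull of the interior lattice points. -/
def interiorHull (P : Set (ℝ × ℝ)) : Set (ℝ × ℝ) :=
  convexHull ℝ (toPlane '' interiorLatticePoints P)

/-- A polygon of genus `g` is hyperelliptic if its interior hull is a line segment of lattice
length `g - 1`. -/
def IsHyperelliptic (g : ℕ) (P : Set (ℝ × ℝ)) : Prop :=
  IsPolygonOfGenus g P ∧ ∃ p q : ℤ × ℤ, interiorHull P = segment ℝ (toPlane p) (toPlane q) ∧
    Int.gcd (q.1 - p.1) (q.2 - p.2) + 1 = g

/-- The polygon `conv {(0,0), (0,2), (g+k,0), (g+2-k,2)}`.  It is a triangle for `k = g + 2`. -/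
def hyperellipticPolygon (g k : ℕ) : Set (ℝ × ℝ) :=
  convexHull ℝ {((0 : ℝ), (0 : ℝ)), (0, 2), ((g : ℝ) + k, 0), ((g : ℝ) + 2 - k, 2)}

/-! ### Tropical plane curves -/

/-- The lattice points `(i, j)` of `P` at which `i x + j y + h(i, j)` is minimal.  For varying
`w = (x, y)` these are the cells of the regular subdivision of the lattice points of `P` given by
the height function `h` (only the values of `h` at lattice points of `P` matter). -/
def cell (P : Set (ℝ × ℝ)) (h : ℤ × ℤ → ℝ) (w : ℝ × ℝ) : Set (ℤ × ℤ) :=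
  {a ∈ latticePoints P | ∀ b ∈ latticePoints P,
    a.1 * w.1 + a.2 * w.2 + h a ≤ b.1 * w.1 + b.2 * w.2 + h b}

/-- The tropical curve: the minimum is attained at least twice. -/
def tropicalCurve (P : Set (ℝ × ℝ)) (h : ℤ × ℤ → ℝ) : Set (ℝ × ℝ) :=
  {w | (cell P h w).Nontrivial}

/-- Twice the signed area of the triangle `a b c`. -/
def doubleArea (a b c : ℤ × ℤ) : ℤ :=
  (b.1 - a.1) * (c.2 - a.2) - (c.1 - a.1) * (b.2 - a.2)

/-- The tropical curve is smooth: the regular subdivision is a unimodular triangulation, that is,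
every two-dimensional cell is a triangle of area `1/2`. -/
def IsSmooth (P : Set (ℝ × ℝ)) (h : ℤ × ℤ → ℝ) : Prop :=
  ∀ w, (∃ a ∈ cell P h w, ∃ b ∈ cell P h w, ∃ c ∈ cell P h w, doubleArea a b c ≠ 0) →
    ∃ a b c : ℤ × ℤ, cell P h w = {a, b, c} ∧ |doubleArea a b c| = 1

/-- `φ` and `γ` embed the metric graph `(G, ℓ)` into the subset `C` of the plane, isometrically
for the lattice length: the vertex `v` is sent to `φ v`, and the edge `e` of length `ℓ e` is sent
to the path `γ e` parametrized by `[0, ℓ e]`, whose velocity is a primitive integer vector at all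
but finitely many times. -/
structure IsLatticeEmbedding (G : WeightedGraph) (ℓ : G.E → ℝ≥0) (C : Set (ℝ × ℝ))
    (φ : G.V → ℝ × ℝ) (γ : G.E → ℝ → ℝ × ℝ) : Prop where
  vertex_mem : ∀ v, φ v ∈ C
  path_mem : ∀ e, ∀ t ∈ Set.Icc (0 : ℝ) (ℓ e), γ e t ∈ C
  continuousOn : ∀ e, ContinuousOn (γ e) (Set.Icc (0 : ℝ) (ℓ e))
  ends_eq : ∀ e, (G.ends e).map φ = s(γ e 0, γ e (ℓ e))
  vertex_injective : Function.Injective φ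
  path_injective : ∀ e e', ∀ t ∈ Set.Ioo (0 : ℝ) (ℓ e), ∀ t' ∈ Set.Ioo (0 : ℝ) (ℓ e'),
    γ e t = γ e' t' → e = e' ∧ t = t'
  path_ne_vertex : ∀ e v, ∀ t ∈ Set.Ioo (0 : ℝ) (ℓ e), γ e t ≠ φ v
  velocity : ∀ e, ∃ F : Finset ℝ, ∀ t ∈ Set.Ioo (0 : ℝ) (ℓ e), t ∉ F →
    ∃ p q : ℤ, IsCoprime p q ∧ HasDerivAt (γ e) ((p : ℝ), (q : ℝ)) t

/-- The metric graphs realized by smooth tropical plane curves with Newton polygon `P`, where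
`P` has genus `g`.  The skeleton of a smooth tropical curve of genus `g ≥ 2` is the metric graph
of genus `g` with all valences at least three (no vertex weights) that has a subdivision contained
in the curve; that metric graph is unique. -/
def realized (g : ℕ) (P : Set (ℝ × ℝ)) : Set (Moduli g) :=
  {x | ∃ (G : StableGraph g) (ℓ : G.1.E → ℝ≥0), x = Moduli.mk G ℓ ∧
    (∀ v, G.1.weight v = 0) ∧ (∀ e, 0 < ℓ e) ∧
    ∃ h : ℤ × ℤ → ℝ, IsSmooth P h ∧
      ∃ φ γ, IsLatticeEmbedding G.1 ℓ (tropicalCurve P h) φ γ}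

/-- The moduli space of tropical plane curves with Newton polygon `P` of genus `g`. -/
def moduliOfPolygon (g : ℕ) (P : Set (ℝ × ℝ)) : Set (Moduli g) := closure (realized g P)

/-- The moduli space of tropical plane curves of genus `g`. -/
def moduliPlanar (g : ℕ) : Set (Moduli g) :=
  ⋃ (P : Set (ℝ × ℝ)) (_ : IsPolygonOfGenus g P), moduliOfPolygon g P

/-- The moduli space of hyperelliptic tropical plane curves of genus `g`. -/
def moduliPlanarHyp (g : ℕ) : Set (Moduli g) :=
  ⋃ (P : Set (ℝ × ℝ)) (_ : IsHyperelliptic g P), moduliOfPolygon g P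

/-! ### Chains -/

/-- Each of the `g - 1` four-valent nodes `k` of the line of doubled edges and loops is split into
the two vertices `(k, false)`, `(k, true)`.  Before splitting, four half-edges are attached to
`k`, on the side `false` (left) or `true` (right), at the position `false` (bottom) or
`true` (top).  If `s k` holds, the splitting separates left from right; otherwise it separates
bottom from top. -/
def chainVertex {n : ℕ} (s : Fin n → Bool) (k : Fin n) (side pos : Bool) : Fin n × Bool :=
  (k, if s k then side else pos)

/-- The underlying graph of a chain.  Its edges are the two loops (left and right), the doubled
edges `(j, pos)` joining the nodes `j` and `j + 1`, and an edge for each split node. -/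
def chainGraph (g : ℕ) (hg : 2 ≤ g) (s : Fin (g - 1) → Bool) : WeightedGraph where
  V := Fin (g - 1) × Bool
  E := Bool ⊕ (Fin (g - 2) × Bool) ⊕ Fin (g - 1)
  ends
    | .inl false => s(chainVertex s ⟨0, by omega⟩ false false,
        chainVertex s ⟨0, by omega⟩ false true)
    | .inl true => s(chainVertex s ⟨g - 2, by omega⟩ true false,
        chainVertex s ⟨g - 2, by omega⟩ true true)
    | .inr (.inl (j, pos)) => s(chainVertex s ⟨j, by omega⟩ true pos,
        chainVertex s ⟨j + 1, by omega⟩ false pos)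
    | .inr (.inr k) => s((k, false), (k, true))
  weight _ := 0

/-- The edge lengths of a chain: the loops have lengths `a`, both edges between the nodes `j` and
`j + 1` have length `d j`, and the edge at the split node `k` has length `m k`. -/
def chainLength (g : ℕ) (hg : 2 ≤ g) (s : Fin (g - 1) → Bool) (a : Bool → ℝ≥0)
    (d : Fin (g - 2) → ℝ≥0) (m : Fin (g - 1) → ℝ≥0) : (chainGraph g hg s).E → ℝ≥0
  | .inl b => a b
  | .inr (.inl (j, _)) => d j
  | .inr (.inr k) => m k

theorem chainGraph_connected (g : ℕ) (hg : 2 ≤ g) (s : Fin (g - 1) → Bool) :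
    (chainGraph g hg s).Connected := by
  have key : ∀ u v : (chainGraph g hg s).V, ∀ e : (chainGraph g hg s).E,
      (chainGraph g hg s).ends e = s(u, v) →
      ((chainGraph g hg s).span Set.univ).Reachable u v := by
    intro u v e he
    by_cases huv : u = v
    · rw [huv]
    · exact SimpleGraph.Adj.reachable
        ((SimpleGraph.fromRel_adj _ _ _).2 ⟨huv, Or.inl ⟨e, Set.mem_univ _, he⟩⟩)
  have hmid : ∀ (k : Fin (g - 1)) (x y : Bool),
      ((chainGraph g hg s).span Set.univ).Reachable (k, x) (k, y) := by
    intro k x y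
    have h := key (k, false) (k, true) (.inr (.inr k)) rfl
    cases x <;> cases y
    · exact SimpleGraph.Reachable.refl _
    · exact h
    · exact h.symm
    · exact SimpleGraph.Reachable.refl _
  have hall : ∀ (n : ℕ) (hn : n < g - 1) (x : Bool),
      ((chainGraph g hg s).span Set.univ).Reachable (⟨0, by omega⟩, false) (⟨n, hn⟩, x) := by
    intro n
    induction n with
    | zero => exact fun hn x => hmid _ _ _
    | succ n ih =>
      intro hn x
      have h := key (chainVertex s ⟨n, by omega⟩ true true)
        (chainVertex s ⟨n + 1, hn⟩ false true) (.inr (.inl (⟨n, by omega⟩, true))) rfl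
      exact ((ih (by omega) _).trans h).trans (hmid _ _ _)
  have : Nonempty (chainGraph g hg s).V := ⟨(⟨0, by omega⟩, false)⟩
  exact ⟨fun u v => (hall u.1.1 u.1.2 u.2).symm.trans (hall v.1.1 v.1.2 v.2)⟩

theorem chainGraph_hasGenus (g : ℕ) (hg : 2 ≤ g) (s : Fin (g - 1) → Bool) :
    (chainGraph g hg s).HasGenus g := by
  have hE : Fintype.card (chainGraph g hg s).E = 2 + ((g - 2) * 2 + (g - 1)) := by
    change Fintype.card (Bool ⊕ (Fin (g - 2) × Bool) ⊕ Fin (g - 1)) = _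
    simp
  have hV : Fintype.card (chainGraph g hg s).V = (g - 1) * 2 := by
    change Fintype.card (Fin (g - 1) × Bool) = _
    simp
  have hw : ∑ v, (chainGraph g hg s).weight v = 0 := Finset.sum_eq_zero fun _ _ => rfl
  unfold WeightedGraph.HasGenus
  rw [hE, hV, hw]
  omega

/-- At every four-valent node, the two half-edges on a given side come from two different edges
(or are the two ends of the same loop). -/
theorem chainGraph_side (g : ℕ) (hg : 2 ≤ g) (s : Fin (g - 1) → Bool) (k : Fin (g - 1))
    (side : Bool) :
    ((chainGraph g hg s).ends (.inl side) =
      s(chainVertex s k side false, chainVertex s k side true)) ∨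
    (∃ j : Fin (g - 2), j.1 + (if side then 0 else 1) = k.1 ∧ ∀ pos, chainVertex s k side pos ∈
      (chainGraph g hg s).ends (.inr (.inl (j, pos)))) := by
  obtain ⟨k, hk⟩ := k
  cases side
  · rcases k with _ | k
    · exact Or.inl rfl
    · exact Or.inr ⟨⟨k, by omega⟩, rfl, fun pos => Sym2.mem_mk_right _ _⟩
  · by_cases h : k = g - 2
    · subst h
      exact Or.inl rfl
    · exact Or.inr ⟨⟨k, by omega⟩, rfl, fun pos => Sym2.mem_mk_left _ _⟩

theorem three_le_valence_of_edges (G : WeightedGraph) (v : G.V) (e₁ e₂ e₃ : G.E)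
    (h₁₂ : e₁ ≠ e₂) (h₁₃ : e₁ ≠ e₃) (h₂₃ : e₂ ≠ e₃) (h₁ : v ∈ G.ends e₁) (h₂ : v ∈ G.ends e₂)
    (h₃ : v ∈ G.ends e₃) : 3 ≤ G.valence v := by
  classical
  refine le_trans ?_ (Nat.le_add_right _ _)
  rw [← Finset.card_eq_three.2 ⟨e₁, e₂, e₃, h₁₂, h₁₃, h₂₃, rfl⟩]
  apply Finset.card_le_card
  intro x hx
  simp only [Finset.mem_insert, Finset.mem_singleton] at hx
  rw [Finset.mem_filter]
  refine ⟨Finset.mem_univ _, ?_⟩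
  rcases hx with rfl | rfl | rfl <;> assumption

theorem three_le_valence_of_loop (G : WeightedGraph) (v : G.V) (e₁ e₂ : G.E)
    (h₁₂ : e₁ ≠ e₂) (h₁ : G.ends e₁ = s(v, v)) (h₂ : v ∈ G.ends e₂) : 3 ≤ G.valence v := by
  classical
  refine Nat.add_le_add (a := 2) (c := 1) ?_ ?_
  · refine Finset.one_lt_card.2 ⟨e₁, ?_, e₂, ?_, h₁₂⟩
    · rw [Finset.mem_filter, h₁]
      exact ⟨Finset.mem_univ _, Sym2.mem_mk_left _ _⟩
    · rw [Finset.mem_filter]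
      exact ⟨Finset.mem_univ _, h₂⟩
  · refine Finset.card_pos.2 ⟨e₁, ?_⟩
    rw [Finset.mem_filter]
    exact ⟨Finset.mem_univ _, h₁⟩

theorem chainGraph_stable (g : ℕ) (hg : 2 ≤ g) (s : Fin (g - 1) → Bool) :
    (chainGraph g hg s).Stable := by
  rintro ⟨k, b⟩
  have hmid : ((k, b) : (chainGraph g hg s).V) ∈ (chainGraph g hg s).ends (.inr (.inr k)) := by
    cases b
    · exact Sym2.mem_mk_left _ _
    · exact Sym2.mem_mk_right _ _
  have hthree : ∀ e e' : Bool ⊕ (Fin (g - 2) × Bool) ⊕ Fin (g - 1), e ≠ e' →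
      e ≠ .inr (.inr k) → e' ≠ .inr (.inr k) →
      ((k, b) : (chainGraph g hg s).V) ∈ (chainGraph g hg s).ends e →
      ((k, b) : (chainGraph g hg s).V) ∈ (chainGraph g hg s).ends e' →
      3 ≤ (chainGraph g hg s).valence (k, b) :=
    fun e e' h₁ h₂ h₃ h₄ h₅ => three_le_valence_of_edges _ _ _ _ _ h₁ h₂ h₃ h₄ h₅ hmid
  suffices 3 ≤ (chainGraph g hg s).valence (k, b) by omega
  cases hs : s k
  · have hv : ∀ side, chainVertex s k side b = (k, b) := fun side => by simp [chainVertex, hs]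
    have hmem : ∀ side, (chainGraph g hg s).ends (.inl side) =
        s(chainVertex s k side false, chainVertex s k side true) →
        ((k, b) : (chainGraph g hg s).V) ∈ (chainGraph g hg s).ends (.inl side) := by
      intro side h
      rw [h]
      refine (hv side) ▸ ?_
      cases b
      · exact Sym2.mem_mk_left _ _
      · exact Sym2.mem_mk_right _ _
    rcases chainGraph_side g hg s k false with h1 | ⟨j1, e1, h1⟩ <;>
      rcases chainGraph_side g hg s k true with h2 | ⟨j2, e2, h2⟩
    · exact hthree _ _ (by simp) (by simp) (by simp) (hmem _ h1) (hmem _ h2)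
    · exact hthree (.inl false) (.inr (.inl (j2, b))) (by simp) (by simp) (by simp) (hmem _ h1)
        (hv true ▸ h2 b)
    · exact hthree (.inl true) (.inr (.inl (j1, b))) (by simp) (by simp) (by simp) (hmem _ h2)
        (hv false ▸ h1 b)
    · refine hthree (.inr (.inl (j1, b))) (.inr (.inl (j2, b))) ?_ (by simp) (by simp)
        (hv false ▸ h1 b) (hv true ▸ h2 b)
      intro h
      have : j1 = j2 := by simpa using h
      subst this
      simp at e1 e2
      omega
  · have hv : ∀ pos, chainVertex s k b pos = (k, b) := fun pos => by simp [chainVertex, hs]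
    rcases chainGraph_side g hg s k b with h1 | ⟨j1, e1, h1⟩
    · rw [hv, hv] at h1
      have hne : (.inl b : Bool ⊕ (Fin (g - 2) × Bool) ⊕ Fin (g - 1)) ≠ .inr (.inr k) := by simp
      exact three_le_valence_of_loop _ _ _ _ hne h1 hmid
    · exact hthree (.inr (.inl (j1, false))) (.inr (.inl (j1, true))) (by simp) (by simp) (by simp)
        (hv false ▸ h1 false) (hv true ▸ h1 true)

/-- The combinatorial type of a chain of genus `g`. -/
def chainType (g : ℕ) (hg : 2 ≤ g) (s : Fin (g - 1) → Bool) : StableGraph g :=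
  ⟨chainGraph g hg s, chainGraph_connected g hg s, chainGraph_hasGenus g hg s,
    chainGraph_stable g hg s⟩

/-- The locus of chains of genus `g`. -/
def moduliChain (g : ℕ) (hg : 2 ≤ g) : Set (Moduli g) :=
  {x | ∃ (s : Fin (g - 1) → Bool) (a : Bool → ℝ≥0) (d : Fin (g - 2) → ℝ≥0)
    (m : Fin (g - 1) → ℝ≥0), x = Moduli.mk (chainType g hg s) (chainLength g hg s a d m)}

end TropicalModuli

end

open TropicalModuli

/-! A unimodular change of coordinates moves the interior lattice points of a hyperelliptic polygon
to (1,0), …, (g,0), and then all its lattice points lie in the rows 1, 0 and -1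
(`IsHyperelliptic.exists_isStandard`, `IsStandard.abs_row_le`). With heights, and in the maximum
convention, such a configuration is a `Strip`: at abscissa x the tropical polynomial is the maximum
of up(x) + y, mid(x) and low(x) - y, where up, mid, low are convex and piecewise linear. If the
points 0 or g + 1 of the middle row are missing, they can be added with heights so large that the
curve changes only far away from the bounded graph under study (`Strip.IsStandard.exists_isFull`).
So the middle row is 0, …, g + 1, with vertical walls between neighbours, numbered 0, …, g.

Everything is read off from the function gap = 2 mid - up - low. Smoothness forces the gap to be
nonzero at every wall, and the set where it is at most zero to be a disjoint union of intervals
centred at the walls of negative gap, with slope -1 before the wall and +1 after it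
(`Strip.exists_wall_of_gap_neg`, `Strip.wallEnd_lt_wallStart`). The two boundary branches of the
middle region merge along these intervals, and are joined by a vertical edge at each wall of
positive gap. This is a chain: the walls 0 and g close the loops, and the walls 1, …, g - 1 are the
nodes, split left/right for negative and bottom/top for positive gap. It embeds in the curve
(`Strip.isLatticeEmbedding_chain`). Conversely a graph without leaves cannot leave it
(`Strip.pathImage_subset_chain`), and a graph of the same genus with valences at least three inside
a trivalent graph is all of it (`IsLatticeEmbedding.isometric_of_pathImage_subset`). So the skeleton
is the chain, and its lengths depend only on the positions of the walls and the gaps there.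

Since only the sum up + low enters the gap, the two outer rows can be replaced by a single strictly
convex lower row which has the same tangents at the walls; this is a curve of the hyperelliptic
triangle (`exists_convex_interpolation`, `Strip.exists_triangle`). Hence the equality before
closures. The chain locus is closed, because its preimage in each orthant is a finite union of
closed cones (`isClosed_moduliChain`), so it also contains the closures. It depends on 2g - 1
lengths, which bounds the dimensions from above; they are attained because every chain with positive
lengths and all nodes split left/right comes from the triangle (`Strip.exists_triangle_of_chain`).
-/

namespace TropicalModuli

/-! ### Contractions of weighted graphs -/

namespace WeightedGraph

/-- `π` and `ι` exhibit `H` as the graph obtained from `G` by contracting the edges outside the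
range of `ι`. -/
structure IsContraction (G H : WeightedGraph) (π : G.V → H.V) (ι : H.E → G.E) : Prop where
  surjective : Function.Surjective π
  injective : Function.Injective ι
  eq_iff : ∀ u v, π u = π v ↔ (G.span (Set.range ι)ᶜ).Reachable u v
  ends_eq : ∀ e, H.ends e = (G.ends (ι e)).map π
  weight_eq : ∀ w, H.weight w + Nat.card {v // π v = w} =
    (∑ᶠ v ∈ {v | π v = w}, G.weight v) +
      Nat.card {e // e ∉ Set.range ι ∧ ∃ v ∈ G.ends e, π v = w} + 1

theorem span_adj {G : WeightedGraph} {S : Set G.E} {u v : G.V} :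
    (G.span S).Adj u v ↔ u ≠ v ∧ ∃ e ∈ S, G.ends e = s(u, v) := by
  unfold span
  rw [SimpleGraph.fromRel_adj]
  constructor
  · rintro ⟨h, ⟨e, he, h'⟩ | ⟨e, he, h'⟩⟩
    · exact ⟨h, e, he, h'⟩
    · exact ⟨h, e, he, by rw [h', Sym2.eq_swap]⟩
  · rintro ⟨h, e, he, h'⟩
    exact ⟨h, Or.inl ⟨e, he, h'⟩⟩

theorem reachable_of_ends {G : WeightedGraph} {S : Set G.E} {u v : G.V} {e : G.E} (he : e ∈ S)
    (h : G.ends e = s(u, v)) : (G.span S).Reachable u v := by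
  by_cases huv : u = v
  · rw [huv]
  · exact (span_adj.2 ⟨huv, e, he, h⟩).reachable

/-- A connected graph has at least one edge less than it has vertices, and different adjacent pairs
come from different edges of the multigraph. This keeps the natural number subtraction in the
weights of `contract` from truncating. -/
theorem card_component_le (G : WeightedGraph) (S : Set G.E) (c : (G.span S).ConnectedComponent) :
    Nat.card {v // (G.span S).connectedComponentMk v = c} ≤
      Nat.card {e // e ∈ S ∧ ∃ v ∈ G.ends e, (G.span S).connectedComponentMk v = c} + 1 := by
  classical
  have hconn := c.connected_toSimpleGraph
  have h1 := hconn.card_vert_le_card_edgeSet_add_one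
  refine h1.trans (Nat.add_le_add_right ?_ 1)
  have key : ∀ x : c.toSimpleGraph.edgeSet,
      ∃ e : {e // e ∈ S ∧ ∃ v ∈ G.ends e, (G.span S).connectedComponentMk v = c},
        G.ends e.1 = x.1.map Subtype.val := by
    rintro ⟨x, hx⟩
    induction x using Sym2.ind with
    | _ u v =>
      have h2 : (G.span S).Adj u.1 v.1 := hx
      obtain ⟨-, e, he, h3⟩ := span_adj.1 h2
      exact ⟨⟨e, he, u.1, h3 ▸ Sym2.mem_mk_left _ _, u.2⟩, h3⟩
  choose f hf using key
  refine Nat.card_le_card_of_injective f fun x y hxy => ?_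
  have := hf x
  rw [hxy, hf y] at this
  exact Subtype.ext (Sym2.map.injective Subtype.val_injective this.symm)

theorem isContraction_contract (G : WeightedGraph) (ℓ : G.E → ℝ≥0) :
    IsContraction G (G.contract ℓ) (G.span {e | ℓ e = 0}).connectedComponentMk Subtype.val := by
  classical
  have hr : (Set.range (Subtype.val : {e : G.E // ℓ e ≠ 0} → G.E))ᶜ = {e | ℓ e = 0} := by
    ext e; simp
  refine ⟨?_, Subtype.val_injective, ?_, fun _ => rfl, ?_⟩
  · exact Quot.mk_surjective
  · intro u v
    exact SimpleGraph.ConnectedComponent.eq.trans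
      (iff_of_eq (congrArg (fun T => (G.span T).Reachable u v) hr.symm))
  · intro c
    have h1 := card_component_le G {e | ℓ e = 0} c
    have e1 : (∑ᶠ v ∈ {v | (G.span {e | ℓ e = 0}).connectedComponentMk v = c}, G.weight v) =
        ∑ v ∈ Finset.univ.filter
          (fun v => (G.span {e | ℓ e = 0}).connectedComponentMk v = c), G.weight v := by
      rw [finsum_mem_eq_finite_toFinset_sum _ (Set.toFinite _)]
      congr 1
      ext v
      simp
    have e2 : Nat.card {e : G.E // e ∉ Set.range (Subtype.val : (G.contract ℓ).E → G.E) ∧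
        ∃ v ∈ G.ends e, (G.span {e | ℓ e = 0}).connectedComponentMk v = c} =
        (Finset.univ.filter fun e => ℓ e = 0 ∧
          ∃ v ∈ G.ends e, (G.span {e | ℓ e = 0}).connectedComponentMk v = c).card := by
      rw [Nat.card_eq_fintype_card, Fintype.card_subtype]
      congr 1
      ext e
      have : e ∉ Set.range (Subtype.val : (G.contract ℓ).E → G.E) ↔ ℓ e = 0 := by
        rw [← Set.mem_compl_iff]
        exact Set.ext_iff.1 hr e
      simp only [this, Finset.mem_filter, Finset.mem_univ, true_and]
    have e3 : Nat.card {e // e ∈ {e | ℓ e = 0} ∧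
        ∃ v ∈ G.ends e, (G.span {e | ℓ e = 0}).connectedComponentMk v = c} =
        (Finset.univ.filter fun e => ℓ e = 0 ∧
          ∃ v ∈ G.ends e, (G.span {e | ℓ e = 0}).connectedComponentMk v = c).card := by
      rw [Nat.card_eq_fintype_card, Fintype.card_subtype]
      congr 1
    have e4 : Nat.card {v // (G.span {e | ℓ e = 0}).connectedComponentMk v = c} =
        (Finset.univ.filter
          fun v => (G.span {e | ℓ e = 0}).connectedComponentMk v = c).card := by
      rw [Nat.card_eq_fintype_card, Fintype.card_subtype]
    rw [e3, e4] at h1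
    refine (congrArg₂ (· + ·) rfl e4).trans (Eq.trans ?_
      (congrArg₂ (fun a b : ℕ => a + b + 1) e1 e2).symm)
    change _ + _ + 1 - _ + _ = _ + _ + 1
    omega

theorem IsContraction.exists_edge {G H : WeightedGraph} {π : G.V → H.V} {ι : H.E → G.E}
    (h : IsContraction G H π ι) {e : H.E} {x y : H.V} (he : H.ends e = s(x, y)) :
    ∃ u v, G.ends (ι e) = s(u, v) ∧ π u = x ∧ π v = y := by
  have h1 := h.ends_eq e
  rw [he] at h1
  obtain ⟨u, v, huv⟩ : ∃ u v, G.ends (ι e) = s(u, v) := by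
    induction G.ends (ι e) using Sym2.ind with
    | _ u v => exact ⟨u, v, rfl⟩
  rw [huv, Sym2.map_mk, Sym2.eq_iff] at h1
  rcases h1 with ⟨a, b⟩ | ⟨a, b⟩
  · exact ⟨u, v, huv, a.symm, b.symm⟩
  · exact ⟨v, u, by rw [huv, Sym2.eq_swap], a.symm, b.symm⟩

/-- The weight equation is additive: summing it for the first contraction over the vertices x with
π' x = w and adding it for the second one gives the equation of the composite. -/
theorem IsContraction.comp {G H K : WeightedGraph} {π : G.V → H.V} {ι : H.E → G.E}
    {π' : H.V → K.V} {ι' : K.E → H.E} (h : IsContraction G H π ι) (h' : IsContraction H K π' ι') :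
    IsContraction G K (π' ∘ π) (ι ∘ ι') := by
  classical
  refine ⟨h'.surjective.comp h.surjective, h.injective.comp h'.injective, fun u v => ?_,
    fun e => ?_, fun w => ?_⟩
  · have hmono : G.span (Set.range ι)ᶜ ≤ G.span (Set.range (ι ∘ ι'))ᶜ := by
      intro a b hab
      obtain ⟨h1, e, h2, h3⟩ := span_adj.1 hab
      refine span_adj.2 ⟨h1, e, fun h4 => h2 (Set.range_comp_subset_range _ _ h4), h3⟩
    rw [Function.comp_apply, Function.comp_apply, h'.eq_iff]
    constructor
    · have : ∀ x y : H.V, (H.span (Set.range ι')ᶜ).Reachable x y → ∀ u v, π u = x → π v = y →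
          (G.span (Set.range (ι ∘ ι'))ᶜ).Reachable u v := by
        rintro x y ⟨p⟩
        induction p with
        | nil =>
          intro u v hu hv
          exact ((h.eq_iff u v).1 (hu.trans hv.symm)).mono hmono
        | @cons x y z hxy p ih =>
          intro u v hu hv
          obtain ⟨-, e, he, h3⟩ := span_adj.1 hxy
          obtain ⟨a, b, hab, ha, hb⟩ := h.exists_edge h3
          have r1 := ((h.eq_iff u a).1 (hu.trans ha.symm)).mono hmono
          have r2 : (G.span (Set.range (ι ∘ ι'))ᶜ).Reachable a b := by
            refine reachable_of_ends (e := ι e) ?_ hab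
            rintro ⟨e', he'⟩
            exact he ⟨e', h.injective he'⟩
          exact (r1.trans r2).trans (ih b v hb hv)
      exact fun hr => this _ _ hr u v rfl rfl
    · rintro ⟨p⟩
      induction p with
      | nil => exact SimpleGraph.Reachable.refl _
      | @cons x y z hxy p ih =>
        refine SimpleGraph.Reachable.trans ?_ ih
        obtain ⟨-, e, he, h3⟩ := span_adj.1 hxy
        by_cases hι : e ∈ Set.range ι
        · obtain ⟨e, rfl⟩ := hι
          refine reachable_of_ends (e := e) ?_ ?_
          · rintro ⟨e', rfl⟩
            exact he ⟨e', rfl⟩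
          · rw [h.ends_eq, h3, Sym2.map_mk]
        · rw [(h.eq_iff x y).2 (reachable_of_ends hι h3)]
  · rw [h'.ends_eq, h.ends_eq, Sym2.map_map]
    rfl
  · have h1 := h'.weight_eq w
    set W : Set H.V := {x | π' x = w} with hW
    have hsum : ∑ x ∈ W.toFinset, (H.weight x + Nat.card {v // π v = x}) =
        ∑ x ∈ W.toFinset, ((∑ᶠ v ∈ {v | π v = x}, G.weight v) +
          Nat.card {e // e ∉ Set.range ι ∧ ∃ v ∈ G.ends e, π v = x} + 1) :=
      Finset.sum_congr rfl fun x _ => h.weight_eq x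
    rw [Finset.sum_add_distrib, Finset.sum_add_distrib, Finset.sum_add_distrib] at hsum
    have a1 : (∑ᶠ x ∈ W, H.weight x) = ∑ x ∈ W.toFinset, H.weight x := by
      rw [finsum_mem_eq_toFinset_sum]
    have a2 : ∑ x ∈ W.toFinset, Nat.card {v // π v = x} = Nat.card {v // (π' ∘ π) v = w} := by
      simp only [Nat.card_eq_fintype_card, Fintype.card_subtype]
      rw [← Finset.card_biUnion]
      · congr 1
        ext v
        simp [hW]
      · intro x _ y _ hxy
        refine Finset.disjoint_left.2 fun v hv hv' => hxy ?_
        simp only [Finset.mem_filter, Finset.mem_univ, true_and] at hv hv'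
        rw [← hv, hv']
    have a3 : ∑ x ∈ W.toFinset, (∑ᶠ v ∈ {v | π v = x}, G.weight v) =
        ∑ᶠ v ∈ {v | (π' ∘ π) v = w}, G.weight v := by
      rw [finsum_mem_eq_toFinset_sum]
      simp only [finsum_mem_eq_toFinset_sum]
      rw [← Finset.sum_biUnion]
      · congr 1
        ext v
        simp [hW]
      · intro x _ y _ hxy
        refine Finset.disjoint_left.2 fun v hv hv' => hxy ?_
        simp only [Set.mem_toFinset, Set.mem_ofPred_eq] at hv hv'
        rw [← hv, hv']
    have a4 : ∑ x ∈ W.toFinset, 1 = Nat.card {x // π' x = w} := by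
      simp only [Nat.card_eq_fintype_card, Fintype.card_subtype, Finset.sum_const, smul_eq_mul,
        mul_one]
      congr 1
      ext v
      simp [hW]
    -- An edge contracted by the composite over w is either contracted by the first map, and then
    -- counted at its image vertex, or survives as `ι e` with `e` contracted by the second map.
    have a5 : Nat.card {e // e ∉ Set.range (ι ∘ ι') ∧ ∃ v ∈ G.ends e, (π' ∘ π) v = w} =
        (∑ x ∈ W.toFinset, Nat.card {e // e ∉ Set.range ι ∧ ∃ v ∈ G.ends e, π v = x}) +
        Nat.card {e // e ∉ Set.range ι' ∧ ∃ v ∈ H.ends e, π' v = w} := by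
      simp only [Nat.card_eq_fintype_card, Fintype.card_subtype]
      rw [← Finset.card_biUnion, ← Finset.card_map ⟨ι, h.injective⟩, ← Finset.card_union_of_disjoint]
      · congr 1
        ext e
        simp only [Finset.mem_filter, Finset.mem_univ, true_and, Finset.mem_union,
          Finset.mem_biUnion, Finset.mem_map, Function.Embedding.coeFn_mk, Set.mem_toFinset]
        by_cases he : e ∈ Set.range ι
        · obtain ⟨e, rfl⟩ := he
          constructor
          · rintro ⟨b1, v, b2, b3⟩
            refine Or.inr ⟨e, ⟨fun ⟨e', h5⟩ => b1 ⟨e', by rw [Function.comp_apply, h5]⟩, π v, ?_, b3⟩,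
              rfl⟩
            rw [h.ends_eq]
            exact Sym2.mem_map.2 ⟨v, b2, rfl⟩
          · rintro (⟨x, -, b1, -⟩ | ⟨e', ⟨b1, x, b2, b3⟩, b4⟩)
            · exact absurd ⟨e, rfl⟩ b1
            · obtain rfl := h.injective b4
              rw [h.ends_eq] at b2
              obtain ⟨v, b5, rfl⟩ := Sym2.mem_map.1 b2
              refine ⟨?_, v, b5, b3⟩
              rintro ⟨e'', b6⟩
              exact b1 ⟨e'', h.injective b6⟩
        · constructor
          · rintro ⟨b1, v, b2, b3⟩
            exact Or.inl ⟨π v, b3, he, v, b2, rfl⟩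
          · rintro (⟨x, b0, b1, v, b2, b3⟩ | ⟨e', -, b4⟩)
            · exact ⟨fun h5 => he (Set.range_comp_subset_range _ _ h5), v, b2,
                by rw [Function.comp_apply, b3]; exact b0⟩
            · exact absurd ⟨e', b4⟩ he
      · rw [Finset.disjoint_left]
        intro e he he'
        simp only [Finset.mem_filter, Finset.mem_univ, true_and, Finset.mem_biUnion,
          Finset.mem_map, Function.Embedding.coeFn_mk, Set.mem_toFinset] at he he'
        obtain ⟨x, -, b1, -⟩ := he
        obtain ⟨e', -, b2⟩ := he'
        exact b1 ⟨e', b2⟩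
      · intro x _ y _ hxy
        refine Finset.disjoint_left.2 fun e he he' => hxy ?_
        simp only [Finset.mem_filter, Finset.mem_univ, true_and] at he he'
        obtain ⟨b1, v, b2, b3⟩ := he
        obtain ⟨-, v', b2', b3'⟩ := he'
        rw [← b3, ← b3', h.eq_iff]
        by_cases hvv : v = v'
        · rw [hvv]
        · exact reachable_of_ends b1 ((Sym2.mem_and_mem_iff hvv).1 ⟨b2, b2'⟩)
    rw [a1] at h1
    rw [a2, a3, a4] at hsum
    rw [a5]
    omega

/-- The set of surviving edges determines a contraction up to isomorphism: the fibres on vertices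
are the components of the other edges, and the weights follow from the additive weight equation. -/
theorem IsContraction.isometric {G H H' : WeightedGraph} {π : G.V → H.V} {ι : H.E → G.E}
    {π' : G.V → H'.V} {ι' : H'.E → G.E} (h : IsContraction G H π ι) (h' : IsContraction G H' π' ι')
    (hr : Set.range ι = Set.range ι') {ℓ : H.E → ℝ≥0} {ℓ' : H'.E → ℝ≥0}
    (hℓ : ∀ e e', ι e = ι' e' → ℓ e = ℓ' e') : H.Isometric ℓ H' ℓ' := by
  classical
  have heq : ∀ u v, π u = π v ↔ π' u = π' v := fun u v => by rw [h.eq_iff, h'.eq_iff, hr]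
  obtain ⟨s, hs⟩ := h.surjective.hasRightInverse
  obtain ⟨s', hs'⟩ := h'.surjective.hasRightInverse
  have hf : ∀ v, π' (s (π v)) = π' v := fun v => (heq _ _).1 (hs _)
  have hf' : ∀ v, π (s' (π' v)) = π v := fun v => (heq _ _).2 (hs' _)
  let f : H.V ≃ H'.V :=
    { toFun := fun x => π' (s x)
      invFun := fun y => π (s' y)
      left_inv := fun x => (hf' _).trans (hs x)
      right_inv := fun y => (hf _).trans (hs' y) }
  have hfπ : ∀ v, f (π v) = π' v := hf
  let k : H.E ≃ H'.E := (Equiv.ofInjective ι h.injective).trans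
    ((Equiv.setCongr hr).trans (Equiv.ofInjective ι' h'.injective).symm)
  have hk : ∀ e, ι' (k e) = ι e := fun e => by
    have := Equiv.apply_ofInjective_symm h'.injective
      ((Equiv.setCongr hr) (Equiv.ofInjective ι h.injective e))
    exact this
  refine ⟨f, k, fun e => ?_, fun x => ?_, fun e => (hℓ _ _ (hk e).symm).symm⟩
  · rw [h'.ends_eq, hk, h.ends_eq, Sym2.map_map]
    congr 1
    funext v
    exact (hfπ v).symm
  · obtain ⟨v, rfl⟩ := h.surjective x
    have e1 := h.weight_eq (π v)
    have e2 := h'.weight_eq (π' v)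
    rw [hfπ]
    simp only [heq, hr] at e1
    omega

theorem Isometric.isContraction {G G' : WeightedGraph} (f : G.V ≃ G'.V) (k : G.E ≃ G'.E)
    (hends : ∀ e, G'.ends (k e) = (G.ends e).map f)
    (hw : ∀ v, G'.weight (f v) = G.weight v) : IsContraction G G' f k.symm := by
  have hr : (Set.range k.symm)ᶜ = ∅ := by
    rw [k.symm.surjective.range_eq, Set.compl_univ]
  refine ⟨f.surjective, k.symm.injective, fun u v => ?_, fun e => ?_, fun w => ?_⟩
  · rw [hr, f.injective.eq_iff]
    constructor
    · rintro rfl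
      exact SimpleGraph.Reachable.refl _
    · rintro ⟨p⟩
      cases p with
      | nil => rfl
      | cons h p =>
        obtain ⟨-, e, he, -⟩ := span_adj.1 h
        exact absurd he (Set.notMem_empty _)
  · rw [← hends, k.apply_symm_apply]
  · obtain ⟨v, rfl⟩ := f.surjective w
    have h1 : {u | f u = f v} = {v} := by
      ext u
      simp
    have h2 : Nat.card {u // f u = f v} = 1 := by
      have : Nat.card ({u | f u = f v} : Set G.V) = 1 := by
        rw [h1]
        simp
      exact this
    have h3 : IsEmpty {e // e ∉ Set.range k.symm ∧ ∃ u ∈ G.ends e, f u = f v} :=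
      ⟨fun e => e.2.1 (k.symm.surjective e.1)⟩
    rw [h1, h2, hw, finsum_mem_singleton, Nat.card_of_isEmpty]

/-- Isometric graphs have isometric contractions. -/
theorem Isometric.contract {G G' : WeightedGraph} {ℓ : G.E → ℝ≥0} {ℓ' : G'.E → ℝ≥0}
    (h : G.Isometric ℓ G' ℓ') : (G.contract ℓ).Isometric (fun e => ℓ e.1)
      (G'.contract ℓ') (fun e => ℓ' e.1) := by
  obtain ⟨f, k, h1, h2, h3⟩ := h
  refine (isContraction_contract G ℓ).isometric
    ((Isometric.isContraction f k h1 h2).comp (isContraction_contract G' ℓ')) ?_ ?_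
  · ext e
    constructor
    · rintro ⟨⟨e, he⟩, rfl⟩
      exact ⟨⟨k e, by rwa [h3]⟩, k.symm_apply_apply e⟩
    · rintro ⟨⟨e, he⟩, rfl⟩
      exact ⟨⟨k.symm e, by rwa [← h3, k.apply_symm_apply]⟩, rfl⟩
  · rintro ⟨e, he⟩ ⟨e', he'⟩ h4
    have h5 : e = k.symm e' := h4
    simp [h5, ← h3]

/-- If two metric graphs become isometric by contraction, then so do two further degenerations of
them whose edge lengths correspond to each other. -/
theorem contract_isometric_of_degeneration {G G' : WeightedGraph} {ℓ : G.E → ℝ≥0}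
    {ℓ' : G'.E → ℝ≥0} (f : (G.contract ℓ).V ≃ (G'.contract ℓ').V)
    (k : (G.contract ℓ).E ≃ (G'.contract ℓ').E)
    (h1 : ∀ e, (G'.contract ℓ').ends (k e) = ((G.contract ℓ).ends e).map f)
    (h2 : ∀ v, (G'.contract ℓ').weight (f v) = (G.contract ℓ).weight v)
    {r : G.E → ℝ≥0} {r' : G'.E → ℝ≥0} (hr : ∀ e, ℓ e = 0 → r e = 0)
    (hr' : ∀ e, ℓ' e = 0 → r' e = 0) (h3 : ∀ e, r' (k e).1 = r e.1) :
    (G.contract r).Isometric (fun e => r e.1) (G'.contract r') (fun e => r' e.1) := by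
  -- Contracting the zeros of `r` at once agrees with contracting the zeros of `ℓ` first and the
  -- remaining zeros of `r` afterwards.
  have step : ∀ (G : WeightedGraph) (ℓ r : G.E → ℝ≥0), (∀ e, ℓ e = 0 → r e = 0) →
      (G.contract r).Isometric (fun e => r e.1)
        ((G.contract ℓ).contract fun e => r e.1) fun e => r e.1.1 := by
    intro G ℓ r hr
    refine (isContraction_contract G r).isometric
      ((isContraction_contract G ℓ).comp (isContraction_contract (G.contract ℓ) fun e => r e.1))
      ?_ ?_
    · ext e
      constructor
      · rintro ⟨⟨e, he⟩, rfl⟩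
        exact ⟨⟨⟨e, fun h => he (hr e h)⟩, he⟩, rfl⟩
      · rintro ⟨⟨⟨e, he⟩, he'⟩, rfl⟩
        exact ⟨⟨e, he'⟩, rfl⟩
    · intro e e' h
      have h5 : e.1 = e'.1.1 := h
      simp [h5]
  have mid : (G.contract ℓ).Isometric (fun e => r e.1) (G'.contract ℓ') (fun e => r' e.1) :=
    ⟨f, k, h1, h2, h3⟩
  have trans : ∀ {G₁ G₂ G₃ : WeightedGraph} {a : G₁.E → ℝ≥0} {b : G₂.E → ℝ≥0} {c : G₃.E → ℝ≥0},
      G₁.Isometric a G₂ b → G₂.Isometric b G₃ c → G₁.Isometric a G₃ c := by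
    rintro G₁ G₂ G₃ a b c ⟨f, k, h1, h2, h3⟩ ⟨f', k', h1', h2', h3'⟩
    exact ⟨f.trans f', k.trans k', fun e => by simp [h1, h1', Sym2.map_map],
      fun v => by simp [h2, h2'], fun e => by simpa [h3] using h3' (k e)⟩
  have symm : ∀ {G₁ G₂ : WeightedGraph} {a : G₁.E → ℝ≥0} {b : G₂.E → ℝ≥0},
      G₁.Isometric a G₂ b → G₂.Isometric b G₁ a := by
    rintro G₁ G₂ a b ⟨f, k, h1, h2, h3⟩
    refine ⟨f.symm, k.symm, fun e => ?_, fun v => ?_, fun e => ?_⟩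
    · obtain ⟨e, rfl⟩ := k.surjective e
      rw [h1, Sym2.map_map]
      simp
    · obtain ⟨v, rfl⟩ := f.surjective v
      simp [h2]
    · obtain ⟨e, rfl⟩ := k.surjective e
      simpa using (h3 e).symm
  exact trans (step G ℓ r hr) (trans mid.contract (symm (step G' ℓ' r' hr')))

end WeightedGraph

/-! ### The chain locus: closedness and dimension -/

theorem Moduli.mk_eq_mk {g : ℕ} {G G' : StableGraph g} {ℓ : G.1.E → ℝ≥0} {ℓ' : G'.1.E → ℝ≥0} :
    Moduli.mk G ℓ = Moduli.mk G' ℓ' ↔ (G.1.contract ℓ).Isometric (fun e => ℓ e.1)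
      (G'.1.contract ℓ') (fun e => ℓ' e.1) :=
  Quotient.eq

theorem Moduli.mk_eq_mk_of_isometric {g : ℕ} {G G' : StableGraph g} {ℓ : G.1.E → ℝ≥0}
    {ℓ' : G'.1.E → ℝ≥0} (h : G.1.Isometric ℓ G'.1 ℓ') : Moduli.mk G ℓ = Moduli.mk G' ℓ' :=
  Moduli.mk_eq_mk.2 h.contract

theorem continuous_option_elim {α : Type*} (r : Option α) :
    Continuous fun ℓ : α → ℝ≥0 => r.elim 0 ℓ := by
  cases r with
  | none => exact continuous_const
  | some a => exact continuous_apply a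

/-- The preimage is a finite union of closed cones. A cone is indexed by the edges forced to vanish
and by the edge of `G` that carries each chain edge, if any; its equations are the vanishing ones
and the equality of the two strands of each doubled edge. -/
theorem isClosed_preimage_moduliChain {g : ℕ} (hg : 2 ≤ g) (G : StableGraph g) :
    IsClosed {ℓ : G.1.E → ℝ≥0 | Moduli.mk G ℓ ∈ moduliChain g hg} := by
  classical
  let E' := Bool ⊕ (Fin (g - 2) × Bool) ⊕ Fin (g - 1)
  let cone : Set G.1.E × (E' → Option G.1.E) → Set (G.1.E → ℝ≥0) := fun i =>
    {ℓ | (∀ e ∈ i.1, ℓ e = 0) ∧ ∀ j, (i.2 (.inr (.inl (j, false)))).elim 0 ℓ =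
      (i.2 (.inr (.inl (j, true)))).elim 0 ℓ}
  have hcone : ∀ i, IsClosed (cone i) := fun i => by
    have : cone i = (⋂ e ∈ i.1, {ℓ | ℓ e = 0}) ∩ ⋂ j, {ℓ |
        (i.2 (.inr (.inl (j, false)))).elim 0 ℓ = (i.2 (.inr (.inl (j, true)))).elim 0 ℓ} := by
      ext ℓ
      simp [cone]
    rw [this]
    refine IsClosed.inter (isClosed_biInter fun e _ => ?_) (isClosed_iInter fun j => ?_)
    · exact isClosed_eq (continuous_apply e) continuous_const
    · exact isClosed_eq (continuous_option_elim _) (continuous_option_elim _)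
  have hunion : {ℓ : G.1.E → ℝ≥0 | Moduli.mk G ℓ ∈ moduliChain g hg} =
      ⋃ i ∈ {i | cone i ⊆ {ℓ : G.1.E → ℝ≥0 | Moduli.mk G ℓ ∈ moduliChain g hg}}, cone i := by
    refine Set.Subset.antisymm ?_ (Set.iUnion₂_subset fun i hi => hi)
    rintro ℓ ⟨s, a, d, m, hℓ⟩
    obtain ⟨f, k, h1, h2, h3⟩ := Moduli.mk_eq_mk.1 hℓ
    let L := chainLength g hg s a d m
    -- The edge of `G` matched with a chain edge of positive length; `none` stands for length zero.
    let r : E' → Option G.1.E := fun e' => if h : L e' ≠ 0 then some (k.symm ⟨e', h⟩).1 else none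
    have hr0 : ∀ e', L e' = 0 → r e' = none := fun e' h => dif_neg (not_not.2 h)
    have hr1 : ∀ e' (h : L e' ≠ 0), r e' = some (k.symm ⟨e', h⟩).1 := fun e' h => dif_pos h
    have hrL : ∀ e', (r e').elim 0 ℓ = L e' := fun e' => by
      by_cases h : L e' = 0
      · rw [hr0 _ h, h]
        rfl
      · rw [hr1 _ h]
        exact (h3 (k.symm ⟨e', h⟩)).symm.trans
          (congrArg (fun x => L x.1) (k.apply_symm_apply ⟨e', h⟩))
    refine Set.mem_iUnion₂.2 ⟨({e | ℓ e = 0}, r), ?_, fun e he => he, fun j => ?_⟩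
    -- All of this cone consists of chains: edges that vanish at `ℓ` still vanish at `ρ`, and the
    -- other lengths move along the matching `k`, so `ρ` and the chain `L'` are corresponding
    -- degenerations.
    · rintro ρ ⟨hρ, hρ'⟩
      let L' := chainLength g hg s (fun b => (r (.inl b)).elim 0 ρ)
        (fun j => (r (.inr (.inl (j, false)))).elim 0 ρ) fun k => (r (.inr (.inr k))).elim 0 ρ
      have hL' : ∀ e', L' e' = (r e').elim 0 ρ := by
        rintro (b | ⟨j, pos⟩ | k)
        · rfl
        · cases pos
          · rfl
          · exact hρ' j
        · rfl
      refine ⟨s, _, _, _, Moduli.mk_eq_mk.2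
        (WeightedGraph.contract_isometric_of_degeneration f k h1 h2 hρ (r' := L') ?_ ?_)⟩
      · intro e he
        exact (hL' e).trans (by rw [hr0 e he]; rfl)
      · intro e
        exact (hL' (k e).1).trans (by
          rw [hr1 (k e).1 (k e).2]
          exact congrArg (fun x => ρ x.1) (k.symm_apply_apply e))
    · exact (hrL (.inr (.inl (j, false)))).trans (hrL (.inr (.inl (j, true)))).symm
  rw [hunion]
  exact (Set.toFinite _).isClosed_biUnion fun i _ => hcone i

theorem isClosed_moduliChain {g : ℕ} (hg : 2 ≤ g) : IsClosed (moduliChain g hg) := by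
  have hq : Topology.IsQuotientMap (Quotient.mk (gluing g)) := isQuotientMap_quotient_mk'
  exact hq.isClosed_preimage.1 (isClosed_sigma_iff.2 fun G => isClosed_preimage_moduliChain hg G)

theorem dimension_mono {g : ℕ} {S T : Set (Moduli g)} (h : S ⊆ T) : dimension S ≤ dimension T :=
  iSup_mono fun _ => dimH_mono fun _ hℓ => h hℓ

/-- The parameters of a chain: the lengths of the loops, of the doubled edges and of the edges at
the split nodes. -/
abbrev ChainParameter (g : ℕ) : Type := Bool ⊕ Fin (g - 2) ⊕ Fin (g - 1)

theorem card_chainParameter {g : ℕ} (hg : 2 ≤ g) : Fintype.card (ChainParameter g) = 2 * g - 1 := by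
  simp only [Fintype.card_sum, Fintype.card_bool, Fintype.card_fin]
  omega

/-- Each edge of `G` has length zero or the value of one of the 2g - 1 parameters. So the preimage
is covered by finitely many 1-Lipschitz images of a real vector space of dimension 2g - 1. -/
theorem dimension_moduliChain_le {g : ℕ} (hg : 2 ≤ g) :
    dimension (moduliChain g hg) ≤ ((2 * g - 1 : ℕ) : ℝ≥0∞) := by
  classical
  refine iSup_le fun G => ?_
  let Ψ : (G.1.E → Option (ChainParameter g)) → (ChainParameter g → ℝ) → G.1.E → ℝ≥0 :=
    fun ρ q e => (ρ e).elim 0 fun p => (q p).toNNReal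
  have hΨ : ∀ ρ, LipschitzWith 1 (Ψ ρ) := by
    intro ρ q q'
    rw [ENNReal.coe_one, one_mul, edist_pi_le_iff]
    intro e
    change edist ((ρ e).elim 0 fun p => (q p).toNNReal) ((ρ e).elim 0 fun p => (q' p).toNNReal) ≤ _
    cases ρ e with
    | none => simp
    | some p =>
      refine le_trans ?_ (edist_le_pi_edist q q' p)
      simpa using Real.lipschitzWith_toNNReal (q p) (q' p)
  have hsub : {ℓ : G.1.E → ℝ≥0 | Moduli.mk G ℓ ∈ moduliChain g hg} ⊆ ⋃ ρ, Set.range (Ψ ρ) := by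
    rintro ℓ ⟨s, a, d, m, hℓ⟩
    obtain ⟨f, k, -, -, h3⟩ := Moduli.mk_eq_mk.1 hℓ
    let param : Bool ⊕ (Fin (g - 2) × Bool) ⊕ Fin (g - 1) → ChainParameter g :=
      Sum.map id (Sum.map Prod.fst id)
    let q : ChainParameter g → ℝ≥0 := Sum.elim a (Sum.elim d m)
    have hq : ∀ e, chainLength g hg s a d m e = q (param e) := by
      rintro (b | ⟨j, pos⟩ | k) <;> rfl
    refine Set.mem_iUnion.2 ⟨fun e => if h : ℓ e ≠ 0 then some (param (k ⟨e, h⟩).1) else none,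
      fun p => q p, funext fun e => ?_⟩
    by_cases h : ℓ e = 0
    · change Option.elim (dite _ _ _) _ _ = _
      rw [dif_neg (not_not.2 h), h]
      rfl
    · change Option.elim (dite _ _ _) _ _ = _
      rw [dif_pos h]
      have h4 : q (param (k ⟨e, h⟩).1) = ℓ e := (hq _).symm.trans (h3 ⟨e, h⟩)
      change ((q (param _) : ℝ≥0) : ℝ).toNNReal = _
      rw [Real.toNNReal_coe, h4]
  refine (dimH_mono hsub).trans ?_
  rw [dimH_iUnion]
  refine iSup_le fun ρ => ((hΨ ρ).dimH_range_le).trans ?_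
  rw [Real.dimH_univ_pi, card_chainParameter hg]

/-- If every chain with positive edge lengths whose nodes are all split into left and right belongs
to `S`, then `S` has dimension at least `2 g - 1`. -/
theorem le_dimension_of_chain {g : ℕ} (hg : 2 ≤ g) (S : Set (Moduli g))
    (hS : ∀ (a : Bool → ℝ≥0) (d : Fin (g - 2) → ℝ≥0) (m : Fin (g - 1) → ℝ≥0), (∀ b, 0 < a b) →
      (∀ j, 0 < d j) → (∀ k, 0 < m k) → Moduli.mk (chainType g hg fun _ => true)
        (chainLength g hg (fun _ => true) a d m) ∈ S) :
    ((2 * g - 1 : ℕ) : ℝ≥0∞) ≤ dimension S := by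
  classical
  refine le_trans ?_ (le_iSup _ (chainType g hg fun _ => true))
  let pick : ChainParameter g → Bool ⊕ (Fin (g - 2) × Bool) ⊕ Fin (g - 1) :=
    Sum.map id (Sum.map (fun j => (j, false)) id)
  -- Reading off one length for each parameter is 1-Lipschitz, so it does not raise the dimension,
  -- and its image contains a ball. The centre 2 and the radius 1 keep all lengths positive.
  let proj : (Bool ⊕ (Fin (g - 2) × Bool) ⊕ Fin (g - 1) → ℝ≥0) → ChainParameter g → ℝ :=
    fun ℓ p => ℓ (pick p)
  have hproj : LipschitzWith 1 proj := by
    intro ℓ ℓ'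
    rw [ENNReal.coe_one, one_mul, edist_pi_le_iff]
    exact fun p => edist_le_pi_edist ℓ ℓ' (pick p)
  set T : Set ((chainType g hg fun _ => true).1.E → ℝ≥0) :=
    {ℓ | Moduli.mk (chainType g hg fun _ => true) ℓ ∈ S} with hT
  refine le_trans ?_ (hproj.dimH_image_le T)
  have hsub : Metric.ball (fun _ => (2 : ℝ)) 1 ⊆ proj '' T := by
    intro q hq
    have hpos : ∀ p, 0 < q p := fun p => by
      have := (dist_le_pi_dist q (fun _ => (2 : ℝ)) p).trans_lt hq
      rw [Real.dist_eq, abs_lt] at this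
      linarith
    refine ⟨chainLength g hg (fun _ => true) (fun b => (q (.inl b)).toNNReal)
      (fun j => (q (.inr (.inl j))).toNNReal) (fun k => (q (.inr (.inr k))).toNNReal),
      hS _ _ _ ?_ ?_ ?_, ?_⟩
    · exact fun b => Real.toNNReal_pos.2 (hpos _)
    · exact fun b => Real.toNNReal_pos.2 (hpos _)
    · exact fun b => Real.toNNReal_pos.2 (hpos _)
    · funext p
      rcases p with b | j | k <;> exact Real.coe_toNNReal _ (hpos _).le
  refine le_trans ?_ (dimH_mono hsub)
  rw [Real.dimH_ball_pi _ one_pos, card_chainParameter hg]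

end TropicalModuli

namespace TropicalModuli

open Set Filter Topology

/-! ### Lifting paths along arcs -/

/-- A path inside an arc lifts continuously to the parameter interval of the arc. -/
theorem exists_lift {X Y : Type*} [TopologicalSpace X] [TopologicalSpace Y] [T2Space Y]
    {α : ℝ → Y} {K U : Set ℝ}
    (hK : IsCompact K) (hα : ContinuousOn α K) (hUK : U ⊆ K)
    (hinj : ∀ s ∈ U, ∀ t ∈ K, α s = α t → s = t) {σ : X → Y} {s : Set X}
    (hσ : ContinuousOn σ s) (hmap : ∀ t ∈ s, σ t ∈ α '' U) :
    ∃ θ : X → ℝ, ContinuousOn θ s ∧ ∀ t ∈ s, θ t ∈ U ∧ α (θ t) = σ t := by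
  classical
  have hex : ∀ t, ∃ r, t ∈ s → r ∈ U ∧ α r = σ t := fun t => by
    by_cases h : t ∈ s
    · obtain ⟨r, hr, h'⟩ := hmap t h
      exact ⟨r, fun _ => ⟨hr, h'⟩⟩
    · exact ⟨0, fun h' => absurd h' h⟩
  choose θ hθ using hex
  refine ⟨θ, fun t ht => ?_, hθ⟩
  rw [ContinuousWithinAt, tendsto_nhds]
  intro O hO htO
  -- The part of the arc outside `O` is compact and by injectivity misses `σ t`; hence `σ` avoids it
  -- near `t`, which is continuity of `θ`.
  have hc : IsClosed (α '' (K \ O)) :=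
    ((hK.diff hO).image_of_continuousOn (hα.mono sdiff_subset)).isClosed
  have hn : σ t ∉ α '' (K \ O) := by
    rintro ⟨r, ⟨hr, hrO⟩, h⟩
    have := hinj _ (hθ t ht).1 r hr ((hθ t ht).2.trans h.symm)
    exact hrO (this ▸ htO)
  filter_upwards [(hσ t ht) (hc.isOpen_compl.mem_nhds hn), self_mem_nhdsWithin] with r hr hrs
  by_contra hrO
  exact hr ⟨θ r, ⟨hUK (hθ r hrs).1, hrO⟩, (hθ r hrs).2⟩

/-- Two real functions which start at the same value and then increase have a common value. -/
theorem exists_common_value {u₁ u₂ : ℝ → ℝ} {ε₁ ε₂ c : ℝ} (h₁ : 0 < ε₁) (h₂ : 0 < ε₂)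
    (hc₁ : ContinuousOn u₁ (Icc 0 ε₁)) (hc₂ : ContinuousOn u₂ (Icc 0 ε₂))
    (h0₁ : u₁ 0 = c) (h0₂ : u₂ 0 = c) (hp₁ : c < u₁ ε₁) (hp₂ : c < u₂ ε₂) :
    ∃ t₁ ∈ Ioc 0 ε₁, ∃ t₂ ∈ Ioc 0 ε₂, u₁ t₁ = u₂ t₂ := by
  have aux : ∀ (u : ℝ → ℝ) (ε r : ℝ), 0 < ε → ContinuousOn u (Icc 0 ε) → u 0 = c → c < r →
      r ≤ u ε → ∃ t ∈ Ioc 0 ε, u t = r := by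
    intro u ε r hε hu h0 hr hr'
    obtain ⟨t, ht, h⟩ := intermediate_value_Icc hε.le hu ⟨h0.le.trans hr.le, hr'⟩
    refine ⟨t, ⟨lt_of_le_of_ne ht.1 ?_, ht.2⟩, h⟩
    rintro rfl
    linarith
  obtain ⟨t₁, ht₁, e₁⟩ := aux u₁ ε₁ (min (u₁ ε₁) (u₂ ε₂)) h₁ hc₁ h0₁ (lt_min hp₁ hp₂)
    (min_le_left _ _)
  obtain ⟨t₂, ht₂, e₂⟩ := aux u₂ ε₂ (min (u₁ ε₁) (u₂ ε₂)) h₂ hc₂ h0₂ (lt_min hp₁ hp₂)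
    (min_le_right _ _)
  exact ⟨t₁, ht₁, t₂, ht₂, e₁.trans e₂.symm⟩

/-- A path germ which leaves the point `p`. -/
structure IsGerm (p : ℝ × ℝ) (σ : ℝ → ℝ × ℝ) (ε : ℝ) : Prop where
  pos : 0 < ε
  cont : ContinuousOn σ (Icc 0 ε)
  zero : σ 0 = p
  ne : ∀ t ∈ Ioc 0 ε, σ t ≠ p

theorem IsGerm.mono {p : ℝ × ℝ} {σ : ℝ → ℝ × ℝ} {ε ε' : ℝ} (h : IsGerm p σ ε) (h0 : 0 < ε')
    (hle : ε' ≤ ε) : IsGerm p σ ε' :=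
  ⟨h0, h.cont.mono (Icc_subset_Icc_right hle), h.zero, fun t ht => h.ne t ⟨ht.1, ht.2.trans hle⟩⟩

theorem IsGerm.eventually {p : ℝ × ℝ} {σ : ℝ → ℝ × ℝ} {ε : ℝ} (h : IsGerm p σ ε)
    {P : ℝ × ℝ → Prop} (hP : ∀ᶠ q in 𝓝 p, P q) :
    ∃ ε', 0 < ε' ∧ ε' ≤ ε ∧ ∀ t ∈ Icc 0 ε', P (σ t) := by
  have h0 : ContinuousWithinAt σ (Icc 0 ε) 0 := h.cont 0 (left_mem_Icc.2 h.pos.le)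
  have h1 : ∀ᶠ t in 𝓝[Icc 0 ε] 0, P (σ t) := by
    have := h0.tendsto
    rw [h.zero] at this
    exact this.eventually hP
  rw [nhdsWithin_Icc_eq_nhdsGE h.pos] at h1
  obtain ⟨δ, hδ, hsub⟩ := (mem_nhdsGE_iff_exists_Icc_subset (a := (0 : ℝ))).1 h1
  refine ⟨min δ ε, lt_min hδ h.pos, min_le_right _ _, fun t ht => ?_⟩
  exact hsub ⟨ht.1, ht.2.trans (min_le_left _ _)⟩

/-- Two germs inside an arc on which the coordinate `u` is injective and bounded below by its
value at the origin of the germs have to meet. -/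
theorem IsGerm.meet_of_coordinate {p : ℝ × ℝ} {σ₁ σ₂ : ℝ → ℝ × ℝ} {ε₁ ε₂ : ℝ}
    (h₁ : IsGerm p σ₁ ε₁) (h₂ : IsGerm p σ₂ ε₂) {N : Set (ℝ × ℝ)} {u : ℝ × ℝ → ℝ}
    (hu : Continuous u) (hinj : InjOn u N) (hpos : ∀ q ∈ N, q ≠ p → u p < u q)
    (hN₁ : ∀ t ∈ Ioc 0 ε₁, σ₁ t ∈ N) (hN₂ : ∀ t ∈ Ioc 0 ε₂, σ₂ t ∈ N) :
    ∃ t₁ ∈ Ioc 0 ε₁, ∃ t₂ ∈ Ioc 0 ε₂, σ₁ t₁ = σ₂ t₂ := by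
  obtain ⟨t₁, ht₁, t₂, ht₂, h⟩ := exists_common_value (u₁ := u ∘ σ₁) (u₂ := u ∘ σ₂) h₁.pos h₂.pos
    (hu.comp_continuousOn h₁.cont) (hu.comp_continuousOn h₂.cont) (congrArg u h₁.zero)
    (congrArg u h₂.zero)
    (hpos _ (hN₁ _ (right_mem_Ioc.2 h₁.pos)) (h₁.ne _ (right_mem_Ioc.2 h₁.pos)))
    (hpos _ (hN₂ _ (right_mem_Ioc.2 h₂.pos)) (h₂.ne _ (right_mem_Ioc.2 h₂.pos)))
  exact ⟨t₁, ht₁, t₂, ht₂, hinj (hN₁ _ ht₁) (hN₂ _ ht₂) h⟩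

/-- Near `p`, the set `X` is the union of the arcs `α i`, which meet at `p` only. -/
structure IsStar (X : Set (ℝ × ℝ)) (p : ℝ × ℝ) {ι : Type*} (α : ι → ℝ → ℝ × ℝ) (δ : ι → ℝ) :
    Prop where
  pos : ∀ i, 0 < δ i
  cont : ∀ i, ContinuousOn (α i) (Icc 0 (δ i))
  inj : ∀ i, InjOn (α i) (Icc 0 (δ i))
  zero : ∀ i, α i 0 = p
  disjoint : ∀ i j, i ≠ j → ∀ s ∈ Ioc 0 (δ i), ∀ t ∈ Ioc 0 (δ j), α i s ≠ α j t
  cover : ∀ᶠ q in 𝓝 p, q ∈ X → q ∈ ⋃ i, α i '' Icc 0 (δ i)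

/-- Without its origin the germ is connected. It is covered by finitely many closed arms that meet
only at p, a point it does not revisit, so it stays in one arm. -/
theorem IsStar.exists_arm {X : Set (ℝ × ℝ)} {p : ℝ × ℝ} {ι : Type*} [Finite ι]
    {α : ι → ℝ → ℝ × ℝ} {δ : ι → ℝ} (h : IsStar X p α δ) {σ : ℝ → ℝ × ℝ} {ε : ℝ}
    (hσ : IsGerm p σ ε) (hX : ∀ t ∈ Icc 0 ε, σ t ∈ X) :
    ∃ i ε', 0 < ε' ∧ ε' ≤ ε ∧ ∀ t ∈ Icc 0 ε', σ t ∈ α i '' Icc 0 (δ i) := by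
  obtain ⟨ε', h0, hle, hcov⟩ := hσ.eventually h.cover
  have hcov' : ∀ t ∈ Icc 0 ε', σ t ∈ ⋃ i, α i '' Icc 0 (δ i) := fun t ht =>
    hcov t ht (hX t ⟨ht.1, ht.2.trans hle⟩)
  obtain ⟨i, hi⟩ := mem_iUnion.1 (hcov' ε' (right_mem_Icc.2 h0.le))
  refine ⟨i, ε', h0, hle, ?_⟩
  have hcl : ∀ j, IsClosed (α j '' Icc 0 (δ j)) := fun j =>
    (isCompact_Icc.image_of_continuousOn (h.cont j)).isClosed
  have hcl' : IsClosed (⋃ j ∈ {j | j ≠ i}, α j '' Icc 0 (δ j)) :=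
    (Set.toFinite _).isClosed_biUnion fun j _ => hcl j
  have hconn : IsPreconnected (σ '' Ioc 0 ε') :=
    isPreconnected_Ioc.image _ (hσ.cont.mono fun t ht => ⟨ht.1.le, ht.2.trans hle⟩)
  have hzero : σ 0 ∈ α i '' Icc 0 (δ i) :=
    ⟨0, left_mem_Icc.2 (h.pos i).le, (h.zero i).trans hσ.zero.symm⟩
  intro t ht
  rcases ht.1.eq_or_lt with rfl | ht0
  · exact hzero
  by_contra hti
  have hsub : σ '' Ioc 0 ε' ⊆ (α i '' Icc 0 (δ i)) ∪ ⋃ j ∈ {j | j ≠ i}, α j '' Icc 0 (δ j) := by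
    rintro _ ⟨r, hr, rfl⟩
    obtain ⟨j, hj⟩ := mem_iUnion.1 (hcov' r ⟨hr.1.le, hr.2⟩)
    by_cases hji : j = i
    · exact Or.inl (hji ▸ hj)
    · exact Or.inr (mem_biUnion (show j ∈ {j | j ≠ i} from hji) hj)
  have hmeet := isPreconnected_closed_iff.1 hconn _ _ (hcl i) hcl' hsub
    ⟨σ ε', ⟨ε', right_mem_Ioc.2 h0, rfl⟩, hi⟩
    ⟨σ t, ⟨t, ⟨ht0, ht.2⟩, rfl⟩, (hsub ⟨t, ⟨ht0, ht.2⟩, rfl⟩).resolve_left hti⟩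
  obtain ⟨_, ⟨r, hr, rfl⟩, ⟨s, hs, hs'⟩, hj⟩ := hmeet
  obtain ⟨j, hji, s', hs₁, hs₁'⟩ := mem_iUnion₂.1 hj
  have hne := hσ.ne r ⟨hr.1, hr.2.trans hle⟩
  have aux : ∀ k s, s ∈ Icc 0 (δ k) → α k s = σ r → s ∈ Ioc 0 (δ k) := fun k s hs h' =>
    ⟨lt_of_le_of_ne hs.1 (by rintro rfl; exact hne (h'.symm.trans (h.zero k))), hs.2⟩
  exact h.disjoint i j (fun h' => hji h'.symm) s (aux i s hs hs') s' (aux j s' hs₁ hs₁')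
    (hs'.trans hs₁'.symm)

/-- The number of disjoint germs at `p` is at most the number of arms. -/
theorem IsStar.card_le {X : Set (ℝ × ℝ)} {p : ℝ × ℝ} {ι κ : Type*} [Fintype ι] [Fintype κ]
    {α : ι → ℝ → ℝ × ℝ} {δ : ι → ℝ} (h : IsStar X p α δ) {σ : κ → ℝ → ℝ × ℝ} {ε : κ → ℝ}
    (hσ : ∀ k, IsGerm p (σ k) (ε k)) (hX : ∀ k, ∀ t ∈ Icc 0 (ε k), σ k t ∈ X)
    (hdisj : ∀ k l, k ≠ l → ∀ s ∈ Ioc 0 (ε k), ∀ t ∈ Ioc 0 (ε l), σ k s ≠ σ l t) :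
    Fintype.card κ ≤ Fintype.card ι := by
  choose f ε' h0 hle harm using fun k => h.exists_arm (hσ k) (hX k)
  refine Fintype.card_le_of_injective f fun k l hkl => ?_
  by_contra hne
  -- If two germs run in the same arm, their lifts to its parameter start at 0 and become positive,
  -- so they share a value and the germs meet.
  have key : ∀ m, f m = f k → ∃ θ : ℝ → ℝ, ContinuousOn θ (Icc 0 (ε' m)) ∧ θ 0 = 0 ∧
      (∀ t ∈ Icc 0 (ε' m), α (f k) (θ t) = σ m t) ∧ 0 < θ (ε' m) := by
    intro m hm
    obtain ⟨θ, hθ, hθ'⟩ := exists_lift (isCompact_Icc (a := 0) (b := δ (f k))) (h.cont (f k))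
      subset_rfl (fun s hs t ht hst => h.inj (f k) hs ht hst)
      ((hσ m).cont.mono (Icc_subset_Icc_right (hle m))) (fun t ht => hm ▸ harm m t ht)
    have z : ∀ t ∈ Icc 0 (ε' m), θ t = 0 ↔ σ m t = p := fun t ht => by
      rw [← (hθ' t ht).2]
      constructor
      · intro h'
        rw [h', h.zero]
      · intro h'
        exact h.inj _ (hθ' t ht).1 (left_mem_Icc.2 (h.pos _).le) (h'.trans (h.zero _).symm)
    refine ⟨θ, hθ, (z 0 (left_mem_Icc.2 (h0 m).le)).2 (hσ m).zero, fun t ht => (hθ' t ht).2, ?_⟩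
    have hr := right_mem_Icc.2 (h0 m).le
    exact lt_of_le_of_ne (hθ' _ hr).1.1 fun h' =>
      (hσ m).ne _ ⟨h0 m, hle m⟩ ((z _ hr).1 h'.symm)
  obtain ⟨θ₁, hc₁, hz₁, he₁, hp₁⟩ := key k rfl
  obtain ⟨θ₂, hc₂, hz₂, he₂, hp₂⟩ := key l hkl.symm
  obtain ⟨t₁, ht₁, t₂, ht₂, ht⟩ := exists_common_value (h0 k) (h0 l) hc₁ hc₂ hz₁ hz₂ hp₁ hp₂
  refine hdisj k l hne t₁ ⟨ht₁.1, ht₁.2.trans (hle k)⟩ t₂ ⟨ht₂.1, ht₂.2.trans (hle l)⟩ ?_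
  rw [← he₁ t₁ ⟨ht₁.1.le, ht₁.2⟩, ← he₂ t₂ ⟨ht₂.1.le, ht₂.2⟩, ht]

/-! ### Reparametrizations of lattice paths -/

/-- Only continuity of θ is known beforehand. The slope of θ is the quotient of the slope of B by a
slope of A, and the latter converges because `dslope` is continuous at a point of differentiability.
-/
theorem hasDerivAt_of_comp {A B θ : ℝ → ℝ} {D D' t : ℝ} (hA : HasDerivAt A D' (θ t)) (hD : D' ≠ 0)
    (hθ : ContinuousAt θ t) (hAB : ∀ᶠ r in 𝓝 t, A (θ r) = B r) (hB : HasDerivAt B D t) :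
    HasDerivAt θ (D / D') t := by
  rw [hasDerivAt_iff_tendsto_slope]
  have h1 : Tendsto (fun r => dslope A (θ t) (θ r)) (𝓝[≠] t) (𝓝 D') := by
    have hc : ContinuousAt (dslope A (θ t)) (θ t) :=
      continuousAt_dslope_same.2 hA.differentiableAt
    have h2 : Tendsto (dslope A (θ t)) (𝓝 (θ t)) (𝓝 D') := by
      have := hc.tendsto
      rwa [dslope_same, hA.deriv] at this
    exact h2.comp (hθ.tendsto.mono_left nhdsWithin_le_nhds)
  have h3 := (hasDerivAt_iff_tendsto_slope.1 hB).div h1 hD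
  refine h3.congr' ?_
  filter_upwards [h1.eventually_ne hD, nhdsWithin_le_nhds hAB, self_mem_nhdsWithin] with r h4 h5 h6
  have h7 := sub_smul_dslope A (θ t) (θ r)
  rw [h5, hAB.self_of_nhds, smul_eq_mul] at h7
  have h8 : r - t ≠ 0 := sub_ne_zero.2 h6
  change slope B t r / _ = _
  rw [slope_def_field, slope_def_field, ← h7]
  field_simp

/-- By Bézout both r and its inverse are integers. -/
theorem eq_one_or_neg_one_of_smul {p q p' q' : ℤ} (h : IsCoprime p q) (h' : IsCoprime p' q')
    {r : ℝ} (hp : (p : ℝ) = r * p') (hq : (q : ℝ) = r * q') : r = 1 ∨ r = -1 := by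
  obtain ⟨a, b, hab⟩ := h
  obtain ⟨a', b', hab'⟩ := h'
  have e1 : ((a * p + b * q : ℤ) : ℝ) = 1 := by rw [hab]; simp
  have e2 : ((a' * p' + b' * q' : ℤ) : ℝ) = 1 := by rw [hab']; simp
  push_cast at e1 e2
  have e3 : r = ((a' * p + b' * q : ℤ) : ℝ) := by
    push_cast
    rw [hp, hq]
    linear_combination (-r) * e2
  have e4 : r * ((a * p' + b * q' : ℤ) : ℝ) = 1 := by
    push_cast
    rw [← e1, hp, hq]
    ring
  rw [e3] at e4 ⊢
  have e5 : (a' * p + b' * q) * (a * p' + b * q') = 1 := by exact_mod_cast e4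
  rcases Int.eq_one_or_neg_one_of_mul_eq_one e5 with h | h <;> rw [h] <;> simp

/-- The path `γ` on the open interval from `0` to `L` is parametrized by lattice length. -/
def HasPrimitiveVelocity (γ : ℝ → ℝ × ℝ) (L : ℝ) : Prop :=
  ∃ F : Finset ℝ, ∀ t ∈ Ioo (0 : ℝ) L, t ∉ F →
    ∃ p q : ℤ, IsCoprime p q ∧ HasDerivAt γ ((p : ℝ), (q : ℝ)) t

/-- Off a countable set both velocities are primitive and proportional, so θ has derivative 1 or -1.
As θ is injective and continuous it is strictly monotone, which fixes the sign, and the fundamental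
theorem of calculus integrates it. Lattice length is therefore intrinsic to the arc. -/
theorem abs_sub_eq_of_reparametrization {σ α : ℝ → ℝ × ℝ} {L L' : ℝ}
    (hσ : HasPrimitiveVelocity σ L) (hα : HasPrimitiveVelocity α L') {θ : ℝ → ℝ}
    (hθ : ContinuousOn θ (Ioo 0 L)) (hmem : ∀ t ∈ Ioo 0 L, θ t ∈ Ioo 0 L' ∧ α (θ t) = σ t)
    (hinj : InjOn σ (Ioo 0 L)) {s t : ℝ} (hs : s ∈ Ioo 0 L) (ht : t ∈ Ioo 0 L) :
    |θ t - θ s| = |t - s| := by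
  wlog hst : s ≤ t generalizing s t
  · rw [abs_sub_comm, this ht hs (le_of_not_ge hst), abs_sub_comm]
  obtain ⟨F, hF⟩ := hσ
  obtain ⟨F', hF'⟩ := hα
  have hθinj : InjOn θ (Ioo 0 L) := fun a ha b hb hab => hinj ha hb (by
    rw [← (hmem a ha).2, ← (hmem b hb).2, hab])
  have hsub : Icc s t ⊆ Ioo 0 L := fun r hr => ⟨hs.1.trans_le hr.1, hr.2.trans_lt ht.2⟩
  set Z : Set ℝ := (F : Set ℝ) ∪ {r ∈ Ioo 0 L | θ r ∈ F'} with hZ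
  have hZc : Z.Countable := by
    refine (F.countable_toSet).union (Set.Finite.countable ?_)
    refine Set.Finite.of_finite_image ((F'.finite_toSet).subset ?_) (hθinj.mono fun r hr => hr.1)
    rintro _ ⟨r, hr, rfl⟩
    exact hr.2
  have hder : ∀ r ∈ Ioo s t \ Z, ∃ d, HasDerivAt θ d r ∧ (d = 1 ∨ d = -1) := by
    rintro r ⟨hr, hrZ⟩
    have hrL : r ∈ Ioo 0 L := hsub ⟨hr.1.le, hr.2.le⟩
    obtain ⟨p, q, hpq, h1⟩ := hF r hrL fun h => hrZ (Or.inl h)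
    obtain ⟨p', q', hpq', h2⟩ := hF' _ (hmem r hrL).1 fun h => hrZ (Or.inr ⟨hrL, h⟩)
    have hev : ∀ᶠ x in 𝓝 r, α (θ x) = σ x := by
      filter_upwards [isOpen_Ioo.mem_nhds hrL] with x hx using (hmem x hx).2
    have hcat : ContinuousAt θ r := hθ.continuousAt (isOpen_Ioo.mem_nhds hrL)
    have hne : (p' : ℝ) * p' + q' * q' ≠ 0 := by
      intro h0
      have hp0 : (p' : ℝ) = 0 := by nlinarith [mul_self_nonneg (p' : ℝ), mul_self_nonneg (q' : ℝ)]
      have hq0 : (q' : ℝ) = 0 := by nlinarith [mul_self_nonneg (p' : ℝ), mul_self_nonneg (q' : ℝ)]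
      have hp1 : p' = 0 := by exact_mod_cast hp0
      have hq1 : q' = 0 := by exact_mod_cast hq0
      rw [hp1, hq1] at hpq'
      exact not_isCoprime_zero_zero hpq'
    have h1x : HasDerivAt (fun x => (σ x).1) p r := h1.fst
    have h1y : HasDerivAt (fun x => (σ x).2) q r := h1.snd
    have h2x : HasDerivAt (fun x => (α x).1) p' (θ r) := h2.fst
    have h2y : HasDerivAt (fun x => (α x).2) q' (θ r) := h2.snd
    -- Pairing both paths with the velocity (p', q') of `α` reduces to scalar functions; the
    -- derivative p'² + q'² of the first one is nonzero.
    have h3 := hasDerivAt_of_comp (A := fun x => p' * (α x).1 + q' * (α x).2)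
      (B := fun x => p' * (σ x).1 + q' * (σ x).2)
      ((h2x.const_mul (p' : ℝ)).add (h2y.const_mul (q' : ℝ))) hne hcat
      (hev.mono fun x hx => by rw [hx]) ((h1x.const_mul (p' : ℝ)).add (h1y.const_mul (q' : ℝ)))
    refine ⟨_, h3, eq_one_or_neg_one_of_smul hpq hpq' ?_ ?_⟩
    · refine h1x.unique (((h2x.comp r h3).congr_of_eventuallyEq ?_).congr_deriv (mul_comm _ _))
      exact hev.mono fun x hx => by rw [Function.comp_apply, hx]
    · refine h1y.unique (((h2y.comp r h3).congr_of_eventuallyEq ?_).congr_deriv (mul_comm _ _))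
      exact hev.mono fun x hx => by rw [Function.comp_apply, hx]
  have hcont := hθ.mono hsub
  have ftc : ∀ d : ℝ, (∀ r ∈ Ioo s t \ Z, HasDerivAt θ d r) → d * (t - s) = θ t - θ s := by
    intro d hd
    rw [← MeasureTheory.integral_eq_of_hasDerivAt_off_countable_of_le θ (fun _ => d) hst hZc hcont
      hd (by simp)]
    simp [mul_comm]
  rcases hcont.strictMonoOn_of_injOn_Icc' hst (hθinj.mono hsub) with hm | hm
  · have := ftc 1 fun r hr => by
      obtain ⟨d, h1, h2⟩ := hder r hr
      have h0 : 0 ≤ d := by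
        have hmono : MonotoneOn θ (Icc s t) := hm.monotoneOn
        have := hmono.derivWithin_nonneg (x := r)
        rwa [h1.hasDerivWithinAt.derivWithin (uniqueDiffOn_Icc (hr.1.1.trans hr.1.2) r
          ⟨hr.1.1.le, hr.1.2.le⟩)] at this
      rcases h2 with rfl | rfl
      · exact h1
      · linarith
    rw [← this, one_mul]
  · have := ftc (-1) fun r hr => by
      obtain ⟨d, h1, h2⟩ := hder r hr
      have h0 : d ≤ 0 := by
        have hmono : AntitoneOn θ (Icc s t) := hm.antitoneOn
        have := hmono.derivWithin_nonpos (x := r)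
        rwa [h1.hasDerivWithinAt.derivWithin (uniqueDiffOn_Icc (hr.1.1.trans hr.1.2) r
          ⟨hr.1.1.le, hr.1.2.le⟩)] at this
      rcases h2 with rfl | rfl
      · linarith
      · exact h1
    rw [← this, neg_one_mul, abs_neg]

/-- An isometry of an interval is a translation or a reflection; the images of two reference points
decide which. -/
theorem exists_eq_add_or_sub_of_abs {θ : ℝ → ℝ} {L : ℝ} (hL : 0 < L)
    (h : ∀ s ∈ Ioo 0 L, ∀ t ∈ Ioo 0 L, |θ t - θ s| = |t - s|) :
    ∃ c, (∀ t ∈ Ioo 0 L, θ t = c + t) ∨ ∀ t ∈ Ioo 0 L, θ t = c - t := by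
  have h1 : L / 3 ∈ Ioo 0 L := ⟨by linarith, by linarith⟩
  have h2 : L / 2 ∈ Ioo 0 L := ⟨by linarith, by linarith⟩
  have e := h _ h1 _ h2
  rw [abs_of_pos (by linarith : 0 < L / 2 - L / 3)] at e
  rcases abs_cases (θ (L / 2) - θ (L / 3)) with ⟨e1, -⟩ | ⟨e1, -⟩
  · refine ⟨θ (L / 3) - L / 3, Or.inl fun t ht => ?_⟩
    have a1 := h _ h1 _ ht
    have a2 := h _ h2 _ ht
    rcases abs_cases (θ t - θ (L / 3)) with ⟨b1, -⟩ | ⟨b1, -⟩ <;>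
    rcases abs_cases (θ t - θ (L / 2)) with ⟨b2, -⟩ | ⟨b2, -⟩ <;>
    rcases abs_cases (t - L / 3) with ⟨b3, -⟩ | ⟨b3, -⟩ <;>
    rcases abs_cases (t - L / 2) with ⟨b4, -⟩ | ⟨b4, -⟩ <;> linarith
  · refine ⟨θ (L / 3) + L / 3, Or.inr fun t ht => ?_⟩
    have a1 := h _ h1 _ ht
    have a2 := h _ h2 _ ht
    rcases abs_cases (θ t - θ (L / 3)) with ⟨b1, -⟩ | ⟨b1, -⟩ <;>
    rcases abs_cases (θ t - θ (L / 2)) with ⟨b2, -⟩ | ⟨b2, -⟩ <;>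
    rcases abs_cases (t - L / 3) with ⟨b3, -⟩ | ⟨b3, -⟩ <;>
    rcases abs_cases (t - L / 2) with ⟨b4, -⟩ | ⟨b4, -⟩ <;> linarith

/-- If the closed arc of length `L` runs inside the closed arc of length `L'`, and joins endpoints
of that arc without passing through them, then the two arcs coincide, up to reversal. -/
theorem eq_or_reverse_of_reparametrization {σ α : ℝ → ℝ × ℝ} {L L' : ℝ} (hL : 0 < L)
    (hσc : ContinuousOn σ (Icc 0 L)) (hαc : ContinuousOn α (Icc 0 L'))
    (hσ : HasPrimitiveVelocity σ L) (hα : HasPrimitiveVelocity α L')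
    (hinj : InjOn σ (Ioo 0 L)) (hαinj : ∀ s ∈ Ioo 0 L', ∀ t ∈ Icc 0 L', α s = α t → s = t)
    (hmem : ∀ t ∈ Ioo 0 L, σ t ∈ α '' Ioo 0 L')
    (h0 : σ 0 ∉ α '' Ioo 0 L') (h1 : σ L ∉ α '' Ioo 0 L') :
    L = L' ∧ ((∀ t ∈ Icc 0 L, σ t = α t) ∨ ∀ t ∈ Icc 0 L, σ t = α (L - t)) := by
  obtain ⟨θ, hθ, hθ'⟩ := exists_lift isCompact_Icc hαc Ioo_subset_Icc_self hαinj
    (hσc.mono Ioo_subset_Icc_self) hmem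
  obtain ⟨c, hc⟩ := exists_eq_add_or_sub_of_abs hL fun s hs t ht =>
    abs_sub_eq_of_reparametrization hσ hα hθ hθ' hinj hs ht
  have hcl : Icc 0 L ⊆ closure (Ioo 0 L) := (closure_Ioo hL.ne).ge
  have l0 : (0 : ℝ) ∈ Icc 0 L := left_mem_Icc.2 hL.le
  have l1 : L ∈ Icc 0 L := right_mem_Icc.2 hL.le
  have general : ∀ f : ℝ → ℝ, Continuous f → (∀ t ∈ Ioo 0 L, θ t = f t) →
      (∀ t ∈ Icc 0 L, f t ∈ Icc 0 L') ∧ ∀ t ∈ Icc 0 L, σ t = α (f t) := by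
    intro f hf hfθ
    have hmaps : MapsTo f (Icc 0 L) (Icc 0 L') := by
      intro t ht
      have := map_mem_closure hf (hcl ht) (t := Ioo 0 L') (fun r hr => by
        rw [← hfθ r hr]
        exact (hθ' r hr).1)
      exact closure_minimal Ioo_subset_Icc_self isClosed_Icc this
    refine ⟨hmaps, fun t ht => ?_⟩
    refine Set.EqOn.of_subset_closure (s := Ioo 0 L) (t := Icc 0 L) (f := σ) (g := fun t => α (f t))
      (fun r hr => ?_) hσc (hαc.comp hf.continuousOn hmaps) Ioo_subset_Icc_self hcl ht
    change σ r = α (f r)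
    rw [← hfθ r hr, (hθ' r hr).2]
  have ends : ∀ x ∈ Icc 0 L', ∀ t, σ t = α x → σ t ∉ α '' Ioo 0 L' → x = 0 ∨ x = L' := by
    intro x hx t h h'
    by_contra hne
    push Not at hne
    exact h' ⟨x, ⟨lt_of_le_of_ne hx.1 hne.1.symm, lt_of_le_of_ne hx.2 hne.2⟩, h.symm⟩
  rcases hc with hc | hc
  · obtain ⟨g1, g2⟩ := general (fun t => c + t) (by fun_prop) hc
    have z0 := ends _ (g1 0 l0) 0 (g2 0 l0) h0
    have z1 := ends _ (g1 L l1) L (g2 L l1) h1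
    have i0 := g1 0 l0
    have i1 := g1 L l1
    simp only [mem_Icc] at i0 i1
    -- Both ends of the interval go to ends of the arc, and a translation is increasing, so it
    -- starts at 0.
    have hc0 : c = 0 := by
      rcases z0 with z | z
      · linarith
      · rcases z1 with z' | z' <;> linarith [i0.1, i1.2]
    have hLL : L = L' := by
      rcases z1 with z' | z'
      · linarith
      · linarith
    refine ⟨hLL, Or.inl fun t ht => ?_⟩
    rw [g2 t ht, hc0, zero_add]
  · obtain ⟨g1, g2⟩ := general (fun t => c - t) (by fun_prop) hc
    have z0 := ends _ (g1 0 l0) 0 (g2 0 l0) h0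
    have z1 := ends _ (g1 L l1) L (g2 L l1) h1
    have i0 := g1 0 l0
    have i1 := g1 L l1
    simp only [mem_Icc] at i0 i1
    have hc0 : c = L := by
      rcases z1 with z | z
      · linarith
      · rcases z0 with z' | z' <;> linarith [i0.1, i1.2]
    have hLL : L = L' := by
      rcases z0 with z' | z'
      · linarith
      · linarith
    refine ⟨hLL, Or.inr fun t ht => ?_⟩
    rw [g2 t ht, hc0]

/-! ### Half-edges and embedded graphs -/

namespace WeightedGraph

/-- An orientation of the edges assigns to each half-edge `(e, b)` its vertex. -/
def IsOrientation (G : WeightedGraph) (o : G.E × Bool → G.V) : Prop :=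
  ∀ e, G.ends e = s(o (e, false), o (e, true))

theorem IsOrientation.valence_eq {G : WeightedGraph} {o : G.E × Bool → G.V}
    (ho : G.IsOrientation o) (v : G.V) : G.valence v = Nat.card {η // o η = v} := by
  classical
  rw [Nat.card_eq_fintype_card, Fintype.card_subtype, Finset.card_filter,
    Fintype.sum_prod_type, valence, Finset.card_filter, Finset.card_filter,
    ← Finset.sum_add_distrib]
  refine Finset.sum_congr rfl fun e _ => ?_
  rw [Fintype.sum_bool, ho e]
  simp only [Sym2.mem_iff, Sym2.eq_iff]
  by_cases h1 : o (e, false) = v <;> by_cases h2 : o (e, true) = v <;>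
    simp [h1, h2, eq_comm (a := v)]

theorem IsOrientation.sum_valence {G : WeightedGraph} {o : G.E × Bool → G.V}
    (ho : G.IsOrientation o) : ∑ v, G.valence v = 2 * Fintype.card G.E := by
  classical
  have h1 : ∀ v, G.valence v = (Finset.univ.filter fun η => o η = v).card := fun v => by
    rw [ho.valence_eq, Nat.card_eq_fintype_card, Fintype.card_subtype]
  simp only [h1]
  have h2 := Finset.card_eq_sum_card_fiberwise (f := o) (s := Finset.univ) (t := Finset.univ)
    fun η _ => Finset.mem_coe.2 (Finset.mem_univ _)
  rw [← h2, Finset.card_univ, Fintype.card_prod, Fintype.card_bool, mul_comm]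

end WeightedGraph

/-- The path that starts at the half-edge `η`. -/
def halfEdgePath {E : Type} (ℓ : E → ℝ≥0) (γ : E → ℝ → ℝ × ℝ) (η : E × Bool) (t : ℝ) : ℝ × ℝ :=
  if η.2 then γ η.1 (ℓ η.1 - t) else γ η.1 t

/-- The union of the closed edges. -/
def pathImage {E : Type} (ℓ : E → ℝ≥0) (γ : E → ℝ → ℝ × ℝ) : Set (ℝ × ℝ) :=
  ⋃ e, γ e '' Icc 0 (ℓ e : ℝ)

namespace IsLatticeEmbedding

variable {G : WeightedGraph} {ℓ : G.E → ℝ≥0} {C : Set (ℝ × ℝ)} {φ : G.V → ℝ × ℝ}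
  {γ : G.E → ℝ → ℝ × ℝ}

theorem pathImage_subset (h : IsLatticeEmbedding G ℓ C φ γ) : pathImage ℓ γ ⊆ C := by
  rintro _ hq
  obtain ⟨e, t, ht, rfl⟩ := mem_iUnion.1 hq
  exact h.path_mem e t ht

theorem isCompact_pathImage (h : IsLatticeEmbedding G ℓ C φ γ) : IsCompact (pathImage ℓ γ) :=
  isCompact_iUnion fun e => isCompact_Icc.image_of_continuousOn (h.continuousOn e)

theorem exists_orientation (h : IsLatticeEmbedding G ℓ C φ γ) :
    ∃ o : G.E × Bool → G.V, G.IsOrientation o ∧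
      ∀ e, φ (o (e, false)) = γ e 0 ∧ φ (o (e, true)) = γ e (ℓ e) := by
  have key : ∀ e, ∃ o : Bool → G.V, G.ends e = s(o false, o true) ∧
      φ (o false) = γ e 0 ∧ φ (o true) = γ e (ℓ e) := by
    intro e
    obtain ⟨u, v, huv⟩ : ∃ u v, G.ends e = s(u, v) := by
      induction G.ends e using Sym2.ind with
      | _ u v => exact ⟨u, v, rfl⟩
    have h1 := h.ends_eq e
    rw [huv, Sym2.map_mk, Sym2.eq_iff] at h1
    rcases h1 with ⟨a, b⟩ | ⟨a, b⟩
    · exact ⟨fun x => if x then v else u, by simpa using huv, by simpa using a, by simpa using b⟩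
    · exact ⟨fun x => if x then u else v, by simpa [Sym2.eq_swap] using huv, by simpa using b,
        by simpa using a⟩
  choose o ho using key
  exact ⟨fun η => o η.1 η.2, fun e => (ho e).1, fun e => (ho e).2⟩

theorem exists_vertex_zero (h : IsLatticeEmbedding G ℓ C φ γ) (e : G.E) : ∃ v, γ e 0 = φ v :=
  let ⟨o, _, ho⟩ := h.exists_orientation
  ⟨o (e, false), (ho e).1.symm⟩

theorem exists_vertex_length (h : IsLatticeEmbedding G ℓ C φ γ) (e : G.E) :
    ∃ v, γ e (ℓ e) = φ v :=
  let ⟨o, _, ho⟩ := h.exists_orientation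
  ⟨o (e, true), (ho e).2.symm⟩

theorem eq_of_eq_interior (h : IsLatticeEmbedding G ℓ C φ γ) {e e' : G.E} {s t : ℝ}
    (hs : s ∈ Ioo 0 (ℓ e : ℝ)) (ht : t ∈ Icc 0 (ℓ e' : ℝ)) (hst : γ e s = γ e' t) :
    e = e' ∧ s = t := by
  rcases ht.1.eq_or_lt with rfl | h0
  · obtain ⟨v, hv⟩ := h.exists_vertex_zero e'
    exact absurd (hst.trans hv) (h.path_ne_vertex e v s hs)
  rcases ht.2.eq_or_lt with rfl | h1
  · obtain ⟨v, hv⟩ := h.exists_vertex_length e'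
    exact absurd (hst.trans hv) (h.path_ne_vertex e v s hs)
  exact h.path_injective e e' s hs t ⟨h0, h1⟩ hst

/-- One third of the edge, rather than one half, keeps the two closed half-edges of one edge
disjoint. -/
theorem halfEdgePath_eq (η : G.E × Bool) {t : ℝ} (ht : t ∈ Ioc 0 ((ℓ η.1 : ℝ) / 3)) :
    ∃ s ∈ Ioo 0 (ℓ η.1 : ℝ), halfEdgePath ℓ γ η t = γ η.1 s ∧
      (η.2 = false → s = t) ∧ (η.2 = true → s = ℓ η.1 - t) := by
  have := ht.1
  have := ht.2
  obtain ⟨e, b⟩ := η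
  cases b
  · exact ⟨t, ⟨ht.1, by dsimp only at *; linarith⟩, by simp [halfEdgePath]⟩
  · exact ⟨ℓ e - t, ⟨by dsimp only at *; linarith, by dsimp only at *; linarith⟩,
      by simp [halfEdgePath]⟩

theorem continuousOn_halfEdgePath (h : IsLatticeEmbedding G ℓ C φ γ) (η : G.E × Bool) :
    ContinuousOn (halfEdgePath ℓ γ η) (Icc 0 (ℓ η.1 : ℝ)) := by
  obtain ⟨e, b⟩ := η
  cases b
  · exact h.continuousOn e
  · refine (h.continuousOn e).comp (f := fun t : ℝ => (ℓ e : ℝ) - t) (by fun_prop) fun t ht => ?_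
    exact ⟨by have := ht.2; dsimp only at *; linarith, by have := ht.1; dsimp only at *; linarith⟩

theorem isGerm_halfEdgePath (h : IsLatticeEmbedding G ℓ C φ γ) (hℓ : ∀ e, 0 < ℓ e)
    {o : G.E × Bool → G.V} (ho : ∀ e, φ (o (e, false)) = γ e 0 ∧ φ (o (e, true)) = γ e (ℓ e))
    (η : G.E × Bool) : IsGerm (φ (o η)) (halfEdgePath ℓ γ η) ((ℓ η.1 : ℝ) / 3) := by
  have hp : (0 : ℝ) < ℓ η.1 := hℓ η.1
  refine ⟨by linarith, (h.continuousOn_halfEdgePath η).mono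
    (Icc_subset_Icc_right (by linarith)), ?_, fun t ht => ?_⟩
  · obtain ⟨e, b⟩ := η
    cases b
    · exact (ho e).1.symm
    · simpa [halfEdgePath] using (ho e).2.symm
  · obtain ⟨s, hs, h1, -⟩ := halfEdgePath_eq (γ := γ) η ht
    rw [h1]
    exact h.path_ne_vertex _ _ _ hs

theorem halfEdgePath_mem (hℓ : ∀ e, 0 < ℓ e) (η : G.E × Bool)
    {t : ℝ} (ht : t ∈ Icc 0 ((ℓ η.1 : ℝ) / 3)) : halfEdgePath ℓ γ η t ∈ pathImage ℓ γ := by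
  have hp : (0 : ℝ) < ℓ η.1 := hℓ η.1
  have := ht.1
  have := ht.2
  refine mem_iUnion.2 ⟨η.1, ?_⟩
  obtain ⟨e, b⟩ := η
  dsimp only at *
  cases b
  · exact ⟨t, ⟨ht.1, by linarith⟩, by simp [halfEdgePath]⟩
  · exact ⟨ℓ e - t, ⟨by linarith, by linarith⟩, by simp [halfEdgePath]⟩

theorem halfEdgePath_ne (h : IsLatticeEmbedding G ℓ C φ γ) {η η' : G.E × Bool} (hne : η ≠ η')
    {s t : ℝ} (hs : s ∈ Ioc 0 ((ℓ η.1 : ℝ) / 3)) (ht : t ∈ Ioc 0 ((ℓ η'.1 : ℝ) / 3)) :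
    halfEdgePath ℓ γ η s ≠ halfEdgePath ℓ γ η' t := by
  intro heq
  obtain ⟨s', hs', h1, h1f, h1t⟩ := halfEdgePath_eq (γ := γ) η hs
  obtain ⟨t', ht', h2, h2f, h2t⟩ := halfEdgePath_eq (γ := γ) η' ht
  rw [h1, h2] at heq
  obtain ⟨he, hst⟩ := h.path_injective _ _ _ hs' _ ht' heq
  obtain ⟨e, b⟩ := η
  obtain ⟨e', b'⟩ := η'
  obtain rfl : e = e' := he
  have a1 := hs.1
  have a2 := hs.2
  have a3 := ht.1
  have a4 := ht.2
  dsimp only at *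
  cases b <;> cases b'
  · exact hne rfl
  · have := h1f rfl
    have := h2t rfl
    linarith
  · have := h1t rfl
    have := h2f rfl
    linarith
  · exact hne rfl

theorem isStar_vertex (h : IsLatticeEmbedding G ℓ C φ γ) (hℓ : ∀ e, 0 < ℓ e)
    {o : G.E × Bool → G.V} (ho : ∀ e, φ (o (e, false)) = γ e 0 ∧ φ (o (e, true)) = γ e (ℓ e))
    (v : G.V) : IsStar (pathImage ℓ γ) (φ v) (fun η : {η // o η = v} => halfEdgePath ℓ γ η.1)
      fun η => (ℓ η.1.1 : ℝ) / 3 := by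
  have hg : ∀ η : {η // o η = v}, IsGerm (φ v) (halfEdgePath ℓ γ η.1) ((ℓ η.1.1 : ℝ) / 3) := by
    rintro ⟨η, rfl⟩
    exact h.isGerm_halfEdgePath hℓ ho η
  refine ⟨fun η => (hg η).pos, fun η => (hg η).cont, fun η s hs t ht hst => ?_, fun η => (hg η).zero,
    fun η η' hne s hs t ht => h.halfEdgePath_ne (fun h' => hne (Subtype.ext h')) hs ht, ?_⟩
  · rcases hs.1.eq_or_lt with rfl | hs0 <;> rcases ht.1.eq_or_lt with rfl | ht0
    · rfl
    · exact absurd (hst.symm.trans (hg η).zero) ((hg η).ne t ⟨ht0, ht.2⟩)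
    · exact absurd (hst.trans (hg η).zero) ((hg η).ne s ⟨hs0, hs.2⟩)
    · obtain ⟨s', hs', h1, h1f, h1t⟩ := halfEdgePath_eq (γ := γ) η.1 ⟨hs0, hs.2⟩
      obtain ⟨t', ht', h2, h2f, h2t⟩ := halfEdgePath_eq (γ := γ) η.1 ⟨ht0, ht.2⟩
      have := (h.path_injective _ _ _ hs' _ ht' (h1.symm.trans (hst.trans h2))).2
      cases hb : η.1.2
      · rw [← h1f hb, ← h2f hb, this]
      · have e1 := h1t hb
        have e2 := h2t hb
        linarith
  -- `T e` consists of the parameters of `e` on no open half-edge at `v`. Its images form a closed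
  -- set that misses `φ v`, and the complement is the neighbourhood sought.
  · let T : G.E → Set ℝ := fun e => Icc 0 (ℓ e : ℝ) ∩
      ({t | o (e, false) ≠ v} ∪ {t | (ℓ e : ℝ) / 3 ≤ t}) ∩
      ({t | o (e, true) ≠ v} ∪ {t | t ≤ ℓ e - (ℓ e : ℝ) / 3})
    have hTc : ∀ e, IsCompact (T e) := fun e => by
      refine (isCompact_Icc.inter_right (isClosed_const.union ?_)).inter_right
        (isClosed_const.union ?_)
      · exact isClosed_le continuous_const continuous_id
      · exact isClosed_le continuous_id continuous_const
    have hF : IsClosed (⋃ e, γ e '' T e) := isClosed_iUnion_of_finite fun e =>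
      ((hTc e).image_of_continuousOn ((h.continuousOn e).mono fun t ht => ht.1.1)).isClosed
    have hnot : φ v ∉ ⋃ e, γ e '' T e := by
      intro hv
      obtain ⟨e, t, ⟨⟨ht, ht1⟩, ht2⟩, htv⟩ := mem_iUnion.1 hv
      have hp : (0 : ℝ) < ℓ e := hℓ e
      rcases ht.1.eq_or_lt with rfl | h0
      · have : o (e, false) = v := h.vertex_injective ((ho e).1.trans htv)
        rcases ht1 with h' | h'
        · exact h' this
        · exact absurd h' (by simp; linarith)
      rcases ht.2.eq_or_lt with rfl | h1
      · have : o (e, true) = v := h.vertex_injective ((ho e).2.trans htv)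
        rcases ht2 with h' | h'
        · exact h' this
        · exact absurd h' (by simp; linarith)
      exact h.path_ne_vertex e v t ⟨h0, h1⟩ htv
    filter_upwards [hF.isOpen_compl.mem_nhds hnot] with q hq hqX
    obtain ⟨e, t, ht, rfl⟩ := mem_iUnion.1 hqX
    have hnt : t ∉ T e := fun h' => hq (mem_iUnion.2 ⟨e, t, h', rfl⟩)
    have hsplit : (o (e, false) = v ∧ t < (ℓ e : ℝ) / 3) ∨
        (o (e, true) = v ∧ ℓ e - (ℓ e : ℝ) / 3 < t) := by
      by_contra hcon
      rw [not_or, not_and_or, not_and_or, not_lt, not_lt] at hcon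
      exact hnt ⟨⟨ht, hcon.1⟩, hcon.2⟩
    rcases hsplit with ⟨h1, h2⟩ | ⟨h1, h2⟩
    · exact mem_iUnion.2 ⟨⟨(e, false), h1⟩, t, ⟨ht.1, h2.le⟩, by simp [halfEdgePath]⟩
    · have := ht.2
      exact mem_iUnion.2 ⟨⟨(e, true), h1⟩, ℓ e - t, ⟨by linarith, by dsimp only; linarith⟩,
        by simp [halfEdgePath]⟩

/-- The two directions in which an edge leaves an interior point. -/
def sidePath (γ : ℝ → ℝ × ℝ) (t₀ : ℝ) (b : Bool) (t : ℝ) : ℝ × ℝ :=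
  γ (if b then t₀ + t else t₀ - t)

theorem isStar_interior (h : IsLatticeEmbedding G ℓ C φ γ) {e : G.E} {t₀ : ℝ}
    (ht₀ : t₀ ∈ Ioo 0 (ℓ e : ℝ)) :
    IsStar (pathImage ℓ γ) (γ e t₀) (sidePath (γ e) t₀) fun _ => min t₀ (ℓ e - t₀) / 2 := by
  set δ := min t₀ (ℓ e - t₀) / 2 with hδ
  have hδ0 : 0 < δ := half_pos (lt_min ht₀.1 (sub_pos.2 ht₀.2))
  have hδ1 : δ ≤ t₀ / 2 := div_le_div_of_nonneg_right (min_le_left _ _) zero_le_two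
  have hδ2 : δ ≤ (ℓ e - t₀) / 2 := div_le_div_of_nonneg_right (min_le_right _ _) zero_le_two
  have a1 := ht₀.1
  have a2 := ht₀.2
  have hmem : ∀ b : Bool, ∀ t ∈ Icc 0 δ, (if b then t₀ + t else t₀ - t) ∈ Ioo 0 (ℓ e : ℝ) := by
    intro b t ht
    have := ht.1
    have := ht.2
    cases b <;> simp <;> constructor <;> linarith
  have heq : ∀ b b' : Bool, ∀ s ∈ Icc 0 δ, ∀ t ∈ Icc 0 δ,
      sidePath (γ e) t₀ b s = sidePath (γ e) t₀ b' t →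
      (if b then t₀ + s else t₀ - s) = if b' then t₀ + t else t₀ - t :=
    fun b b' s hs t ht hst => (h.path_injective _ _ _ (hmem b s hs) _ (hmem b' t ht) hst).2
  refine ⟨fun _ => hδ0, fun b => ?_, fun b s hs t ht hst => ?_, fun b => ?_,
    fun b b' hne s hs t ht hst => ?_, ?_⟩
  · refine (h.continuousOn e).comp (f := fun t : ℝ => if b then t₀ + t else t₀ - t) ?_
      fun t ht => Ioo_subset_Icc_self (hmem b t ht)
    cases b <;> simp <;> fun_prop
  · have := heq b b s hs t ht hst
    cases b <;> simp at this <;> exact this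
  · cases b <;> simp [sidePath]
  · have := heq b b' s (Ioc_subset_Icc_self hs) t (Ioc_subset_Icc_self ht) hst
    have := hs.1
    have := ht.1
    cases b <;> cases b' <;> simp at * <;> linarith
  -- The other edges, and this edge away from `t₀`, form a closed set that misses the point.
  · have hF : IsClosed ((⋃ e' ∈ {e' | e' ≠ e}, γ e' '' Icc 0 (ℓ e' : ℝ)) ∪
        γ e '' (Icc 0 (ℓ e : ℝ) \ Ioo (t₀ - δ) (t₀ + δ))) := by
      refine IsClosed.union ((Set.toFinite _).isClosed_biUnion fun e' _ =>
        (isCompact_Icc.image_of_continuousOn (h.continuousOn e')).isClosed) ?_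
      exact ((isCompact_Icc.diff isOpen_Ioo).image_of_continuousOn
        ((h.continuousOn e).mono sdiff_subset)).isClosed
    have hnot : γ e t₀ ∉ ((⋃ e' ∈ {e' | e' ≠ e}, γ e' '' Icc 0 (ℓ e' : ℝ)) ∪
        γ e '' (Icc 0 (ℓ e : ℝ) \ Ioo (t₀ - δ) (t₀ + δ))) := by
      rintro (hq | ⟨t, ⟨ht, ht'⟩, htq⟩)
      · obtain ⟨e', he', t, ht, htq⟩ := mem_iUnion₂.1 hq
        exact he' (h.eq_of_eq_interior ht₀ ht htq.symm).1.symm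
      · have := (h.eq_of_eq_interior ht₀ ht htq.symm).2
        subst this
        exact ht' ⟨by linarith, by linarith⟩
    filter_upwards [hF.isOpen_compl.mem_nhds hnot] with q hq hqX
    obtain ⟨e', t, ht, rfl⟩ := mem_iUnion.1 hqX
    have he' : e' = e := by
      by_contra hne
      exact hq (Or.inl (mem_iUnion₂.2 ⟨e', hne, t, ht, rfl⟩))
    subst he'
    have ht' : t ∈ Ioo (t₀ - δ) (t₀ + δ) := by
      by_contra hne
      exact hq (Or.inr ⟨t, ⟨ht, hne⟩, rfl⟩)
    rcases le_total t₀ t with hle | hle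
    · exact mem_iUnion.2 ⟨true, t - t₀, ⟨by linarith, by have := ht'.2; linarith⟩,
        by simp [sidePath]⟩
    · exact mem_iUnion.2 ⟨false, t₀ - t, ⟨by linarith, by have := ht'.1; linarith⟩,
        by simp [sidePath]⟩

/-- Two disjoint germs of the graph at each of its points. -/
theorem exists_two_germs (h : IsLatticeEmbedding G ℓ C φ γ) (hℓ : ∀ e, 0 < ℓ e)
    (hval : ∀ v, 2 ≤ G.valence v) {p : ℝ × ℝ} (hp : p ∈ pathImage ℓ γ) :
    ∃ σ₁ σ₂ ε, IsGerm p σ₁ ε ∧ IsGerm p σ₂ ε ∧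
      (∀ t ∈ Icc 0 ε, σ₁ t ∈ pathImage ℓ γ) ∧ (∀ t ∈ Icc 0 ε, σ₂ t ∈ pathImage ℓ γ) ∧
      ∀ s ∈ Ioc 0 ε, ∀ t ∈ Ioc 0 ε, σ₁ s ≠ σ₂ t := by
  have vertexCase : ∀ v, ∃ σ₁ σ₂ ε, IsGerm (φ v) σ₁ ε ∧ IsGerm (φ v) σ₂ ε ∧
      (∀ t ∈ Icc 0 ε, σ₁ t ∈ pathImage ℓ γ) ∧ (∀ t ∈ Icc 0 ε, σ₂ t ∈ pathImage ℓ γ) ∧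
      ∀ s ∈ Ioc 0 ε, ∀ t ∈ Ioc 0 ε, σ₁ s ≠ σ₂ t := by
    intro v
    obtain ⟨o, ho, ho'⟩ := h.exists_orientation
    have h1 := hval v
    rw [ho.valence_eq] at h1
    obtain ⟨⟨η, hη⟩, ⟨η', hη'⟩, hne⟩ := (Finite.one_lt_card_iff_nontrivial.1 h1).exists_pair_ne
    subst hη
    have g1 := h.isGerm_halfEdgePath hℓ ho' η
    have g2 := h.isGerm_halfEdgePath hℓ ho' η'
    rw [hη'] at g2
    refine ⟨_, _, min ((ℓ η.1 : ℝ) / 3) ((ℓ η'.1 : ℝ) / 3), g1.mono (lt_min g1.pos g2.pos)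
      (min_le_left _ _), g2.mono (lt_min g1.pos g2.pos) (min_le_right _ _), fun t ht => ?_,
      fun t ht => ?_, fun s hs t ht => ?_⟩
    · exact halfEdgePath_mem hℓ _ ⟨ht.1, ht.2.trans (min_le_left _ _)⟩
    · exact halfEdgePath_mem hℓ _ ⟨ht.1, ht.2.trans (min_le_right _ _)⟩
    · exact h.halfEdgePath_ne (fun h' => hne (Subtype.ext h'))
        ⟨hs.1, hs.2.trans (min_le_left _ _)⟩ ⟨ht.1, ht.2.trans (min_le_right _ _)⟩
  obtain ⟨e, t, ht, rfl⟩ := mem_iUnion.1 hp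
  rcases ht.1.eq_or_lt with rfl | h0
  · obtain ⟨v, hv⟩ := h.exists_vertex_zero e
    rw [hv]
    exact vertexCase v
  rcases ht.2.eq_or_lt with rfl | h1
  · obtain ⟨v, hv⟩ := h.exists_vertex_length e
    rw [hv]
    exact vertexCase v
  have hs := h.isStar_interior ⟨h0, h1⟩
  have hg : ∀ b, IsGerm (γ e t) (sidePath (γ e) t b) (min t (ℓ e - t) / 2) := fun b =>
    ⟨hs.pos b, hs.cont b, hs.zero b, fun r hr hrp =>
      hr.1.ne' (hs.inj b (Ioc_subset_Icc_self hr) (left_mem_Icc.2 (hs.pos b).le)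
        (hrp.trans (hs.zero b).symm))⟩
  have hmem : ∀ b, ∀ r ∈ Icc 0 (min t (ℓ e - t) / 2), sidePath (γ e) t b r ∈ pathImage ℓ γ := by
    intro b r hr
    have m1 := min_le_left t (ℓ e - t)
    have m2 := min_le_right t (ℓ e - t)
    have r1 := hr.1
    have r2 := hr.2
    refine mem_iUnion.2 ⟨e, _, ?_, rfl⟩
    cases b <;> simp <;> constructor <;> linarith
  exact ⟨_, _, _, hg false, hg true, hmem false, hmem true, hs.disjoint _ _ (by simp)⟩

/-- A graph without vertices of valence at most two inside a trivalent graph of the same genus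
coincides with it. -/
theorem isometric_of_pathImage_subset (h : IsLatticeEmbedding G ℓ C φ γ) (hℓ : ∀ e, 0 < ℓ e)
    (hval : ∀ v, 3 ≤ G.valence v) {G' : WeightedGraph} {ℓ' : G'.E → ℝ≥0} {C' : Set (ℝ × ℝ)}
    {φ' : G'.V → ℝ × ℝ} {γ' : G'.E → ℝ → ℝ × ℝ} (h' : IsLatticeEmbedding G' ℓ' C' φ' γ')
    (hℓ' : ∀ e, 0 < ℓ' e) (hval' : ∀ v, G'.valence v = 3)
    (hw : ∀ v, G.weight v = 0) (hw' : ∀ v, G'.weight v = 0)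
    (hgenus : Fintype.card G.E + Fintype.card G'.V = Fintype.card G'.E + Fintype.card G.V)
    (hsub : pathImage ℓ γ ⊆ pathImage ℓ' γ') : G.Isometric ℓ G' ℓ' := by
  classical
  obtain ⟨o, ho, hφ⟩ := h.exists_orientation
  obtain ⟨o', ho', hφ'⟩ := h'.exists_orientation
  have hgerm : ∀ v, ∀ η : {η // o η = v}, IsGerm (φ v) (halfEdgePath ℓ γ η.1) ((ℓ η.1.1 : ℝ) / 3) := by
    rintro v ⟨η, rfl⟩
    exact h.isGerm_halfEdgePath hℓ hφ η
  have hcard : ∀ v {ι : Type} [Fintype ι] (α : ι → ℝ → ℝ × ℝ) (δ : ι → ℝ),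
      IsStar (pathImage ℓ' γ') (φ v) α δ → G.valence v ≤ Fintype.card ι := by
    intro v ι _ α δ hs
    rw [ho.valence_eq, Nat.card_eq_fintype_card]
    exact hs.card_le (hgerm v) (fun η t ht => hsub (halfEdgePath_mem hℓ _ ht))
      fun η η' hne s hs t ht => h.halfEdgePath_ne (fun he => hne (Subtype.ext he)) hs ht
  have hX : ∀ v, φ v ∈ pathImage ℓ' γ' := by
    intro v
    have h1 := hval v
    rw [ho.valence_eq] at h1
    obtain ⟨⟨η, hη⟩⟩ : Nonempty {η // o η = v} := (Nat.card_pos_iff.1 (by omega)).1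
    have h2 := hgerm v ⟨η, hη⟩
    rw [← h2.zero]
    exact hsub (halfEdgePath_mem hℓ _ (left_mem_Icc.2 h2.pos.le))
  -- Three disjoint germs leave `φ v`, but an interior point of an edge of `G'` has only two arms,
  -- so `φ v` is a vertex of `G'`.
  have hvert : ∀ v, ∃ v', φ' v' = φ v := by
    intro v
    obtain ⟨e, t, ht, hte⟩ := mem_iUnion.1 (hX v)
    rcases ht.1.eq_or_lt with rfl | h0
    · obtain ⟨v', hv'⟩ := h'.exists_vertex_zero e
      exact ⟨v', hv'.symm.trans hte⟩
    rcases ht.2.eq_or_lt with rfl | h1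
    · obtain ⟨v', hv'⟩ := h'.exists_vertex_length e
      exact ⟨v', hv'.symm.trans hte⟩
    have h2 := h'.isStar_interior ⟨h0, h1⟩
    rw [hte] at h2
    have := hcard v _ _ h2
    have := hval v
    rw [Fintype.card_bool] at *
    omega
  choose f hf using hvert
  have hfinj : Function.Injective f := fun u v huv => h.vertex_injective (by
    rw [← hf u, ← hf v, huv])
  have hval3 : ∀ v, G.valence v = 3 := by
    intro v
    refine le_antisymm ?_ (hval v)
    have h2 := h'.isStar_vertex hℓ' hφ' (f v)
    rw [hf] at h2
    refine (hcard v _ _ h2).trans (le_of_eq ?_)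
    rw [← Nat.card_eq_fintype_card, ← ho'.valence_eq, hval']
  have c1 := ho.sum_valence
  have c2 := ho'.sum_valence
  simp only [hval3, hval', Finset.sum_const, Finset.card_univ, smul_eq_mul] at c1 c2
  -- Both graphs are trivalent, so 3 #V = 2 #E for each; the equality of the genera then gives equal
  -- numbers of vertices and edges.
  have hcV : Fintype.card G.V = Fintype.card G'.V := by omega
  have hcE : Fintype.card G.E = Fintype.card G'.E := by omega
  have hfbij : Function.Bijective f := (Fintype.bijective_iff_injective_and_card f).2 ⟨hfinj, hcV⟩
  have hφφ' : ∀ v', ∃ v, φ v = φ' v' := fun v' => by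
    obtain ⟨v, rfl⟩ := hfbij.2 v'
    exact ⟨v, (hf v).symm⟩
  have hcl : ∀ e', IsClosed (γ' e' '' Icc 0 (ℓ' e' : ℝ)) := fun e' =>
    (isCompact_Icc.image_of_continuousOn (h'.continuousOn e')).isClosed
  have hinterior : ∀ e, ∀ t ∈ Ioo 0 (ℓ e : ℝ), ∀ e', ∀ s ∈ Icc 0 (ℓ' e' : ℝ),
      γ' e' s = γ e t → s ∈ Ioo 0 (ℓ' e' : ℝ) := by
    intro e t ht e' s hs hst
    refine ⟨lt_of_le_of_ne hs.1 ?_, lt_of_le_of_ne hs.2 ?_⟩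
    · rintro rfl
      obtain ⟨v', hv'⟩ := h'.exists_vertex_zero e'
      obtain ⟨v, hv⟩ := hφφ' v'
      exact h.path_ne_vertex e v t ht (by rw [hv, ← hv', hst])
    · rintro rfl
      obtain ⟨v', hv'⟩ := h'.exists_vertex_length e'
      obtain ⟨v, hv⟩ := hφφ' v'
      exact h.path_ne_vertex e v t ht (by rw [hv, ← hv', hst])
  -- All vertices of `G'` are vertices of `G`, so an open edge of `G` meets none of them. Being
  -- connected, it lies in one open edge of `G'`.
  have hedge : ∀ e, ∃ e', ∀ t ∈ Ioo 0 (ℓ e : ℝ), γ e t ∈ γ' e' '' Ioo 0 (ℓ' e' : ℝ) := by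
    intro e
    have hp : (0 : ℝ) < ℓ e := hℓ e
    have hin : ∀ t ∈ Ioo 0 (ℓ e : ℝ), ∃ e', γ e t ∈ γ' e' '' Icc 0 (ℓ' e' : ℝ) := fun t ht =>
      mem_iUnion.1 (hsub (mem_iUnion.2 ⟨e, t, Ioo_subset_Icc_self ht, rfl⟩))
    have hmid : (ℓ e : ℝ) / 2 ∈ Ioo 0 (ℓ e : ℝ) := ⟨by linarith, by linarith⟩
    obtain ⟨e', he'⟩ := hin _ hmid
    refine ⟨e', ?_⟩
    have hconn : IsPreconnected (γ e '' Ioo 0 (ℓ e : ℝ)) :=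
      isPreconnected_Ioo.image _ ((h.continuousOn e).mono Ioo_subset_Icc_self)
    have hsubs : γ e '' Ioo 0 (ℓ e : ℝ) ⊆ (γ' e' '' Icc 0 (ℓ' e' : ℝ)) ∪
        ⋃ d ∈ {d | d ≠ e'}, γ' d '' Icc 0 (ℓ' d : ℝ) := by
      rintro _ ⟨t, ht, rfl⟩
      obtain ⟨d, hd⟩ := hin t ht
      by_cases hde : d = e'
      · exact Or.inl (hde ▸ hd)
      · exact Or.inr (mem_iUnion₂.2 ⟨d, hde, hd⟩)
    intro t ht
    have htm : γ e t ∈ γ' e' '' Icc 0 (ℓ' e' : ℝ) := by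
      by_contra hcon
      obtain ⟨_, ⟨r, hr, rfl⟩, ⟨s, hs, hsr⟩, hd⟩ := isPreconnected_closed_iff.1 hconn _ _ (hcl e')
        ((Set.toFinite _).isClosed_biUnion fun d _ => hcl d) hsubs
        ⟨_, ⟨_, hmid, rfl⟩, he'⟩ ⟨_, ⟨t, ht, rfl⟩, (hsubs ⟨t, ht, rfl⟩).resolve_left hcon⟩
      obtain ⟨d, hde, s', hs', hsr'⟩ := mem_iUnion₂.1 hd
      exact hde (h'.eq_of_eq_interior (hinterior e r hr d s' hs' hsr') hs
        (hsr'.trans hsr.symm)).1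
    obtain ⟨s, hs, hst⟩ := htm
    exact ⟨s, hinterior e t ht e' s hs hst, hst⟩
  choose k hk using hedge
  have hvnot : ∀ e' v, φ v ∉ γ' e' '' Ioo 0 (ℓ' e' : ℝ) := by
    rintro e' v ⟨s, hs, hsv⟩
    exact h'.path_ne_vertex e' (f v) s hs (hsv.trans (hf v).symm)
  have hmain : ∀ e, (ℓ e : ℝ) = ℓ' (k e) ∧ ((∀ t ∈ Icc 0 (ℓ e : ℝ), γ e t = γ' (k e) t) ∨
      ∀ t ∈ Icc 0 (ℓ e : ℝ), γ e t = γ' (k e) (ℓ e - t)) := by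
    intro e
    refine eq_or_reverse_of_reparametrization (hℓ e) (h.continuousOn e) (h'.continuousOn _)
      (h.velocity e) (h'.velocity _) (fun s hs t ht hst => (h.path_injective _ _ s hs t ht hst).2)
      (fun s hs t ht hst => (h'.eq_of_eq_interior hs ht hst).2) (hk e) ?_ ?_
    · rw [← (hφ e).1]
      exact hvnot _ _
    · rw [← (hφ e).2]
      exact hvnot _ _
  have hkinj : Function.Injective k := by
    intro e₁ e₂ he
    -- Reversal fixes midpoints, so the midpoint of an edge determines it whichever way it runs.
    have hmidpt : ∀ e, γ e ((ℓ e : ℝ) / 2) = γ' (k e) ((ℓ' (k e) : ℝ) / 2) := by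
      intro e
      have hp : (0 : ℝ) < ℓ e := hℓ e
      obtain ⟨h1, h2⟩ := hmain e
      have hm : (ℓ e : ℝ) / 2 ∈ Icc 0 (ℓ e : ℝ) := ⟨by linarith, by linarith⟩
      rcases h2 with h2 | h2
      · rw [h2 _ hm, h1]
      · rw [h2 _ hm, ← h1]
        congr 1
        ring
    have hp₁ : (0 : ℝ) < ℓ e₁ := hℓ e₁
    have hp₂ : (0 : ℝ) < ℓ e₂ := hℓ e₂
    refine (h.path_injective e₁ e₂ ((ℓ e₁ : ℝ) / 2) ⟨by linarith, by linarith⟩ ((ℓ e₂ : ℝ) / 2)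
      ⟨by linarith, by linarith⟩ ?_).1
    rw [hmidpt, hmidpt, he]
  have hkbij : Function.Bijective k := (Fintype.bijective_iff_injective_and_card k).2 ⟨hkinj, hcE⟩
  refine ⟨Equiv.ofBijective f hfbij, Equiv.ofBijective k hkbij, fun e => ?_, fun v => by
    rw [hw, hw'], fun e => NNReal.coe_injective (hmain e).1.symm⟩
  change G'.ends (k e) = (G.ends e).map f
  rw [ho e, ho' (k e), Sym2.map_mk]
  have hl : (0 : ℝ) ∈ Icc 0 (ℓ e : ℝ) := left_mem_Icc.2 (hℓ e).le
  have hr : (ℓ e : ℝ) ∈ Icc 0 (ℓ e : ℝ) := right_mem_Icc.2 (hℓ e).le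
  obtain ⟨h1, h2 | h2⟩ := hmain e
  · have e1 : o' (k e, false) = f (o (e, false)) := h'.vertex_injective (by
      rw [(hφ' _).1, hf, (hφ e).1, h2 _ hl])
    have e2 : o' (k e, true) = f (o (e, true)) := h'.vertex_injective (by
      rw [(hφ' _).2, hf, (hφ e).2, h2 _ hr, h1])
    rw [e1, e2]
  · have e1 : o' (k e, false) = f (o (e, true)) := h'.vertex_injective (by
      rw [(hφ' _).1, hf, (hφ e).2, h2 _ hr, sub_self])
    have e2 : o' (k e, true) = f (o (e, false)) := h'.vertex_injective (by
      rw [(hφ' _).2, hf, (hφ e).1, h2 _ hl, h1, sub_zero])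
    rw [e1, e2, Sym2.eq_swap]

end IsLatticeEmbedding

/-! ### Tropical polynomials in one variable -/

/-- The maximum of the affine functions `i x - u i` with slopes `i ∈ I`. -/
noncomputable def rowMax (I : Finset ℤ) (u : ℤ → ℝ) (x : ℝ) : ℝ :=
  sSup ((fun i : ℤ => (i : ℝ) * x - u i) '' (I : Set ℤ))

/-- The slopes at which the maximum is attained. -/
def rowArg (I : Finset ℤ) (u : ℤ → ℝ) (x : ℝ) : Set ℤ :=
  {i | i ∈ I ∧ (i : ℝ) * x - u i = rowMax I u x}

section Row

variable {I : Finset ℤ} {u : ℤ → ℝ}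

theorem le_rowMax {i : ℤ} (hi : i ∈ I) (x : ℝ) : (i : ℝ) * x - u i ≤ rowMax I u x :=
  le_csSup (I.finite_toSet.image _).bddAbove ⟨i, hi, rfl⟩

theorem rowArg_nonempty (hI : I.Nonempty) (u : ℤ → ℝ) (x : ℝ) : (rowArg I u x).Nonempty := by
  have h := ((Finset.coe_nonempty.2 hI).image fun i : ℤ => (i : ℝ) * x - u i).csSup_mem
    (I.finite_toSet.image _)
  obtain ⟨i, hi, h⟩ := h
  exact ⟨i, hi, h⟩

theorem rowMax_le (hI : I.Nonempty) {x b : ℝ} (h : ∀ i ∈ I, (i : ℝ) * x - u i ≤ b) :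
    rowMax I u x ≤ b := by
  obtain ⟨i, hi, hi'⟩ := rowArg_nonempty hI u x
  exact hi' ▸ h i hi

theorem mem_rowArg_of_forall_le (hI : I.Nonempty) {i : ℤ} {x : ℝ} (hi : i ∈ I)
    (h : ∀ j ∈ I, (j : ℝ) * x - u j ≤ i * x - u i) : i ∈ rowArg I u x :=
  ⟨hi, le_antisymm (le_rowMax hi x) (rowMax_le hI h)⟩

theorem continuous_rowMax (hI : I.Nonempty) (u : ℤ → ℝ) : Continuous (rowMax I u) := by
  have : rowMax I u = fun x => I.sup' hI fun i : ℤ => (i : ℝ) * x - u i := by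
    funext x
    rw [Finset.sup'_eq_csSup_image]
    rfl
  rw [this]
  exact Continuous.finset_sup'_apply hI fun i _ => by fun_prop

theorem isClosed_mem_rowArg (hI : I.Nonempty) (u : ℤ → ℝ) (i : ℤ) :
    IsClosed {x | i ∈ rowArg I u x} := by
  by_cases hi : i ∈ I
  · have : {x | i ∈ rowArg I u x} = {x | (i : ℝ) * x - u i = rowMax I u x} := by
      ext x
      simp [rowArg, hi]
    rw [this]
    exact isClosed_eq (by fun_prop) (continuous_rowMax hI u)
  · have : {x | i ∈ rowArg I u x} = ∅ := by
      ext x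
      simp [rowArg, hi]
    rw [this]
    exact isClosed_empty

/-- Each slope is maximal on a closed set, and there are finitely many slopes. -/
theorem eventually_rowArg_subset (hI : I.Nonempty) (u : ℤ → ℝ) (x : ℝ) :
    ∀ᶠ y in 𝓝 x, rowArg I u y ⊆ rowArg I u x := by
  have h : ∀ i ∈ I, ∀ᶠ y in 𝓝 x, i ∈ rowArg I u y → i ∈ rowArg I u x := fun i _ => by
    by_cases hi : i ∈ rowArg I u x
    · exact Eventually.of_forall fun _ _ => hi
    · filter_upwards [(isClosed_mem_rowArg hI u i).isOpen_compl.mem_nhds hi] with y hy h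
      exact absurd h hy
  filter_upwards [(Filter.eventually_all_finset I).2 h] with y hy i hi using hy i hi.1 hi

/-- Convexity of the maximum: its slopes increase with x. -/
theorem rowArg_mono {i j : ℤ} {x y : ℝ} (hi : i ∈ rowArg I u x) (hj : j ∈ rowArg I u y)
    (hxy : x < y) : i ≤ j := by
  have h1 := le_rowMax (u := u) hj.1 x
  have h2 := le_rowMax (u := u) hi.1 y
  rw [← hi.2] at h1
  rw [← hj.2] at h2
  by_contra! hlt
  have h3 : (j : ℝ) < i := by exact_mod_cast hlt
  nlinarith

/-- A slope that is the only maximal one persists nearby, and a slope that is not maximal stays so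
nearby; on a connected set with unique maxima the slope is constant. -/
theorem rowArg_of_isPreconnected (hI : I.Nonempty) {J : Set ℝ} (hJ : IsPreconnected J)
    (hs : ∀ x ∈ J, (rowArg I u x).Subsingleton) {x y : ℝ} (hx : x ∈ J) (hy : y ∈ J) {t : ℤ}
    (ht : t ∈ rowArg I u x) : t ∈ rowArg I u y := by
  have hU : IsOpen {x | rowArg I u x ⊆ {t}} := by
    rw [isOpen_iff_mem_nhds]
    intro z hz
    filter_upwards [eventually_rowArg_subset hI u z] with w hw using hw.trans hz
  have hV : IsOpen {x | t ∉ rowArg I u x} := (isClosed_mem_rowArg hI u t).isOpen_compl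
  have hmem : ∀ z, rowArg I u z ⊆ {t} → t ∈ rowArg I u z := fun z hz => by
    obtain ⟨i, hi⟩ := rowArg_nonempty hI u z
    rwa [← mem_singleton_iff.1 (hz hi)]
  have := hJ.subset_left_of_subset_union hU hV
    (Set.disjoint_left.2 fun z hz hz' => hz' (hmem z hz)) (fun z hz => by
      by_cases h : t ∈ rowArg I u z
      · exact Or.inl fun i hi => mem_singleton_iff.2 (hs z hz hi h)
      · exact Or.inr h) ⟨x, hx, fun i hi => mem_singleton_iff.2 (hs x hx hi ht)⟩
  exact hmem y (this hy)

theorem exists_rowArg_atTop (hI : I.Nonempty) (u : ℤ → ℝ) :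
    ∃ i ∈ I, (∀ j ∈ I, j ≤ i) ∧ ∀ᶠ x in atTop, rowArg I u x = {i} := by
  refine ⟨I.max' hI, I.max'_mem hI, fun j hj => I.le_max' j hj, ?_⟩
  have h : ∀ j ∈ I, ∀ᶠ x : ℝ in atTop, j ∈ rowArg I u x → j = I.max' hI := fun j hj => by
    rcases (I.le_max' j hj).eq_or_lt with h | h
    · exact Eventually.of_forall fun _ _ => h
    · filter_upwards [eventually_gt_atTop (u (I.max' hI) - u j), eventually_ge_atTop 0]
        with x hx hx0 hjx
      exfalso
      have h1 := le_rowMax (u := u) (I.max'_mem hI) x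
      rw [← hjx.2] at h1
      have h2 : (j : ℝ) + 1 ≤ I.max' hI := by exact_mod_cast h
      nlinarith
  filter_upwards [(Filter.eventually_all_finset I).2 h] with x hx
  obtain ⟨i, hi⟩ := rowArg_nonempty hI u x
  refine Subset.antisymm (fun j hj => hx j hj.1 hj) ?_
  rw [singleton_subset_iff, ← hx i hi.1 hi]
  exact hi

/-- The reflection that transfers the behaviour at infinity to minus infinity. -/
theorem rowArg_neg (x : ℝ) : rowArg (I.image Neg.neg) (fun i => u (-i)) (-x) =
    Neg.neg '' rowArg I u x := by
  have h : rowMax (I.image Neg.neg) (fun i => u (-i)) (-x) = rowMax I u x := by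
    unfold rowMax
    congr 1
    ext r
    constructor
    · rintro ⟨i, hi, rfl⟩
      obtain ⟨j, hj, rfl⟩ := Finset.mem_image.1 (Finset.mem_coe.1 hi)
      exact ⟨j, hj, by simp⟩
    · rintro ⟨i, hi, rfl⟩
      exact ⟨-i, by simpa using hi, by simp⟩
  ext i
  constructor
  · rintro ⟨hi, hi'⟩
    obtain ⟨j, hj, rfl⟩ := Finset.mem_image.1 hi
    rw [h] at hi'
    refine ⟨j, ⟨hj, ?_⟩, rfl⟩
    rw [← hi']
    simp
  · rintro ⟨j, ⟨hj, hj'⟩, rfl⟩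
    refine ⟨by simpa using hj, ?_⟩
    rw [h, ← hj']
    simp

theorem exists_rowArg_atBot (hI : I.Nonempty) (u : ℤ → ℝ) :
    ∃ i ∈ I, (∀ j ∈ I, i ≤ j) ∧ ∀ᶠ x in atBot, rowArg I u x = {i} := by
  obtain ⟨i, hi, hmax, hev⟩ := exists_rowArg_atTop (hI.image Neg.neg) fun i => u (-i)
  obtain ⟨j, hj, rfl⟩ := Finset.mem_image.1 hi
  refine ⟨j, hj, fun k hk => ?_, ?_⟩
  · have := hmax (-k) (Finset.mem_image_of_mem _ hk)
    omega
  · filter_upwards [tendsto_neg_atBot_atTop.eventually hev] with x hx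
    rw [rowArg_neg] at hx
    have := congrArg (fun s => Neg.neg '' s) hx
    simpa [image_image] using this

/-- Outside a finite set the maximum is attained only once. -/
theorem exists_finset_rowArg_subsingleton (I : Finset ℤ) (u : ℤ → ℝ) :
    ∃ F : Finset ℝ, ∀ x ∉ F, (rowArg I u x).Subsingleton := by
  classical
  refine ⟨(I ×ˢ I).image fun p => (u p.1 - u p.2) / ((p.1 : ℝ) - p.2), fun x hx i hi j hj => ?_⟩
  by_contra hne
  refine hx (Finset.mem_image.2 ⟨(i, j), Finset.mem_product.2 ⟨hi.1, hj.1⟩, ?_⟩)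
  have h1 : (i : ℝ) - j ≠ 0 := sub_ne_zero.2 (by exact_mod_cast hne)
  have h2 := hi.2.trans hj.2.symm
  dsimp only
  rw [div_eq_iff h1]
  linarith

theorem rowMax_eventuallyEq (hI : I.Nonempty) {x : ℝ} {i : ℤ} (h : rowArg I u x = {i}) :
    ∀ᶠ y in 𝓝 x, rowMax I u y = i * y - u i := by
  filter_upwards [eventually_rowArg_subset hI u x] with y hy
  obtain ⟨j, hj⟩ := rowArg_nonempty hI u y
  have := hy hj
  rw [h, mem_singleton_iff] at this
  rw [← hj.2, this]

theorem hasDerivAt_rowMax (hI : I.Nonempty) {x : ℝ} {i : ℤ} (h : rowArg I u x = {i}) :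
    HasDerivAt (rowMax I u) i x := by
  have h1 : HasDerivAt (fun y : ℝ => (i : ℝ) * y - u i) i x := by
    simpa using ((hasDerivAt_id x).const_mul (i : ℝ)).sub_const (u i)
  exact h1.congr_of_eventuallyEq (rowMax_eventuallyEq hI h)

end Row

/-! ### Regular subdivisions, in the maximum convention -/

/-- The points of `S` at which `a · w - h a` is maximal. -/
def maxCell (S : Set (ℤ × ℤ)) (h : ℤ × ℤ → ℝ) (w : ℝ × ℝ) : Set (ℤ × ℤ) :=
  {a ∈ S | ∀ b ∈ S, b.1 * w.1 + b.2 * w.2 - h b ≤ a.1 * w.1 + a.2 * w.2 - h a}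

def maxCurve (S : Set (ℤ × ℤ)) (h : ℤ × ℤ → ℝ) : Set (ℝ × ℝ) := {w | (maxCell S h w).Nontrivial}

def IsMaxSmooth (S : Set (ℤ × ℤ)) (h : ℤ × ℤ → ℝ) : Prop :=
  ∀ w, (∃ a ∈ maxCell S h w, ∃ b ∈ maxCell S h w, ∃ c ∈ maxCell S h w, doubleArea a b c ≠ 0) →
    ∃ a b c : ℤ × ℤ, maxCell S h w = {a, b, c} ∧ |doubleArea a b c| = 1

theorem doubleArea_rotate (a b c : ℤ × ℤ) : doubleArea b c a = doubleArea a b c := by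
  unfold doubleArea
  ring

theorem doubleArea_swap (a b c : ℤ × ℤ) : doubleArea b a c = -doubleArea a b c := by
  unfold doubleArea
  ring

theorem doubleArea_self (a b : ℤ × ℤ) : doubleArea a a b = 0 := by
  unfold doubleArea
  ring

/-- A two-dimensional cell has exactly three points, so any three noncollinear points in it are all
of it. In this form smoothness is used: a fourth point in the cell is a contradiction. -/
theorem IsMaxSmooth.eq_triple {S : Set (ℤ × ℤ)} {h : ℤ × ℤ → ℝ} (hs : IsMaxSmooth S h)
    {w : ℝ × ℝ} {a b c : ℤ × ℤ} (ha : a ∈ maxCell S h w) (hb : b ∈ maxCell S h w)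
    (hc : c ∈ maxCell S h w) (harea : doubleArea a b c ≠ 0) :
    maxCell S h w = {a, b, c} ∧ |doubleArea a b c| = 1 := by
  obtain ⟨a', b', c', heq, h1⟩ := hs w ⟨a, ha, b, hb, c, hc, harea⟩
  have hab : a ≠ b := by
    rintro rfl
    exact harea (doubleArea_self a c)
  have hbc : b ≠ c := by
    rintro rfl
    exact harea (by rw [← doubleArea_rotate]; exact doubleArea_self b a)
  have hac : a ≠ c := by
    rintro rfl
    exact harea (by rw [← doubleArea_rotate, ← doubleArea_rotate]; exact doubleArea_self a b)
  have s1 := doubleArea_rotate a' b' c'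
  have s2 := doubleArea_rotate b' c' a'
  have s3 := doubleArea_swap a' b' c'
  have s4 := doubleArea_rotate b' a' c'
  have s5 := doubleArea_rotate a' c' b'
  rw [heq] at ha hb hc ⊢
  simp only [mem_insert_iff, mem_singleton_iff] at ha hb hc
  rcases ha with rfl | rfl | rfl <;> rcases hb with rfl | rfl | rfl <;>
    rcases hc with rfl | rfl | rfl <;>
    first
    | exact absurd rfl hab
    | exact absurd rfl hbc
    | exact absurd rfl hac
    | refine ⟨by ext x; simp only [mem_insert_iff, mem_singleton_iff] <;> tauto, ?_⟩
      first
      | exact h1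
      | rwa [s1]
      | rwa [s2, s1]
      | rwa [s3, abs_neg]
      | rwa [s4, s3, abs_neg]
      | rwa [s5, s4, s3, abs_neg]

/-! ### Point configurations in three rows -/

/-- A point configuration in three consecutive rows, with heights. -/
structure Strip where
  upper : Finset ℤ
  middle : Finset ℤ
  lower : Finset ℤ
  upper_nonempty : upper.Nonempty
  middle_nonempty : middle.Nonempty
  lower_nonempty : lower.Nonempty
  height : ℤ × ℤ → ℝ

namespace Strip

variable (S : Strip)

def points : Set (ℤ × ℤ) :=
  {a | a.2 = 1 ∧ a.1 ∈ S.upper ∨ a.2 = 0 ∧ a.1 ∈ S.middle ∨ a.2 = -1 ∧ a.1 ∈ S.lower}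

noncomputable def up : ℝ → ℝ := rowMax S.upper fun i => S.height (i, 1)
noncomputable def mid : ℝ → ℝ := rowMax S.middle fun i => S.height (i, 0)
noncomputable def low : ℝ → ℝ := rowMax S.lower fun i => S.height (i, -1)

def argUp (x : ℝ) : Set ℤ := rowArg S.upper (fun i => S.height (i, 1)) x
def argMid (x : ℝ) : Set ℤ := rowArg S.middle (fun i => S.height (i, 0)) x
def argLow (x : ℝ) : Set ℤ := rowArg S.lower (fun i => S.height (i, -1)) x

/-- The vertical extent of the region of the plane where the middle row is maximal. -/
noncomputable def gap (x : ℝ) : ℝ := 2 * S.mid x - S.up x - S.low x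

theorem continuous_up : Continuous S.up := continuous_rowMax S.upper_nonempty _
theorem continuous_mid : Continuous S.mid := continuous_rowMax S.middle_nonempty _
theorem continuous_low : Continuous S.low := continuous_rowMax S.lower_nonempty _

theorem continuous_gap : Continuous S.gap :=
  ((continuous_const.mul S.continuous_mid).sub S.continuous_up).sub S.continuous_low

variable {S}

theorem exists_argUp (S : Strip) (x : ℝ) : ∃ t, t ∈ S.argUp x := rowArg_nonempty S.upper_nonempty _ x
theorem exists_argMid (S : Strip) (x : ℝ) : ∃ k, k ∈ S.argMid x :=
  rowArg_nonempty S.middle_nonempty _ x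
theorem exists_argLow (S : Strip) (x : ℝ) : ∃ b, b ∈ S.argLow x :=
  rowArg_nonempty S.lower_nonempty _ x

/-- For fixed x the three rows contribute the values up + y, mid and low - y. The plane problem thus
becomes a comparison of three functions of x. -/
theorem mem_maxCell_iff {a : ℤ × ℤ} {x y : ℝ} : a ∈ maxCell S.points S.height (x, y) ↔
    (a.2 = 1 ∧ a.1 ∈ S.argUp x ∧ S.mid x ≤ S.up x + y ∧ S.low x - y ≤ S.up x + y) ∨
    (a.2 = 0 ∧ a.1 ∈ S.argMid x ∧ S.up x + y ≤ S.mid x ∧ S.low x - y ≤ S.mid x) ∨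
    (a.2 = -1 ∧ a.1 ∈ S.argLow x ∧ S.up x + y ≤ S.low x - y ∧ S.mid x ≤ S.low x - y) := by
  have key : ∀ r : ℝ, (∀ b ∈ S.points, (b.1 : ℝ) * x + b.2 * y - S.height b ≤ r) ↔
      S.up x + y ≤ r ∧ S.mid x ≤ r ∧ S.low x - y ≤ r := by
    intro r
    constructor
    · intro h
      obtain ⟨t, ht⟩ := S.exists_argUp x
      obtain ⟨k, hk⟩ := S.exists_argMid x
      obtain ⟨b, hb⟩ := S.exists_argLow x
      have h1 := h (t, 1) (Or.inl ⟨rfl, ht.1⟩)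
      have h2 := h (k, 0) (Or.inr (Or.inl ⟨rfl, hk.1⟩))
      have h3 := h (b, -1) (Or.inr (Or.inr ⟨rfl, hb.1⟩))
      have e1 := ht.2
      have e2 := hk.2
      have e3 := hb.2
      push_cast at h1 h2 h3
      refine ⟨?_, ?_, ?_⟩
      · change rowMax _ _ _ + _ ≤ _
        linarith
      · change rowMax _ _ _ ≤ _
        linarith
      · change rowMax _ _ _ - _ ≤ _
        linarith
    · rintro ⟨h1, h2, h3⟩ ⟨i, j⟩ hb
      rcases hb with ⟨hj, hi⟩ | ⟨hj, hi⟩ | ⟨hj, hi⟩ <;> dsimp only at hj hi <;> subst hj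
      · have := le_rowMax (u := fun i => S.height (i, 1)) hi x
        change _ ≤ S.up x at this
        push_cast
        linarith
      · have := le_rowMax (u := fun i => S.height (i, 0)) hi x
        change _ ≤ S.mid x at this
        push_cast
        linarith
      · have := le_rowMax (u := fun i => S.height (i, -1)) hi x
        change _ ≤ S.low x at this
        push_cast
        linarith
  obtain ⟨i, j⟩ := a
  rw [maxCell, mem_sep_iff]
  dsimp only
  rw [key]
  constructor
  · rintro ⟨hb, h1, h2, h3⟩
    rcases hb with ⟨hj, hi⟩ | ⟨hj, hi⟩ | ⟨hj, hi⟩ <;> dsimp only at hj hi <;> subst hj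
    · have h4 := le_rowMax (u := fun i => S.height (i, 1)) hi x
      change _ ≤ S.up x at h4
      push_cast at h1 h2 h3
      refine Or.inl ⟨rfl, ⟨hi, ?_⟩, by linarith, by linarith⟩
      change _ = S.up x
      linarith
    · have h4 := le_rowMax (u := fun i => S.height (i, 0)) hi x
      change _ ≤ S.mid x at h4
      push_cast at h1 h2 h3
      refine Or.inr (Or.inl ⟨rfl, ⟨hi, ?_⟩, by linarith, by linarith⟩)
      change _ = S.mid x
      linarith
    · have h4 := le_rowMax (u := fun i => S.height (i, -1)) hi x
      change _ ≤ S.low x at h4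
      push_cast at h1 h2 h3
      refine Or.inr (Or.inr ⟨rfl, ⟨hi, ?_⟩, by linarith, by linarith⟩)
      change _ = S.low x
      linarith
  · rintro (⟨hj, hi, h1, h2⟩ | ⟨hj, hi, h1, h2⟩ | ⟨hj, hi, h1, h2⟩) <;> subst hj
    · have h4 : (i : ℝ) * x - S.height (i, 1) = S.up x := hi.2
      refine ⟨Or.inl ⟨rfl, hi.1⟩, ?_⟩
      push_cast
      refine ⟨?_, ?_, ?_⟩ <;> linarith
    · have h4 : (i : ℝ) * x - S.height (i, 0) = S.mid x := hi.2
      refine ⟨Or.inr (Or.inl ⟨rfl, hi.1⟩), ?_⟩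
      push_cast
      refine ⟨?_, ?_, ?_⟩ <;> linarith
    · have h4 : (i : ℝ) * x - S.height (i, -1) = S.low x := hi.2
      refine ⟨Or.inr (Or.inr ⟨rfl, hi.1⟩), ?_⟩
      push_cast
      refine ⟨?_, ?_, ?_⟩ <;> linarith

variable (S) in
def IsSmooth : Prop := IsMaxSmooth S.points S.height

/-- The segment on which the middle row wins ends at y = mid - up and y = low - mid. At each end two
middle points and an outer point form a triangle, which has to be unimodular and the whole cell. If
the gap were zero the two ends would coincide and the cell would contain a fourth point. -/
theorem IsSmooth.argMid_of_nonneg (hs : S.IsSmooth) {x : ℝ} (hx : 0 ≤ S.gap x) {k k' : ℤ}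
    (hk : k ∈ S.argMid x) (hk' : k' ∈ S.argMid x) (hne : k ≠ k') :
    |k' - k| = 1 ∧ 0 < S.gap x ∧ (S.argUp x).Subsingleton ∧ (S.argLow x).Subsingleton := by
  unfold gap at *
  obtain ⟨t, ht⟩ := S.exists_argUp x
  obtain ⟨b, hb⟩ := S.exists_argLow x
  have m1 : ∀ i ∈ S.argUp x, (i, (1 : ℤ)) ∈ maxCell S.points S.height (x, S.mid x - S.up x) :=
    fun i hi => mem_maxCell_iff.2 (Or.inl ⟨rfl, hi, by linarith, by linarith⟩)
  have m2 : ∀ i ∈ S.argMid x, (i, (0 : ℤ)) ∈ maxCell S.points S.height (x, S.mid x - S.up x) :=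
    fun i hi => mem_maxCell_iff.2 (Or.inr (Or.inl ⟨rfl, hi, by linarith, by linarith⟩))
  have m3 : ∀ i ∈ S.argLow x, (i, (-1 : ℤ)) ∈ maxCell S.points S.height (x, S.low x - S.mid x) :=
    fun i hi => mem_maxCell_iff.2 (Or.inr (Or.inr ⟨rfl, hi, by linarith, by linarith⟩))
  have m4 : ∀ i ∈ S.argMid x, (i, (0 : ℤ)) ∈ maxCell S.points S.height (x, S.low x - S.mid x) :=
    fun i hi => mem_maxCell_iff.2 (Or.inr (Or.inl ⟨rfl, hi, by linarith, by linarith⟩))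
  have a1 : doubleArea (k, 0) (k', 0) (t, 1) = k' - k := by simp [doubleArea]
  have a2 : doubleArea (k, 0) (k', 0) (b, -1) = -(k' - k) := by simp [doubleArea]
  have hne' : k' - k ≠ 0 := by omega
  obtain ⟨c1, d1⟩ := hs.eq_triple (m2 k hk) (m2 k' hk') (m1 t ht) (by rw [a1]; exact hne')
  obtain ⟨c2, -⟩ := hs.eq_triple (m4 k hk) (m4 k' hk') (m3 b hb) (by rw [a2]; omega)
  refine ⟨by rwa [a1] at d1, lt_of_le_of_ne hx fun h0 => ?_, fun i hi j hj => ?_,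
    fun i hi j hj => ?_⟩
  · have : (b, (-1 : ℤ)) ∈ maxCell S.points S.height (x, S.mid x - S.up x) :=
      mem_maxCell_iff.2 (Or.inr (Or.inr ⟨rfl, hb, by linarith, by linarith⟩))
    rw [c1] at this
    simp at this
  · have e1 := m1 i hi
    have e2 := m1 j hj
    rw [c1] at e1 e2
    simp at e1 e2
    rw [e1, e2]
  · have e1 := m3 i hi
    have e2 := m3 j hj
    rw [c2] at e1 e2
    simp at e1 e2
    rw [e1, e2]

/-- Two upper points and a middle point already fill the cell at y = mid - up; a vanishing gap would
add a lower point. -/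
theorem IsSmooth.pos_of_argUp (hs : S.IsSmooth) {x : ℝ} (hx : 0 ≤ S.gap x) {t t' : ℤ}
    (ht : t ∈ S.argUp x) (ht' : t' ∈ S.argUp x) (hne : t ≠ t') : 0 < S.gap x := by
  unfold gap at *
  obtain ⟨k, hk⟩ := S.exists_argMid x
  obtain ⟨b, hb⟩ := S.exists_argLow x
  have m1 : ∀ i ∈ S.argUp x, (i, (1 : ℤ)) ∈ maxCell S.points S.height (x, S.mid x - S.up x) :=
    fun i hi => mem_maxCell_iff.2 (Or.inl ⟨rfl, hi, by linarith, by linarith⟩)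
  have m2 : ∀ i ∈ S.argMid x, (i, (0 : ℤ)) ∈ maxCell S.points S.height (x, S.mid x - S.up x) :=
    fun i hi => mem_maxCell_iff.2 (Or.inr (Or.inl ⟨rfl, hi, by linarith, by linarith⟩))
  have a1 : doubleArea (t, 1) (t', 1) (k, 0) = -(t' - t) := by simp [doubleArea]
  obtain ⟨c1, -⟩ := hs.eq_triple (m1 t ht) (m1 t' ht') (m2 k hk) (by rw [a1]; omega)
  refine lt_of_le_of_ne hx fun h0 => ?_
  have : (b, (-1 : ℤ)) ∈ maxCell S.points S.height (x, S.mid x - S.up x) :=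
    mem_maxCell_iff.2 (Or.inr (Or.inr ⟨rfl, hb, by linarith, by linarith⟩))
  rw [c1] at this
  simp at this

theorem IsSmooth.pos_of_argLow (hs : S.IsSmooth) {x : ℝ} (hx : 0 ≤ S.gap x) {b b' : ℤ}
    (hb : b ∈ S.argLow x) (hb' : b' ∈ S.argLow x) (hne : b ≠ b') : 0 < S.gap x := by
  unfold gap at *
  obtain ⟨k, hk⟩ := S.exists_argMid x
  obtain ⟨t, ht⟩ := S.exists_argUp x
  have m1 : ∀ i ∈ S.argLow x, (i, (-1 : ℤ)) ∈ maxCell S.points S.height (x, S.low x - S.mid x) :=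
    fun i hi => mem_maxCell_iff.2 (Or.inr (Or.inr ⟨rfl, hi, by linarith, by linarith⟩))
  have m2 : ∀ i ∈ S.argMid x, (i, (0 : ℤ)) ∈ maxCell S.points S.height (x, S.low x - S.mid x) :=
    fun i hi => mem_maxCell_iff.2 (Or.inr (Or.inl ⟨rfl, hi, by linarith, by linarith⟩))
  have a1 : doubleArea (b, -1) (b', -1) (k, 0) = b' - b := by simp [doubleArea]
  obtain ⟨c1, -⟩ := hs.eq_triple (m1 b hb) (m1 b' hb') (m2 k hk) (by rw [a1]; omega)
  refine lt_of_le_of_ne hx fun h0 => ?_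
  have : (t, (1 : ℤ)) ∈ maxCell S.points S.height (x, S.low x - S.mid x) :=
    mem_maxCell_iff.2 (Or.inl ⟨rfl, ht, by linarith, by linarith⟩)
  rw [c1] at this
  simp at this

/-- At y = (low - up)/2 the upper and lower rows share a cell. Two points in one outer row would
span with the other row, two units away, a triangle of even doubled area. -/
theorem IsSmooth.subsingleton_of_neg (hs : S.IsSmooth) {x : ℝ} (hx : S.gap x < 0) :
    (S.argUp x).Subsingleton ∧ (S.argLow x).Subsingleton := by
  unfold gap at *
  have m1 : ∀ i ∈ S.argUp x, (i, (1 : ℤ)) ∈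
      maxCell S.points S.height (x, (S.low x - S.up x) / 2) :=
    fun i hi => mem_maxCell_iff.2 (Or.inl ⟨rfl, hi, by linarith, by linarith⟩)
  have m2 : ∀ i ∈ S.argLow x, (i, (-1 : ℤ)) ∈
      maxCell S.points S.height (x, (S.low x - S.up x) / 2) :=
    fun i hi => mem_maxCell_iff.2 (Or.inr (Or.inr ⟨rfl, hi, by linarith, by linarith⟩))
  constructor
  · intro i hi j hj
    by_contra hne
    obtain ⟨b, hb⟩ := S.exists_argLow x
    have a1 : doubleArea (i, 1) (j, 1) (b, -1) = -(2 * (j - i)) := by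
      simp [doubleArea]
      ring
    obtain ⟨-, d1⟩ := hs.eq_triple (m1 i hi) (m1 j hj) (m2 b hb) (by rw [a1]; omega)
    rw [a1] at d1
    rcases abs_cases (-(2 * (j - i))) with h | h <;> omega
  · intro i hi j hj
    by_contra hne
    obtain ⟨t, ht⟩ := S.exists_argUp x
    have a1 : doubleArea (i, -1) (j, -1) (t, 1) = 2 * (j - i) := by
      simp [doubleArea]
      ring
    obtain ⟨-, d1⟩ := hs.eq_triple (m2 i hi) (m2 j hj) (m1 t ht) (by rw [a1]; omega)
    rw [a1] at d1
    rcases abs_cases (2 * (j - i)) with h | h <;> omega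

theorem IsSmooth.subsingleton_of_nonpos (hs : S.IsSmooth) {x : ℝ} (hx : S.gap x ≤ 0) :
    (S.argUp x).Subsingleton ∧ (S.argLow x).Subsingleton := by
  rcases hx.lt_or_eq with h | h
  · exact hs.subsingleton_of_neg h
  · constructor
    · intro i hi j hj
      by_contra hne
      exact (hs.pos_of_argUp h.ge hi hj hne).ne' h
    · intro i hi j hj
      by_contra hne
      exact (hs.pos_of_argLow h.ge hi hj hne).ne' h

theorem IsSmooth.argMid_subsingleton (hs : S.IsSmooth) {x : ℝ} (hx : S.gap x = 0) :
    (S.argMid x).Subsingleton := by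
  intro i hi j hj
  by_contra hne
  exact (hs.argMid_of_nonneg hx.ge hi hj hne).2.1.ne' hx

/-- At a zero of the gap all three rows meet in one cell. The number t + b - 2k is minus the slope
of the gap and, up to sign, the doubled area of a triangle in that cell. -/
theorem IsSmooth.slope_of_eq_zero (hs : S.IsSmooth) {x : ℝ} (hx : S.gap x = 0) {t k b : ℤ}
    (ht : t ∈ S.argUp x) (hk : k ∈ S.argMid x) (hb : b ∈ S.argLow x) :
    t + b - 2 * k = 0 ∨ |t + b - 2 * k| = 1 := by
  unfold gap at *
  have m1 : (t, (1 : ℤ)) ∈ maxCell S.points S.height (x, S.mid x - S.up x) :=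
    mem_maxCell_iff.2 (Or.inl ⟨rfl, ht, by linarith, by linarith⟩)
  have m2 : (k, (0 : ℤ)) ∈ maxCell S.points S.height (x, S.mid x - S.up x) :=
    mem_maxCell_iff.2 (Or.inr (Or.inl ⟨rfl, hk, by linarith, by linarith⟩))
  have m3 : (b, (-1 : ℤ)) ∈ maxCell S.points S.height (x, S.mid x - S.up x) :=
    mem_maxCell_iff.2 (Or.inr (Or.inr ⟨rfl, hb, by linarith, by linarith⟩))
  have a1 : doubleArea (k, 0) (t, 1) (b, -1) = -(t + b - 2 * k) := by
    simp [doubleArea]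
    ring
  by_cases h0 : t + b - 2 * k = 0
  · exact Or.inl h0
  · obtain ⟨-, d1⟩ := hs.eq_triple m2 m1 m3 (by rw [a1]; omega)
    rw [a1, abs_neg] at d1
    exact Or.inr d1

end Strip

/-! ### Walls of a full strip and the sign of the gap -/

namespace Strip

variable {S : Strip} {g : ℕ} {x y : ℝ} {t k b : ℤ}

/-- The middle row consists of the points `0, …, g + 1`, and the first coordinate of the midpoint of
an upper and a lower point is between `0` and `g + 1`. -/
structure IsFull (S : Strip) (g : ℕ) : Prop where
  middle_eq : S.middle = Finset.Icc 0 ((g : ℤ) + 1)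
  nonneg : ∀ t ∈ S.upper, ∀ b ∈ S.lower, 0 ≤ t + b
  le : ∀ t ∈ S.upper, ∀ b ∈ S.lower, t + b ≤ 2 * g + 2

theorem up_eq (h : t ∈ S.argUp x) : S.up x = t * x - S.height (t, 1) := h.2.symm
theorem mid_eq (h : k ∈ S.argMid x) : S.mid x = k * x - S.height (k, 0) := h.2.symm
theorem low_eq (h : b ∈ S.argLow x) : S.low x = b * x - S.height (b, -1) := h.2.symm

theorem le_mid (h : k ∈ S.middle) (x : ℝ) : k * x - S.height (k, 0) ≤ S.mid x :=
  le_rowMax (u := fun i => S.height (i, 0)) h x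

theorem argUp_eq_singleton (hs : (S.argUp x).Subsingleton) (h : t ∈ S.argUp x) : S.argUp x = {t} :=
  hs.eq_singleton_of_mem h
theorem argLow_eq_singleton (hs : (S.argLow x).Subsingleton) (h : b ∈ S.argLow x) :
    S.argLow x = {b} := hs.eq_singleton_of_mem h

theorem argUp_const (hs : S.IsSmooth) {J : Set ℝ} (hJ : IsPreconnected J)
    (hgap : ∀ x ∈ J, S.gap x ≤ 0) (hx : x ∈ J) (hy : y ∈ J) (ht : t ∈ S.argUp x) : t ∈ S.argUp y :=
  rowArg_of_isPreconnected S.upper_nonempty hJ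
    (fun x hx => (hs.subsingleton_of_nonpos (hgap x hx)).1) hx hy ht

theorem argLow_const (hs : S.IsSmooth) {J : Set ℝ} (hJ : IsPreconnected J)
    (hgap : ∀ x ∈ J, S.gap x ≤ 0) (hx : x ∈ J) (hy : y ∈ J) (hb : b ∈ S.argLow x) :
    b ∈ S.argLow y :=
  rowArg_of_isPreconnected S.lower_nonempty hJ
    (fun x hx => (hs.subsingleton_of_nonpos (hgap x hx)).2) hx hy hb

variable (hf : S.IsFull g) (hs : S.IsSmooth)

include hf in
theorem IsFull.mem_middle : k ∈ S.middle ↔ 0 ≤ k ∧ k ≤ g + 1 := by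
  rw [hf.middle_eq, Finset.mem_Icc]

include hf in
theorem IsFull.bounds (hk : k ∈ S.argMid x) : 0 ≤ k ∧ k ≤ g + 1 := hf.mem_middle.1 hk.1

include hf in
theorem IsFull.exists_zero_mem : ∃ x₀, ∀ x ≤ x₀, S.argMid x = {0} := by
  obtain ⟨i, hi, hmin, hev⟩ := exists_rowArg_atBot S.middle_nonempty fun i => S.height (i, 0)
  have h0 := hmin 0 (hf.mem_middle.2 ⟨le_rfl, by positivity⟩)
  have h1 := (hf.mem_middle.1 hi).1
  obtain rfl : i = 0 := by omega
  obtain ⟨x₀, h⟩ := eventually_atBot.1 hev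
  exact ⟨x₀, h⟩

include hf in
theorem IsFull.exists_last_mem : ∃ x₀, ∀ x, x₀ ≤ x → S.argMid x = {(g : ℤ) + 1} := by
  obtain ⟨i, hi, hmax, hev⟩ := exists_rowArg_atTop S.middle_nonempty fun i => S.height (i, 0)
  have h0 := hmax (g + 1) (hf.mem_middle.2 ⟨by positivity, le_rfl⟩)
  have h1 := (hf.mem_middle.1 hi).2
  obtain rfl : i = g + 1 := by omega
  obtain ⟨x₀, h⟩ := eventually_atTop.1 hev
  exact ⟨x₀, h⟩

include hs in
/-- Near a zero of the gap, each row attains its maximum once. -/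
theorem eventually_mem_of_gap_eq_zero (hx : S.gap x = 0) (ht : t ∈ S.argUp x) (hk : k ∈ S.argMid x)
    (hb : b ∈ S.argLow x) : ∀ᶠ y in 𝓝 x, t ∈ S.argUp y ∧ k ∈ S.argMid y ∧ b ∈ S.argLow y := by
  filter_upwards [eventually_rowArg_subset S.upper_nonempty (fun i => S.height (i, 1)) x,
    eventually_rowArg_subset S.middle_nonempty (fun i => S.height (i, 0)) x,
    eventually_rowArg_subset S.lower_nonempty (fun i => S.height (i, -1)) x] with y h1 h2 h3
  obtain ⟨t', ht'⟩ := S.exists_argUp y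
  obtain ⟨k', hk'⟩ := S.exists_argMid y
  obtain ⟨b', hb'⟩ := S.exists_argLow y
  obtain ⟨s1, s3⟩ := hs.subsingleton_of_nonpos hx.le
  rw [s1 ht (h1 ht'), hs.argMid_subsingleton hx hk (h2 hk'), s3 hb (h3 hb')]
  exact ⟨ht', hk', hb'⟩

-- With slope zero the gap would vanish identically nearby with the same maximal points. The set
-- where this happens is open and closed, hence the whole line, but the slope of the middle row
-- changes from 0 to g + 1.
include hf hs in
theorem slope_ne_zero_of_gap_eq_zero (hx : S.gap x = 0) (ht : t ∈ S.argUp x) (hk : k ∈ S.argMid x)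
    (hb : b ∈ S.argLow x) : t + b - 2 * k ≠ 0 := by
  intro h0
  have h0' : (t : ℝ) + b - 2 * k = 0 := by exact_mod_cast h0
  set A : Set ℝ := {y | S.gap y = 0} ∩ ({y | t ∈ S.argUp y} ∩ ({y | k ∈ S.argMid y} ∩
    {y | b ∈ S.argLow y})) with hA
  have hclosed : IsClosed A :=
    (isClosed_eq S.continuous_gap continuous_const).inter
      ((isClosed_mem_rowArg S.upper_nonempty _ t).inter
        ((isClosed_mem_rowArg S.middle_nonempty _ k).inter
          (isClosed_mem_rowArg S.lower_nonempty _ b)))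
  have hopen : IsOpen A := by
    rw [isOpen_iff_mem_nhds]
    rintro y ⟨h1, h2, h3, h4⟩
    filter_upwards [eventually_mem_of_gap_eq_zero hs h1 h2 h3 h4] with w ⟨w2, w3, w4⟩
    refine ⟨?_, w2, w3, w4⟩
    change S.gap w = 0
    have h1' : S.gap y = 0 := h1
    rw [gap, up_eq w2, mid_eq w3, low_eq w4]
    rw [gap, up_eq h2, mid_eq h3, low_eq h4] at h1'
    have : (2 * (k : ℝ) - t - b) * (w - y) = 0 := by
      rw [show (2 * (k : ℝ) - t - b) = 0 by linarith, zero_mul]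
    linarith
  have huniv : A = univ := IsClopen.eq_univ ⟨hclosed, hopen⟩ ⟨x, hx, ht, hk, hb⟩
  have hall : ∀ y, k ∈ S.argMid y := fun y => (huniv.symm ▸ mem_univ y : y ∈ A).2.2.1
  obtain ⟨x₀, h1⟩ := hf.exists_zero_mem
  obtain ⟨x₁, h2⟩ := hf.exists_last_mem
  have e1 := hall x₀
  have e2 := hall x₁
  rw [h1 x₀ le_rfl, mem_singleton_iff] at e1
  rw [h2 x₁ le_rfl, mem_singleton_iff] at e2
  omega

include hf hs in
theorem abs_slope_of_gap_eq_zero (hx : S.gap x = 0) (ht : t ∈ S.argUp x) (hk : k ∈ S.argMid x)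
    (hb : b ∈ S.argLow x) : 2 * k = t + b - 1 ∨ 2 * k = t + b + 1 := by
  rcases hs.slope_of_eq_zero hx ht hk hb with h | h
  · exact absurd h (slope_ne_zero_of_gap_eq_zero hf hs hx ht hk hb)
  · rcases abs_cases (t + b - 2 * k) with h' | h' <;> omega

-- If the gap stayed negative, the points t and b would stay maximal; comparison with the middle
-- point g + 1 bounds the gap below by an affine function of slope 2g + 2 - t - b ≥ 1, which becomes
-- positive. Compactness then gives the first zero.
include hf hs in
theorem exists_gap_eq_zero_right (hx : S.gap x < 0) (ht : t ∈ S.argUp x) (hb : b ∈ S.argLow x)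
    (hne : t + b ≠ 2 * g + 2) : ∃ q, x < q ∧ S.gap q = 0 ∧ ∀ y ∈ Ico x q, S.gap y < 0 := by
  have hz : ∃ y, x ≤ y ∧ 0 ≤ S.gap y := by
    by_contra! hcon
    have hlt : t + b < 2 * g + 2 := lt_of_le_of_ne (hf.le t ht.1 b hb.1) hne
    have hlt' : (t : ℝ) + b + 1 ≤ 2 * g + 2 := by exact_mod_cast hlt
    set C : ℝ := 2 * S.height ((g : ℤ) + 1, 0) - S.height (t, 1) - S.height (b, -1)
    set y := max x (max 0 C) with hy
    have hxy : x ≤ y := le_max_left _ _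
    have hC : C ≤ y := (le_max_right _ _).trans (le_max_right _ _)
    have h0 : 0 ≤ y := (le_max_left _ _).trans (le_max_right _ _)
    have h1 : t ∈ S.argUp y := argUp_const hs isPreconnected_Ici (fun z hz => (hcon z hz).le)
      self_mem_Ici hxy ht
    have h2 : b ∈ S.argLow y := argLow_const hs isPreconnected_Ici (fun z hz => (hcon z hz).le)
      self_mem_Ici hxy hb
    have h3 := hcon y hxy
    have h4 := le_mid (S := S) (k := (g : ℤ) + 1) (hf.mem_middle.2 ⟨by positivity, le_rfl⟩) y
    rw [gap, up_eq h1, low_eq h2] at h3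
    push_cast at h4
    nlinarith
  obtain ⟨y₁, hy₁, hy₁'⟩ := hz
  obtain ⟨q, ⟨hq1, hq2⟩, hq3⟩ := (isCompact_Icc.inter_right
    (isClosed_eq S.continuous_gap continuous_const) :
      IsCompact (Icc x y₁ ∩ {y | S.gap y = 0})).exists_isLeast (by
    obtain ⟨q, hq, hq'⟩ := intermediate_value_Icc hy₁ S.continuous_gap.continuousOn
      ⟨hx.le, hy₁'⟩
    exact ⟨q, hq, hq'⟩)
  refine ⟨q, lt_of_le_of_ne hq1.1 ?_, hq2, fun y hy => ?_⟩
  · rintro rfl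
    exact hx.ne hq2
  · by_contra! hy0
    obtain ⟨w, hw, hw'⟩ := intermediate_value_Icc hy.1 S.continuous_gap.continuousOn ⟨hx.le, hy0⟩
    exact absurd (hq3 ⟨⟨hw.1, hw.2.trans (hy.2.le.trans hq1.2)⟩, hw'⟩)
      (not_le.2 (hw.2.trans_lt hy.2))

include hf hs in
theorem exists_gap_eq_zero_left (hx : S.gap x < 0) (ht : t ∈ S.argUp x) (hb : b ∈ S.argLow x)
    (hne : t + b ≠ 0) : ∃ p, p < x ∧ S.gap p = 0 ∧ ∀ y ∈ Ioc p x, S.gap y < 0 := by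
  have hz : ∃ y, y ≤ x ∧ 0 ≤ S.gap y := by
    by_contra! hcon
    have hlt : 0 < t + b := lt_of_le_of_ne (hf.nonneg t ht.1 b hb.1) hne.symm
    have hlt' : (1 : ℝ) ≤ t + b := by exact_mod_cast hlt
    set C : ℝ := 2 * S.height (0, 0) - S.height (t, 1) - S.height (b, -1)
    set y := min x (min 0 (-C)) with hy
    have hxy : y ≤ x := min_le_left _ _
    have hC : y ≤ -C := (min_le_right _ _).trans (min_le_right _ _)
    have h0 : y ≤ 0 := (min_le_right _ _).trans (min_le_left _ _)
    have h1 : t ∈ S.argUp y := argUp_const hs isPreconnected_Iic (fun z hz => (hcon z hz).le)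
      self_mem_Iic hxy ht
    have h2 : b ∈ S.argLow y := argLow_const hs isPreconnected_Iic (fun z hz => (hcon z hz).le)
      self_mem_Iic hxy hb
    have h3 := hcon y hxy
    have h4 := le_mid (S := S) (k := 0) (hf.mem_middle.2 ⟨le_rfl, by positivity⟩) y
    rw [gap, up_eq h1, low_eq h2] at h3
    push_cast at h4
    nlinarith
  obtain ⟨y₁, hy₁, hy₁'⟩ := hz
  obtain ⟨p, ⟨hp1, hp2⟩, hp3⟩ := (isCompact_Icc.inter_right
    (isClosed_eq S.continuous_gap continuous_const) :
      IsCompact (Icc y₁ x ∩ {y | S.gap y = 0})).exists_isGreatest (by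
    obtain ⟨q, hq, hq'⟩ := intermediate_value_Icc' hy₁ S.continuous_gap.continuousOn
      ⟨hx.le, hy₁'⟩
    exact ⟨q, hq, hq'⟩)
  refine ⟨p, lt_of_le_of_ne hp1.2 ?_, hp2, fun y hy => ?_⟩
  · rintro rfl
    exact hx.ne hp2
  · by_contra! hy0
    obtain ⟨w, hw, hw'⟩ := intermediate_value_Icc' hy.2 S.continuous_gap.continuousOn ⟨hx.le, hy0⟩
    exact absurd (hp3 ⟨⟨hp1.1.trans (hy.1.le.trans hw.1), hw.2⟩, hw'⟩)
      (not_le.2 (hy.1.trans_le hw.1))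

/-- The abscissa of the vertical line that separates the regions of the points `k` and `k + 1` of
the middle row. -/
noncomputable def wall (S : Strip) (k : ℤ) : ℝ := S.height (k + 1, 0) - S.height (k, 0)

/-- The half-width of the interval around the `k`-th wall where the gap is negative. -/
noncomputable def halfWidth (S : Strip) (k : ℤ) : ℝ := max 0 (-S.gap (S.wall k))

noncomputable def wallStart (S : Strip) (k : ℤ) : ℝ := S.wall k - S.halfWidth k

noncomputable def wallEnd (S : Strip) (k : ℤ) : ℝ := S.wall k + S.halfWidth k

include hf hs in
/-- The intervals where the gap is negative. -/
theorem exists_valley (hx : S.gap x < 0) : ∃ p q : ℝ, ∃ k t b : ℤ, p < x ∧ x < q ∧ S.gap p = 0 ∧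
    S.gap q = 0 ∧ (∀ y ∈ Ioo p q, S.gap y < 0) ∧
    (∀ y ∈ Icc p q, t ∈ S.argUp y ∧ b ∈ S.argLow y) ∧ t + b = 2 * k + 1 ∧
    k ∈ S.argMid p ∧ k + 1 ∈ S.argMid q := by
  obtain ⟨t, ht⟩ := S.exists_argUp x
  obtain ⟨b, hb⟩ := S.exists_argLow x
  have odd_of_right : ∀ q, x < q → S.gap q = 0 → (∀ y ∈ Ico x q, S.gap y < 0) →
      ∃ k ∈ S.argMid q, t + b = 2 * k - 1 := by
    intro q hxq hq hneg
    have hnonpos : ∀ y ∈ Icc x q, S.gap y ≤ 0 := fun y hy => by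
      rcases hy.2.lt_or_eq with h | rfl
      · exact (hneg y ⟨hy.1, h⟩).le
      · exact hq.le
    have h1 := argUp_const hs isPreconnected_Icc hnonpos (left_mem_Icc.2 hxq.le)
      (right_mem_Icc.2 hxq.le) ht
    have h2 := argLow_const hs isPreconnected_Icc hnonpos (left_mem_Icc.2 hxq.le)
      (right_mem_Icc.2 hxq.le) hb
    obtain ⟨k, hk⟩ := S.exists_argMid q
    refine ⟨k, hk, ?_⟩
    rcases abs_slope_of_gap_eq_zero hf hs hq h1 hk h2 with h | h
    -- With slope -1 at `q`, the affine function through the middle point `k` bounds the gap below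
    -- by q - x > 0 at `x`.
    · exfalso
      have h' : 2 * (k : ℝ) = t + b - 1 := by exact_mod_cast h
      have h3 := le_mid (S := S) hk.1 x
      rw [gap, up_eq h1, mid_eq hk, low_eq h2] at hq
      rw [gap, up_eq ht, low_eq hb] at hx
      nlinarith
    · omega
  have odd_of_left : ∀ p, p < x → S.gap p = 0 → (∀ y ∈ Ioc p x, S.gap y < 0) →
      ∃ k ∈ S.argMid p, t + b = 2 * k + 1 := by
    intro q hxq hq hneg
    have hnonpos : ∀ y ∈ Icc q x, S.gap y ≤ 0 := fun y hy => by
      rcases hy.1.lt_or_eq with h | rfl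
      · exact (hneg y ⟨h, hy.2⟩).le
      · exact hq.le
    have h1 := argUp_const hs isPreconnected_Icc hnonpos (right_mem_Icc.2 hxq.le)
      (left_mem_Icc.2 hxq.le) ht
    have h2 := argLow_const hs isPreconnected_Icc hnonpos (right_mem_Icc.2 hxq.le)
      (left_mem_Icc.2 hxq.le) hb
    obtain ⟨k, hk⟩ := S.exists_argMid q
    refine ⟨k, hk, ?_⟩
    rcases abs_slope_of_gap_eq_zero hf hs hq h1 hk h2 with h | h
    · omega
    · exfalso
      have h' : 2 * (k : ℝ) = t + b + 1 := by exact_mod_cast h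
      have h3 := le_mid (S := S) hk.1 x
      rw [gap, up_eq h1, mid_eq hk, low_eq h2] at hq
      rw [gap, up_eq ht, low_eq hb] at hx
      nlinarith
  -- A zero on either side makes t + b odd. So the even extremes 2g + 2 and 0 are impossible, and
  -- both one-sided searches for a zero apply.
  have hr : t + b ≠ 2 * g + 2 := by
    intro h
    obtain ⟨p, h1, h2, h3⟩ := exists_gap_eq_zero_left hf hs hx ht hb (by omega)
    obtain ⟨k, -, hk⟩ := odd_of_left p h1 h2 h3
    omega
  have hl : t + b ≠ 0 := by
    intro h
    obtain ⟨p, h1, h2, h3⟩ := exists_gap_eq_zero_right hf hs hx ht hb (by omega)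
    obtain ⟨k, -, hk⟩ := odd_of_right p h1 h2 h3
    omega
  obtain ⟨p, p1, p2, p3⟩ := exists_gap_eq_zero_left hf hs hx ht hb hl
  obtain ⟨q, q1, q2, q3⟩ := exists_gap_eq_zero_right hf hs hx ht hb hr
  obtain ⟨k, hk, hk'⟩ := odd_of_left p p1 p2 p3
  obtain ⟨k₂, hk₂, hk₂'⟩ := odd_of_right q q1 q2 q3
  obtain rfl : k₂ = k + 1 := by omega
  have hneg : ∀ y ∈ Ioo p q, S.gap y < 0 := fun y hy => by
    rcases le_total y x with h | h
    · exact p3 y ⟨hy.1, h⟩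
    · exact q3 y ⟨h, hy.2⟩
  have hnonpos : ∀ y ∈ Icc p q, S.gap y ≤ 0 := fun y hy => by
    rcases hy.1.lt_or_eq with h | rfl
    · rcases hy.2.lt_or_eq with h' | rfl
      · exact (hneg y ⟨h, h'⟩).le
      · exact q2.le
    · exact p2.le
  exact ⟨p, q, k, t, b, p1, q1, p2, q2, hneg,
    fun y hy => ⟨argUp_const hs isPreconnected_Icc hnonpos ⟨p1.le, q1.le⟩ hy ht,
      argLow_const hs isPreconnected_Icc hnonpos ⟨p1.le, q1.le⟩ hy hb⟩, hk', hk, hk₂⟩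

-- Where the gap is at least zero this is unimodularity. Where it is negative the middle row is
-- invisible to the curve, but monotonicity of the slopes confines them between their values k and k
-- + 1 at the two ends of the valley.
include hf hs in
theorem argMid_consecutive {k' : ℤ} (hk : k ∈ S.argMid x) (hk' : k' ∈ S.argMid x) (h : k < k') :
    k' = k + 1 := by
  rcases le_or_gt 0 (S.gap x) with h0 | h0
  · have := (hs.argMid_of_nonneg h0 hk hk' h.ne).1
    rcases abs_cases (k' - k) with h' | h' <;> omega
  · obtain ⟨p, q, i, t, b, h1, h2, -, -, -, -, -, h3, h4⟩ := exists_valley hf hs h0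
    have e1 := rowArg_mono h3 hk h1
    have e2 := rowArg_mono hk' h4 h2
    omega

theorem eq_wall (hk : k ∈ S.argMid x) (hk' : k + 1 ∈ S.argMid x) : x = S.wall k := by
  have h1 := mid_eq hk
  rw [mid_eq hk'] at h1
  push_cast at h1
  rw [wall]
  linarith

-- The abscissae with a maximal slope at most k, and those with one at least k + 1, are closed,
-- nonempty and cover the line. At a common point the two slopes are consecutive, hence k and k + 1,
-- and the point is the wall.
include hf hs in
theorem mem_argMid_wall (h0 : 0 ≤ k) (hg : k ≤ g) :
    k ∈ S.argMid (S.wall k) ∧ k + 1 ∈ S.argMid (S.wall k) := by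
  have hclosed : ∀ J : Finset ℤ, IsClosed {x | ∃ i ∈ J, i ∈ S.argMid x} := by
    intro J
    have : {x | ∃ i ∈ J, i ∈ S.argMid x} = ⋃ i ∈ J, {x | i ∈ S.argMid x} := by
      ext x
      simp
    rw [this]
    exact J.finite_toSet.isClosed_biUnion fun i _ => isClosed_mem_rowArg S.middle_nonempty _ i
  obtain ⟨x₀, h1⟩ := hf.exists_zero_mem
  obtain ⟨x₁, h2⟩ := hf.exists_last_mem
  obtain ⟨x, -, ⟨i, hi, hi'⟩, ⟨j, hj, hj'⟩⟩ := isPreconnected_closed_iff.1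
    (isPreconnected_univ (α := ℝ)) _ _ (hclosed (Finset.Icc 0 k))
    (hclosed (Finset.Icc (k + 1) (g + 1))) (fun x _ => by
      obtain ⟨i, hi⟩ := S.exists_argMid x
      have := hf.bounds hi
      rcases le_or_gt i k with h | h
      · exact Or.inl ⟨i, Finset.mem_Icc.2 ⟨this.1, h⟩, hi⟩
      · exact Or.inr ⟨i, Finset.mem_Icc.2 ⟨h, this.2⟩, hi⟩)
    ⟨x₀, mem_univ _, 0, Finset.mem_Icc.2 ⟨le_rfl, h0⟩, by rw [h1 x₀ le_rfl]; rfl⟩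
    ⟨x₁, mem_univ _, g + 1, Finset.mem_Icc.2 ⟨by omega, le_rfl⟩, by rw [h2 x₁ le_rfl]; rfl⟩
  rw [Finset.mem_Icc] at hi hj
  have hij := argMid_consecutive hf hs hi' hj' (by omega)
  obtain rfl : i = k := by omega
  subst hij
  rw [← eq_wall hi' hj']
  exact ⟨hi', hj'⟩

include hf hs in
theorem wall_lt_wall {j : ℤ} (h0 : 0 ≤ j) (hjk : j < k) (hg : k ≤ g) : S.wall j < S.wall k := by
  obtain ⟨h1, h2⟩ := mem_argMid_wall hf hs h0 (by omega)
  obtain ⟨h3, h4⟩ := mem_argMid_wall hf hs (k := k) (by omega) hg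
  rcases lt_trichotomy (S.wall j) (S.wall k) with h | h | h
  · exact h
  · rw [h] at h1
    have := argMid_consecutive hf hs h1 h4 (by omega)
    omega
  · have := rowArg_mono h4 h1 h
    omega

include hf hs in
theorem wall_le_of_mem (hk : k + 1 ∈ S.argMid x) (h0 : 0 ≤ k) : S.wall k ≤ x := by
  have hb := hf.bounds hk
  by_contra! h
  have := rowArg_mono hk (mem_argMid_wall hf hs h0 (by omega)).1 h
  omega

include hf hs in
theorem le_wall_of_mem (hk : k ∈ S.argMid x) (hg : k ≤ g) : x ≤ S.wall k := by
  have hb := hf.bounds hk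
  by_contra! h
  have := rowArg_mono (mem_argMid_wall hf hs hb.1 hg).2 hk h
  omega

include hf hs in
theorem gap_wall_ne_zero (h0 : 0 ≤ k) (hg : k ≤ g) : S.gap (S.wall k) ≠ 0 := fun h => by
  obtain ⟨h1, h2⟩ := mem_argMid_wall hf hs h0 hg
  have := hs.argMid_subsingleton h h1 h2
  omega

include hf hs in
/-- The intervals where the gap is negative are those around the walls with negative gap. -/
theorem exists_wall_of_gap_neg (hx : S.gap x < 0) : ∃ k t b : ℤ, 0 ≤ k ∧ k ≤ g ∧
    S.gap (S.wall k) < 0 ∧ x ∈ Ioo (S.wallStart k) (S.wallEnd k) ∧ t + b = 2 * k + 1 ∧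
    (∀ y ∈ Ioo (S.wallStart k) (S.wallEnd k), S.gap y < 0) ∧ S.gap (S.wallStart k) = 0 ∧
    S.gap (S.wallEnd k) = 0 ∧
    (∀ y ∈ Icc (S.wallStart k) (S.wallEnd k), t ∈ S.argUp y ∧ b ∈ S.argLow y) ∧
    k ∈ S.argMid (S.wallStart k) ∧ k + 1 ∈ S.argMid (S.wallEnd k) := by
  obtain ⟨p, q, k, t, b, h1, h2, h3, h4, h5, h6, h7, h8, h9⟩ := exists_valley hf hs hx
  have hb1 := hf.bounds h8
  have hb2 := hf.bounds h9
  have w1 := le_wall_of_mem hf hs h8 (by omega)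
  have w2 := wall_le_of_mem hf hs h9 hb1.1
  have hne := gap_wall_ne_zero hf hs hb1.1 (k := k) (by omega)
  have w1' : p < S.wall k := lt_of_le_of_ne w1 fun h => hne (by rw [← h, h3])
  have w2' : S.wall k < q := lt_of_le_of_ne w2 fun h => hne (by rw [h, h4])
  have hneg := h5 _ ⟨w1', w2'⟩
  obtain ⟨m1, m2⟩ := mem_argMid_wall hf hs hb1.1 (k := k) (by omega)
  have h7' : (t : ℝ) + b = 2 * k + 1 := by exact_mod_cast h7
  obtain ⟨u1, l1⟩ := h6 p ⟨le_rfl, by linarith⟩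
  obtain ⟨u2, l2⟩ := h6 q ⟨by linarith, le_rfl⟩
  obtain ⟨u3, l3⟩ := h6 _ ⟨w1, w2⟩
  -- The outer slopes are constant on the valley with sum 2k + 1, so the gap falls with slope -1 up
  -- to the wall and rises with slope 1 after it. The wall is the midpoint and its gap is minus half
  -- the width.
  have g1 : S.gap (S.wall k) = p - S.wall k := by
    have e1 := h3
    rw [gap, up_eq u1, mid_eq h8, low_eq l1] at e1
    rw [gap, up_eq u3, mid_eq m1, low_eq l3]
    linear_combination e1 + (p - S.wall k) * h7'
  have g2 : S.gap (S.wall k) = S.wall k - q := by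
    have e1 := h4
    rw [gap, up_eq u2, mid_eq h9, low_eq l2] at e1
    rw [gap, up_eq u3, mid_eq m2, low_eq l3]
    push_cast at e1 ⊢
    linear_combination e1 + (q - S.wall k) * h7'
  have hw : S.halfWidth k = -S.gap (S.wall k) := max_eq_right (by linarith)
  have hp : S.wallStart k = p := by
    rw [wallStart, hw]
    linarith
  have hq : S.wallEnd k = q := by
    rw [wallEnd, hw]
    linarith
  exact ⟨k, t, b, hb1.1, by omega, hneg, by rw [hp, hq]; exact ⟨h1, h2⟩, h7, by rwa [hp, hq],
    by rwa [hp], by rwa [hq], by rwa [hp, hq], by rwa [hp], by rwa [hq]⟩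

theorem halfWidth_nonneg (S : Strip) (k : ℤ) : 0 ≤ S.halfWidth k := le_max_left _ _

theorem wallStart_le_wall (S : Strip) (k : ℤ) : S.wallStart k ≤ S.wall k :=
  sub_le_self _ (S.halfWidth_nonneg k)

theorem wall_le_wallEnd (S : Strip) (k : ℤ) : S.wall k ≤ S.wallEnd k :=
  le_add_of_nonneg_right (S.halfWidth_nonneg k)

theorem halfWidth_of_pos (h : 0 < S.gap (S.wall k)) : S.halfWidth k = 0 :=
  max_eq_left (by linarith)

theorem halfWidth_of_neg (h : S.gap (S.wall k) < 0) : S.halfWidth k = -S.gap (S.wall k) :=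
  max_eq_right (by linarith)

include hf hs in
theorem wall_of_neg (h0 : 0 ≤ k) (hg : k ≤ g) (hneg : S.gap (S.wall k) < 0) :
    ∃ t b : ℤ, t + b = 2 * k + 1 ∧
    (∀ y ∈ Ioo (S.wallStart k) (S.wallEnd k), S.gap y < 0) ∧ S.gap (S.wallStart k) = 0 ∧
    S.gap (S.wallEnd k) = 0 ∧
    (∀ y ∈ Icc (S.wallStart k) (S.wallEnd k), t ∈ S.argUp y ∧ b ∈ S.argLow y) ∧
    k ∈ S.argMid (S.wallStart k) ∧ k + 1 ∈ S.argMid (S.wallEnd k) := by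
  obtain ⟨i, t, b, h1, h2, h3, h4, h5, h6⟩ := exists_wall_of_gap_neg hf hs hneg
  obtain ⟨m1, m2⟩ := mem_argMid_wall hf hs h0 hg
  have e1 := rowArg_mono h6.2.2.2.2.1 m1 h4.1
  have e2 := rowArg_mono m2 h6.2.2.2.2.2 h4.2
  obtain rfl : i = k := by omega
  exact ⟨t, b, h5, h6⟩

include hf hs in
theorem gap_nonpos_of_mem (h0 : 0 ≤ k) (hg : k ≤ g) (hneg : S.gap (S.wall k) < 0)
    (hx : x ∈ Icc (S.wallStart k) (S.wallEnd k)) : S.gap x ≤ 0 := by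
  obtain ⟨t, b, -, h1, h2, h3, -⟩ := wall_of_neg hf hs h0 hg hneg
  rcases hx.1.eq_or_lt with h | h
  · rw [← h, h2]
  · rcases hx.2.eq_or_lt with h' | h'
    · rw [h', h3]
    · exact (h1 x ⟨h, h'⟩).le

include hf hs in
/-- Around a wall, the outer rows attain their maxima once. -/
theorem exists_arg_eq_singleton (h0 : 0 ≤ k) (hg : k ≤ g) : ∃ t b : ℤ,
    (∀ y ∈ Icc (S.wallStart k) (S.wallEnd k), S.argUp y = {t} ∧ S.argLow y = {b}) ∧
    (S.gap (S.wall k) < 0 → t + b = 2 * k + 1) := by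
  rcases (gap_wall_ne_zero hf hs h0 hg).lt_or_gt with hneg | hpos
  · obtain ⟨t, b, h1, -, -, -, h2, -⟩ := wall_of_neg hf hs h0 hg hneg
    refine ⟨t, b, fun y hy => ?_, fun _ => h1⟩
    obtain ⟨s1, s2⟩ := hs.subsingleton_of_nonpos (gap_nonpos_of_mem hf hs h0 hg hneg hy)
    exact ⟨argUp_eq_singleton s1 (h2 y hy).1, argLow_eq_singleton s2 (h2 y hy).2⟩
  · obtain ⟨t, ht⟩ := S.exists_argUp (S.wall k)
    obtain ⟨b, hb⟩ := S.exists_argLow (S.wall k)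
    refine ⟨t, b, fun y hy => ?_, fun h => absurd h hpos.le.not_gt⟩
    have hy' : y = S.wall k := by
      rw [wallStart, wallEnd, halfWidth_of_pos hpos, sub_zero, add_zero] at hy
      exact le_antisymm hy.2 hy.1
    obtain ⟨m1, m2⟩ := mem_argMid_wall hf hs h0 hg
    obtain ⟨-, -, s1, s2⟩ := hs.argMid_of_nonneg hpos.le m1 m2 (by omega)
    rw [hy']
    exact ⟨argUp_eq_singleton s1 ht, argLow_eq_singleton s2 hb⟩

-- Two overlapping negative intervals would share the outer points t and b, while t + b is 2j + 1 on
-- one and 2k + 1 on the other. A wall of positive gap cannot lie in an interval where the gap is at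
-- most zero.
include hf hs in
theorem wallEnd_lt_wallStart {j : ℤ} (h0 : 0 ≤ j) (hjk : j < k) (hg : k ≤ g) :
    S.wallEnd j < S.wallStart k := by
  have hz := wall_lt_wall hf hs h0 hjk hg
  by_contra! hcon
  rcases (gap_wall_ne_zero hf hs h0 (k := j) (by omega)).lt_or_gt with h1 | h1 <;>
    rcases (gap_wall_ne_zero hf hs (k := k) (by omega) hg).lt_or_gt with h2 | h2
  · obtain ⟨t, b, e1, e2⟩ := exists_arg_eq_singleton hf hs h0 (k := j) (by omega)
    obtain ⟨t', b', e1', e2'⟩ := exists_arg_eq_singleton hf hs (k := k) (by omega) hg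
    have a1 := S.wallStart_le_wall j
    have a2 := S.wall_le_wallEnd j
    have a3 := S.wallStart_le_wall k
    have a4 := S.wall_le_wallEnd k
    obtain ⟨f1, f2⟩ := e1 (max (S.wallStart j) (S.wallStart k))
      ⟨le_max_left _ _, max_le (by linarith) hcon⟩
    obtain ⟨f3, f4⟩ := e1' (max (S.wallStart j) (S.wallStart k))
      ⟨le_max_right _ _, max_le (by linarith) (by linarith)⟩
    rw [f1, singleton_eq_singleton_iff] at f3
    rw [f2, singleton_eq_singleton_iff] at f4
    have := e2 h1
    have := e2' h2
    omega
  · rw [wallStart, halfWidth_of_pos h2, sub_zero] at hcon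
    have := gap_nonpos_of_mem hf hs h0 (by omega) h1 (x := S.wall k)
      ⟨(S.wallStart_le_wall j).trans hz.le, hcon⟩
    linarith
  · rw [wallEnd, halfWidth_of_pos h1, add_zero] at hcon
    have := gap_nonpos_of_mem hf hs (by omega) hg h2 (x := S.wall j)
      ⟨hcon, hz.le.trans (S.wall_le_wallEnd k)⟩
    linarith
  · rw [wallStart, wallEnd, halfWidth_of_pos h1, halfWidth_of_pos h2] at hcon
    linarith

-- At a zero the gap has slope 1 or -1, so it is negative right next to it on one side; the zero is
-- an end of that negative interval.
include hf hs in
theorem exists_wall_of_gap_nonpos (hx : S.gap x ≤ 0) : ∃ k : ℤ, 0 ≤ k ∧ k ≤ g ∧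
    S.gap (S.wall k) < 0 ∧ x ∈ Icc (S.wallStart k) (S.wallEnd k) := by
  rcases hx.lt_or_eq with h | h
  · obtain ⟨k, t, b, h1, h2, h3, h4, -⟩ := exists_wall_of_gap_neg hf hs h
    exact ⟨k, h1, h2, h3, Ioo_subset_Icc_self h4⟩
  obtain ⟨t, ht⟩ := S.exists_argUp x
  obtain ⟨k, hk⟩ := S.exists_argMid x
  obtain ⟨b, hb⟩ := S.exists_argLow x
  obtain ⟨ε, hε, hball⟩ := Metric.eventually_nhds_iff.1
    (eventually_mem_of_gap_eq_zero hs h ht hk hb)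
  have hlin : ∀ y, |y - x| < ε → S.gap y = (2 * k - t - b) * (y - x) := fun y hy => by
    obtain ⟨h1, h2, h3⟩ := hball (y := y) (by rwa [Real.dist_eq])
    have e := h
    rw [gap, up_eq ht, mid_eq hk, low_eq hb] at e
    rw [gap, up_eq h1, mid_eq h2, low_eq h3]
    linear_combination e
  rcases abs_slope_of_gap_eq_zero hf hs h ht hk hb with hsl | hsl
  · have hsl' : 2 * (k : ℝ) = t + b - 1 := by exact_mod_cast hsl
    have hneg : ∀ y, x < y → y < x + ε → S.gap y < 0 := fun y h1 h2 => by
      rw [hlin y (by rw [abs_of_pos (by linarith)]; linarith)]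
      nlinarith
    obtain ⟨i, t', b', h1, h2, h3, h4, -, h5, h6, -⟩ :=
      exists_wall_of_gap_neg hf hs (hneg (x + ε / 2) (by linarith) (by linarith))
    refine ⟨i, h1, h2, h3, ?_, ?_⟩
    · by_contra! hlt
      exact (hneg _ hlt (by linarith [h4.1])).ne h6
    · by_contra! hlt
      linarith [h4.2]
  · have hsl' : 2 * (k : ℝ) = t + b + 1 := by exact_mod_cast hsl
    have hneg : ∀ y, y < x → x - ε < y → S.gap y < 0 := fun y h1 h2 => by
      rw [hlin y (by rw [abs_of_neg (by linarith)]; linarith)]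
      nlinarith
    obtain ⟨i, t', b', h1, h2, h3, h4, -, h5, -, h6, -⟩ :=
      exists_wall_of_gap_neg hf hs (hneg (x - ε / 2) (by linarith) (by linarith))
    refine ⟨i, h1, h2, h3, ?_, ?_⟩
    · by_contra! hlt
      linarith [h4.1]
    · by_contra! hlt
      exact (hneg _ hlt (by linarith [h4.2])).ne h6

include hf hs in
theorem gap_pos_of_between (h0 : 0 ≤ k) (hg : k < g) (h1 : S.wallEnd k < x)
    (h2 : x < S.wallStart (k + 1)) : 0 < S.gap x := by
  by_contra! h
  obtain ⟨i, i0, ig, -, hi⟩ := exists_wall_of_gap_nonpos hf hs h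
  rcases lt_trichotomy i k with h' | rfl | h'
  · have := wallEnd_lt_wallStart hf hs i0 h' (by omega)
    linarith [hi.2, S.wallStart_le_wall k, S.wall_le_wallEnd k]
  · linarith [hi.2]
  · rcases (show k + 1 ≤ i from h').eq_or_lt with rfl | h''
    · linarith [hi.1]
    · have := wallEnd_lt_wallStart hf hs (by omega) h'' ig
      linarith [hi.1, S.wallStart_le_wall (k + 1), S.wall_le_wallEnd (k + 1)]

include hf hs in
theorem gap_pos_of_lt (h : x < S.wallStart 0) : 0 < S.gap x := by
  by_contra! h'
  obtain ⟨i, i0, ig, -, hi⟩ := exists_wall_of_gap_nonpos hf hs h'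
  rcases i0.eq_or_lt with rfl | h''
  · linarith [hi.1]
  · have := wallEnd_lt_wallStart hf hs le_rfl h'' ig
    linarith [hi.1, S.wallStart_le_wall 0, S.wall_le_wallEnd 0]

include hf hs in
theorem gap_pos_of_gt (h : S.wallEnd g < x) : 0 < S.gap x := by
  by_contra! h'
  obtain ⟨i, i0, ig, -, hi⟩ := exists_wall_of_gap_nonpos hf hs h'
  rcases ig.eq_or_lt with rfl | h''
  · linarith [hi.2]
  · have := wallEnd_lt_wallStart hf hs i0 h'' le_rfl
    linarith [hi.2, S.wallStart_le_wall g, S.wall_le_wallEnd g]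

end Strip

namespace Strip

variable {S : Strip} {g : ℕ} {x y : ℝ} {t k b : ℤ}

/-! ### The two branches of the curve that bound the region of the middle row -/

/-- The middle of the segment from low - mid to mid - up on which the middle row wins. Where the gap
is at most zero the radius vanishes, and both branches follow the edge between the upper and lower
regions. -/
noncomputable def center (S : Strip) (x : ℝ) : ℝ := (S.low x - S.up x) / 2

noncomputable def radius (S : Strip) (x : ℝ) : ℝ := max 0 (S.gap x) / 2

noncomputable def branchY (S : Strip) (pos : Bool) (x : ℝ) : ℝ :=
  S.center x + (if pos then S.radius x else -S.radius x)

noncomputable def branch (S : Strip) (pos : Bool) (x : ℝ) : ℝ × ℝ := (x, S.branchY pos x)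

theorem continuous_center (S : Strip) : Continuous S.center :=
  (S.continuous_low.sub S.continuous_up).div_const 2

theorem continuous_radius (S : Strip) : Continuous S.radius :=
  (continuous_const.max S.continuous_gap).div_const 2

theorem continuous_branchY (S : Strip) (pos : Bool) : Continuous (S.branchY pos) := by
  cases pos
  · exact S.continuous_center.add S.continuous_radius.neg
  · exact S.continuous_center.add S.continuous_radius

theorem continuous_branch (S : Strip) (pos : Bool) : Continuous (S.branch pos) :=
  continuous_id.prodMk (S.continuous_branchY pos)

theorem radius_nonneg (S : Strip) (x : ℝ) : 0 ≤ S.radius x := by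
  unfold radius
  positivity

theorem radius_pos (h : 0 < S.gap x) : 0 < S.radius x := by
  rw [radius, max_eq_right h.le]
  positivity

theorem radius_eq (h : 0 ≤ S.gap x) : S.radius x = S.gap x / 2 := by rw [radius, max_eq_right h]

theorem radius_eq_zero (h : S.gap x ≤ 0) : S.radius x = 0 := by rw [radius, max_eq_left h, zero_div]

theorem branch_mem_maxCurve (S : Strip) (pos : Bool) (x : ℝ) :
    S.branch pos x ∈ maxCurve S.points S.height := by
  obtain ⟨t, ht⟩ := S.exists_argUp x
  obtain ⟨k, hk⟩ := S.exists_argMid x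
  obtain ⟨b, hb⟩ := S.exists_argLow x
  rcases le_total 0 (S.gap x) with h | h
  · have h' := h
    rw [gap] at h'
    cases pos
    · refine ⟨(b, -1), mem_maxCell_iff.2 (Or.inr (Or.inr ⟨rfl, hb, ?_, ?_⟩)), (k, 0),
        mem_maxCell_iff.2 (Or.inr (Or.inl ⟨rfl, hk, ?_, ?_⟩)), by simp⟩ <;>
        simp only [branchY, radius_eq h, center, gap] <;> norm_num <;> linarith
    · refine ⟨(t, 1), mem_maxCell_iff.2 (Or.inl ⟨rfl, ht, ?_, ?_⟩), (k, 0),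
        mem_maxCell_iff.2 (Or.inr (Or.inl ⟨rfl, hk, ?_, ?_⟩)), by simp⟩ <;>
        simp only [branchY, radius_eq h, center, gap] <;> norm_num <;> linarith
  · have h' := h
    rw [gap] at h'
    refine ⟨(t, 1), mem_maxCell_iff.2 (Or.inl ⟨rfl, ht, ?_, ?_⟩), (b, -1),
      mem_maxCell_iff.2 (Or.inr (Or.inr ⟨rfl, hb, ?_, ?_⟩)), by simp⟩ <;>
      simp only [branchY, radius_eq_zero h, center] <;> norm_num <;> linarith

theorem wall_mem_maxCurve (hf : S.IsFull g) (hs : S.IsSmooth) (h0 : 0 ≤ k) (hg : k ≤ g) {r : ℝ}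
    (hr : |r| ≤ S.radius (S.wall k)) :
    (S.wall k, S.center (S.wall k) + r) ∈ maxCurve S.points S.height := by
  obtain ⟨h1, h2⟩ := abs_le.1 hr
  rcases le_total 0 (S.gap (S.wall k)) with h | h
  · obtain ⟨m1, m2⟩ := mem_argMid_wall hf hs h0 hg
    rw [radius_eq h, gap] at h1 h2
    refine ⟨(k, 0), mem_maxCell_iff.2 (Or.inr (Or.inl ⟨rfl, m1, ?_, ?_⟩)), (k + 1, 0),
      mem_maxCell_iff.2 (Or.inr (Or.inl ⟨rfl, m2, ?_, ?_⟩)), by simp⟩ <;>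
      rw [center] <;> linarith
  · rw [radius_eq_zero h] at h1 h2
    have := S.branch_mem_maxCurve true (S.wall k)
    rw [branch, branchY, radius_eq_zero h] at this
    rw [show r = 0 by linarith]
    simpa using this

/-! ### Derivatives -/

theorem exists_finset_arg (S : Strip) : ∃ F : Finset ℝ, ∀ x ∉ F,
    ∃ t k b, S.argUp x = {t} ∧ S.argMid x = {k} ∧ S.argLow x = {b} := by
  classical
  obtain ⟨F₁, h₁⟩ := exists_finset_rowArg_subsingleton S.upper fun i => S.height (i, 1)
  obtain ⟨F₂, h₂⟩ := exists_finset_rowArg_subsingleton S.middle fun i => S.height (i, 0)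
  obtain ⟨F₃, h₃⟩ := exists_finset_rowArg_subsingleton S.lower fun i => S.height (i, -1)
  refine ⟨F₁ ∪ F₂ ∪ F₃, fun x hx => ?_⟩
  simp only [Finset.mem_union, not_or] at hx
  obtain ⟨t, ht⟩ := S.exists_argUp x
  obtain ⟨k, hk⟩ := S.exists_argMid x
  obtain ⟨b, hb⟩ := S.exists_argLow x
  exact ⟨t, k, b, (h₁ x hx.1.1).eq_singleton_of_mem ht, (h₂ x hx.1.2).eq_singleton_of_mem hk,
    (h₃ x hx.2).eq_singleton_of_mem hb⟩

theorem hasDerivAt_branchY_of_pos (pos : Bool) (hx : 0 < S.gap x) (ht : S.argUp x = {t})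
    (hk : S.argMid x = {k}) (hb : S.argLow x = {b}) :
    ∃ q : ℤ, HasDerivAt (S.branchY pos) q x := by
  have h1 : HasDerivAt S.up t x := hasDerivAt_rowMax S.upper_nonempty ht
  have h2 : HasDerivAt S.mid k x := hasDerivAt_rowMax S.middle_nonempty hk
  have h3 : HasDerivAt S.low b x := hasDerivAt_rowMax S.lower_nonempty hb
  have hev : ∀ᶠ y in 𝓝 x, 0 < S.gap y := S.continuous_gap.continuousAt.eventually (lt_mem_nhds hx)
  cases pos
  · refine ⟨b - k, ?_⟩
    push_cast
    refine (h3.sub h2).congr_of_eventuallyEq ?_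
    filter_upwards [hev] with y hy
    simp only [branchY, radius_eq hy.le, center, gap, Pi.sub_apply]
    norm_num
    ring
  · refine ⟨k - t, ?_⟩
    push_cast
    refine (h2.sub h1).congr_of_eventuallyEq ?_
    filter_upwards [hev] with y hy
    simp only [branchY, radius_eq hy.le, center, gap, Pi.sub_apply]
    norm_num
    ring

theorem hasDerivAt_branchY_of_neg (pos : Bool) (hx : S.gap x < 0) (ht : S.argUp x = {t})
    (hb : S.argLow x = {b}) : HasDerivAt (S.branchY pos) ((b - t) / 2) x := by
  have h1 : HasDerivAt S.up t x := hasDerivAt_rowMax S.upper_nonempty ht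
  have h3 : HasDerivAt S.low b x := hasDerivAt_rowMax S.lower_nonempty hb
  have hev : ∀ᶠ y in 𝓝 x, S.gap y < 0 := S.continuous_gap.continuousAt.eventually (gt_mem_nhds hx)
  refine ((h3.sub h1).div_const 2).congr_of_eventuallyEq ?_
  filter_upwards [hev] with y hy
  simp only [branchY, radius_eq_zero hy.le, center, Pi.sub_apply]
  cases pos <;> simp

theorem hasDerivAt_branch {pos : Bool} {q c x₀ t : ℝ} (h : HasDerivAt (S.branchY pos) q (x₀ + c * t)) :
    HasDerivAt (fun t => S.branch pos (x₀ + c * t)) (c, c * q) t := by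
  have h1 : HasDerivAt (fun t => x₀ + c * t) c t := by
    simpa using ((hasDerivAt_id t).const_mul c).const_add x₀
  have h2 := HasDerivAt.comp t h h1
  rw [mul_comm] at h2
  exact h1.prodMk h2

/-- The exceptional parameters of a path that runs along a branch. -/
theorem exists_finset_preimage (F : Finset ℝ) {c : ℝ} (hc : c ≠ 0) (x₀ : ℝ) :
    ∃ F' : Finset ℝ, ∀ t ∉ F', x₀ + c * t ∉ F := by
  classical
  refine ⟨F.image fun x => (x - x₀) / c, fun t ht h => ht (Finset.mem_image.2 ⟨_, h, ?_⟩)⟩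
  field_simp
  ring

theorem hasPrimitiveVelocity_branch_of_pos (pos : Bool) {c x₀ L : ℝ} (hc : c = 1 ∨ c = -1)
    (hgap : ∀ t ∈ Ioo 0 L, 0 < S.gap (x₀ + c * t)) :
    HasPrimitiveVelocity (fun t => S.branch pos (x₀ + c * t)) L := by
  obtain ⟨F, hF⟩ := S.exists_finset_arg
  have hc0 : c ≠ 0 := by rcases hc with rfl | rfl <;> norm_num
  obtain ⟨F', hF'⟩ := exists_finset_preimage F hc0 x₀
  refine ⟨F', fun t ht htF => ?_⟩
  obtain ⟨i, k, b, h1, h2, h3⟩ := hF _ (hF' t htF)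
  obtain ⟨q, hq⟩ := hasDerivAt_branchY_of_pos pos (hgap t ht) h1 h2 h3
  rcases hc with rfl | rfl
  · exact ⟨1, q, isCoprime_one_left, by simpa using hasDerivAt_branch hq⟩
  · exact ⟨-1, -q, isCoprime_one_left.neg_left, by simpa using hasDerivAt_branch hq⟩

/-- The merged branch has slope (b - t)/2, and b - t is odd, so (2, b - t) is primitive. Its lattice
length is thus half its horizontal extent. -/
theorem hasPrimitiveVelocity_branch_of_neg (pos : Bool) {x₀ L : ℝ} (hodd : Odd (t + b))
    (hgap : ∀ r ∈ Ioo 0 L, S.gap (x₀ + 2 * r) < 0 ∧ S.argUp (x₀ + 2 * r) = {t} ∧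
      S.argLow (x₀ + 2 * r) = {b}) :
    HasPrimitiveVelocity (fun t => S.branch pos (x₀ + 2 * t)) L := by
  refine ⟨∅, fun r hr _ => ⟨2, b - t, ?_, ?_⟩⟩
  · obtain ⟨m, hm⟩ := hodd
    exact ⟨t - m, 1, by linarith⟩
  · obtain ⟨h1, h2, h3⟩ := hgap r hr
    have := hasDerivAt_branch (hasDerivAt_branchY_of_neg pos h1 h2 h3)
    push_cast
    convert this using 2
    ring

/-! ### Loops -/

/-- A path of length `2 h + v` that runs along the lower branch from `X` to `X + c h`, goes up
by `v` and comes back along the upper branch. -/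
noncomputable def loopPath (S : Strip) (X c h v t : ℝ) : ℝ × ℝ :=
  -- The horizontal displacement is `t`, then constantly `h`, then 2h + v - t. Writing all three
  -- stretches by minima and maxima makes continuity immediate.
  (X + c * (min t h + min (2 * h + v - t) h - h),
    S.center (X + c * (min t h + min (2 * h + v - t) h - h)) +
      (max (-(v / 2)) (min (v / 2) (t - h - v / 2)) - (S.radius (X + c * min t h) - v / 2) +
        (S.radius (X + c * min (2 * h + v - t) h) - v / 2)))

section Loop

variable {X c h v r : ℝ}

theorem continuous_loopPath (S : Strip) (X c h v : ℝ) : Continuous (S.loopPath X c h v) := by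
  have h1 := S.continuous_center
  have h2 := S.continuous_radius
  unfold loopPath
  fun_prop

theorem loopPath_of_le (hv : 0 ≤ v) (hr : S.radius (X + c * h) = v / 2) (ht : r ≤ h) :
    S.loopPath X c h v r = S.branch false (X + c * r) := by
  have e1 : min r h = r := min_eq_left ht
  have e2 : min (2 * h + v - r) h = h := min_eq_right (by linarith)
  have e3 : max (-(v / 2)) (min (v / 2) (r - h - v / 2)) = -(v / 2) :=
    max_eq_left ((min_le_right _ _).trans (by linarith))
  simp only [loopPath, e1, e2, e3, hr, branch, branchY]
  norm_num
  ring

theorem loopPath_of_ge (hv : 0 ≤ v) (hr : S.radius (X + c * h) = v / 2) (ht : h + v ≤ r) :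
    S.loopPath X c h v r = S.branch true (X + c * (2 * h + v - r)) := by
  have e1 : min r h = h := min_eq_right (by linarith)
  have e2 : min (2 * h + v - r) h = 2 * h + v - r := min_eq_left (by linarith)
  have e3 : max (-(v / 2)) (min (v / 2) (r - h - v / 2)) = v / 2 := by
    rw [min_eq_left (by linarith), max_eq_right (by linarith)]
  have e4 : h + (2 * h + v - r) - h = 2 * h + v - r := by ring
  simp only [loopPath, e1, e2, e3, e4, hr, branch, branchY]
  norm_num

theorem loopPath_of_mem (hr : S.radius (X + c * h) = v / 2) (ht : r ∈ Icc h (h + v)) :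
    S.loopPath X c h v r = (X + c * h, S.center (X + c * h) + (r - h - v / 2)) := by
  have e1 : min r h = h := min_eq_right ht.1
  have e2 : min (2 * h + v - r) h = h := min_eq_right (by linarith [ht.2])
  have e3 : max (-(v / 2)) (min (v / 2) (r - h - v / 2)) = r - h - v / 2 := by
    rw [min_eq_right (by linarith [ht.2]), max_eq_right (by linarith [ht.1])]
  simp only [loopPath, e1, e2, e3, hr]
  norm_num

theorem loopPath_cases (hv : 0 ≤ v) (hr : S.radius (X + c * h) = v / 2)
    (hpos : ∀ s ∈ Ioo 0 h, 0 < S.gap (X + c * s)) (ht : r ∈ Ioo 0 (2 * h + v)) :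
    (r ∈ Ioo 0 h ∧ S.loopPath X c h v r = (X + c * r, S.center (X + c * r) - S.radius (X + c * r)) ∧
      0 < S.radius (X + c * r)) ∨
    (r ∈ Icc h (h + v) ∧
      S.loopPath X c h v r = (X + c * h, S.center (X + c * h) + (r - h - v / 2))) ∨
    (r ∈ Ioo (h + v) (2 * h + v) ∧ S.loopPath X c h v r = (X + c * (2 * h + v - r),
      S.center (X + c * (2 * h + v - r)) + S.radius (X + c * (2 * h + v - r))) ∧
      0 < S.radius (X + c * (2 * h + v - r))) := by
  rcases lt_or_ge r h with h1 | h1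
  · refine Or.inl ⟨⟨ht.1, h1⟩, ?_, radius_pos (hpos r ⟨ht.1, h1⟩)⟩
    rw [loopPath_of_le hv hr h1.le]
    simp [branch, branchY, sub_eq_add_neg]
  · rcases le_or_gt r (h + v) with h2 | h2
    · exact Or.inr (Or.inl ⟨⟨h1, h2⟩, loopPath_of_mem hr ⟨h1, h2⟩⟩)
    · refine Or.inr (Or.inr ⟨⟨h2, ht.2⟩, ?_,
        radius_pos (hpos _ ⟨by linarith [ht.2], by linarith⟩)⟩)
      rw [loopPath_of_ge hv hr h2.le]
      simp [branch, branchY]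

theorem exists_loopPath_fst (hh : 0 < h) (hv : 0 ≤ v) (hr : S.radius (X + c * h) = v / 2)
    (hpos : ∀ s ∈ Ioo 0 h, 0 < S.gap (X + c * s)) (ht : r ∈ Ioo 0 (2 * h + v)) :
    ∃ m ∈ Ioc 0 h, (S.loopPath X c h v r).1 = X + c * m := by
  rcases loopPath_cases hv hr hpos ht with ⟨h1, h2, -⟩ | ⟨-, h2⟩ | ⟨h1, h2, -⟩ <;> rw [h2]
  · exact ⟨r, ⟨h1.1, h1.2.le⟩, rfl⟩
  · exact ⟨h, ⟨hh, le_rfl⟩, rfl⟩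
  · exact ⟨_, ⟨by linarith [h1.2], by linarith [h1.1]⟩, rfl⟩

theorem loopPath_injOn (hc : c ≠ 0) (hv : 0 ≤ v)
    (hr : S.radius (X + c * h) = v / 2) (hpos : ∀ s ∈ Ioo 0 h, 0 < S.gap (X + c * s)) :
    InjOn (S.loopPath X c h v) (Ioo 0 (2 * h + v)) := by
  intro r hr₁ r' hr₂ heq
  have hx : ∀ {m m' : ℝ}, X + c * m = X + c * m' → m = m' := fun hm =>
    mul_left_cancel₀ hc (add_left_cancel hm)
  rcases loopPath_cases hv hr hpos hr₁ with ⟨h1, h2, h3⟩ | ⟨h1, h2⟩ | ⟨h1, h2, h3⟩ <;>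
    rcases loopPath_cases hv hr hpos hr₂ with ⟨h1', h2', h3'⟩ | ⟨h1', h2'⟩ | ⟨h1', h2', h3'⟩ <;>
    rw [h2, h2', Prod.mk.injEq] at heq <;> obtain ⟨e1, e2⟩ := heq <;> have e3 := hx e1
  · exact e3
  · linarith [h1.2]
  · rw [← e3] at e2 h3'
    linarith
  · linarith [h1'.2]
  · linarith
  · linarith [h1'.1]
  · rw [← e3] at e2 h3'
    linarith
  · linarith [h1.1]
  · linarith

theorem hasPrimitiveVelocity_loopPath (hc : c = 1 ∨ c = -1) (hv : 0 ≤ v)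
    (hr : S.radius (X + c * h) = v / 2) (hpos : ∀ s ∈ Ioo 0 h, 0 < S.gap (X + c * s)) :
    HasPrimitiveVelocity (S.loopPath X c h v) (2 * h + v) := by
  classical
  have hc' : -c = 1 ∨ -c = -1 := by
    rcases hc with rfl | rfl <;> norm_num
  obtain ⟨F₁, h₁⟩ := hasPrimitiveVelocity_branch_of_pos (S := S) false hc hpos
  obtain ⟨F₂, h₂⟩ := hasPrimitiveVelocity_branch_of_pos (S := S) true (c := -c)
    (x₀ := X + c * h) (L := h) hc' (fun s hs => by
      have := hpos (h - s) ⟨by linarith [hs.2], by linarith [hs.1]⟩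
      rwa [show X + c * h + -c * s = X + c * (h - s) by ring])
  refine ⟨F₁ ∪ F₂.image (fun s => h + v + s) ∪ {h, h + v}, fun r hr' hF => ?_⟩
  simp only [Finset.mem_union, Finset.mem_insert, Finset.mem_singleton, not_or,
    Finset.mem_image, not_exists, not_and] at hF
  obtain ⟨⟨f1, f2⟩, f3, f4⟩ := hF
  rcases lt_or_gt_of_ne f3 with h1 | h1
  · obtain ⟨p, q, hpq, hd⟩ := h₁ r ⟨hr'.1, h1⟩ f1
    refine ⟨p, q, hpq, hd.congr_of_eventuallyEq ?_⟩
    filter_upwards [gt_mem_nhds h1] with s hs using loopPath_of_le hv hr (le_of_lt hs)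
  · rcases lt_or_gt_of_ne f4 with h2 | h2
    · refine ⟨0, 1, isCoprime_one_right, ?_⟩
      have hd : HasDerivAt (fun r : ℝ => ((X + c * h : ℝ), S.center (X + c * h) + (r - h - v / 2)))
          (0, 1) r := (hasDerivAt_const r _).prodMk
        ((((hasDerivAt_id r).sub_const h).sub_const (v / 2)).const_add _)
      push_cast
      refine hd.congr_of_eventuallyEq ?_
      filter_upwards [gt_mem_nhds h2, lt_mem_nhds h1] with s hs hs'
      exact loopPath_of_mem hr ⟨le_of_lt hs', le_of_lt hs⟩
    · obtain ⟨p, q, hpq, hd⟩ := h₂ (r - h - v) ⟨by linarith, by linarith [hr'.2]⟩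
        (fun hmem => f2 _ hmem (by ring))
      have hd' : HasDerivAt (fun r => S.branch true (X + c * h + -c * (r - h - v))) ((p : ℝ), (q : ℝ)) r := by
        have h3 : HasDerivAt (fun r : ℝ => r - h - v) 1 r :=
          ((hasDerivAt_id r).sub_const h).sub_const v
        have := HasDerivAt.scomp r hd h3
        rw [one_smul] at this
        exact this
      refine ⟨p, q, hpq, hd'.congr_of_eventuallyEq ?_⟩
      filter_upwards [lt_mem_nhds h2] with s hs
      rw [loopPath_of_ge hv hr (le_of_lt hs)]
      congr 1
      ring

end Loop

end Strip

namespace Strip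

variable {S : Strip} {g : ℕ} {x y : ℝ} {t k b : ℤ}

section Order

variable (hf : S.IsFull g) (hs : S.IsSmooth)

include hf hs

theorem wallEnd_le_wallEnd {j : ℤ} (h0 : 0 ≤ j) (hjk : j ≤ k) (hg : k ≤ g) :
    S.wallEnd j ≤ S.wallEnd k := by
  rcases hjk.eq_or_lt with rfl | h
  · exact le_rfl
  · have := wallEnd_lt_wallStart hf hs h0 h hg
    linarith [S.wallStart_le_wall k, S.wall_le_wallEnd k]

theorem wallStart_le_wallStart {j : ℤ} (h0 : 0 ≤ j) (hjk : j ≤ k) (hg : k ≤ g) :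
    S.wallStart j ≤ S.wallStart k := by
  rcases hjk.eq_or_lt with rfl | h
  · exact le_rfl
  · have := wallEnd_lt_wallStart hf hs h0 h hg
    linarith [S.wallStart_le_wall j, S.wall_le_wallEnd j]

theorem radius_wallEnd (h0 : 0 ≤ k) (hg : k ≤ g) :
    S.radius (S.wallEnd k) = max 0 (S.gap (S.wall k)) / 2 := by
  rcases (gap_wall_ne_zero hf hs h0 hg).lt_or_gt with h | h
  · obtain ⟨-, -, -, -, -, h1, -⟩ := wall_of_neg hf hs h0 hg h
    rw [radius, h1, max_self, max_eq_left h.le]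
  · rw [wallEnd, halfWidth_of_pos h, add_zero, radius]

theorem radius_wallStart (h0 : 0 ≤ k) (hg : k ≤ g) :
    S.radius (S.wallStart k) = max 0 (S.gap (S.wall k)) / 2 := by
  rcases (gap_wall_ne_zero hf hs h0 hg).lt_or_gt with h | h
  · obtain ⟨-, -, -, -, h1, -⟩ := wall_of_neg hf hs h0 hg h
    rw [radius, h1, max_self, max_eq_left h.le]
  · rw [wallStart, halfWidth_of_pos h, sub_zero, radius]

end Order

theorem wallStart_eq_wall (h : 0 < S.gap (S.wall k)) : S.wallStart k = S.wall k := by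
  rw [wallStart, halfWidth_of_pos h, sub_zero]

theorem wallEnd_eq_wall (h : 0 < S.gap (S.wall k)) : S.wallEnd k = S.wall k := by
  rw [wallEnd, halfWidth_of_pos h, add_zero]

theorem branch_eq_of_gap_nonpos (h : S.gap x ≤ 0) (pos pos' : Bool) :
    S.branch pos x = S.branch pos' x := by
  simp [branch, branchY, radius_eq_zero h]

/-! ### Chain data of a strip -/

/-- The nodes that are split into a left and a right vertex. -/
noncomputable def chainSplit (S : Strip) (g : ℕ) (k : Fin (g - 1)) : Bool :=
  decide (S.gap (S.wall (k.1 + 1)) < 0)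

/-- Two horizontal strands plus the vertical edge at the outermost wall. If the gap there is
negative, the strands meet where the negative interval begins and the vertical part has length zero.
-/
noncomputable def chainLoop (S : Strip) (g : ℕ) (pos : Bool) : ℝ≥0 :=
  if pos then Real.toNNReal (2 * (S.wallStart g - S.wallEnd (g - 1)) + max 0 (S.gap (S.wall g)))
  else Real.toNNReal (2 * (S.wallStart 1 - S.wallEnd 0) + max 0 (S.gap (S.wall 0)))

noncomputable def chainDouble (S : Strip) (g : ℕ) (j : Fin (g - 2)) : ℝ≥0 :=
  Real.toNNReal (S.wallStart (j.1 + 1 + 1) - S.wallEnd (j.1 + 1))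

/-- For positive gap this is the length of the vertical edge. For negative gap the bridge is 2 |gap|
wide and has horizontal speed 2, so the same formula applies. Node k corresponds to wall k + 1. -/
noncomputable def chainMiddle (S : Strip) (g : ℕ) (k : Fin (g - 1)) : ℝ≥0 :=
  Real.toNNReal |S.gap (S.wall (k.1 + 1))|

noncomputable def nodePath (S : Strip) (k : ℤ) (t : ℝ) : ℝ × ℝ :=
  if S.gap (S.wall k) < 0 then S.branch false (S.wallStart k + 2 * t)
  else (S.wall k, S.center (S.wall k) - S.radius (S.wall k) + t)

/-- The loop starts at the first node and runs to the left, hence the direction -1, and closes at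
wall 0. -/
noncomputable def leftLoop (S : Strip) : ℝ → ℝ × ℝ :=
  S.loopPath (S.wallStart 1) (-1) (S.wallStart 1 - S.wallEnd 0) (max 0 (S.gap (S.wall 0)))

noncomputable def rightLoop (S : Strip) (g : ℕ) : ℝ → ℝ × ℝ :=
  S.loopPath (S.wallEnd (g - 1)) 1 (S.wallStart g - S.wallEnd (g - 1)) (max 0 (S.gap (S.wall g)))

noncomputable def chainPath (S : Strip) (g : ℕ) :
    Bool ⊕ (Fin (g - 2) × Bool) ⊕ Fin (g - 1) → ℝ → ℝ × ℝ
  | .inl false => S.leftLoop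
  | .inl true => S.rightLoop g
  | .inr (.inl (j, pos)) => fun t => S.branch pos (S.wallEnd (j.1 + 1) + 1 * t)
  | .inr (.inr k) => S.nodePath (k.1 + 1)

/-- One formula for both splittings. At a positive gap the interval shrinks to the wall and the two
points are the bottom and top of the vertical edge; at a negative gap the branches agree at both
ends, and the points are the left and right ends of the bridge. -/
noncomputable def chainPoint (S : Strip) (g : ℕ) (v : Fin (g - 1) × Bool) : ℝ × ℝ :=
  S.branch v.2 (if v.2 then S.wallEnd (v.1.1 + 1) else S.wallStart (v.1.1 + 1))

noncomputable def stripLength (S : Strip) (g : ℕ) (hg : 2 ≤ g) :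
    (chainGraph g hg (S.chainSplit g)).E → ℝ≥0 :=
  chainLength g hg (S.chainSplit g) (S.chainLoop g) (S.chainDouble g) (S.chainMiddle g)

/-- Nodes and the intervals between them: `(k, true)` is the `k`-th node and `(k, false)` the
interval between the nodes `k` and `k + 1`. -/
def slot (S : Strip) (g : ℕ) (p : ℤ × Bool) : Set ℝ :=
  if p.2 then Icc (S.wallStart p.1) (S.wallEnd p.1)
  -- The first and the last interval, which carry the loops, are unbounded on the outer side.
  else {x | (1 ≤ p.1 → S.wallEnd p.1 < x) ∧ (p.1 + 2 ≤ g → x < S.wallStart (p.1 + 1))}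

def IsSlot (g : ℕ) (p : ℤ × Bool) : Prop := (if p.2 then 1 else 0) ≤ p.1 ∧ p.1 + 1 ≤ g

section Embedding

variable (hg : 2 ≤ g) (hf : S.IsFull g) (hs : S.IsSmooth)

include hf hs

/-- Slots are pairwise disjoint sets of abscissae. Different parts of the chain are thereby
separated by their first coordinate, and injectivity need only be checked inside one slot. -/
theorem slot_unique {p p' : ℤ × Bool} (hp : IsSlot g p) (hp' : IsSlot g p') (h : x ∈ S.slot g p)
    (h' : x ∈ S.slot g p') : p = p' := by
  obtain ⟨k, b⟩ := p
  obtain ⟨k', b'⟩ := p'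
  wlog hkk : k ≤ k' generalizing k k' b b'
  · exact (this k' b' hp' h' k b hp h (by omega)).symm
  cases b <;> cases b' <;> simp only [IsSlot, slot] at hp hp' h h' <;> norm_num at hp hp' h h' ⊢
  · by_contra hne
    have h1 := h.2 (by omega)
    have h2 := h'.1 (by omega)
    have h3 := wallStart_le_wallStart hf hs (j := k + 1) (k := k') (by omega) (by omega) (by omega)
    linarith [S.wallStart_le_wall k', S.wall_le_wallEnd k']
  · rcases hkk.eq_or_lt with rfl | hlt
    · linarith [h.1 (by omega)]
    · have h1 := h.2 (by omega)
      have h3 := wallStart_le_wallStart hf hs (j := k + 1) (k := k') (by omega) (by omega)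
        (by omega)
      linarith
  · have h1 := h'.1 (by omega)
    have h3 := wallEnd_le_wallEnd hf hs (j := k) (k := k') (by omega) (by omega) (by omega)
    linarith
  · by_contra hne
    have h3 := wallEnd_lt_wallStart hf hs (j := k) (k := k') (by omega) (by omega) (by omega)
    linarith

include hg in
theorem leftLoop_spec : 0 < S.wallStart 1 - S.wallEnd 0 ∧ 0 ≤ max 0 (S.gap (S.wall 0)) ∧
    S.radius (S.wallStart 1 + -1 * (S.wallStart 1 - S.wallEnd 0)) =
      max 0 (S.gap (S.wall 0)) / 2 ∧
    ∀ s ∈ Ioo 0 (S.wallStart 1 - S.wallEnd 0), 0 < S.gap (S.wallStart 1 + -1 * s) := by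
  have h1 := wallEnd_lt_wallStart hf hs le_rfl zero_lt_one (by omega)
  refine ⟨by linarith, le_max_left _ _, ?_, fun s hs' => ?_⟩
  · rw [← radius_wallEnd hf hs le_rfl (by omega)]
    congr 1
    ring
  · exact gap_pos_of_between hf hs le_rfl (by omega) (by linarith [hs'.2]) (by
      rw [zero_add]
      linarith [hs'.1])

include hg in
theorem rightLoop_spec : 0 < S.wallStart g - S.wallEnd (g - 1) ∧ 0 ≤ max 0 (S.gap (S.wall g)) ∧
    S.radius (S.wallEnd (g - 1) + 1 * (S.wallStart g - S.wallEnd (g - 1))) =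
      max 0 (S.gap (S.wall g)) / 2 ∧
    ∀ s ∈ Ioo 0 (S.wallStart g - S.wallEnd (g - 1)), 0 < S.gap (S.wallEnd (g - 1) + 1 * s) := by
  have h1 := wallEnd_lt_wallStart hf hs (j := g - 1) (k := g) (by omega) (by omega) le_rfl
  refine ⟨by linarith, le_max_left _ _, ?_, fun s hs' => ?_⟩
  · rw [← radius_wallStart hf hs (by omega) le_rfl]
    congr 1
    ring
  · exact gap_pos_of_between hf hs (k := g - 1) (by omega) (by omega) (by linarith [hs'.1]) (by
      rw [sub_add_cancel]
      linarith [hs'.2])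

include hg in
theorem coe_chainLoop_false : (S.chainLoop g false : ℝ) =
    2 * (S.wallStart 1 - S.wallEnd 0) + max 0 (S.gap (S.wall 0)) := by
  obtain ⟨h1, h2, -⟩ := leftLoop_spec hg hf hs
  simp only [chainLoop]
  exact Real.coe_toNNReal _ (by linarith)

include hg in
theorem coe_chainLoop_true : (S.chainLoop g true : ℝ) =
    2 * (S.wallStart g - S.wallEnd (g - 1)) + max 0 (S.gap (S.wall g)) := by
  obtain ⟨h1, h2, -⟩ := rightLoop_spec hg hf hs
  simp only [chainLoop]
  exact Real.coe_toNNReal _ (by linarith)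

theorem chainDouble_pos (j : Fin (g - 2)) :
    0 < S.wallStart (j.1 + 1 + 1) - S.wallEnd (j.1 + 1) := by
  have := j.2
  exact sub_pos.2 (wallEnd_lt_wallStart hf hs (by omega) (by omega) (by omega))

theorem coe_chainDouble (j : Fin (g - 2)) :
    (S.chainDouble g j : ℝ) = S.wallStart (j.1 + 1 + 1) - S.wallEnd (j.1 + 1) :=
  Real.coe_toNNReal _ (chainDouble_pos hf hs j).le

omit hf hs in
theorem coe_chainMiddle (k : Fin (g - 1)) :
    (S.chainMiddle g k : ℝ) = |S.gap (S.wall (k.1 + 1))| := Real.coe_toNNReal _ (abs_nonneg _)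

theorem stripLength_pos (e) : 0 < S.stripLength g hg e := by
  rw [← NNReal.coe_pos]
  rcases e with (_ | _) | ⟨j, b⟩ | k
  · change 0 < (S.chainLoop g false : ℝ)
    obtain ⟨h1, h2, -⟩ := leftLoop_spec hg hf hs
    rw [coe_chainLoop_false hg hf hs]
    linarith
  · change 0 < (S.chainLoop g true : ℝ)
    obtain ⟨h1, h2, -⟩ := rightLoop_spec hg hf hs
    rw [coe_chainLoop_true hg hf hs]
    linarith
  · change 0 < (S.chainDouble g j : ℝ)
    rw [coe_chainDouble hf hs]
    exact chainDouble_pos hf hs j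
  · change 0 < (S.chainMiddle g k : ℝ)
    rw [coe_chainMiddle]
    have := k.2
    exact abs_pos.2 (gap_wall_ne_zero hf hs (by omega) (by omega))

theorem chainPoint_chainVertex (k : Fin (g - 1)) (side pos : Bool) :
    S.chainPoint g (chainVertex (S.chainSplit g) k side pos) =
      S.branch pos (if side then S.wallEnd (k.1 + 1) else S.wallStart (k.1 + 1)) := by
  have hk := k.2
  by_cases h : S.gap (S.wall (k.1 + 1)) < 0
  · have : chainVertex (S.chainSplit g) k side pos = (k, side) := by
      simp [chainVertex, chainSplit, h]
    rw [this]
    obtain ⟨-, -, -, -, h1, h2, -⟩ := wall_of_neg hf hs (k := k.1 + 1) (by omega) (by omega) h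
    refine branch_eq_of_gap_nonpos (le_of_eq ?_) _ _
    cases side
    · exact h1
    · exact h2
  · have : chainVertex (S.chainSplit g) k side pos = (k, pos) := by
      simp [chainVertex, chainSplit, h]
    rw [this]
    have hpos := lt_of_le_of_ne (not_lt.1 h)
      (gap_wall_ne_zero hf hs (k := k.1 + 1) (by omega) (by omega)).symm
    rw [chainPoint, wallEnd_eq_wall hpos, wallStart_eq_wall hpos]
    simp

theorem nodePath_zero (h0 : 0 ≤ k) (hk : k ≤ g) :
    S.nodePath k 0 = S.branch false (S.wallStart k) := by
  unfold nodePath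
  split_ifs with h
  · simp
  · have hpos := lt_of_le_of_ne (not_lt.1 h) (gap_wall_ne_zero hf hs h0 hk).symm
    rw [wallStart_eq_wall hpos]
    simp [branch, branchY, sub_eq_add_neg]

theorem nodePath_length (h0 : 0 ≤ k) (hk : k ≤ g) :
    S.nodePath k |S.gap (S.wall k)| = S.branch true (S.wallEnd k) := by
  unfold nodePath
  split_ifs with h
  · obtain ⟨-, -, -, -, -, h2, -⟩ := wall_of_neg hf hs h0 hk h
    rw [branch_eq_of_gap_nonpos h2.le true false, wallStart, wallEnd, halfWidth_of_neg h,
      abs_of_neg h]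
    congr 1
    ring
  · have hpos := lt_of_le_of_ne (not_lt.1 h) (gap_wall_ne_zero hf hs h0 hk).symm
    rw [wallEnd_eq_wall hpos, branch, branchY, if_pos rfl, abs_of_pos hpos, radius_eq hpos.le]
    congr 1
    ring

omit hf hs in
theorem continuous_nodePath (S : Strip) (k : ℤ) : Continuous (S.nodePath k) := by
  unfold nodePath
  split_ifs
  · exact (S.continuous_branch false).comp (by fun_prop)
  · fun_prop

/-- The interior of the path of a split node. -/
theorem nodePath_cases (h0 : 0 ≤ k) (hk : k ≤ g) {r : ℝ} (hr : r ∈ Ioo 0 |S.gap (S.wall k)|) :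
    (S.gap (S.wall k) < 0 ∧ S.nodePath k r = S.branch false (S.wallStart k + 2 * r) ∧
      S.wallStart k + 2 * r ∈ Ioo (S.wallStart k) (S.wallEnd k)) ∨
    (0 < S.gap (S.wall k) ∧
      S.nodePath k r = (S.wall k, S.center (S.wall k) + (r - S.radius (S.wall k))) ∧
      |r - S.radius (S.wall k)| < S.radius (S.wall k)) := by
  unfold nodePath
  split_ifs with h
  · rw [abs_of_neg h] at hr
    refine Or.inl ⟨h, rfl, by linarith [hr.1], ?_⟩
    rw [wallEnd, wallStart, halfWidth_of_neg h]
    linarith [hr.2]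
  · have hpos := lt_of_le_of_ne (not_lt.1 h) (gap_wall_ne_zero hf hs h0 hk).symm
    rw [abs_of_pos hpos] at hr
    refine Or.inr ⟨hpos, ?_, ?_⟩
    · congr 1
      ring
    · rw [radius_eq hpos.le, abs_lt]
      constructor <;> linarith [hr.1, hr.2]

theorem nodePath_mem (h0 : 0 ≤ k) (hk : k ≤ g) {r : ℝ} (hr : r ∈ Icc 0 |S.gap (S.wall k)|) :
    S.nodePath k r ∈ maxCurve S.points S.height := by
  rcases hr.1.eq_or_lt with rfl | h1
  · rw [nodePath_zero hf hs h0 hk]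
    exact S.branch_mem_maxCurve _ _
  rcases hr.2.eq_or_lt with rfl | h2
  · rw [nodePath_length hf hs h0 hk]
    exact S.branch_mem_maxCurve _ _
  rcases nodePath_cases hf hs h0 hk ⟨h1, h2⟩ with ⟨-, h, -⟩ | ⟨-, h, h'⟩
  · rw [h]
    exact S.branch_mem_maxCurve _ _
  · rw [h]
    exact wall_mem_maxCurve hf hs h0 hk h'.le

theorem hasPrimitiveVelocity_nodePath (h0 : 0 ≤ k) (hk : k ≤ g) :
    HasPrimitiveVelocity (S.nodePath k) |S.gap (S.wall k)| := by
  by_cases h : S.gap (S.wall k) < 0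
  · have e : S.nodePath k = fun t => S.branch false (S.wallStart k + 2 * t) := by
      funext t
      rw [nodePath, if_pos h]
    rw [e, abs_of_neg h]
    obtain ⟨t, b, h1, h2⟩ := exists_arg_eq_singleton hf hs h0 hk
    obtain ⟨-, -, -, h3, -⟩ := wall_of_neg hf hs h0 hk h
    refine hasPrimitiveVelocity_branch_of_neg false (t := t) (b := b) ⟨k, h2 h⟩ fun r hr => ?_
    have hmem : S.wallStart k + 2 * r ∈ Ioo (S.wallStart k) (S.wallEnd k) := by
      refine ⟨by linarith [hr.1], ?_⟩
      rw [wallEnd, wallStart, halfWidth_of_neg h]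
      linarith [hr.2]
    exact ⟨h3 _ hmem, h1 _ (Ioo_subset_Icc_self hmem)⟩
  · refine ⟨∅, fun r _ _ => ⟨0, 1, isCoprime_one_right, ?_⟩⟩
    have e : S.nodePath k = fun t => (S.wall k, S.center (S.wall k) - S.radius (S.wall k) + t) := by
      funext t
      rw [nodePath, if_neg h]
    rw [e]
    push_cast
    exact (hasDerivAt_const r _).prodMk ((hasDerivAt_id r).const_add _)

theorem nodePath_injOn (h0 : 0 ≤ k) (hk : k ≤ g) :
    InjOn (S.nodePath k) (Ioo 0 |S.gap (S.wall k)|) := by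
  intro r hr r' hr' heq
  rcases nodePath_cases hf hs h0 hk hr with ⟨h1, h2, -⟩ | ⟨h1, h2, -⟩ <;>
    rcases nodePath_cases hf hs h0 hk hr' with ⟨h1', h2', -⟩ | ⟨h1', h2', -⟩ <;>
    rw [h2, h2'] at heq
  · have := congrArg Prod.fst heq
    simp only [branch] at this
    linarith
  · linarith
  · linarith
  · have := congrArg Prod.snd heq
    simp only at this
    linarith

omit hf hs in
theorem loopPath_mem_maxCurve {X c h v r : ℝ} (hv : 0 ≤ v)
    (hr : S.radius (X + c * h) = v / 2)
    (hmem : ∀ s, |s| ≤ v / 2 → (X + c * h, S.center (X + c * h) + s) ∈ maxCurve S.points S.height) :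
    S.loopPath X c h v r ∈ maxCurve S.points S.height := by
  rcases le_or_gt r h with h1 | h1
  · rw [loopPath_of_le hv hr h1]
    exact S.branch_mem_maxCurve _ _
  · rcases le_or_gt (h + v) r with h2 | h2
    · rw [loopPath_of_ge hv hr h2]
      exact S.branch_mem_maxCurve _ _
    · rw [loopPath_of_mem hr ⟨h1.le, h2.le⟩]
      exact hmem _ (abs_le.2 ⟨by linarith, by linarith⟩)

theorem tip_mem_maxCurve (h0 : 0 ≤ k) (hk : k ≤ g) (hx : x = S.wallStart k ∨ x = S.wallEnd k)
    {s : ℝ} (hs' : |s| ≤ max 0 (S.gap (S.wall k)) / 2) :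
    (x, S.center x + s) ∈ maxCurve S.points S.height := by
  rcases (gap_wall_ne_zero hf hs h0 hk).lt_or_gt with h | h
  · rw [max_eq_left h.le, zero_div, abs_nonpos_iff] at hs'
    obtain ⟨-, -, -, -, h1, h2, -⟩ := wall_of_neg hf hs h0 hk h
    have hx0 : S.gap x ≤ 0 := by
      rcases hx with rfl | rfl
      · exact h1.le
      · exact h2.le
    have := S.branch_mem_maxCurve true x
    rw [branch, branchY, radius_eq_zero hx0] at this
    rw [hs']
    simpa using this
  · rw [wallStart_eq_wall h, wallEnd_eq_wall h, or_self] at hx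
    rw [hx]
    exact wall_mem_maxCurve hf hs h0 hk hs'

include hg in
theorem leftLoop_mem (r : ℝ) : S.leftLoop r ∈ maxCurve S.points S.height := by
  obtain ⟨h1, h2, h3, h4⟩ := leftLoop_spec hg hf hs
  refine loopPath_mem_maxCurve h2 h3 fun s hs' => ?_
  exact tip_mem_maxCurve hf hs (k := 0) le_rfl (by omega) (Or.inr (by ring)) hs'

include hg in
theorem rightLoop_mem (r : ℝ) : S.rightLoop g r ∈ maxCurve S.points S.height := by
  obtain ⟨h1, h2, h3, h4⟩ := rightLoop_spec hg hf hs
  refine loopPath_mem_maxCurve h2 h3 fun s hs' => ?_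
  exact tip_mem_maxCurve hf hs (k := g) (by omega) le_rfl (Or.inl (by ring)) hs'

end Embedding

/-- The slot of an edge of a chain. -/
def edgeSlot (g : ℕ) : Bool ⊕ (Fin (g - 2) × Bool) ⊕ Fin (g - 1) → ℤ × Bool
  | .inl false => (0, false)
  | .inl true => (g - 1, false)
  | .inr (.inl (j, _)) => (j.1 + 1, false)
  | .inr (.inr k) => (k.1 + 1, true)

theorem isSlot_edgeSlot (hg : 2 ≤ g) (e) : IsSlot g (edgeSlot g e) := by
  rcases e with (_ | _) | ⟨j, b⟩ | k
  · simp only [IsSlot, edgeSlot]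
    norm_num
    omega
  · simp only [IsSlot, edgeSlot]
    norm_num
    omega
  · simp only [IsSlot, edgeSlot]
    norm_num
    have := j.2
    omega
  · simp only [IsSlot, edgeSlot]
    norm_num
    have := k.2
    omega

section Embedding

variable (hg : 2 ≤ g) (hf : S.IsFull g) (hs : S.IsSmooth)

include hf hs

theorem chainPath_fst_mem_slot (e : (chainGraph g hg (S.chainSplit g)).E) {r : ℝ}
    (hr : r ∈ Ioo 0 (S.stripLength g hg e : ℝ)) : (S.chainPath g e r).1 ∈ S.slot g (edgeSlot g e) := by
  rcases e with (_ | _) | ⟨j, b⟩ | k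
  · change r ∈ Ioo 0 (S.chainLoop g false : ℝ) at hr
    rw [coe_chainLoop_false hg hf hs] at hr
    obtain ⟨h1, h2, h3, h4⟩ := leftLoop_spec hg hf hs
    obtain ⟨m, hm, he⟩ := exists_loopPath_fst h1 h2 h3 h4 hr
    change (S.leftLoop r).1 ∈ _
    rw [leftLoop, he]
    simp only [slot, edgeSlot]
    norm_num
    intro
    exact hm.1
  · change r ∈ Ioo 0 (S.chainLoop g true : ℝ) at hr
    rw [coe_chainLoop_true hg hf hs] at hr
    obtain ⟨h1, h2, h3, h4⟩ := rightLoop_spec hg hf hs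
    obtain ⟨m, hm, he⟩ := exists_loopPath_fst h1 h2 h3 h4 hr
    change (S.rightLoop g r).1 ∈ _
    rw [rightLoop, he]
    simp only [slot, edgeSlot]
    norm_num
    exact ⟨fun _ => hm.1, fun h => by omega⟩
  · change r ∈ Ioo 0 (S.chainDouble g j : ℝ) at hr
    rw [coe_chainDouble hf hs] at hr
    change S.wallEnd (j.1 + 1) + 1 * r ∈ _
    simp only [slot, edgeSlot]
    norm_num
    exact ⟨hr.1, fun _ => by linarith [hr.2]⟩
  · change r ∈ Ioo 0 (S.chainMiddle g k : ℝ) at hr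
    rw [coe_chainMiddle] at hr
    change (S.nodePath (k.1 + 1) r).1 ∈ _
    have := k.2
    simp only [slot, edgeSlot, if_true]
    rcases nodePath_cases hf hs (k := k.1 + 1) (by omega) (by omega) hr with ⟨-, h, h'⟩ | ⟨-, h, -⟩
    · rw [h]
      exact Ioo_subset_Icc_self h'
    · rw [h]
      exact ⟨S.wallStart_le_wall _, S.wall_le_wallEnd _⟩

omit hf hs in
theorem chainPoint_fst_mem (v : Fin (g - 1) × Bool) :
    (S.chainPoint g v).1 ∈ S.slot g (v.1.1 + 1, true) := by
  obtain ⟨k, b⟩ := v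
  have h1 := S.wallStart_le_wall (k.1 + 1)
  have h2 := S.wall_le_wallEnd (k.1 + 1)
  cases b <;> simp only [chainPoint, branch, slot, if_true] <;> norm_num <;> linarith

/-- A full smooth strip realizes its chain. -/
theorem isLatticeEmbedding_chain : IsLatticeEmbedding (chainGraph g hg (S.chainSplit g))
    (S.stripLength g hg) (maxCurve S.points S.height) (S.chainPoint g) (S.chainPath g) where
  vertex_mem v := S.branch_mem_maxCurve _ _
  path_mem := by
    rintro ((_ | _) | ⟨j, b⟩ | k) r hr
    · exact leftLoop_mem hg hf hs r
    · exact rightLoop_mem hg hf hs r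
    · exact S.branch_mem_maxCurve _ _
    · have := k.2
      change r ∈ Icc 0 (S.chainMiddle g k : ℝ) at hr
      rw [coe_chainMiddle] at hr
      exact nodePath_mem hf hs (by omega) (by omega) hr
  continuousOn := by
    rintro ((_ | _) | ⟨j, b⟩ | k)
    · exact (S.continuous_loopPath _ _ _ _).continuousOn
    · exact (S.continuous_loopPath _ _ _ _).continuousOn
    · exact ((S.continuous_branch b).comp (by fun_prop)).continuousOn
    · exact (S.continuous_nodePath _).continuousOn
  ends_eq := by
    rintro ((_ | _) | ⟨j, b⟩ | k)
    · change s(S.chainPoint g _, S.chainPoint g _) = s(S.leftLoop 0, S.leftLoop (S.chainLoop g false : ℝ))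
      obtain ⟨h1, h2, h3, h4⟩ := leftLoop_spec hg hf hs
      rw [chainPoint_chainVertex hf hs, chainPoint_chainVertex hf hs, coe_chainLoop_false hg hf hs,
        leftLoop, loopPath_of_le h2 h3 h1.le, loopPath_of_ge h2 h3 (by linarith)]
      simp
    · change s(S.chainPoint g _, S.chainPoint g _) =
        s(S.rightLoop g 0, S.rightLoop g (S.chainLoop g true : ℝ))
      obtain ⟨h1, h2, h3, h4⟩ := rightLoop_spec hg hf hs
      rw [chainPoint_chainVertex hf hs, chainPoint_chainVertex hf hs, coe_chainLoop_true hg hf hs,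
        rightLoop, loopPath_of_le h2 h3 h1.le, loopPath_of_ge h2 h3 (by linarith)]
      have : ((g - 2 : ℕ) : ℤ) + 1 = g - 1 := by omega
      simp [this]
    · change s(S.chainPoint g _, S.chainPoint g _) = s(S.branch b (S.wallEnd (j.1 + 1) + 1 * 0),
        S.branch b (S.wallEnd (j.1 + 1) + 1 * (S.chainDouble g j : ℝ)))
      rw [chainPoint_chainVertex hf hs, chainPoint_chainVertex hf hs, coe_chainDouble hf hs]
      simp
    · change s(S.chainPoint g (k, false), S.chainPoint g (k, true)) =
        s(S.nodePath (k.1 + 1) 0, S.nodePath (k.1 + 1) (S.chainMiddle g k : ℝ))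
      have := k.2
      rw [coe_chainMiddle, nodePath_zero hf hs (by omega) (by omega),
        nodePath_length hf hs (by omega) (by omega)]
      rfl
  vertex_injective := by
    rintro ⟨k, b⟩ ⟨k', b'⟩ heq
    have hk := k.2
    have hk' := k'.2
    have h1 := S.chainPoint_fst_mem (k, b)
    have h2 := S.chainPoint_fst_mem (k', b')
    rw [heq] at h1
    have h3 := slot_unique hf hs (by simp only [IsSlot]; norm_num; omega)
      (by simp only [IsSlot]; norm_num; omega) h1 h2
    obtain rfl : k = k' := by
      have := congrArg Prod.fst h3
      simp only at this
      exact Fin.ext (by omega)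
    by_contra hne
    have hbb : ∀ c : Bool, S.chainPoint g (k, false) ≠ S.chainPoint g (k, true) := by
      intro _ heq
      rcases (gap_wall_ne_zero hf hs (k := k.1 + 1) (by omega) (by omega)).lt_or_gt with h | h
      · have h4 := congrArg Prod.fst heq
        simp only [chainPoint, branch, wallStart, wallEnd, halfWidth_of_neg h] at h4
        norm_num at h4
        linarith
      · have h4 := congrArg Prod.snd heq
        simp only [chainPoint, branch, wallStart_eq_wall h, wallEnd_eq_wall h, branchY] at h4
        norm_num at h4
        linarith [radius_pos h]
    cases b <;> cases b'
    · exact hne rfl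
    · exact hbb true heq
    · exact hbb true heq.symm
    · exact hne rfl
  path_injective := by
    intro e e' r hr r' hr' heq
    have h1 := chainPath_fst_mem_slot hg hf hs e hr
    have h2 := chainPath_fst_mem_slot hg hf hs e' hr'
    rw [heq] at h1
    have h3 := slot_unique hf hs (isSlot_edgeSlot hg e) (isSlot_edgeSlot hg e') h1 h2
    -- Equal slots identify the edges, except for the two strands of a doubled edge; those are
    -- separated by the positive radius.
    have hee : e = e' := by
      rcases e with (_ | _) | ⟨j, b⟩ | k <;> rcases e' with (_ | _) | ⟨j', b'⟩ | k' <;>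
        simp only [edgeSlot, Prod.mk.injEq] at h3 <;> try rfl
      · omega
      · omega
      · simp at h3
      · omega
      · have := j'.2
        omega
      · simp at h3
      · omega
      · have := j.2
        omega
      · obtain rfl : j = j' := Fin.ext (by omega)
        change r ∈ Ioo 0 (S.chainDouble g j : ℝ) at hr
        rw [coe_chainDouble hf hs] at hr
        change S.branch b (S.wallEnd (j.1 + 1) + 1 * r) =
          S.branch b' (S.wallEnd (j.1 + 1) + 1 * r') at heq
        obtain rfl : r = r' := by
          have := congrArg Prod.fst heq
          simp only [branch] at this
          linarith
        have hj := j.2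
        have hpos := gap_pos_of_between hf hs (k := j.1 + 1) (by omega) (by omega)
          (x := S.wallEnd (j.1 + 1) + 1 * r) (by linarith [hr.1]) (by linarith [hr.2])
        have e1 := radius_pos hpos
        rw [one_mul] at e1
        have e2 := congrArg Prod.snd heq
        simp only [branch, branchY] at e2
        cases b <;> cases b' <;> first | rfl | (norm_num at e2; linarith)
      · simp at h3
      · simp at h3
      · simp at h3
      · simp at h3
      · obtain rfl : k = k' := Fin.ext (by omega)
        rfl
    subst hee
    refine ⟨rfl, ?_⟩
    rcases e with (_ | _) | ⟨j, b⟩ | k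
    · obtain ⟨h1, h2, h3, h4⟩ := leftLoop_spec hg hf hs
      change r ∈ Ioo 0 (S.chainLoop g false : ℝ) at hr
      change r' ∈ Ioo 0 (S.chainLoop g false : ℝ) at hr'
      rw [coe_chainLoop_false hg hf hs] at hr hr'
      exact loopPath_injOn (by norm_num) h2 h3 h4 hr hr' heq
    · obtain ⟨h1, h2, h3, h4⟩ := rightLoop_spec hg hf hs
      change r ∈ Ioo 0 (S.chainLoop g true : ℝ) at hr
      change r' ∈ Ioo 0 (S.chainLoop g true : ℝ) at hr'
      rw [coe_chainLoop_true hg hf hs] at hr hr'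
      exact loopPath_injOn (by norm_num) h2 h3 h4 hr hr' heq
    · have := congrArg Prod.fst heq
      simp only [chainPath, branch] at this
      linarith
    · have hk := k.2
      change r ∈ Ioo 0 (S.chainMiddle g k : ℝ) at hr
      change r' ∈ Ioo 0 (S.chainMiddle g k : ℝ) at hr'
      rw [coe_chainMiddle] at hr hr'
      exact nodePath_injOn hf hs (by omega) (by omega) hr hr' heq
  path_ne_vertex := by
    intro e v r hr heq
    have h1 := chainPath_fst_mem_slot hg hf hs e hr
    have h2 := S.chainPoint_fst_mem v
    rw [heq] at h1
    have hv := v.1.2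
    have h3 := slot_unique hf hs (isSlot_edgeSlot hg e)
      (by simp only [IsSlot]; norm_num; omega) h1 h2
    rcases e with (_ | _) | ⟨j, b⟩ | k <;> simp only [edgeSlot, Prod.mk.injEq] at h3
    · simp at h3
    · simp at h3
    · simp at h3
    · obtain ⟨k', b⟩ := v
      obtain rfl : k = k' := Fin.ext (by simp only at h3; omega)
      change r ∈ Ioo 0 (S.chainMiddle g k : ℝ) at hr
      rw [coe_chainMiddle] at hr
      change S.nodePath (k.1 + 1) r = _ at heq
      have hk := k.2
      rcases nodePath_cases hf hs (k := k.1 + 1) (by omega) (by omega) hr with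
        ⟨-, h4, h5⟩ | ⟨h4, h5, h6⟩
      · rw [h4] at heq
        have h6 := congrArg Prod.fst heq
        simp only [chainPoint, branch] at h6
        cases b <;> norm_num at h6 <;> linarith [h5.1, h5.2]
      · rw [h5] at heq
        have h7 := congrArg Prod.snd heq
        simp only [chainPoint, branch, wallStart_eq_wall h4, wallEnd_eq_wall h4, branchY] at h7
        obtain ⟨h8, h9⟩ := abs_lt.1 h6
        cases b <;> norm_num at h7 <;> linarith
  velocity := by
    rintro ((_ | _) | ⟨j, b⟩ | k)
    · obtain ⟨h1, h2, h3, h4⟩ := leftLoop_spec hg hf hs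
      change HasPrimitiveVelocity S.leftLoop (S.chainLoop g false : ℝ)
      rw [coe_chainLoop_false hg hf hs]
      exact hasPrimitiveVelocity_loopPath (Or.inr rfl) h2 h3 h4
    · obtain ⟨h1, h2, h3, h4⟩ := rightLoop_spec hg hf hs
      change HasPrimitiveVelocity (S.rightLoop g) (S.chainLoop g true : ℝ)
      rw [coe_chainLoop_true hg hf hs]
      exact hasPrimitiveVelocity_loopPath (Or.inl rfl) h2 h3 h4
    · have hj := j.2
      change HasPrimitiveVelocity (fun t => S.branch b (S.wallEnd (j.1 + 1) + 1 * t))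
        (S.chainDouble g j : ℝ)
      rw [coe_chainDouble hf hs]
      exact hasPrimitiveVelocity_branch_of_pos b (Or.inl rfl) fun r hr =>
        gap_pos_of_between hf hs (k := j.1 + 1) (by omega) (by omega) (by linarith [hr.1])
          (by linarith [hr.2])
    · have hk := k.2
      change HasPrimitiveVelocity (S.nodePath (k.1 + 1)) (S.chainMiddle g k : ℝ)
      rw [coe_chainMiddle]
      exact hasPrimitiveVelocity_nodePath hf hs (by omega) (by omega)

end Embedding

end Strip

/-! ### Graphs without leaves inside the curve of a full strip -/

/-- The image of an embedded graph without leaves has no point that is strictly extremal for a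
function which is locally a coordinate. -/
theorem IsLatticeEmbedding.false_of_extremal {G : WeightedGraph} {ℓ : G.E → ℝ≥0}
    {C : Set (ℝ × ℝ)} {φ : G.V → ℝ × ℝ} {γ : G.E → ℝ → ℝ × ℝ} (h : IsLatticeEmbedding G ℓ C φ γ)
    (hℓ : ∀ e, 0 < ℓ e) (hval : ∀ v, 2 ≤ G.valence v) {p : ℝ × ℝ} (hp : p ∈ pathImage ℓ γ)
    {u : ℝ × ℝ → ℝ} (hu : Continuous u) {N : Set (ℝ × ℝ)}
    (hN : ∀ᶠ q in 𝓝 p, q ∈ pathImage ℓ γ → q ∈ N) (hinj : InjOn u N)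
    (hpos : ∀ q ∈ N, q ≠ p → u p < u q) : False := by
  -- Two disjoint germs leave `p`, but both would increase along the same coordinate `u`, which is
  -- injective near `p`, and therefore meet.
  obtain ⟨σ₁, σ₂, ε, h₁, h₂, m₁, m₂, hd⟩ := h.exists_two_germs hℓ hval hp
  obtain ⟨ε₁, p₁, l₁, n₁⟩ := h₁.eventually hN
  obtain ⟨ε₂, p₂, l₂, n₂⟩ := h₂.eventually hN
  obtain ⟨t₁, ht₁, t₂, ht₂, heq⟩ := (h₁.mono p₁ l₁).meet_of_coordinate (h₂.mono p₂ l₂) hu hinj hpos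
    (fun t ht => n₁ t ⟨ht.1.le, ht.2⟩ (m₁ t ⟨ht.1.le, ht.2.trans l₁⟩))
    (fun t ht => n₂ t ⟨ht.1.le, ht.2⟩ (m₂ t ⟨ht.1.le, ht.2.trans l₂⟩))
  exact hd t₁ ⟨ht₁.1, ht₁.2.trans l₁⟩ t₂ ⟨ht₂.1, ht₂.2.trans l₂⟩ heq

namespace Strip

variable {S : Strip} {g : ℕ} {x y : ℝ} {t k b : ℤ}

/-- The signed vertical distance from the midpoint of the two branches. -/
noncomputable def offset (S : Strip) (q : ℝ × ℝ) : ℝ := q.2 - S.center q.1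

theorem continuous_offset (S : Strip) : Continuous S.offset := by
  have := S.continuous_center
  unfold offset
  fun_prop

theorem eq_branch_true {q : ℝ × ℝ} (h : S.offset q = S.radius q.1) : q = S.branch true q.1 := by
  refine Prod.ext rfl ?_
  simp only [offset, branch, branchY, if_true] at h ⊢
  linarith

theorem eq_branch_false {q : ℝ × ℝ} (h : S.offset q = -S.radius q.1) : q = S.branch false q.1 := by
  refine Prod.ext rfl ?_
  simp only [offset, branch, branchY] at h ⊢
  norm_num
  linarith

/-- Away from a finite set of abscissas the curve lies between the two branches. -/
theorem exists_finset_legs (S : Strip) : ∃ F : Finset ℝ, ∀ q ∈ maxCurve S.points S.height,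
    S.radius q.1 < |S.offset q| → q.1 ∈ F := by
  obtain ⟨F, hF⟩ := S.exists_finset_arg
  refine ⟨F, fun q hq hlt => ?_⟩
  by_contra hmem
  obtain ⟨t, k, b, h1, h2, h3⟩ := hF _ hmem
  obtain ⟨x, y⟩ := q
  have hr : S.gap x ≤ 2 * S.radius x := by
    rw [radius]
    linarith [le_max_right 0 (S.gap x)]
  have hr0 := S.radius_nonneg x
  obtain ⟨a, ha, a', ha', hne⟩ := hq
  rw [mem_maxCell_iff] at ha ha'
  simp only at h1 h2 h3 hlt
  rw [h1, h2, h3] at ha ha'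
  rw [gap] at hr
  simp only [offset, center] at hlt
  apply hne
  rcases lt_abs.1 hlt with hlt | hlt
  · rcases ha with ⟨e1, e2, -⟩ | ⟨-, -, e3, -⟩ | ⟨-, -, e3, -⟩
    · rcases ha' with ⟨f1, f2, -⟩ | ⟨-, -, f3, -⟩ | ⟨-, -, f3, -⟩
      · exact Prod.ext (e2.trans f2.symm) (e1.trans f1.symm)
      · linarith
      · linarith
    · linarith
    · linarith
  · rcases ha with ⟨-, -, -, e3⟩ | ⟨-, -, -, e3⟩ | ⟨e1, e2, -⟩
    · linarith
    · linarith
    · rcases ha' with ⟨-, -, -, f3⟩ | ⟨-, -, -, f3⟩ | ⟨f1, f2, -⟩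
      · linarith
      · linarith
      · exact Prod.ext (e2.trans f2.symm) (e1.trans f1.symm)

variable (hg : 2 ≤ g) (hf : S.IsFull g) (hs : S.IsSmooth)

include hf hs in
/-- Strictly between the two branches, the curve consists of the walls. -/
theorem exists_wall_of_mem_maxCurve {q : ℝ × ℝ} (hq : q ∈ maxCurve S.points S.height)
    (hlt : |S.offset q| < S.radius q.1) : ∃ k : ℤ, 0 ≤ k ∧ k ≤ g ∧ q.1 = S.wall k := by
  obtain ⟨x, y⟩ := q
  have hgap : 0 < S.gap x := by
    by_contra! h
    simp only [radius_eq_zero h] at hlt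
    exact (abs_nonneg _).not_gt hlt
  obtain ⟨a, ha, a', ha', hne⟩ := hq
  rw [mem_maxCell_iff] at ha ha'
  simp only [radius_eq hgap.le, offset, center] at hlt
  rw [gap] at hlt
  obtain ⟨l1, l2⟩ := abs_lt.1 hlt
  have key : ∀ {i j : ℤ}, i ∈ S.argMid x → j ∈ S.argMid x → i < j →
      ∃ k : ℤ, 0 ≤ k ∧ k ≤ g ∧ x = S.wall k := by
    intro i j hi hj hij
    have h1 := hf.bounds hi
    have h2 := hf.bounds hj
    have h3 := argMid_consecutive hf hs hi hj hij
    rw [h3] at hj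
    exact ⟨i, h1.1, by omega, eq_wall hi hj⟩
  rcases ha with ⟨-, -, e3, -⟩ | ⟨e1, e2, -⟩ | ⟨-, -, -, e3⟩
  · linarith
  · rcases ha' with ⟨-, -, f3, -⟩ | ⟨f1, f2, -⟩ | ⟨-, -, -, f3⟩
    · linarith
    · rcases lt_trichotomy a.1 a'.1 with h | h | h
      · exact key e2 f2 h
      · exact absurd (Prod.ext h (e1.trans f1.symm)) hne
      · exact key f2 e2 h
    · linarith
  · linarith

section Core

variable {G : WeightedGraph} {ℓ : G.E → ℝ≥0} {φ : G.V → ℝ × ℝ} {γ : G.E → ℝ → ℝ × ℝ}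
  (h : IsLatticeEmbedding G ℓ (maxCurve S.points S.height) φ γ) (hℓ : ∀ e, 0 < ℓ e)
  (hval : ∀ v, 2 ≤ G.valence v)

include h hℓ hval

/-- An embedded graph without leaves does not meet the vertical legs. -/
theorem abs_offset_le {q : ℝ × ℝ} (hq : q ∈ pathImage ℓ γ) : |S.offset q| ≤ S.radius q.1 := by
  obtain ⟨F, hF⟩ := S.exists_finset_legs
  have key : ∀ σ : ℝ, σ = 1 ∨ σ = -1 → ∀ q ∈ pathImage ℓ γ, σ * S.offset q ≤ S.radius q.1 := by
    intro σ hσ q hq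
    by_contra! hlt
    have habs : ∀ r : ℝ, σ * r ≤ |r| := fun r => by
      rcases hσ with rfl | rfl
      · rw [one_mul]
        exact le_abs_self r
      · rw [neg_one_mul]
        exact neg_le_abs r
    have hcont : Continuous fun q : ℝ × ℝ => σ * S.offset q - S.radius q.1 :=
      (continuous_const.mul S.continuous_offset).sub (S.continuous_radius.comp continuous_fst)
    -- At a point `p` of largest excess over the branch, the graph is locally contained in a
    -- vertical leg, since the abscissae outside the branches form a finite set. So `p` is extremal
    -- for the vertical coordinate.
    obtain ⟨p, hp, hmax⟩ := h.isCompact_pathImage.exists_isMaxOn ⟨q, hq⟩ hcont.continuousOn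
    have hp0 : 0 < σ * S.offset p - S.radius p.1 := by
      have : σ * S.offset q - S.radius q.1 ≤ σ * S.offset p - S.radius p.1 := hmax hq
      linarith
    refine h.false_of_extremal hℓ hval hp (u := fun q => -σ * q.2) (by fun_prop)
      (N := {q | q ∈ pathImage ℓ γ ∧ q.1 = p.1}) ?_ ?_ ?_
    · have h1 : ∀ᶠ x in 𝓝 p.1, x ∉ ((F : Set ℝ) \ {p.1}) :=
        (F.finite_toSet.subset sdiff_subset).isClosed.isOpen_compl.mem_nhds (by simp)
      filter_upwards [continuous_fst.continuousAt.eventually h1,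
        hcont.continuousAt.eventually (lt_mem_nhds hp0)] with q h1 h2 hq
      refine ⟨hq, ?_⟩
      have h3 := hF q (h.pathImage_subset hq) (by linarith [habs (S.offset q)])
      by_contra hne
      exact h1 ⟨h3, hne⟩
    · rintro q ⟨-, hq⟩ q' ⟨-, hq'⟩ heq
      refine Prod.ext (hq.trans hq'.symm) (mul_left_cancel₀ (a := -σ) ?_ heq)
      rcases hσ with rfl | rfl <;> norm_num
    · rintro q ⟨hq, hq'⟩ hne
      have h1 : σ * S.offset q - S.radius q.1 ≤ σ * S.offset p - S.radius p.1 := hmax hq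
      simp only [offset, hq'] at h1
      have h2 : q.2 ≠ p.2 := fun h => hne (Prod.ext hq' h)
      have h3 : σ * q.2 ≠ σ * p.2 := fun h => h2 (mul_left_cancel₀ (by
        rcases hσ with rfl | rfl <;> norm_num) h)
      have h4 : σ * q.2 < σ * p.2 := lt_of_le_of_ne (by linarith) h3
      linarith
  refine abs_le.2 ⟨?_, ?_⟩
  · linarith [key (-1) (Or.inr rfl) q hq]
  · linarith [key 1 (Or.inl rfl) q hq]

/-- An embedded graph without leaves has no first or last point on a branch. -/
theorem false_of_branch {p : ℝ × ℝ} (hp : p ∈ pathImage ℓ γ) {σ : ℝ} (hσ : σ ≠ 0)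
    (hmin : ∀ q ∈ pathImage ℓ γ, σ * p.1 ≤ σ * q.1) (pos : Bool)
    (hbr : ∀ᶠ q in 𝓝 p, q ∈ pathImage ℓ γ → q = S.branch pos q.1) : False := by
  refine h.false_of_extremal hℓ hval hp (u := fun q => σ * q.1) (by fun_prop)
    (N := {q | q ∈ pathImage ℓ γ ∧ q = S.branch pos q.1}) ?_ ?_ ?_
  · filter_upwards [hbr] with q hq hq'
    exact ⟨hq', hq hq'⟩
  · rintro q ⟨-, hq⟩ q' ⟨-, hq'⟩ heq
    rw [hq, hq', mul_left_cancel₀ hσ heq]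
  · rintro q ⟨hq, hq'⟩ hne
    refine lt_of_le_of_ne (hmin q hq) fun heq => hne ?_
    have hp' := hbr.self_of_nhds hp
    rw [hq', hp', ← mul_left_cancel₀ hσ heq]

include hf hs in
/-- Where the gap is positive and there is no wall, the graph runs along the branches. -/
theorem exists_branch_of_pos {p : ℝ × ℝ} (hp : p ∈ pathImage ℓ γ) (hgap : 0 < S.gap p.1)
    (hwall : ∀ᶠ x in 𝓝 p.1, ∀ k : ℤ, 0 ≤ k → k ≤ g → x ≠ S.wall k) :
    ∃ pos, ∀ᶠ q in 𝓝 p, q ∈ pathImage ℓ γ → q = S.branch pos q.1 := by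
  have hoff : ∀ q ∈ pathImage ℓ γ, (∀ k : ℤ, 0 ≤ k → k ≤ g → q.1 ≠ S.wall k) →
      |S.offset q| = S.radius q.1 := by
    intro q hq hne
    refine le_antisymm (abs_offset_le h hℓ hval hq) ?_
    by_contra! hlt
    obtain ⟨k, h0, hk, hkq⟩ := exists_wall_of_mem_maxCurve hf hs (h.pathImage_subset hq) hlt
    exact hne k h0 hk hkq
  have hp0 : S.offset p ≠ 0 := by
    rw [← abs_pos, hoff p hp hwall.self_of_nhds]
    exact radius_pos hgap
  have hev := continuous_fst.continuousAt.eventually hwall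
  rcases hp0.lt_or_gt with hneg | hpos
  · refine ⟨false, ?_⟩
    filter_upwards [S.continuous_offset.continuousAt.eventually (gt_mem_nhds hneg), hev]
      with q h1 h2 hq
    refine eq_branch_false ?_
    rw [← hoff q hq h2, abs_of_neg h1, neg_neg]
  · refine ⟨true, ?_⟩
    filter_upwards [S.continuous_offset.continuousAt.eventually (lt_mem_nhds hpos), hev]
      with q h1 h2 hq
    refine eq_branch_true ?_
    rw [← hoff q hq h2, abs_of_pos h1]

omit h hℓ hval in
theorem branch_of_nonpos (hle : ∀ q ∈ pathImage ℓ γ, |S.offset q| ≤ S.radius q.1) {q : ℝ × ℝ}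
    (hq : q ∈ pathImage ℓ γ) (hgap : S.gap q.1 ≤ 0) : q = S.branch true q.1 := by
  have := hle q hq
  rw [radius_eq_zero hgap, abs_nonpos_iff] at this
  exact eq_branch_true (by rw [this, radius_eq_zero hgap])

-- Suppose a leftmost point p of the graph lay before the end of wall 0. Left of the negative
-- interval the gap is positive without walls, and on that interval the branches coincide; either
-- way the graph is locally part of one branch, which is the graph of a function of x, and p would
-- be a leaf.
include hf hs in
theorem wallEnd_zero_le {q : ℝ × ℝ} (hq : q ∈ pathImage ℓ γ) : S.wallEnd 0 ≤ q.1 := by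
  by_contra! hlt
  obtain ⟨p, hp, hmin⟩ := h.isCompact_pathImage.exists_isMinOn ⟨q, hq⟩ continuous_fst.continuousOn
  have hmin' : ∀ q ∈ pathImage ℓ γ, 1 * p.1 ≤ 1 * q.1 := fun q hq => by
    rw [one_mul, one_mul]
    exact hmin hq
  have hplt : p.1 < S.wallEnd 0 := lt_of_le_of_lt (hmin hq) hlt
  rcases lt_or_ge p.1 (S.wallStart 0) with h1 | h1
  · obtain ⟨pos, hpos⟩ := exists_branch_of_pos hf hs h hℓ hval hp (gap_pos_of_lt hf hs h1) (by
      filter_upwards [gt_mem_nhds h1] with x hx k h0 hk heq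
      have h2 := wallStart_le_wallStart hf hs le_rfl h0 hk
      have hx' : x < S.wallStart 0 := hx
      linarith [S.wallStart_le_wall k])
    exact false_of_branch h hℓ hval hp one_ne_zero hmin' pos hpos
  · have hneg : S.gap (S.wall 0) < 0 := by
      by_contra hcon
      have hpos := lt_of_le_of_ne (not_lt.1 hcon)
        (gap_wall_ne_zero hf hs le_rfl (by positivity)).symm
      rw [wallStart_eq_wall hpos] at h1
      rw [wallEnd_eq_wall hpos] at hplt
      linarith
    refine false_of_branch h hℓ hval hp one_ne_zero hmin' true ?_
    filter_upwards [continuous_fst.continuousAt.eventually (gt_mem_nhds hplt)] with q h2 hq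
    have h3 := hmin' q hq
    exact branch_of_nonpos (fun q hq => abs_offset_le h hℓ hval hq) hq
      (gap_nonpos_of_mem hf hs le_rfl (by positivity) hneg ⟨by linarith, le_of_lt h2⟩)

include hf hs in
theorem le_wallStart_last {q : ℝ × ℝ} (hq : q ∈ pathImage ℓ γ) : q.1 ≤ S.wallStart g := by
  by_contra! hlt
  obtain ⟨p, hp, hmax⟩ := h.isCompact_pathImage.exists_isMaxOn ⟨q, hq⟩ continuous_fst.continuousOn
  have hmin' : ∀ q ∈ pathImage ℓ γ, -1 * p.1 ≤ -1 * q.1 := fun q hq => by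
    have : q.1 ≤ p.1 := hmax hq
    linarith
  have hplt : S.wallStart g < p.1 := lt_of_lt_of_le hlt (hmax hq)
  rcases lt_or_ge (S.wallEnd g) p.1 with h1 | h1
  · obtain ⟨pos, hpos⟩ := exists_branch_of_pos hf hs h hℓ hval hp (gap_pos_of_gt hf hs h1) (by
      filter_upwards [lt_mem_nhds h1] with x hx k h0 hk heq
      have h2 := wallEnd_le_wallEnd hf hs h0 hk le_rfl
      have hx' : S.wallEnd g < x := hx
      linarith [S.wall_le_wallEnd k])
    exact false_of_branch h hℓ hval hp (by norm_num) hmin' pos hpos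
  · have hneg : S.gap (S.wall g) < 0 := by
      by_contra hcon
      have hpos := lt_of_le_of_ne (not_lt.1 hcon)
        (gap_wall_ne_zero hf hs (k := g) (by positivity) le_rfl).symm
      rw [wallStart_eq_wall hpos] at hplt
      rw [wallEnd_eq_wall hpos] at h1
      linarith
    refine false_of_branch h hℓ hval hp (by norm_num) hmin' true ?_
    filter_upwards [continuous_fst.continuousAt.eventually (lt_mem_nhds hplt)] with q h2 hq
    have h3 := hmin' q hq
    exact branch_of_nonpos (fun q hq => abs_offset_le h hℓ hval hq) hq
      (gap_nonpos_of_mem hf hs (k := g) (by positivity) le_rfl hneg ⟨le_of_lt h2, by linarith⟩)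

end Core

/-! ### The image of the chain -/

theorem branch_mem_loopPath {X c h v s : ℝ} (hv : 0 ≤ v)
    (hr : S.radius (X + c * h) = v / 2) (hs : s ∈ Icc 0 h) (pos : Bool) :
    S.branch pos (X + c * s) ∈ S.loopPath X c h v '' Icc 0 (2 * h + v) := by
  cases pos
  · exact ⟨s, ⟨hs.1, by linarith [hs.1, hs.2]⟩, loopPath_of_le hv hr hs.2⟩
  · refine ⟨2 * h + v - s, ⟨by linarith [hs.1, hs.2], by linarith [hs.1]⟩, ?_⟩
    rw [loopPath_of_ge hv hr (by linarith [hs.2])]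
    congr 1
    ring

theorem tip_mem_loopPath {X c h v s : ℝ} (hh : 0 < h)
    (hr : S.radius (X + c * h) = v / 2) (hs : |s| ≤ v / 2) :
    (X + c * h, S.center (X + c * h) + s) ∈ S.loopPath X c h v '' Icc 0 (2 * h + v) := by
  obtain ⟨h1, h2⟩ := abs_le.1 hs
  refine ⟨h + v / 2 + s, ⟨by linarith, by linarith⟩, ?_⟩
  rw [loopPath_of_mem hr ⟨by linarith, by linarith⟩]
  congr 1
  ring

include hf hs

omit hf hs in
/-- The walls and the intervals between them cover the range of the chain. -/
theorem exists_slot {n : ℕ} (hn : 1 ≤ n) (hng : n ≤ g) (h0 : S.wallEnd 0 ≤ x)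
    (hx : x ≤ S.wallStart n) : ∃ k : ℤ, 0 ≤ k ∧ k < n ∧
      (x ∈ Icc (S.wallEnd k) (S.wallStart (k + 1)) ∨
        1 ≤ k ∧ x ∈ Icc (S.wallStart k) (S.wallEnd k)) := by
  induction n, hn using Nat.le_induction with
  | base => exact ⟨0, le_rfl, by norm_num, Or.inl ⟨h0, by simpa using hx⟩⟩
  | succ n hn ih =>
    rcases le_or_gt x (S.wallStart n) with h1 | h1
    · obtain ⟨k, h2, h3, h4⟩ := ih (by omega) h1
      exact ⟨k, h2, by push_cast; omega, h4⟩
    · rcases le_or_gt x (S.wallEnd n) with h2 | h2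
      · exact ⟨n, by positivity, by push_cast; omega, Or.inr ⟨by exact_mod_cast hn, h1.le, h2⟩⟩
      · exact ⟨n, by positivity, by push_cast; omega, Or.inl ⟨h2.le, by exact_mod_cast hx⟩⟩

theorem branch_mem_nodePath (h0 : 0 ≤ k) (hk : k ≤ g)
    (hx : x ∈ Icc (S.wallStart k) (S.wallEnd k)) (pos : Bool) :
    S.branch pos x ∈ S.nodePath k '' Icc 0 |S.gap (S.wall k)| := by
  rcases (gap_wall_ne_zero hf hs h0 hk).lt_or_gt with h | h
  · have h1 := hx.2
    rw [wallEnd, halfWidth_of_neg h] at h1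
    have h2 := hx.1
    rw [wallStart, halfWidth_of_neg h] at h2
    refine ⟨(x - S.wallStart k) / 2, ⟨by linarith [hx.1], ?_⟩, ?_⟩
    · rw [abs_of_neg h, wallStart, halfWidth_of_neg h]
      linarith
    · rw [nodePath, if_pos h, branch_eq_of_gap_nonpos (gap_nonpos_of_mem hf hs h0 hk h hx) pos false]
      congr 1
      ring
  · rw [wallStart_eq_wall h, wallEnd_eq_wall h] at hx
    obtain rfl : x = S.wall k := le_antisymm hx.2 hx.1
    cases pos
    · exact ⟨0, left_mem_Icc.2 (abs_nonneg _), by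
        rw [nodePath_zero hf hs h0 hk, wallStart_eq_wall h]⟩
    · exact ⟨_, right_mem_Icc.2 (abs_nonneg _), by
        rw [nodePath_length hf hs h0 hk, wallEnd_eq_wall h]⟩

include hg

theorem branch_mem_chain (h0 : S.wallEnd 0 ≤ x) (hx : x ≤ S.wallStart g) (pos : Bool) :
    S.branch pos x ∈ pathImage (S.stripLength g hg) (S.chainPath g) := by
  obtain ⟨k, hk0, hkg, hk | ⟨hk1, hk⟩⟩ := exists_slot (by omega) le_rfl h0 hx
  · rcases hk0.eq_or_lt with rfl | hk1
    · refine mem_iUnion.2 ⟨.inl false, ?_⟩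
      obtain ⟨h1, h2, h3, h4⟩ := leftLoop_spec hg hf hs
      have := branch_mem_loopPath h2 h3 (s := S.wallStart 1 - x)
        ⟨by
          rw [zero_add] at hk
          linarith [hk.2], by linarith [hk.1]⟩ pos
      rw [← coe_chainLoop_false hg hf hs] at this
      rwa [show S.wallStart 1 + -1 * (S.wallStart 1 - x) = x by ring] at this
    · rcases (show k + 1 ≤ g from hkg).eq_or_lt with hkg' | hkg'
      · refine mem_iUnion.2 ⟨.inl true, ?_⟩
        obtain ⟨h1, h2, h3, h4⟩ := rightLoop_spec hg hf hs
        rw [hkg', show k = g - 1 by omega] at hk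
        have := branch_mem_loopPath h2 h3 (s := x - S.wallEnd (g - 1))
          ⟨by linarith [hk.1], by linarith [hk.2]⟩ pos
        rw [← coe_chainLoop_true hg hf hs] at this
        rwa [show S.wallEnd (g - 1) + 1 * (x - S.wallEnd (g - 1)) = x by ring] at this
      · obtain ⟨n, rfl⟩ : ∃ n : ℕ, k = n + 1 := ⟨(k - 1).toNat, by omega⟩
        set j : Fin (g - 2) := ⟨n, by omega⟩ with hj
        refine mem_iUnion.2 ⟨.inr (.inl (j, pos)), x - S.wallEnd (n + 1), ?_, ?_⟩
        · change _ ∈ Icc 0 (S.chainDouble g j : ℝ)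
          rw [coe_chainDouble hf hs]
          exact ⟨by linarith [hk.1], by linarith [hk.2]⟩
        · change S.branch pos (S.wallEnd (n + 1) + 1 * (x - S.wallEnd (n + 1))) = _
          congr 1
          ring
  · obtain ⟨n, rfl⟩ : ∃ n : ℕ, k = n + 1 := ⟨(k - 1).toNat, by omega⟩
    set i : Fin (g - 1) := ⟨n, by omega⟩ with hi
    refine mem_iUnion.2 ⟨.inr (.inr i), ?_⟩
    change _ ∈ S.nodePath (n + 1) '' Icc 0 (S.chainMiddle g i : ℝ)
    rw [coe_chainMiddle]
    exact branch_mem_nodePath hf hs (by omega) (by omega) hk pos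

theorem wall_mem_chain (h0 : 0 ≤ k) (hk : k ≤ g) (hpos : 0 < S.gap (S.wall k)) {r : ℝ}
    (hr : |r| ≤ S.radius (S.wall k)) :
    (S.wall k, S.center (S.wall k) + r) ∈ pathImage (S.stripLength g hg) (S.chainPath g) := by
  rcases h0.eq_or_lt with rfl | hk1
  · refine mem_iUnion.2 ⟨.inl false, ?_⟩
    obtain ⟨h1, h2, h3, h4⟩ := leftLoop_spec hg hf hs
    have := tip_mem_loopPath h1 h3 (s := r) hr
    rw [← coe_chainLoop_false hg hf hs] at this
    rwa [show S.wallStart 1 + -1 * (S.wallStart 1 - S.wallEnd 0) = S.wall 0 by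
      rw [wallEnd_eq_wall hpos]; ring] at this
  · rcases hk.eq_or_lt with rfl | hkg
    · refine mem_iUnion.2 ⟨.inl true, ?_⟩
      obtain ⟨h1, h2, h3, h4⟩ := rightLoop_spec hg hf hs
      have := tip_mem_loopPath h1 h3 (s := r) hr
      rw [← coe_chainLoop_true hg hf hs] at this
      rwa [show S.wallEnd (g - 1) + 1 * (S.wallStart g - S.wallEnd (g - 1)) = S.wall g by
        rw [wallStart_eq_wall hpos]; ring] at this
    · obtain ⟨n, rfl⟩ : ∃ n : ℕ, k = n + 1 := ⟨(k - 1).toNat, by omega⟩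
      set i : Fin (g - 1) := ⟨n, by omega⟩ with hi
      refine mem_iUnion.2 ⟨.inr (.inr i), r + S.radius (S.wall (n + 1)), ?_, ?_⟩
      · change _ ∈ Icc 0 (S.chainMiddle g i : ℝ)
        rw [coe_chainMiddle, abs_of_pos hpos]
        obtain ⟨h1, h2⟩ := abs_le.1 hr
        have h3 := radius_eq hpos.le
        exact ⟨by linarith, by linarith⟩
      · change S.nodePath (n + 1) _ = _
        rw [nodePath, if_neg hpos.le.not_gt]
        congr 1
        ring

/-- An embedded graph without leaves lies in the image of the chain. -/
theorem pathImage_subset_chain {G : WeightedGraph} {ℓ : G.E → ℝ≥0} {φ : G.V → ℝ × ℝ}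
    {γ : G.E → ℝ → ℝ × ℝ} (h : IsLatticeEmbedding G ℓ (maxCurve S.points S.height) φ γ)
    (hℓ : ∀ e, 0 < ℓ e) (hval : ∀ v, 2 ≤ G.valence v) :
    pathImage ℓ γ ⊆ pathImage (S.stripLength g hg) (S.chainPath g) := by
  intro q hq
  have h1 := wallEnd_zero_le hf hs h hℓ hval hq
  have h2 := le_wallStart_last hf hs h hℓ hval hq
  have h3 := abs_offset_le h hℓ hval hq
  have hbr : |S.offset q| = S.radius q.1 → q ∈ pathImage (S.stripLength g hg) (S.chainPath g) := by
    intro heq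
    rcases abs_cases (S.offset q) with h4 | h4 <;> rw [h4.1] at heq
    · rw [eq_branch_true heq]
      exact branch_mem_chain hg hf hs h1 h2 true
    · rw [eq_branch_false (neg_eq_iff_eq_neg.1 heq)]
      exact branch_mem_chain hg hf hs h1 h2 false
  rcases h3.eq_or_lt with h4 | h4
  · exact hbr h4
  · obtain ⟨k, hk0, hkg, hk⟩ := exists_wall_of_mem_maxCurve hf hs (h.pathImage_subset hq) h4
    have hpos : 0 < S.gap (S.wall k) := by
      by_contra! hcon
      rw [hk, radius_eq_zero hcon] at h4
      exact (abs_nonneg _).not_gt h4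
    rw [hk] at h3
    have := wall_mem_chain hg hf hs hk0 hkg hpos h3
    convert this using 1
    refine Prod.ext hk ?_
    simp only [offset, hk]
    ring

end Strip

/-! ### The chain is the skeleton -/

theorem chainGraph_valence (g : ℕ) (hg : 2 ≤ g) (s : Fin (g - 1) → Bool)
    (v : (chainGraph g hg s).V) : (chainGraph g hg s).valence v = 3 := by
  obtain ⟨o, ho⟩ : ∃ o : (chainGraph g hg s).E × Bool → (chainGraph g hg s).V,
      (chainGraph g hg s).IsOrientation o := by
    have : ∀ e, ∃ o : Bool → (chainGraph g hg s).V,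
        (chainGraph g hg s).ends e = s(o false, o true) := fun e => by
      induction (chainGraph g hg s).ends e using Sym2.ind with
      | _ u v => exact ⟨fun b => if b then v else u, by simp⟩
    choose o ho using this
    exact ⟨fun η => o η.1 η.2, ho⟩
  have h1 : ∀ v, 3 ≤ (chainGraph g hg s).valence v := fun v => by
    have : 2 < 2 * 0 + (chainGraph g hg s).valence v := chainGraph_stable g hg s v
    omega
  have h2 := ho.sum_valence
  have hgen : (∑ v : (chainGraph g hg s).V, 0) + Fintype.card (chainGraph g hg s).E + 1 =
      g + Fintype.card (chainGraph g hg s).V := chainGraph_hasGenus g hg s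
  have hV : Fintype.card (chainGraph g hg s).V = (g - 1) * 2 := by
    change Fintype.card (Fin (g - 1) × Bool) = _
    simp
  -- The count 2 #E = 3 #V leaves no room for a valence above three, as all are at least three.
  have h3 : ∑ v : (chainGraph g hg s).V, 3 = ∑ v, (chainGraph g hg s).valence v := by
    rw [h2, Finset.sum_const, Finset.card_univ, smul_eq_mul]
    rw [Finset.sum_const_zero] at hgen
    omega
  exact ((Finset.sum_eq_sum_iff_of_le fun v _ => h1 v).1 h3 v (Finset.mem_univ v)).symm

namespace Strip

variable {S : Strip} {g : ℕ} (hg : 2 ≤ g) (hf : S.IsFull g) (hs : S.IsSmooth)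

include hf hs

/-- A graph of genus `g` in a full smooth strip is the chain of this strip. -/
theorem mk_eq_chain {G : StableGraph g} {ℓ : G.1.E → ℝ≥0} {φ : G.1.V → ℝ × ℝ}
    {γ : G.1.E → ℝ → ℝ × ℝ} (h : IsLatticeEmbedding G.1 ℓ (maxCurve S.points S.height) φ γ)
    (hw : ∀ v, G.1.weight v = 0) (hℓ : ∀ e, 0 < ℓ e) :
    Moduli.mk G ℓ = Moduli.mk (chainType g hg (S.chainSplit g)) (S.stripLength g hg) := by
  have hval : ∀ v, 3 ≤ G.1.valence v := fun v => by
    have := G.2.2.2 v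
    rw [hw] at this
    omega
  have hgen := G.2.2.1
  have hgen' := chainGraph_hasGenus g hg (S.chainSplit g)
  unfold WeightedGraph.HasGenus at hgen hgen'
  rw [Finset.sum_eq_zero fun v _ => hw v] at hgen
  rw [Finset.sum_eq_zero fun v _ => (rfl : (chainGraph g hg (S.chainSplit g)).weight v = 0)]
    at hgen'
  have hcard : Fintype.card G.1.E + Fintype.card (chainGraph g hg (S.chainSplit g)).V =
      Fintype.card (chainGraph g hg (S.chainSplit g)).E + Fintype.card G.1.V := by omega
  refine Moduli.mk_eq_mk_of_isometric (h.isometric_of_pathImage_subset hℓ hval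
    (isLatticeEmbedding_chain hg hf hs) (stripLength_pos hg hf hs)
    (chainGraph_valence g hg (S.chainSplit g)) hw (fun _ => rfl) hcard
    (pathImage_subset_chain hg hf hs h hℓ fun v => by
      have := hval v
      omega))

end Strip

/-! ### Strictly convex sequences with prescribed values and slopes -/

/-- The sequence `w` up to `a`, continued by a quadratic polynomial. -/
noncomputable def glue (w : ℤ → ℝ) (a : ℤ) (A B : ℝ) (i : ℤ) : ℝ :=
  if i ≤ a then w i else w a + (i - a) * A + (i - a) ^ 2 * B

section Glue

variable {w : ℤ → ℝ} {a i : ℤ} {A B : ℝ}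

theorem glue_of_le (h : i ≤ a) : glue w a A B i = w i := if_pos h

theorem glue_of_ge (h : a ≤ i) : glue w a A B i = w a + (i - a) * A + (i - a) ^ 2 * B := by
  rcases h.eq_or_lt with rfl | h
  · simp [glue]
  · exact if_neg h.not_ge

theorem glue_sub_of_le (h : i ≤ a) : glue w a A B i - glue w a A B (i - 1) = w i - w (i - 1) := by
  rw [glue_of_le h, glue_of_le (by omega)]

theorem glue_sub_of_gt (h : a < i) :
    glue w a A B i - glue w a A B (i - 1) = A + (2 * (i - a) - 1) * B := by
  rw [glue_of_ge h.le, glue_of_ge (by omega)]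
  push_cast
  ring

theorem glue_strict (hw : ∀ i, w i - w (i - 1) < w (i + 1) - w i) (ha : w a - w (a - 1) < A + B)
    (hB : 0 < B) (i : ℤ) :
    glue w a A B i - glue w a A B (i - 1) < glue w a A B (i + 1) - glue w a A B i := by
  have e : glue w a A B (i + 1) - glue w a A B i =
      glue w a A B (i + 1) - glue w a A B (i + 1 - 1) := by rw [add_sub_cancel_right]
  rw [e]
  rcases lt_trichotomy i a with h | rfl | h
  · rw [glue_sub_of_le h.le, glue_sub_of_le (by omega), add_sub_cancel_right]
    exact hw i
  · rw [glue_sub_of_le le_rfl, glue_sub_of_gt (by omega)]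
    push_cast
    linarith
  · rw [glue_sub_of_gt h, glue_sub_of_gt (by omega)]
    push_cast
    linarith

end Glue

/-- At the node `n k` the sequence takes the value `τ k`, with all increments up to the node below
`hi k` and all later ones above `lo k`; so the slopes in the interval from `hi k` to `lo k` support
it there. Between nodes the required secant slope lies strictly between `lo k` and `hi (k + 1)`,
which leaves room for a slightly bent quadratic arc. Consecutive nodes may coincide, with equal
values. -/
theorem exists_convex_interpolation (lo hi τ : ℕ → ℝ) (n : ℕ → ℤ) (m : ℕ)
    (h1 : ∀ k ≤ m, hi k ≤ lo k) (h2 : ∀ k < m, lo k < hi (k + 1)) (h3 : ∀ k < m, n k ≤ n (k + 1))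
    (h4 : ∀ k < m, n k = n (k + 1) → τ k = τ (k + 1))
    (h5 : ∀ k < m, n k < n (k + 1) → ((n (k + 1) : ℝ) - n k) * lo k < τ (k + 1) - τ k ∧
      τ (k + 1) - τ k < ((n (k + 1) : ℝ) - n k) * hi (k + 1)) :
    ∃ w : ℤ → ℝ, (∀ k ≤ m, w (n k) = τ k) ∧ (∀ i, w i - w (i - 1) < w (i + 1) - w i) ∧
      (∀ k ≤ m, ∀ i ≤ n k, w i - w (i - 1) < hi k) ∧
      (∀ k ≤ m, ∀ i, n k < i → lo k < w i - w (i - 1)) := by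
  have hmono : ∀ j ≤ m, ∀ k ≤ j, n k ≤ n j := by
    intro j hj k hk
    induction j, hk using Nat.le_induction with
    | base => exact le_rfl
    | succ j hkj ih => exact (ih (by omega)).trans (h3 j (by omega))
  have hpartial : ∀ j ≤ m, ∃ w : ℤ → ℝ, (∀ k ≤ j, w (n k) = τ k) ∧
      (∀ i, w i - w (i - 1) < w (i + 1) - w i) ∧
      (∀ k ≤ j, ∀ i ≤ n k, w i - w (i - 1) < hi k) ∧
      (∀ k ≤ j, ∀ i, n k < i → i ≤ n j → lo k < w i - w (i - 1)) := by
    intro j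
    induction j with
    | zero =>
      intro _
      refine ⟨fun i => τ 0 + (i - n 0) * (hi 0 - 1) + (i - n 0) * (i - n 0 + 1) / 2, ?_, ?_, ?_, ?_⟩
      · intro k hk
        obtain rfl : k = 0 := by omega
        simp
      · intro i
        push_cast
        nlinarith
      · intro k hk i hik
        obtain rfl : k = 0 := by omega
        have : (i : ℝ) ≤ n 0 := by exact_mod_cast hik
        push_cast
        nlinarith
      · intro k hk i hik hi0
        obtain rfl : k = 0 := by omega
        omega
    | succ j ih =>
      intro hj
      obtain ⟨w, w1, w2, w3, w4⟩ := ih (by omega)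
      have hlast : w (n j) - w (n j - 1) < hi (j + 1) :=
        (w3 j le_rfl _ le_rfl).trans_le ((h1 j (by omega)).trans (h2 j (by omega)).le)
      have hle : ∀ i ≤ n j, w i - w (i - 1) < hi (j + 1) := fun i hi' =>
        (w3 j le_rfl i hi').trans_le ((h1 j (by omega)).trans (h2 j (by omega)).le)
      rcases (h3 j (by omega)).eq_or_lt with heq | hlt
      · refine ⟨w, fun k hk => ?_, w2, fun k hk i hik => ?_, fun k hk i hik hij => ?_⟩
        · rcases (show k ≤ j ∨ k = j + 1 by omega) with h | rfl
          · exact w1 k h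
          · rw [← heq, w1 j le_rfl]
            exact h4 j (by omega) heq
        · rcases (show k ≤ j ∨ k = j + 1 by omega) with h | rfl
          · exact w3 k h i hik
          · exact hle i (by omega)
        · rcases (show k ≤ j ∨ k = j + 1 by omega) with h | rfl
          · exact w4 k h i hik (by omega)
          · omega
      · obtain ⟨a1, a2⟩ := h5 j (by omega) hlt
        have hN : (0 : ℝ) < n (j + 1) - n j := by
          have : (n j : ℝ) < n (j + 1) := by exact_mod_cast hlt
          linarith
        set N : ℝ := n (j + 1) - n j with hNdef
        set s : ℝ := (τ (j + 1) - τ j) / N with hs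
        have hsN : s * N = τ (j + 1) - τ j := div_mul_cancel₀ _ hN.ne'
        have b1 : lo j < s := by
          rw [hs, lt_div_iff₀ hN]
          linarith
        have b2 : s < hi (j + 1) := by
          rw [hs, div_lt_iff₀ hN]
          linarith
        obtain ⟨δ, hδ, c1, c2⟩ : ∃ δ : ℝ, 0 < δ ∧ N * δ ≤ s - lo j ∧ N * δ ≤ hi (j + 1) - s := by
          refine ⟨min (s - lo j) (hi (j + 1) - s) / N, div_pos (lt_min (by linarith) (by linarith)) hN,
            ?_, ?_⟩ <;> rw [mul_div_cancel₀ _ hN.ne']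
          · exact min_le_left _ _
          · exact min_le_right _ _
        have hsub : ∀ i, n j < i → i ≤ n (j + 1) →
            lo j < glue w (n j) (s - δ * N) δ i - glue w (n j) (s - δ * N) δ (i - 1) ∧
            glue w (n j) (s - δ * N) δ i - glue w (n j) (s - δ * N) δ (i - 1) < hi (j + 1) := by
          intro i i1 i2
          rw [glue_sub_of_gt i1]
          have e1 : (n j : ℝ) + 1 ≤ i := by exact_mod_cast i1
          have e2 : (i : ℝ) ≤ n (j + 1) := by exact_mod_cast i2
          constructor <;> nlinarith
        refine ⟨glue w (n j) (s - δ * N) δ, fun k hk => ?_, glue_strict w2 ?_ hδ,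
          fun k hk i hik => ?_, fun k hk i hik hij => ?_⟩
        · rcases (show k ≤ j ∨ k = j + 1 by omega) with h | rfl
          · rw [glue_of_le (hmono j (by omega) k h)]
            exact w1 k h
          · rw [glue_of_ge hlt.le, w1 j le_rfl, ← hNdef]
            linear_combination hsN
        · have := (w3 j le_rfl _ le_rfl).trans_le (h1 j (by omega))
          nlinarith
        · rcases (show k ≤ j ∨ k = j + 1 by omega) with h | rfl
          · rw [glue_sub_of_le (hik.trans (hmono j (by omega) k h))]
            exact w3 k h i hik
          · rcases le_or_gt i (n j) with h | h
            · rw [glue_sub_of_le h]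
              exact hle i h
            · exact (hsub i h hik).2
        · rcases (show k ≤ j ∨ k = j + 1 by omega) with h | rfl
          · rcases le_or_gt i (n j) with h' | h'
            · rw [glue_sub_of_le h']
              exact w4 k h i hik h'
            · refine lt_of_le_of_lt ?_ (hsub i h' hij).1
              clear hsub
              have hlo : ∀ l, k ≤ l → l ≤ j → lo k ≤ lo l := by
                intro l hkl hl
                induction l, hkl using Nat.le_induction with
                | base => exact le_rfl
                | succ l hkl ih =>
                  exact (ih (by omega)).trans ((h2 l (by omega)).le.trans (h1 (l + 1) (by omega)))
              exact hlo j h le_rfl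
          · omega
  obtain ⟨w, w1, w2, w3, w4⟩ := hpartial m le_rfl
  have hlast := (w3 m le_rfl _ le_rfl).trans_le (h1 m le_rfl)
  -- Beyond the last node any steep quadratic will do; its increments all exceed `lo m`.
  refine ⟨glue w (n m) (lo m + 1) 1, fun k hk => ?_, glue_strict w2 (by linarith) one_pos,
    fun k hk i hik => ?_, fun k hk i hik => ?_⟩
  · rw [glue_of_le (hmono m le_rfl k hk)]
    exact w1 k hk
  · rw [glue_sub_of_le (hik.trans (hmono m le_rfl k hk))]
    exact w3 k hk i hik
  · rcases le_or_gt i (n m) with h' | h'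
    · rw [glue_sub_of_le h']
      exact w4 k hk i hik h'
    · rw [glue_sub_of_gt h']
      have hlo : ∀ l, k ≤ l → l ≤ m → lo k ≤ lo l := by
        intro l hkl hl
        induction l, hkl using Nat.le_induction with
        | base => exact le_rfl
        | succ l hkl ih =>
          exact (ih (by omega)).trans ((h2 l (by omega)).le.trans (h1 (l + 1) (by omega)))
      have e1 := hlo m hk le_rfl
      have e2 : (n m : ℝ) + 1 ≤ i := by exact_mod_cast h'
      linarith

/-! ### Strips of the hyperelliptic triangle -/

namespace Strip

/-- The points of the hyperelliptic triangle, with heights `c` on the middle row and `w` on the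
lower row. -/
noncomputable def triangle (g : ℕ) (c w : ℤ → ℝ) : Strip where
  upper := {0}
  middle := Finset.Icc 0 ((g : ℤ) + 1)
  lower := Finset.Icc 0 (2 * (g : ℤ) + 2)
  upper_nonempty := Finset.singleton_nonempty 0
  middle_nonempty := Finset.nonempty_Icc.2 (by positivity)
  lower_nonempty := Finset.nonempty_Icc.2 (by positivity)
  height a := if a.2 = 1 then 0 else if a.2 = 0 then c a.1 else w a.1

variable {g : ℕ} {c w : ℤ → ℝ} {x : ℝ} {i k : ℤ}

theorem triangle_isFull (g : ℕ) (c w : ℤ → ℝ) : (triangle g c w).IsFull g where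
  middle_eq := rfl
  nonneg t ht b hb := by
    have h1 := Finset.mem_singleton.1 ht
    have h2 := Finset.mem_Icc.1 hb
    omega
  le t ht b hb := by
    have h1 := Finset.mem_singleton.1 ht
    have h2 := Finset.mem_Icc.1 hb
    omega

theorem triangle_wall (g : ℕ) (c w : ℤ → ℝ) (k : ℤ) : (triangle g c w).wall k = c (k + 1) - c k := by
  simp [wall, triangle]

theorem triangle_argUp (x : ℝ) : (triangle g c w).argUp x = {0} := by
  obtain ⟨t, ht⟩ := (triangle g c w).exists_argUp x
  have h : ∀ s ∈ (triangle g c w).argUp x, s = 0 := fun s hs => Finset.mem_singleton.1 hs.1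
  rw [← h t ht]
  exact Subsingleton.eq_singleton_of_mem (fun a ha b hb => (h a ha).trans (h b hb).symm) ht

theorem triangle_up (x : ℝ) : (triangle g c w).up x = 0 := by
  have h : (0 : ℤ) ∈ (triangle g c w).argUp x := by simp [triangle_argUp]
  rw [up_eq h]
  simp [triangle]

theorem triangle_low (h : i ∈ (triangle g c w).argLow x) :
    (triangle g c w).low x = i * x - w i := by
  rw [low_eq h]
  simp [triangle]

theorem triangle_mid (h : k ∈ (triangle g c w).argMid x) :
    (triangle g c w).mid x = k * x - c k := by
  rw [mid_eq h]
  simp [triangle]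

theorem triangle_mem_lower : i ∈ (triangle g c w).lower ↔ 0 ≤ i ∧ i ≤ 2 * g + 2 := Finset.mem_Icc

theorem triangle_mem_middle : k ∈ (triangle g c w).middle ↔ 0 ≤ k ∧ k ≤ g + 1 := Finset.mem_Icc

theorem triangle_le_low (h : 0 ≤ i ∧ i ≤ 2 * g + 2) (x : ℝ) :
    i * x - w i ≤ (triangle g c w).low x := by
  have h1 : i * x - (triangle g c w).height (i, -1) ≤ (triangle g c w).low x :=
    le_rowMax (u := fun i => (triangle g c w).height (i, -1)) (triangle_mem_lower.2 h) x
  rwa [show (triangle g c w).height (i, -1) = w i by simp [triangle]] at h1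

theorem triangle_le_mid (h : 0 ≤ k ∧ k ≤ g + 1) (x : ℝ) :
    k * x - c k ≤ (triangle g c w).mid x := by
  have h1 := le_mid (S := triangle g c w) (triangle_mem_middle.2 h) x
  rwa [show (triangle g c w).height (k, 0) = c k by simp [triangle]] at h1

theorem triangle_le_of_argLow (h : i ∈ (triangle g c w).argLow x) (h0 : 1 ≤ i) :
    w i - w (i - 1) ≤ x := by
  have h1 := triangle_mem_lower.1 h.1
  have h2 := triangle_le_low (c := c) (w := w) (i := i - 1) (g := g) ⟨by omega, by omega⟩ x
  rw [triangle_low h] at h2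
  push_cast at h2
  linarith

theorem le_triangle_of_argLow (h : i ∈ (triangle g c w).argLow x) (h0 : i + 1 ≤ 2 * g + 2) :
    x ≤ w (i + 1) - w i := by
  have h1 := triangle_mem_lower.1 h.1
  have h2 := triangle_le_low (c := c) (w := w) (i := i + 1) (g := g) ⟨by omega, by omega⟩ x
  rw [triangle_low h] at h2
  push_cast at h2
  linarith

theorem triangle_le_of_argMid (h : k ∈ (triangle g c w).argMid x) (h0 : 1 ≤ k) :
    c k - c (k - 1) ≤ x := by
  have h1 := triangle_mem_middle.1 h.1
  have h2 := triangle_le_mid (c := c) (w := w) (k := k - 1) (g := g) ⟨by omega, by omega⟩ x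
  rw [triangle_mid h] at h2
  push_cast at h2
  linarith

theorem le_triangle_of_argMid (h : k ∈ (triangle g c w).argMid x) (h0 : k + 1 ≤ g + 1) :
    x ≤ c (k + 1) - c k := by
  have h1 := triangle_mem_middle.1 h.1
  have h2 := triangle_le_mid (c := c) (w := w) (k := k + 1) (g := g) ⟨by omega, by omega⟩ x
  rw [triangle_mid h] at h2
  push_cast at h2
  linarith

end Strip

/-! ### Triangular strips with prescribed walls and gaps -/

namespace Strip

/-- Heights `c` of the middle row, the gaps `v` at the walls and the slopes `n` of the sum of the
outer rows at the walls, such that they can be realized by a smooth strip. -/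
structure IsProfile (g : ℕ) (c v : ℤ → ℝ) (n : ℤ → ℤ) : Prop where
  sep : ∀ k : ℤ, 0 ≤ k → k < g →
    c (k + 1) - c k + max 0 (-v k) < c (k + 1 + 1) - c (k + 1) - max 0 (-v (k + 1))
  ne : ∀ k : ℤ, 0 ≤ k → k ≤ g → v k ≠ 0
  odd : ∀ k : ℤ, 0 ≤ k → k ≤ g → v k < 0 → n k = 2 * k + 1
  nonneg : 0 ≤ n 0
  le : n g ≤ 2 * g + 2
  mono : ∀ k : ℤ, 0 ≤ k → k < g → n k ≤ n (k + 1)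

/-- The constant term of the sum of the outer rows at a wall. -/
def tangent (c v : ℤ → ℝ) (n : ℤ → ℤ) (k : ℤ) : ℝ :=
  v k + n k * (c (k + 1) - c k) - 2 * (k * (c (k + 1) - c k) - c k)

/-- Heights `w` on the lower row that realize the profile. -/
structure IsProfileRow (g : ℕ) (c v : ℤ → ℝ) (n : ℤ → ℤ) (w : ℤ → ℝ) : Prop where
  value : ∀ k : ℤ, 0 ≤ k → k ≤ g → w (n k) = tangent c v n k
  strict : ∀ i, w i - w (i - 1) < w (i + 1) - w i
  lt : ∀ k : ℤ, 0 ≤ k → k ≤ g → ∀ i ≤ n k, w i - w (i - 1) < c (k + 1) - c k - max 0 (-v k)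
  gt : ∀ k : ℤ, 0 ≤ k → k ≤ g → ∀ i, n k < i → c (k + 1) - c k + max 0 (-v k) < w i - w (i - 1)

variable {g : ℕ} {c v w : ℤ → ℝ} {n : ℤ → ℤ}

theorem IsProfile.exists_row (hp : IsProfile g c v n)
    (heq : ∀ k : ℤ, 0 ≤ k → k < g → n k = n (k + 1) → tangent c v n k = tangent c v n (k + 1))
    (hlt : ∀ k : ℤ, 0 ≤ k → k < g → n k < n (k + 1) →
      ((n (k + 1) : ℝ) - n k) * (c (k + 1) - c k + max 0 (-v k)) <
        tangent c v n (k + 1) - tangent c v n k ∧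
      tangent c v n (k + 1) - tangent c v n k <
        ((n (k + 1) : ℝ) - n k) * (c (k + 1 + 1) - c (k + 1) - max 0 (-v (k + 1)))) :
    ∃ w, IsProfileRow g c v n w := by
  have cast : ∀ k : ℕ, ((k + 1 : ℕ) : ℤ) = (k : ℤ) + 1 := fun k => by push_cast; rfl
  obtain ⟨w, h1, h2, h3, h4⟩ := exists_convex_interpolation
    (fun k => c (k + 1) - c k + max 0 (-v k)) (fun k => c (k + 1) - c k - max 0 (-v k))
    (fun k => tangent c v n k) (fun k => n k) g
    (fun k _ => by
      have := le_max_left 0 (-v k)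
      linarith)
    (fun k hk => by
      have := hp.sep k (by positivity) (by exact_mod_cast hk)
      simpa only [cast] using this)
    (fun k hk => by
      have := hp.mono k (by positivity) (by exact_mod_cast hk)
      simpa only [cast] using this)
    (fun k hk => by
      have := heq k (by positivity) (by exact_mod_cast hk)
      simpa only [cast] using this)
    (fun k hk => by
      have := hlt k (by positivity) (by exact_mod_cast hk)
      simpa only [cast] using this)
  refine ⟨w, fun k h0 hk => ?_, h2, fun k h0 hk i hi => ?_, fun k h0 hk i hi => ?_⟩
  · lift k to ℕ using h0
    exact h1 k (by exact_mod_cast hk)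
  · lift k to ℕ using h0
    exact h3 k (by exact_mod_cast hk) i hi
  · lift k to ℕ using h0
    exact h4 k (by exact_mod_cast hk) i hi

section Smooth

variable (hp : IsProfile g c v n) (hw : IsProfileRow g c v n w) {x : ℝ} {i j k : ℤ}

theorem IsProfileRow.strictMono (hw : IsProfileRow g c v n w) :
    StrictMono fun i => w i - w (i - 1) :=
  strictMono_int_of_lt_succ fun i => by
    rw [add_sub_cancel_right]
    exact hw.strict i

include hp in
theorem IsProfile.lt_of_lt (h0 : 0 ≤ j) (hjk : j < k) (hk : k ≤ g) :
    c (j + 1) - c j + max 0 (-v j) < c (k + 1) - c k - max 0 (-v k) := by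
  induction k, (show j + 1 ≤ k from hjk) using Int.leInduction with
  | base => exact hp.sep j h0 (by omega)
  | succ k hk' ih =>
    have h1 := ih hk' (by omega)
    have h2 := hp.sep k (by omega) (by omega)
    have h3 := le_max_left 0 (-v k)
    linarith

include hp in
theorem IsProfile.wall_lt (h0 : 0 ≤ j) (hjk : j < k) (hk : k ≤ g) :
    c (j + 1) - c j < c (k + 1) - c k := by
  have h1 := hp.lt_of_lt h0 hjk hk
  have h2 := le_max_left 0 (-v k)
  have h3 := le_max_left 0 (-v j)
  linarith

include hp in
theorem IsProfile.mid_consecutive (hi : i ∈ (triangle g c w).argMid x)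
    (hj : j ∈ (triangle g c w).argMid x) (hij : i < j) : j = i + 1 ∧ x = c (i + 1) - c i := by
  have b1 := triangle_mem_middle.1 hi.1
  have b2 := triangle_mem_middle.1 hj.1
  have h1 := le_triangle_of_argMid hi (by omega)
  have h2 := triangle_le_of_argMid hj (by omega)
  obtain rfl : j = i + 1 := by
    by_contra hne
    have h3 := hp.wall_lt (j := i) (k := j - 1) (by omega) (by omega) (by omega)
    rw [sub_add_cancel] at h3
    linarith
  rw [add_sub_cancel_right] at h2
  exact ⟨rfl, le_antisymm h1 h2⟩

include hp in
theorem IsProfile.mem_mid (hk : 0 ≤ k ∧ k ≤ g + 1) (h1 : 1 ≤ k → c k - c (k - 1) ≤ x)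
    (h2 : k ≤ g → x ≤ c (k + 1) - c k) : k ∈ (triangle g c w).argMid x := by
  obtain ⟨i, hi⟩ := (triangle g c w).exists_argMid x
  have b1 := triangle_mem_middle.1 hi.1
  have hmid := triangle_mid hi
  have hheight : (triangle g c w).height (k, 0) = c k := by simp [triangle]
  refine ⟨triangle_mem_middle.2 hk, ?_⟩
  change (k : ℝ) * x - (triangle g c w).height (k, 0) = (triangle g c w).mid x
  rw [hheight, hmid]
  rcases lt_trichotomy i k with h | rfl | h
  · have h3 := le_triangle_of_argMid hi (by omega)
    have h4 := h1 (by omega)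
    obtain rfl : k = i + 1 := by
      by_contra hne
      have h3 := hp.wall_lt (j := i) (k := k - 1) (by omega) (by omega) (by omega)
      rw [sub_add_cancel] at h3
      linarith
    rw [add_sub_cancel_right] at h4
    push_cast
    linarith
  · rfl
  · have h3 := triangle_le_of_argMid hi (by omega)
    have h4 := h2 (by omega)
    obtain rfl : i = k + 1 := by
      by_contra hne
      have h3 := hp.wall_lt (j := k) (k := i - 1) (by omega) (by omega) (by omega)
      rw [sub_add_cancel] at h3
      linarith
    rw [add_sub_cancel_right] at h3
    push_cast
    linarith

include hw in
theorem IsProfileRow.low_consecutive (hi : i ∈ (triangle g c w).argLow x)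
    (hj : j ∈ (triangle g c w).argLow x) (hij : i < j) : j = i + 1 := by
  have b1 := triangle_mem_lower.1 hi.1
  have b2 := triangle_mem_lower.1 hj.1
  have h1 := le_triangle_of_argLow hi (by omega)
  have h2 := triangle_le_of_argLow hj (by omega)
  by_contra hne
  have h3 := hw.strictMono (show i + 1 < j by omega)
  simp only [add_sub_cancel_right] at h3
  linarith

-- Up to the index `n k` all increments of `w` are below this interval, and after it they are above.
-- So the maximal slope is `n k` alone.
include hp hw in
theorem IsProfileRow.low_eq (h0 : 0 ≤ k) (hk : k ≤ g) (h1 : c (k + 1) - c k - max 0 (-v k) ≤ x)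
    (h2 : x ≤ c (k + 1) - c k + max 0 (-v k)) : (triangle g c w).argLow x = {n k} := by
  have key : ∀ i ∈ (triangle g c w).argLow x, i = n k := by
    intro i hi
    have b := triangle_mem_lower.1 hi.1
    have hn : 0 ≤ n k ∧ n k ≤ 2 * g + 2 := by
      have hmono : ∀ j, 0 ≤ j → j ≤ k → n j ≤ n k := fun j hj hjk => by
        clear h1 h2
        induction k, hjk using Int.leInduction with
        | base => exact le_rfl
        | succ k hk' ih => exact (ih (by omega) (by omega)).trans (hp.mono k (by omega) (by omega))
      have hmono' : ∀ j, k ≤ j → j ≤ g → n k ≤ n j := fun j hjk hj => by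
        induction j, hjk using Int.leInduction with
        | base => exact le_rfl
        | succ j hk' ih => exact (ih (by omega)).trans (hp.mono j (by omega) (by omega))
      exact ⟨hp.nonneg.trans (hmono 0 le_rfl h0), (hmono' g hk le_rfl).trans hp.le⟩
    rcases lt_trichotomy i (n k) with h | h | h
    · have h3 := le_triangle_of_argLow hi (by omega)
      have h4 := hw.lt k h0 hk (i + 1) (by omega)
      rw [add_sub_cancel_right] at h4
      linarith
    · exact h
    · have h3 := triangle_le_of_argLow hi (by omega)
      have h4 := hw.gt k h0 hk i h
      linarith
  obtain ⟨i, hi⟩ := (triangle g c w).exists_argLow x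
  rw [← key i hi]
  exact Subsingleton.eq_singleton_of_mem (fun a ha b hb => (key a ha).trans (key b hb).symm) hi

theorem triangle_gap (hk : k ∈ (triangle g c w).argMid x) (hi : i ∈ (triangle g c w).argLow x) :
    (triangle g c w).gap x = 2 * (k * x - c k) - (i * x - w i) := by
  rw [gap, triangle_up, triangle_low hi, triangle_mid hk, sub_zero]

include hp in
theorem IsProfile.wall_mem (h0 : 0 ≤ k) (hk : k ≤ g) :
    k ∈ (triangle g c w).argMid (c (k + 1) - c k) ∧
    k + 1 ∈ (triangle g c w).argMid (c (k + 1) - c k) := by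
  refine ⟨hp.mem_mid ⟨h0, by omega⟩ (fun h => ?_) fun _ => le_rfl,
    hp.mem_mid ⟨by omega, by omega⟩ (fun _ => ?_) fun h => ?_⟩
  · have := hp.wall_lt (j := k - 1) (k := k) (by omega) (by omega) hk
    rw [sub_add_cancel] at this
    exact this.le
  · rw [add_sub_cancel_right]
  · exact (hp.wall_lt h0 (by omega) h).le

include hp hw in
theorem IsProfileRow.gap_wall (h0 : 0 ≤ k) (hk : k ≤ g) :
    (triangle g c w).gap (c (k + 1) - c k) = v k := by
  have he := le_max_left 0 (-v k)
  have h1 := hw.low_eq hp h0 hk (x := c (k + 1) - c k) (by linarith) (by linarith)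
  rw [triangle_gap (hp.wall_mem h0 hk).1 (i := n k) (by rw [h1]; rfl), hw.value k h0 hk, tangent]
  ring

include hp hw in
/-- The gap where it is at most zero. -/
theorem IsProfileRow.gap_eq (h0 : 0 ≤ k) (hk : k ≤ g) (h1 : c (k + 1) - c k - max 0 (-v k) ≤ x)
    (h2 : x ≤ c (k + 1) - c k + max 0 (-v k)) :
    (triangle g c w).gap x = |x - (c (k + 1) - c k)| + v k := by
  rcases (hp.ne k h0 hk).lt_or_gt with hv | hv
  · have hlow := hw.low_eq hp h0 hk h1 h2
    have hmem : n k ∈ (triangle g c w).argLow x := by rw [hlow]; rfl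
    have hval := hw.value k h0 hk
    have hodd : (n k : ℝ) = 2 * k + 1 := by exact_mod_cast hp.odd k h0 hk hv
    rw [tangent] at hval
    rcases le_total x (c (k + 1) - c k) with h | h
    · have hm : k ∈ (triangle g c w).argMid x := hp.mem_mid ⟨h0, by omega⟩ (fun h' => by
        have h3 := hp.lt_of_lt (j := k - 1) (k := k) (by omega) (by omega) hk
        rw [sub_add_cancel] at h3
        linarith [le_max_left 0 (-v (k - 1))]) fun _ => h
      rw [triangle_gap hm hmem, hval, abs_of_nonpos (by linarith), hodd]
      ring
    · have hm : k + 1 ∈ (triangle g c w).argMid x := hp.mem_mid ⟨by omega, by omega⟩ (fun h' => by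
        rwa [add_sub_cancel_right]) fun h' => by
          have h3 := hp.lt_of_lt (j := k) (k := k + 1) h0 (by omega) h'
          linarith [le_max_left 0 (-v (k + 1))]
      rw [triangle_gap hm hmem, hval, abs_of_nonneg (by linarith), hodd]
      push_cast
      ring
  · rw [max_eq_left (by linarith), sub_zero] at h1
    rw [max_eq_left (by linarith), add_zero] at h2
    rw [le_antisymm h2 h1, hw.gap_wall hp h0 hk]
    simp

include hp hw in
theorem IsProfileRow.gap_start (h0 : 0 ≤ k) (hk : k ≤ g) :
    (triangle g c w).gap (c (k + 1) - c k - max 0 (-v k)) = max 0 (v k) := by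
  have he := le_max_left 0 (-v k)
  rw [hw.gap_eq hp h0 hk le_rfl (by linarith), sub_sub_cancel_left, abs_neg, abs_of_nonneg he]
  rcases le_total 0 (v k) with h | h
  · rw [max_eq_left (by linarith), max_eq_right h, zero_add]
  · rw [max_eq_right (by linarith), max_eq_left h]
    ring

include hp hw in
theorem IsProfileRow.gap_end (h0 : 0 ≤ k) (hk : k ≤ g) :
    (triangle g c w).gap (c (k + 1) - c k + max 0 (-v k)) = max 0 (v k) := by
  have he := le_max_left 0 (-v k)
  rw [hw.gap_eq hp h0 hk (by linarith) le_rfl, add_sub_cancel_left, abs_of_nonneg he]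
  rcases le_total 0 (v k) with h | h
  · rw [max_eq_left (by linarith), max_eq_right h, zero_add]
  · rw [max_eq_right (by linarith), max_eq_left h]
    ring

/-- A linear function bounds the gap from above. -/
theorem gap_le_linear (hk : k ∈ (triangle g c w).argMid x) (hi : 0 ≤ i ∧ i ≤ 2 * g + 2) :
    (triangle g c w).gap x ≤ 2 * (k * x - c k) - (i * x - w i) := by
  rw [gap, triangle_up, triangle_mid hk, sub_zero]
  linarith [triangle_le_low (c := c) (w := w) hi x]

theorem mem_argLow_of_linear (hk : k ∈ (triangle g c w).argMid x) (hi : 0 ≤ i ∧ i ≤ 2 * g + 2)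
    (h : 2 * (k * x - c k) - (i * x - w i) ≤ (triangle g c w).gap x) :
    i ∈ (triangle g c w).argLow x := by
  have h1 := triangle_le_low (c := c) (w := w) hi x
  rw [gap, triangle_up, triangle_mid hk, sub_zero] at h
  refine ⟨triangle_mem_lower.2 hi, ?_⟩
  change (i : ℝ) * x - (triangle g c w).height (i, -1) = (triangle g c w).low x
  rw [show (triangle g c w).height (i, -1) = w i by simp [triangle]]
  linarith

-- Between two wall intervals the middle row is affine, so the gap is concave there and bounded
-- above by an affine function that touches it at x. At both ends the gap is at least zero. A
-- nonpositive value in between would force this function to be constant and zero, and the lower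
-- slope to be 2(k + 1); but then this even slope is maximal at an end of negative wall gap, where
-- the only maximal slope is odd. Left of all walls and right of them the argument is the same, with
-- extreme slopes 0 and 2g + 2.
include hp hw in
theorem IsProfileRow.exists_wall_of_gap_nonpos (hx : (triangle g c w).gap x ≤ 0) :
    ∃ k : ℤ, 0 ≤ k ∧ k ≤ g ∧ v k < 0 ∧ c (k + 1) - c k - max 0 (-v k) ≤ x ∧
      x ≤ c (k + 1) - c k + max 0 (-v k) := by
  obtain ⟨i, hi⟩ := (triangle g c w).exists_argLow x
  have hib := triangle_mem_lower.1 hi.1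
  have inside : ∀ k : ℤ, 0 ≤ k → k ≤ g → c (k + 1) - c k - max 0 (-v k) ≤ x →
      x ≤ c (k + 1) - c k + max 0 (-v k) → v k < 0 := by
    intro k h0 hk h1 h2
    by_contra hv
    have := hw.gap_eq hp h0 hk h1 h2
    have h3 := lt_of_le_of_ne (not_lt.1 hv) (hp.ne k h0 hk).symm
    linarith [abs_nonneg (x - (c (k + 1) - c k))]
  -- between two consecutive walls the gap is positive
  have between : ∀ k : ℤ, 0 ≤ k → k < g → c (k + 1) - c k + max 0 (-v k) < x →
      x < c (k + 1 + 1) - c (k + 1) - max 0 (-v (k + 1)) → False := by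
    intro k h0 hk h1 h2
    have e1 := le_max_left 0 (-v k)
    have e2 := le_max_left 0 (-v (k + 1))
    have hm : ∀ y, c (k + 1) - c k + max 0 (-v k) ≤ y →
        y ≤ c (k + 1 + 1) - c (k + 1) - max 0 (-v (k + 1)) → k + 1 ∈ (triangle g c w).argMid y :=
      fun y h3 h4 => hp.mem_mid ⟨by omega, by omega⟩ (fun _ => by
        rw [add_sub_cancel_right]
        linarith) fun _ => by linarith
    have hgap := triangle_gap (hm x h1.le h2.le) hi
    have m1 := hm _ le_rfl (h1.trans h2).le
    have l1 := gap_le_linear m1 hib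
    have l2 := gap_le_linear (hm _ (h1.trans h2).le le_rfl) hib
    have g1 := hw.gap_end hp h0 hk.le
    have g2 := hw.gap_start hp (k := k + 1) (by omega) (by omega)
    have p1 := le_max_left 0 (v k)
    have p2 := le_max_left 0 (v (k + 1))
    rw [g1] at l1
    rw [g2] at l2
    push_cast at hgap l1 l2
    rcases lt_trichotomy i (2 * (k + 1)) with h | h | h
    · have h' : (i : ℝ) + 1 ≤ 2 * (k + 1) := by exact_mod_cast h
      nlinarith
    · have h' : (i : ℝ) = 2 * (k + 1) := by exact_mod_cast h
      rw [h'] at hgap l1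
      -- Slope zero: the touching function is constant, so the slope `i` is already maximal at the
      -- end of wall `k`.
      have hmem := mem_argLow_of_linear m1 hib (by
        rw [g1, h']
        push_cast
        linarith)
      rw [hw.low_eq hp h0 hk.le (by linarith) le_rfl, mem_singleton_iff] at hmem
      have hv : v k < 0 := by
        by_contra hv
        have h3 := lt_of_le_of_ne (not_lt.1 hv) (hp.ne k h0 hk.le).symm
        rw [max_eq_right h3.le] at l1
        linarith
      have := hp.odd k h0 hk.le hv
      omega
    · have h' : 2 * ((k : ℝ) + 1) + 1 ≤ i := by exact_mod_cast h
      nlinarith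
  have left : x < c (0 + 1) - c 0 - max 0 (-v 0) → False := by
    intro h1
    have hg0 : (0 : ℤ) ≤ g := by positivity
    have e1 := le_max_left 0 (-v 0)
    have hm : ∀ y, y ≤ c (0 + 1) - c 0 - max 0 (-v 0) → 0 ∈ (triangle g c w).argMid y :=
      fun y h3 => hp.mem_mid ⟨le_rfl, by omega⟩ (fun h => by omega) fun _ => by linarith
    have hgap := triangle_gap (hm x h1.le) hi
    have l1 := gap_le_linear (hm _ le_rfl) hib
    have g1 := hw.gap_start hp le_rfl hg0
    have p1 := le_max_left 0 (v 0)
    rw [g1] at l1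
    push_cast at hgap l1
    rcases hib.1.eq_or_lt with h | h
    · have hmem := mem_argLow_of_linear (hm _ le_rfl) hib (by
        rw [g1, ← h]
        rw [← h] at hgap l1
        push_cast at hgap l1 ⊢
        linarith)
      rw [hw.low_eq hp le_rfl hg0 le_rfl (by linarith), mem_singleton_iff] at hmem
      have hv : v 0 < 0 := by
        by_contra hv
        have h3 := lt_of_le_of_ne (not_lt.1 hv) (hp.ne 0 le_rfl hg0).symm
        rw [max_eq_right h3.le] at l1
        rw [← h] at hgap l1
        push_cast at hgap l1
        linarith
      have := hp.odd 0 le_rfl hg0 hv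
      omega
    · have h' : (1 : ℝ) ≤ i := by exact_mod_cast h
      rw [zero_add] at h1
      nlinarith
  have right : c (g + 1) - c g + max 0 (-v g) < x → False := by
    intro h1
    have hg0 : (0 : ℤ) ≤ g := by positivity
    have e1 := le_max_left 0 (-v g)
    have hm : ∀ y, c (g + 1) - c g + max 0 (-v g) ≤ y → (g : ℤ) + 1 ∈ (triangle g c w).argMid y :=
      fun y h3 => hp.mem_mid ⟨by omega, le_rfl⟩ (fun h => by
        rw [add_sub_cancel_right]
        linarith) fun _ => by omega
    have hgap := triangle_gap (hm x h1.le) hi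
    have l1 := gap_le_linear (hm _ le_rfl) hib
    have g1 := hw.gap_end hp hg0 le_rfl
    have p1 := le_max_left 0 (v g)
    rw [g1] at l1
    push_cast at hgap l1
    rcases hib.2.eq_or_lt with h | h
    · have h' : (i : ℝ) = 2 * g + 2 := by exact_mod_cast h
      have hmem := mem_argLow_of_linear (hm _ le_rfl) hib (by
        rw [g1, h']
        rw [h'] at hgap l1
        push_cast at hgap l1 ⊢
        linarith)
      rw [hw.low_eq hp hg0 le_rfl (by linarith) le_rfl, mem_singleton_iff] at hmem
      have hv : v g < 0 := by
        by_contra hv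
        have h3 := lt_of_le_of_ne (not_lt.1 hv) (hp.ne g hg0 le_rfl).symm
        rw [max_eq_right h3.le] at l1
        rw [h'] at hgap l1
        linarith
      have := hp.odd g hg0 le_rfl hv
      omega
    · have h' : (i : ℝ) + 1 ≤ 2 * g + 2 := by exact_mod_cast h
      nlinarith
  have climb : ∀ m : ℕ, m ≤ g → x ≤ c (m + 1) - c m + max 0 (-v m) → ∃ k : ℤ, 0 ≤ k ∧ k ≤ g ∧
      c (k + 1) - c k - max 0 (-v k) ≤ x ∧ x ≤ c (k + 1) - c k + max 0 (-v k) := by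
    intro m
    induction m with
    | zero =>
      intro _ h
      refine ⟨0, le_rfl, by positivity, ?_, by simpa using h⟩
      by_contra! h'
      exact left h'
    | succ m ih =>
      intro hm h
      rcases le_or_gt x (c (m + 1) - c m + max 0 (-v m)) with h1 | h1
      · exact ih (by omega) h1
      · push_cast at h
        refine ⟨m + 1, by positivity, by exact_mod_cast hm, ?_, h⟩
        by_contra! h2
        exact between m (by positivity) (by exact_mod_cast hm) h1 h2
  obtain ⟨k, h0, hk, h1, h2⟩ := climb g le_rfl (by
    by_contra! h
    exact right h)
  exact ⟨k, h0, hk, inside k h0 hk h1 h2, h1, h2⟩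

end Smooth

/-- A cell with a nondegenerate triangle that is contained in a unimodular triangle is equal to
it. -/
theorem eq_of_subset_unimodular {C : Set (ℤ × ℤ)} {p q r : ℤ × ℤ} (hC : C ⊆ {p, q, r})
    (harea : |doubleArea p q r| = 1)
    (h : ∃ a ∈ C, ∃ b ∈ C, ∃ d ∈ C, doubleArea a b d ≠ 0) :
    ∃ a b d : ℤ × ℤ, C = {a, b, d} ∧ |doubleArea a b d| = 1 := by
  refine ⟨p, q, r, Subset.antisymm hC ?_, harea⟩
  obtain ⟨a, ha, b, hb, d, hd, hne⟩ := h
  have z1 : ∀ a b : ℤ × ℤ, doubleArea a a b = 0 := doubleArea_self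
  have z2 : ∀ a b : ℤ × ℤ, doubleArea a b a = 0 := fun a b => by
    unfold doubleArea
    ring
  have z3 : ∀ a b : ℤ × ℤ, doubleArea a b b = 0 := fun a b => by
    unfold doubleArea
    ring
  rcases hC ha with rfl | rfl | rfl <;> rcases hC hb with rfl | rfl | rfl <;>
    rcases hC hd with rfl | rfl | rfl <;>
    first
    | exact absurd (z1 _ _) hne
    | exact absurd (z2 _ _) hne
    | exact absurd (z3 _ _) hne
    | (rintro s (rfl | rfl | rfl) <;> assumption)

theorem exists_subset_pair {A : Set ℤ} (hne : A.Nonempty)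
    (h : ∀ i ∈ A, ∀ j ∈ A, i < j → j = i + 1) : ∃ i, A ⊆ {i, i + 1} := by
  obtain ⟨i, hi⟩ := hne
  by_cases h' : i - 1 ∈ A
  · refine ⟨i - 1, fun j hj => ?_⟩
    rcases lt_trichotomy (i - 1) j with hlt | rfl | hlt
    · exact Or.inr (h _ h' _ hj hlt)
    · exact Or.inl rfl
    · have := h _ hj _ h' hlt
      have := h _ hj _ hi (by omega)
      omega
  · refine ⟨i, fun j hj => ?_⟩
    rcases lt_trichotomy i j with hlt | rfl | hlt
    · exact Or.inr (h _ hi _ hj hlt)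
    · exact Or.inl rfl
    · have := h _ hj _ hi hlt
      obtain rfl : j = i - 1 := by omega
      exact absurd hj h'

/-- Where the gap is positive, a cell meets at most one outer row besides the middle row. The rows
have at most two maximal points, consecutive ones, and at a wall the lower row has only one, so the
cell lies in a unimodular triangle. Where the gap is at most zero, x lies around a wall k with lower
slope 2k + 1, and the middle point is k or k + 1, which again gives doubled area 1 with the single
upper point. -/
theorem IsProfileRow.isSmooth (hp : IsProfile g c v n) (hw : IsProfileRow g c v n w) :
    (triangle g c w).IsSmooth := by
  rintro ⟨x, y⟩ htri
  set S := triangle g c w with hS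
  have cases : ∀ a ∈ maxCell S.points S.height (x, y),
      (a = (0, 1) ∧ S.mid x ≤ S.up x + y) ∨
      (a.2 = 0 ∧ a.1 ∈ S.argMid x ∧ S.up x + y ≤ S.mid x ∧ S.low x - y ≤ S.mid x) ∨
      (a.2 = -1 ∧ a.1 ∈ S.argLow x ∧ S.mid x ≤ S.low x - y) := by
    intro a ha
    rcases mem_maxCell_iff.1 ha with ⟨h1, h2, h3, -⟩ | h | ⟨h1, h2, -, h3⟩
    · rw [hS, triangle_argUp, mem_singleton_iff] at h2
      exact Or.inl ⟨Prod.ext h2 h1, h3⟩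
    · exact Or.inr (Or.inl h)
    · exact Or.inr (Or.inr ⟨h1, h2, h3⟩)
  have area1 : ∀ i j : ℤ, |doubleArea (i, 0) (i + 1, 0) (j, 1)| = 1 := fun i j => by
    simp [doubleArea]
  have area2 : ∀ i j : ℤ, |doubleArea (i, 0) (i + 1, 0) (j, -1)| = 1 := fun i j => by
    simp [doubleArea]
  have area3 : ∀ i j : ℤ, |doubleArea (i, -1) (i + 1, -1) (j, 0)| = 1 := fun i j => by
    simp [doubleArea]
  rcases lt_or_ge 0 (S.gap x) with hgap | hgap
  · rw [gap] at hgap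
    by_cases hlow : S.mid x ≤ S.low x - y
    · -- the upper row is not involved
      by_cases hmid : (S.argMid x).Subsingleton
      · obtain ⟨k, hk⟩ := S.exists_argMid x
        obtain ⟨i, hi⟩ := exists_subset_pair (S.exists_argLow x)
          fun i hi j hj => hw.low_consecutive hi hj
        refine eq_of_subset_unimodular (fun a ha => ?_) (area3 i k) htri
        rcases cases a ha with ⟨-, h1⟩ | ⟨h1, h2, -⟩ | ⟨h1, h2, -⟩
        · linarith
        · exact Or.inr (Or.inr (Prod.ext (hmid h2 hk) h1))
        · rcases hi h2 with h3 | h3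
          · exact Or.inl (Prod.ext h3 h1)
          · exact Or.inr (Or.inl (Prod.ext h3 h1))
      · obtain ⟨k, hk, k', hk', hne⟩ := not_subsingleton_iff.1 hmid
        obtain ⟨i, hi0, hig, hix⟩ : ∃ i : ℤ, 0 ≤ i ∧ i ≤ g ∧ x = c (i + 1) - c i := by
          have b1 := triangle_mem_middle.1 hk.1
          have b2 := triangle_mem_middle.1 hk'.1
          rcases lt_or_gt_of_ne hne with h | h
          · exact ⟨k, b1.1, by omega, (hp.mid_consecutive hk hk' h).2⟩
          · exact ⟨k', b2.1, by omega, (hp.mid_consecutive hk' hk h).2⟩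
        have he := le_max_left 0 (-v i)
        have hlow1 := hw.low_eq hp hi0 hig (x := x) (by linarith) (by linarith)
        obtain ⟨j, hj⟩ := exists_subset_pair (S.exists_argMid x)
          fun i hi j hj h => (hp.mid_consecutive hi hj h).1
        refine eq_of_subset_unimodular (fun a ha => ?_) (area2 j (n i)) htri
        rcases cases a ha with ⟨-, h1⟩ | ⟨h1, h2, -⟩ | ⟨h1, h2, -⟩
        · linarith
        · rcases hj h2 with h3 | h3
          · exact Or.inl (Prod.ext h3 h1)
          · exact Or.inr (Or.inl (Prod.ext h3 h1))
        · rw [hS, hlow1, mem_singleton_iff] at h2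
          exact Or.inr (Or.inr (Prod.ext h2 h1))
    · obtain ⟨j, hj⟩ := exists_subset_pair (S.exists_argMid x)
        fun i hi j hj h => (hp.mid_consecutive hi hj h).1
      refine eq_of_subset_unimodular (fun a ha => ?_) (area1 j 0) htri
      rcases cases a ha with ⟨h1, -⟩ | ⟨h1, h2, -⟩ | ⟨-, -, h1⟩
      · exact Or.inr (Or.inr h1)
      · rcases hj h2 with h3 | h3
        · exact Or.inl (Prod.ext h3 h1)
        · exact Or.inr (Or.inl (Prod.ext h3 h1))
      · exact absurd h1 hlow
  · obtain ⟨k, h0, hk, hv, h1, h2⟩ := hw.exists_wall_of_gap_nonpos hp hgap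
    have hlow := hw.low_eq hp h0 hk h1 h2
    have hodd := hp.odd k h0 hk hv
    obtain ⟨k', hk'⟩ := S.exists_argMid x
    have b := triangle_mem_middle.1 hk'.1
    have hkk : k' = k ∨ k' = k + 1 := by
      by_contra! hcon
      rcases lt_or_gt_of_ne hcon.1 with h | h
      · have h3 := le_triangle_of_argMid hk' (by omega)
        have h4 := hp.lt_of_lt b.1 h hk
        linarith [le_max_left 0 (-v k')]
      · have h3 := triangle_le_of_argMid hk' (by omega)
        have h4 := hp.lt_of_lt (j := k) (k := k' - 1) h0 (by omega) (by omega)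
        rw [sub_add_cancel] at h4
        linarith [le_max_left 0 (-v (k' - 1))]
    have harea : |doubleArea (0, 1) (k', 0) (n k, -1)| = 1 := by
      rw [hodd]
      rcases hkk with rfl | rfl <;> simp [doubleArea] <;> ring_nf <;> norm_num
    refine eq_of_subset_unimodular (fun a ha => ?_) harea htri
    rcases cases a ha with ⟨h3, -⟩ | ⟨h3, h4, h5, h6⟩ | ⟨h3, h4, -⟩
    · exact Or.inl h3
    · refine Or.inr (Or.inl (Prod.ext ?_ h3))
      by_contra hne
      -- A second middle point would put `x` on a wall, and a middle point in the cell makes the gap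
      -- at least zero; so the gap would vanish at a wall.
      have hx : ∃ i : ℤ, 0 ≤ i ∧ i ≤ g ∧ x = c (i + 1) - c i := by
        have b' := triangle_mem_middle.1 h4.1
        rcases lt_or_gt_of_ne hne with h | h
        · exact ⟨_, b'.1, by simp only at h; omega, (hp.mid_consecutive h4 hk' h).2⟩
        · exact ⟨_, b.1, by simp only at h; omega, (hp.mid_consecutive hk' h4 h).2⟩
      obtain ⟨i, hi0, hig, hix⟩ := hx
      have hgi := hw.gap_wall hp hi0 hig
      rw [← hix] at hgi
      have : 0 ≤ S.gap x := by
        rw [gap]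
        linarith
      have h7 := hp.ne i hi0 hig
      have h8 : S.gap x = 0 := le_antisymm hgap this
      exact h7 (by rw [← hgi]; exact h8)
    · rw [hS, hlow, mem_singleton_iff] at h4
      exact Or.inr (Or.inr (Prod.ext h4 h3))

end Strip

/-! ### Replacing a strip by one of the triangle, and realizing chains -/

namespace Strip

variable {S S' : Strip} {g : ℕ} {x : ℝ} {t b k : ℤ}

theorem up_gt_of_notMem (ht : t ∈ S.upper) (h : t ∉ S.argUp x) :
    t * x - S.height (t, 1) < S.up x :=
  lt_of_le_of_ne (le_rowMax (u := fun i => S.height (i, 1)) ht x) fun h' => h ⟨ht, h'⟩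

theorem low_gt_of_notMem (hb : b ∈ S.lower) (h : b ∉ S.argLow x) :
    b * x - S.height (b, -1) < S.low x :=
  lt_of_le_of_ne (le_rowMax (u := fun i => S.height (i, -1)) hb x) fun h' => h ⟨hb, h'⟩

/-- Strips with the same walls and the same gaps at the walls define the same chain. -/
theorem mk_chain_congr (hg : 2 ≤ g) (hw : ∀ k : ℤ, 0 ≤ k → k ≤ g → S.wall k = S'.wall k)
    (hgap : ∀ k : ℤ, 0 ≤ k → k ≤ g → S.gap (S.wall k) = S'.gap (S'.wall k)) :
    Moduli.mk (chainType g hg (S.chainSplit g)) (S.stripLength g hg) =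
      Moduli.mk (chainType g hg (S'.chainSplit g)) (S'.stripLength g hg) := by
  have h1 : ∀ k : ℤ, 0 ≤ k → k ≤ g → S.wallStart k = S'.wallStart k := fun k h0 hk => by
    rw [wallStart, wallStart, halfWidth, halfWidth, hgap k h0 hk, hw k h0 hk]
  have h2 : ∀ k : ℤ, 0 ≤ k → k ≤ g → S.wallEnd k = S'.wallEnd k := fun k h0 hk => by
    rw [wallEnd, wallEnd, halfWidth, halfWidth, hgap k h0 hk, hw k h0 hk]
  have e1 : S.chainSplit g = S'.chainSplit g := funext fun k => by
    have := k.2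
    rw [chainSplit, chainSplit, hgap _ (by omega) (by omega)]
  have e2 : S.chainLoop g = S'.chainLoop g := funext fun pos => by
    rw [chainLoop, chainLoop, h1 g (by omega) (by omega), h2 (g - 1) (by omega) (by omega),
      hgap g (by omega) (by omega), h1 1 (by omega) (by omega), h2 0 (by omega) (by omega),
      hgap 0 (by omega) (by omega)]
  have e3 : S.chainDouble g = S'.chainDouble g := funext fun j => by
    have := j.2
    rw [chainDouble, chainDouble, h1 _ (by omega) (by omega), h2 _ (by omega) (by omega)]
  have e4 : S.chainMiddle g = S'.chainMiddle g := funext fun k => by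
    have := k.2
    rw [chainMiddle, chainMiddle, hgap _ (by omega) (by omega)]
  unfold stripLength
  rw [e1, e2, e3, e4]

/-- The chain of a smooth strip is also the chain of a smooth strip of the triangle. -/
theorem exists_triangle (hf : S.IsFull g) (hs : S.IsSmooth) : ∃ c w : ℤ → ℝ,
    (triangle g c w).IsSmooth ∧ ∀ k : ℤ, 0 ≤ k → k ≤ g → (triangle g c w).wall k = S.wall k ∧
      (triangle g c w).gap (S.wall k) = S.gap (S.wall k) := by
  have key : ∀ k : ℤ, ∃ t b : ℤ, 0 ≤ k → k ≤ g →
      (∀ y ∈ Icc (S.wallStart k) (S.wallEnd k), S.argUp y = {t} ∧ S.argLow y = {b}) ∧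
      (S.gap (S.wall k) < 0 → t + b = 2 * k + 1) := fun k => by
    by_cases h : 0 ≤ k ∧ k ≤ g
    · obtain ⟨t, b, h'⟩ := exists_arg_eq_singleton hf hs h.1 h.2
      exact ⟨t, b, fun _ _ => h'⟩
    · exact ⟨0, 0, fun h1 h2 => absurd ⟨h1, h2⟩ h⟩
  choose t b htb using key
  set c : ℤ → ℝ := fun i => S.height (i, 0) with hc
  set v : ℤ → ℝ := fun k => S.gap (S.wall k) with hv
  -- Only up + low enters the gap. Its slope at wall `k` is t + b, and the triangle has to carry
  -- this slope in its lower row alone, its upper row being a single point.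
  set n : ℤ → ℤ := fun k => t k + b k with hn
  have hwall : ∀ k, c (k + 1) - c k = S.wall k := fun k => rfl
  have hst : ∀ k, c (k + 1) - c k - max 0 (-v k) = S.wallStart k := fun k => rfl
  have hen : ∀ k, c (k + 1) - c k + max 0 (-v k) = S.wallEnd k := fun k => rfl
  have mw : ∀ k, S.wall k ∈ Icc (S.wallStart k) (S.wallEnd k) := fun k =>
    ⟨S.wallStart_le_wall k, S.wall_le_wallEnd k⟩
  have ms : ∀ k, S.wallStart k ∈ Icc (S.wallStart k) (S.wallEnd k) := fun k =>
    left_mem_Icc.2 ((mw k).1.trans (mw k).2)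
  have me : ∀ k, S.wallEnd k ∈ Icc (S.wallStart k) (S.wallEnd k) := fun k =>
    right_mem_Icc.2 ((mw k).1.trans (mw k).2)
  have htmem : ∀ k : ℤ, 0 ≤ k → k ≤ g → ∀ y ∈ Icc (S.wallStart k) (S.wallEnd k),
      t k ∈ S.argUp y := fun k h0 hk y hy => by
    rw [((htb k h0 hk).1 y hy).1]
    rfl
  have hbmem : ∀ k : ℤ, 0 ≤ k → k ≤ g → ∀ y ∈ Icc (S.wallStart k) (S.wallEnd k),
      b k ∈ S.argLow y := fun k h0 hk y hy => by
    rw [((htb k h0 hk).1 y hy).2]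
    rfl
  have htan : ∀ k : ℤ, 0 ≤ k → k ≤ g →
      tangent c v n k = S.height (t k, 1) + S.height (b k, -1) := fun k h0 hk => by
    have e1 := up_eq (htmem k h0 hk _ (mw k))
    have e2 := low_eq (hbmem k h0 hk _ (mw k))
    have e3 := mid_eq (mem_argMid_wall hf hs h0 hk).1
    rw [tangent, hwall]
    simp only [hv, hc, hn]
    rw [gap, e1, e2, e3]
    push_cast
    ring
  have htmono : ∀ k : ℤ, 0 ≤ k → k < g → t k ≤ t (k + 1) ∧ b k ≤ b (k + 1) := fun k h0 hk => by
    have h := wallEnd_lt_wallStart hf hs h0 (lt_add_one k) hk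
    exact ⟨rowArg_mono (htmem k h0 hk.le _ (me k)) (htmem (k + 1) (by omega) hk _ (ms (k + 1))) h,
      rowArg_mono (hbmem k h0 hk.le _ (me k)) (hbmem (k + 1) (by omega) hk _ (ms (k + 1))) h⟩
  have hp : IsProfile g c v n := by
    refine ⟨fun k h0 hk => ?_, fun k h0 hk => gap_wall_ne_zero hf hs h0 hk,
      fun k h0 hk h => (htb k h0 hk).2 h, ?_, ?_, fun k h0 hk => ?_⟩
    · exact wallEnd_lt_wallStart hf hs h0 (lt_add_one k) hk
    · exact hf.nonneg _ (htmem 0 le_rfl (by positivity) _ (mw 0)).1 _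
        (hbmem 0 le_rfl (by positivity) _ (mw 0)).1
    · exact hf.le _ (htmem g (by positivity) le_rfl _ (mw g)).1 _
        (hbmem g (by positivity) le_rfl _ (mw g)).1
    · have := htmono k h0 hk
      simp only [hn]
      omega
  -- Both t and b increase from wall to wall. If their sum stays the same, both do, and so does the
  -- tangent of up + low. Otherwise one of them changes; as the maximal points are unique at the
  -- walls' ends, the comparison of the tangents of the convex function up + low is strict at both
  -- ends.
  obtain ⟨w, hw⟩ := hp.exists_row (fun k h0 hk heq => by
    have h1 := htmono k h0 hk
    simp only [hn] at heq
    rw [htan k h0 hk.le, htan (k + 1) (by omega) hk, show t (k + 1) = t k by omega,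
      show b (k + 1) = b k by omega]) (fun k h0 hk hlt => by
    have h1 := htmono k h0 hk
    rw [htan k h0 hk.le, htan (k + 1) (by omega) hk, hen, hst]
    have u1 := htmem k h0 hk.le _ (me k)
    have u2 := htmem (k + 1) (by omega) hk _ (ms (k + 1))
    have l1 := hbmem k h0 hk.le _ (me k)
    have l2 := hbmem (k + 1) (by omega) hk _ (ms (k + 1))
    have e1 := up_eq u1
    have e2 := up_eq u2
    have e3 := low_eq l1
    have e4 := low_eq l2
    have d1 := le_rowMax (u := fun i => S.height (i, 1)) u2.1 (S.wallEnd k)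
    have d2 := le_rowMax (u := fun i => S.height (i, 1)) u1.1 (S.wallStart (k + 1))
    have d3 := le_rowMax (u := fun i => S.height (i, -1)) l2.1 (S.wallEnd k)
    have d4 := le_rowMax (u := fun i => S.height (i, -1)) l1.1 (S.wallStart (k + 1))
    change _ ≤ S.up _ at d1 d2
    change _ ≤ S.low _ at d3 d4
    simp only [hn] at hlt ⊢
    push_cast
    rcases h1.1.lt_or_eq with ht | ht
    · have f1 := up_gt_of_notMem (x := S.wallEnd k) u2.1 (by
        rw [((htb k h0 hk.le).1 _ (me k)).1, mem_singleton_iff]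
        omega)
      have f2 := up_gt_of_notMem (x := S.wallStart (k + 1)) u1.1 (by
        rw [((htb (k + 1) (by omega) hk).1 _ (ms (k + 1))).1, mem_singleton_iff]
        omega)
      constructor <;> nlinarith
    · have f1 := low_gt_of_notMem (x := S.wallEnd k) l2.1 (by
        rw [((htb k h0 hk.le).1 _ (me k)).2, mem_singleton_iff]
        omega)
      have f2 := low_gt_of_notMem (x := S.wallStart (k + 1)) l1.1 (by
        rw [((htb (k + 1) (by omega) hk).1 _ (ms (k + 1))).2, mem_singleton_iff]
        omega)
      constructor <;> nlinarith)
  refine ⟨c, w, hw.isSmooth hp, fun k h0 hk => ⟨?_, ?_⟩⟩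
  · rw [triangle_wall]
    rfl
  · exact hw.gap_wall hp h0 hk

/-- Every chain with bridges between its cycles is the chain of a smooth strip of the triangle. -/
theorem exists_triangle_of_chain (hg : 2 ≤ g) (a : Bool → ℝ≥0) (d : Fin (g - 2) → ℝ≥0)
    (m : Fin (g - 1) → ℝ≥0) (ha : ∀ b, 0 < a b) (hd : ∀ j, 0 < d j) (hm : ∀ k, 0 < m k) :
    ∃ c w : ℤ → ℝ, (triangle g c w).IsSmooth ∧
      Moduli.mk (chainType g hg ((triangle g c w).chainSplit g)) ((triangle g c w).stripLength g hg) =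
      Moduli.mk (chainType g hg fun _ => true) (chainLength g hg (fun _ => true) a d m) := by
  -- Minus the gaps at the walls, equal to the bridge lengths. The outer walls 0 and g carry no edge
  -- of the chain, and their value 1 is arbitrary.
  set e : ℕ → ℝ := fun k => if h : 1 ≤ k ∧ k - 1 < g - 1 then m ⟨k - 1, h.2⟩ else 1 with he
  -- The widths of the cycles. A loop has two strands, so its width is half its length.
  set ω : ℕ → ℝ := fun k => if k = 0 then a false / 2 else
    if h : k - 1 < g - 2 then d ⟨k - 1, h⟩ else a true / 2 with hω
  have epos : ∀ k, 0 < e k := fun k => by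
    simp only [he]
    split_ifs
    · exact_mod_cast hm _
    · exact one_pos
  have ωpos : ∀ k, 0 < ω k := fun k => by
    simp only [hω]
    have h1 : (0 : ℝ) < a false := by exact_mod_cast ha false
    have h2 : (0 : ℝ) < a true := by exact_mod_cast ha true
    split_ifs
    · linarith
    · exact_mod_cast hd _
    · linarith
  -- Consecutive walls are separated by half a valley, the width of a cycle and half the next
  -- valley.
  set z : ℕ → ℝ := fun k => ∑ j ∈ Finset.range k, (e j + ω j + e (j + 1)) with hz
  set c : ℤ → ℝ := fun i => ∑ j ∈ Finset.range i.toNat, z j with hc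
  set v : ℤ → ℝ := fun k => -e k.toNat with hv
  set n : ℤ → ℤ := fun k => 2 * k + 1 with hn
  have hcz : ∀ k : ℕ, c (k + 1) - c k = z k := fun k => by
    simp only [hc]
    rw [show ((k : ℤ) + 1).toNat = k + 1 by omega, Int.toNat_natCast, Finset.sum_range_succ]
    ring
  have hzs : ∀ k : ℕ, z (k + 1) = z k + (e k + ω k + e (k + 1)) := fun k =>
    Finset.sum_range_succ _ k
  have hvn : ∀ k : ℕ, v k = -e k := fun k => by simp only [hv, Int.toNat_natCast]
  have hmax : ∀ k : ℕ, max 0 (-v k) = e k := fun k => by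
    rw [hvn, neg_neg, max_eq_right (epos k).le]
  have hp : IsProfile g c v n := by
    refine ⟨fun k h0 hk => ?_, fun k h0 hk => ?_, fun k h0 hk _ => rfl, ?_, ?_, fun k h0 hk => ?_⟩
    · lift k to ℕ using h0
      have h1 := hcz (k + 1)
      have h2 := hmax (k + 1)
      push_cast at h1 h2
      rw [hcz, hmax, h1, h2, hzs]
      linarith [ωpos k]
    · exact (neg_lt_zero.2 (epos _)).ne
    · simp [hn]
    · simp only [hn]
      omega
    · simp only [hn]
      omega
  have htan : ∀ k : ℕ, tangent c v n k = z k - e k + 2 * c k := fun k => by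
    rw [tangent, hcz, hvn]
    simp only [hn]
    push_cast
    ring
  obtain ⟨w, hw⟩ := hp.exists_row (fun k h0 hk h => by simp only [hn] at h; omega)
    (fun k h0 hk _ => by
      lift k to ℕ using h0
      have h1 := hcz (k + 1)
      have h2 := hmax (k + 1)
      have h3 := htan (k + 1)
      push_cast at h1 h2 h3
      rw [hcz, hmax, h1, h2, h3, htan, hzs]
      have h4 := hcz k
      have h5 : ((n (k + 1) : ℤ) : ℝ) - (n k : ℤ) = 2 := by
        simp only [hn]
        push_cast
        ring
      rw [h5]
      constructor <;> linarith [ωpos k])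
  refine ⟨c, w, hw.isSmooth hp, ?_⟩
  set T := triangle g c w with hT
  have gw : ∀ k : ℕ, T.wall k = z k := fun k => (triangle_wall g c w k).trans (hcz k)
  have gg : ∀ k : ℕ, k ≤ g → T.gap (T.wall k) = -e k := fun k hk => by
    rw [hT, triangle_wall, hw.gap_wall hp (by positivity) (by exact_mod_cast hk), hvn]
  have gh : ∀ k : ℕ, k ≤ g → T.halfWidth k = e k := fun k hk => by
    rw [halfWidth, gg k hk, neg_neg, max_eq_right (epos k).le]
  have gs : ∀ k : ℕ, k ≤ g → T.wallStart k = z k - e k := fun k hk => by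
    rw [wallStart, gw, gh k hk]
  have ge : ∀ k : ℕ, k ≤ g → T.wallEnd k = z k + e k := fun k hk => by
    rw [wallEnd, gw, gh k hk]
  have e1 : T.chainSplit g = fun _ => true := funext fun k => by
    have h1 := gg (k.1 + 1) (by have := k.2; omega)
    push_cast at h1
    rw [chainSplit, h1]
    exact decide_eq_true (neg_lt_zero.2 (epos _))
  have e2 : T.chainLoop g = a := funext fun pos => by
    cases pos
    · have h1 := gs 1 (by omega)
      have h2 := ge 0 (by omega)
      have h3 := gg 0 (by omega)
      have h4 := hzs 0
      push_cast at h1 h2 h3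
      rw [chainLoop, if_neg (by decide), h1, h2, h3, max_eq_left (neg_lt_zero.2 (epos 0)).le]
      rw [zero_add] at h4
      have h5 : ω 0 = a false / 2 := by simp [hω]
      rw [h4, h5]
      refine Eq.trans (congrArg _ ?_) (Real.toNNReal_coe (r := a false))
      ring
    · obtain ⟨i, rfl⟩ : ∃ i, g = i + 2 := ⟨g - 2, by omega⟩
      have h1 := gs (i + 2) (by omega)
      have h2 := ge (i + 1) (by omega)
      have h3 := gg (i + 2) (by omega)
      have h4 := hzs (i + 1)
      rw [chainLoop, if_pos rfl, h1, show ((i + 2 : ℕ) : ℤ) - 1 = (i + 1 : ℕ) by push_cast; ring, h2,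
        h3, max_eq_left (neg_lt_zero.2 (epos _)).le]
      have h5 : ω (i + 1) = a true / 2 := by simp [hω]
      rw [show i + 2 = i + 1 + 1 from rfl, h4, h5]
      refine Eq.trans (congrArg _ ?_) (Real.toNNReal_coe (r := a true))
      ring
  have e3 : T.chainDouble g = d := funext fun j => by
    have hj := j.2
    have h1 := gs (j.1 + 1 + 1) (by omega)
    have h2 := ge (j.1 + 1) (by omega)
    have h4 := hzs (j.1 + 1)
    have h5 : ω (j.1 + 1) = d j := by simp [hω]
    push_cast at h1 h2
    rw [chainDouble, h1, h2, h4, h5]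
    refine Eq.trans (congrArg _ ?_) (Real.toNNReal_coe (r := d j))
    ring
  have e4 : T.chainMiddle g = m := funext fun k => by
    have hk := k.2
    have h1 := gg (k.1 + 1) (by omega)
    have h5 : e (k.1 + 1) = m k := by simp [he]
    push_cast at h1
    rw [chainMiddle, h1, abs_neg, abs_of_pos (epos _), h5]
    exact Real.toNNReal_coe
  unfold stripLength
  rw [e1, e2, e3, e4]

end Strip

/-! ### Unimodular changes of coordinates -/

/-- A unimodular linear map sends primitive velocities to primitive velocities, so the same lengths
work. -/
theorem IsLatticeEmbedding.map {G : WeightedGraph} {ℓ : G.E → ℝ≥0} {C C' : Set (ℝ × ℝ)}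
    {φ : G.V → ℝ × ℝ} {γ : G.E → ℝ → ℝ × ℝ} (h : IsLatticeEmbedding G ℓ C φ γ) {a b c d : ℤ}
    (hdet : a * d - b * c = 1) {L : ℝ × ℝ → ℝ × ℝ}
    (hL : ∀ q, L q = (a * q.1 + b * q.2, c * q.1 + d * q.2)) (hC : ∀ q ∈ C, L q ∈ C') :
    IsLatticeEmbedding G ℓ C' (fun v => L (φ v)) (fun e t => L (γ e t)) := by
  have hdet' : (a : ℝ) * d - b * c = 1 := by exact_mod_cast hdet
  have hinj : Function.Injective L := by
    intro q q' heq
    rw [hL, hL, Prod.mk.injEq] at heq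
    obtain ⟨h1, h2⟩ := heq
    refine Prod.ext ?_ ?_
    · linear_combination d * h1 - b * h2 - (q.1 - q'.1) * hdet'
    · linear_combination a * h2 - c * h1 - (q.2 - q'.2) * hdet'
  have hcont : Continuous L := by
    rw [show L = fun q : ℝ × ℝ => ((a : ℝ) * q.1 + b * q.2, c * q.1 + d * q.2) from funext hL]
    fun_prop
  refine ⟨fun v => hC _ (h.vertex_mem v), fun e t ht => hC _ (h.path_mem e t ht),
    fun e => hcont.comp_continuousOn (h.continuousOn e), fun e => ?_,
    fun u v huv => h.vertex_injective (hinj huv),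
    fun e e' t ht t' ht' heq => h.path_injective e e' t ht t' ht' (hinj heq),
    fun e v t ht heq => h.path_ne_vertex e v t ht (hinj heq), fun e => ?_⟩
  · rw [show (fun v => L (φ v)) = L ∘ φ from rfl, ← Sym2.map_map, h.ends_eq, Sym2.map_mk]
  · obtain ⟨F, hF⟩ := h.velocity e
    refine ⟨F, fun t ht htF => ?_⟩
    obtain ⟨p, q, ⟨u, v, huv⟩, hd⟩ := hF t ht htF
    -- Bézout coefficients of the image vector, obtained by the inverse matrix acting on the old
    -- ones.
    refine ⟨a * p + b * q, c * p + d * q, ⟨u * d - v * c, v * a - u * b, ?_⟩, ?_⟩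
    · linear_combination (a * d - b * c) * huv + hdet
    · have h1 : HasDerivAt (fun t => (γ e t).1) (p : ℝ) t :=
        (hasFDerivAt_fst (𝕜 := ℝ) (p := γ e t)).comp_hasDerivAt t hd
      have h2 : HasDerivAt (fun t => (γ e t).2) (q : ℝ) t :=
        (hasFDerivAt_snd (𝕜 := ℝ) (p := γ e t)).comp_hasDerivAt t hd
      have h3 := ((h1.const_mul (a : ℝ)).add (h2.const_mul (b : ℝ))).prodMk
        ((h1.const_mul (c : ℝ)).add (h2.const_mul (d : ℝ)))
      push_cast
      refine h3.congr_of_eventuallyEq (Eventually.of_forall fun t => ?_)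
      exact hL _

/-- An affine automorphism of the lattice that preserves the orientation. -/
structure UnimodularMap where
  a : ℤ
  b : ℤ
  c : ℤ
  d : ℤ
  p : ℤ
  q : ℤ
  det : a * d - b * c = 1

namespace UnimodularMap

variable (U : UnimodularMap)

def onLattice (x : ℤ × ℤ) : ℤ × ℤ := (U.a * x.1 + U.b * x.2 + U.p, U.c * x.1 + U.d * x.2 + U.q)

def inverse (x : ℤ × ℤ) : ℤ × ℤ :=
  (U.d * (x.1 - U.p) - U.b * (x.2 - U.q), U.a * (x.2 - U.q) - U.c * (x.1 - U.p))

theorem onLattice_inverse (x : ℤ × ℤ) : U.onLattice (U.inverse x) = x := by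
  have h := U.det
  refine Prod.ext ?_ ?_ <;> simp only [onLattice, inverse]
  · linear_combination (x.1 - U.p) * h
  · linear_combination (x.2 - U.q) * h

theorem inverse_onLattice (x : ℤ × ℤ) : U.inverse (U.onLattice x) = x := by
  have h := U.det
  refine Prod.ext ?_ ?_ <;> simp only [onLattice, inverse]
  · linear_combination x.1 * h
  · linear_combination x.2 * h

theorem injective : Function.Injective U.onLattice :=
  Function.LeftInverse.injective U.inverse_onLattice

theorem surjective : Function.Surjective U.onLattice :=
  Function.RightInverse.surjective U.onLattice_inverse

theorem doubleArea_onLattice (x y z : ℤ × ℤ) :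
    doubleArea (U.onLattice x) (U.onLattice y) (U.onLattice z) = doubleArea x y z := by
  simp only [doubleArea, onLattice]
  linear_combination ((y.1 - x.1) * (z.2 - x.2) - (z.1 - x.1) * (y.2 - x.2)) * U.det

/-- The action on the dual plane, composed with the change from the minimum to the maximum
convention. -/
def dual (w : ℝ × ℝ) : ℝ × ℝ := (((-U.d : ℤ) : ℝ) * w.1 + U.c * w.2, U.b * w.1 + ((-U.a : ℤ) : ℝ) * w.2)

def dualInverse (w : ℝ × ℝ) : ℝ × ℝ :=
  (((-U.a : ℤ) : ℝ) * w.1 + ((-U.c : ℤ) : ℝ) * w.2, ((-U.b : ℤ) : ℝ) * w.1 + ((-U.d : ℤ) : ℝ) * w.2)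

theorem dualInverse_dual (w : ℝ × ℝ) : U.dualInverse (U.dual w) = w := by
  have h : (U.a : ℝ) * U.d - U.b * U.c = 1 := by exact_mod_cast U.det
  refine Prod.ext ?_ ?_ <;> simp only [dual, dualInverse] <;> push_cast
  · linear_combination w.1 * h
  · linear_combination w.2 * h

variable {U} {P : Set (ℝ × ℝ)} {h h' : ℤ × ℤ → ℝ} {S : Set (ℤ × ℤ)}
  (hS : ∀ a, U.onLattice a ∈ S ↔ a ∈ latticePoints P) (hh : ∀ a, h' (U.onLattice a) = h a)

include hS hh

/-- The map `dualInverse` is minus the transpose of the linear part. Pairing U a with w therefore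
equals minus the pairing of a with `dualInverse w`, up to a constant from the translation, and the
sign exchanges maximum and minimum. -/
theorem maxCell_eq (w : ℝ × ℝ) : maxCell S h' w = U.onLattice '' cell P h (U.dualInverse w) := by
  have key : ∀ a b : ℤ × ℤ, (((U.onLattice b).1 : ℝ) * w.1 + (U.onLattice b).2 * w.2 -
      h' (U.onLattice b) ≤ (U.onLattice a).1 * w.1 + (U.onLattice a).2 * w.2 - h' (U.onLattice a)) ↔
      (a.1 * (U.dualInverse w).1 + a.2 * (U.dualInverse w).2 + h a ≤
        b.1 * (U.dualInverse w).1 + b.2 * (U.dualInverse w).2 + h b) := by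
    intro a b
    rw [hh, hh]
    simp only [onLattice, dualInverse]
    push_cast
    constructor <;> intro h <;> linarith
  ext x
  obtain ⟨a, rfl⟩ := U.surjective x
  rw [U.injective.mem_set_image]
  constructor
  · rintro ⟨h1, h2⟩
    exact ⟨(hS a).1 h1, fun b hb => (key a b).1 (h2 _ ((hS b).2 hb))⟩
  · rintro ⟨h1, h2⟩
    refine ⟨(hS a).2 h1, fun x hx => ?_⟩
    obtain ⟨b, rfl⟩ := U.surjective x
    exact (key a b).2 (h2 b ((hS b).1 hx))

theorem isMaxSmooth_iff : IsMaxSmooth S h' ↔ IsSmooth P h := by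
  constructor
  · rintro hs w ⟨a, ha, b, hb, c, hc, hne⟩
    have hcell := maxCell_eq hS hh (U.dual w)
    rw [U.dualInverse_dual] at hcell
    have h1 := hs.eq_triple (w := U.dual w) (a := U.onLattice a) (b := U.onLattice b)
      (c := U.onLattice c) (by rw [hcell]; exact mem_image_of_mem _ ha)
      (by rw [hcell]; exact mem_image_of_mem _ hb) (by rw [hcell]; exact mem_image_of_mem _ hc)
      (by rwa [U.doubleArea_onLattice])
    refine ⟨a, b, c, U.injective.image_injective ?_, ?_⟩
    · rw [← hcell, h1.1, image_insert_eq, image_pair]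
    · rw [← U.doubleArea_onLattice]
      exact h1.2
  · rintro hs w hw
    rw [maxCell_eq hS hh] at hw ⊢
    obtain ⟨_, ⟨a, ha, rfl⟩, _, ⟨b, hb, rfl⟩, _, ⟨c, hc, rfl⟩, hne⟩ := hw
    rw [U.doubleArea_onLattice] at hne
    obtain ⟨a, b, c, heq, h1⟩ := hs _ ⟨a, ha, b, hb, c, hc, hne⟩
    refine ⟨U.onLattice a, U.onLattice b, U.onLattice c, ?_, ?_⟩
    · rw [heq, image_insert_eq, image_pair]
    · rwa [U.doubleArea_onLattice]

theorem dual_mem_maxCurve {w : ℝ × ℝ} (hw : w ∈ tropicalCurve P h) : U.dual w ∈ maxCurve S h' := by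
  change (maxCell S h' _).Nontrivial
  rw [maxCell_eq hS hh, U.dualInverse_dual]
  exact Set.Nontrivial.image hw U.injective

theorem dualInverse_mem_tropicalCurve {w : ℝ × ℝ} (hw : w ∈ maxCurve S h') :
    U.dualInverse w ∈ tropicalCurve P h := by
  change (maxCell S h' _).Nontrivial at hw
  rw [maxCell_eq hS hh] at hw
  exact nontrivial_of_image _ _ hw

end UnimodularMap

/-! ### Extending the middle row -/

namespace Strip

variable {S : Strip}

/-- The strip with an additional point of height `H` in the middle row. -/
noncomputable def extend (S : Strip) (i : ℤ) (H : ℝ) : Strip where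
  upper := S.upper
  middle := insert i S.middle
  lower := S.lower
  upper_nonempty := S.upper_nonempty
  middle_nonempty := Finset.insert_nonempty i S.middle
  lower_nonempty := S.lower_nonempty
  height := Function.update S.height (i, 0) H

theorem extend_points (S : Strip) (i : ℤ) (H : ℝ) :
    (S.extend i H).points = insert (i, 0) S.points := by
  ext ⟨x, y⟩
  simp only [points, extend, Finset.mem_insert, mem_insert_iff, Prod.mk.injEq, Set.mem_ofPred_eq]
  tauto

theorem extend_height_of_ne {S : Strip} {i : ℤ} {H : ℝ} {a : ℤ × ℤ} (h : a ≠ (i, 0)) :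
    (S.extend i H).height a = S.height a := Function.update_of_ne h _ _

theorem extend_height_self (S : Strip) (i : ℤ) (H : ℝ) : (S.extend i H).height (i, 0) = H :=
  Function.update_self _ _ _

/-- The new point has no influence where it is not maximal. -/
theorem maxCell_extend {i j : ℤ} {H x y : ℝ} (hi : i ∉ S.middle) (hj : j ∈ S.middle)
    (hlt : i * x - H < j * x - S.height (j, 0)) :
    maxCell (S.extend i H).points (S.extend i H).height (x, y) =
      maxCell S.points S.height (x, y) := by
  have hne : ∀ a ∈ S.points, a ≠ (i, 0) := by
    rintro a ha rfl
    rcases ha with ⟨h1, -⟩ | ⟨-, h2⟩ | ⟨h1, -⟩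
    · simp at h1
    · exact hi h2
    · simp at h1
  have hjp : (j, (0 : ℤ)) ∈ S.points := Or.inr (Or.inl ⟨rfl, hj⟩)
  ext a
  rw [maxCell, maxCell, mem_sep_iff, mem_sep_iff, extend_points]
  constructor
  · rintro ⟨ha | ha, hmax⟩
    · exfalso
      have := hmax (j, 0) (Or.inr hjp)
      rw [ha, extend_height_self, extend_height_of_ne (hne _ hjp)] at this
      simp only at this
      push_cast at this
      linarith
    · refine ⟨ha, fun b hb => ?_⟩
      have := hmax b (Or.inr hb)
      rwa [extend_height_of_ne (hne _ ha), extend_height_of_ne (hne _ hb)] at this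
  · rintro ⟨ha, hmax⟩
    refine ⟨Or.inr ha, fun b hb => ?_⟩
    rw [extend_height_of_ne (hne _ ha)]
    rcases hb with hb | hb
    · have := hmax (j, 0) hjp
      rw [hb, extend_height_self]
      simp only at this ⊢
      push_cast at this ⊢
      linarith
    · rw [extend_height_of_ne (hne _ hb)]
      exact hmax b hb

/-- A point can be added next to the middle row without losing smoothness or changing a given
part of the curve. -/
theorem exists_extend (hs : S.IsSmooth) {i t b δ : ℤ} (hδ : δ = 1 ∨ δ = -1) (hi : i ∉ S.middle)
    (hj : i + δ ∈ S.middle) (htb : t + b = 2 * i + δ) {X : ℝ}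
    (hX : ∀ x : ℝ, δ * x ≤ X → S.argUp x = {t} ∧ S.argMid x = {i + δ} ∧ S.argLow x = {b}) (Y : ℝ) :
    ∃ H, (S.extend i H).IsSmooth ∧ ∀ q ∈ maxCurve S.points S.height, Y ≤ δ * q.1 →
      q ∈ maxCurve (S.extend i H).points (S.extend i H).height := by
  set c₁ := S.height (i + δ, 0) with hc₁
  set α := S.height (t, 1) with hα
  set β := S.height (b, -1) with hβ
  -- Three conditions for a large height: the new point matters only where each row has the known
  -- unique maximum; only beyond the bound `Y`; and the gap at the new wall is negative, so that
  -- this wall is hidden.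
  obtain ⟨H, h1, h2, h3⟩ : ∃ H : ℝ, c₁ - H ≤ X ∧ c₁ - H < Y ∧ α + β - c₁ < H := by
    refine ⟨max (c₁ - X) (max (c₁ - Y + 1) (α + β - c₁ + 1)), ?_, ?_, ?_⟩
    · linarith [le_max_left (c₁ - X) (max (c₁ - Y + 1) (α + β - c₁ + 1))]
    · linarith [le_max_left (c₁ - Y + 1) (α + β - c₁ + 1),
        le_max_right (c₁ - X) (max (c₁ - Y + 1) (α + β - c₁ + 1))]
    · linarith [le_max_right (c₁ - Y + 1) (α + β - c₁ + 1),
        le_max_right (c₁ - X) (max (c₁ - Y + 1) (α + β - c₁ + 1))]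
  have hsame : ∀ x y : ℝ, c₁ - H < δ * x →
      maxCell (S.extend i H).points (S.extend i H).height (x, y) =
        maxCell S.points S.height (x, y) := fun x y hx => by
    refine maxCell_extend hi hj ?_
    push_cast
    linarith
  refine ⟨H, ?_, ?_⟩
  · rintro ⟨x, y⟩ htri
    rcases lt_or_ge (c₁ - H) (δ * x) with hx | hx
    · rw [hsame x y hx] at htri ⊢
      exact hs _ htri
    · obtain ⟨a1, a2, a3⟩ := hX x (hx.trans h1)
      have harea : |doubleArea (t, 1) (b, -1) (i, 0)| = 1 := by
        have : doubleArea (t, 1) (b, -1) (i, 0) = (2 * i - (t + b)) * 1 := by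
          simp only [doubleArea]
          ring
        rw [this, htb]
        rcases hδ with rfl | rfl <;> ring_nf <;> norm_num
      have hne1 : ∀ s : ℤ, (s, (1 : ℤ)) ≠ (i, 0) := fun s h => by simp at h
      have hne2 : ∀ s : ℤ, (s, (-1 : ℤ)) ≠ (i, 0) := fun s h => by simp at h
      have ht : t ∈ S.argUp x := by rw [a1]; rfl
      have hk : i + δ ∈ S.argMid x := by rw [a2]; rfl
      have hb : b ∈ S.argLow x := by rw [a3]; rfl
      refine eq_of_subset_unimodular (fun a ha => ?_) harea htri
      rw [maxCell, mem_sep_iff, extend_points] at ha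
      obtain ⟨ha | ha, hmax⟩ := ha
      · exact Or.inr (Or.inr ha)
      obtain ⟨s, r⟩ := a
      rcases ha with ⟨hr, hs'⟩ | ⟨hr, hs'⟩ | ⟨hr, hs'⟩ <;> simp only at hr hs' <;> subst hr
      · left
        have hmem : s ∈ S.argUp x := mem_rowArg_of_forall_le S.upper_nonempty hs' fun j hj => by
          have := hmax (j, 1) (Or.inr (Or.inl ⟨rfl, hj⟩))
          rw [extend_height_of_ne (hne1 _), extend_height_of_ne (hne1 _)] at this
          simp only at this
          linarith
        rw [a1, mem_singleton_iff] at hmem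
        rw [hmem]
      · exfalso
        have hsi : s ≠ i := fun h => hi (h ▸ hs')
        have hsi' : (s, (0 : ℤ)) ≠ (i, 0) := fun h => hsi (Prod.mk.inj h).1
        have hmem : s ∈ S.argMid x := mem_rowArg_of_forall_le S.middle_nonempty hs' fun j hj => by
          have hji : (j, (0 : ℤ)) ≠ (i, 0) := fun h => hi ((Prod.mk.inj h).1 ▸ hj)
          have := hmax (j, 0) (Or.inr (Or.inr (Or.inl ⟨rfl, hj⟩)))
          rw [extend_height_of_ne hsi', extend_height_of_ne hji] at this
          simp only at this
          push_cast at this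
          linarith
        rw [a2, mem_singleton_iff] at hmem
        subst hmem
        -- The old middle point can compete only on the new wall, and there its maximality against
        -- both outer points contradicts the choice of `H`.
        have m1 := hmax (i, 0) (Or.inl rfl)
        have m2 := hmax (t, 1) (Or.inr (Or.inl ⟨rfl, ht.1⟩))
        have m3 := hmax (b, -1) (Or.inr (Or.inr (Or.inr ⟨rfl, hb.1⟩)))
        rw [extend_height_of_ne hsi'] at m1 m2 m3
        rw [extend_height_self] at m1
        rw [extend_height_of_ne (hne1 _)] at m2
        rw [extend_height_of_ne (hne2 _)] at m3
        simp only at m1 m2 m3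
        push_cast at m1 m2 m3
        rw [← hc₁] at m1 m2 m3
        have htb' : (t : ℝ) + b = 2 * i + δ := by exact_mod_cast htb
        have hx' : δ * x = c₁ - H := by linarith
        have hsum : ((t : ℝ) + b) * x = (2 * i + δ) * x := by rw [htb']
        linarith
      · right; left
        have hmem : s ∈ S.argLow x := mem_rowArg_of_forall_le S.lower_nonempty hs' fun j hj => by
          have := hmax (j, -1) (Or.inr (Or.inr (Or.inr ⟨rfl, hj⟩)))
          rw [extend_height_of_ne (hne2 _), extend_height_of_ne (hne2 _)] at this
          simp only at this
          linarith
        rw [a3, mem_singleton_iff] at hmem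
        rw [hmem]
  · rintro ⟨x, y⟩ hq hY
    change (maxCell _ _ _).Nontrivial
    rw [hsame x y (h2.trans_le hY)]
    exact hq

end Strip

/-! ### Lattice polygons -/

theorem IsLatticePolygon.convex {P : Set (ℝ × ℝ)} (hP : IsLatticePolygon P) : Convex ℝ P := by
  obtain ⟨⟨s, rfl⟩, -⟩ := hP
  exact convex_convexHull ℝ _

theorem IsLatticePolygon.finite_latticePoints {P : Set (ℝ × ℝ)} (hP : IsLatticePolygon P) :
    (latticePoints P).Finite := by
  obtain ⟨⟨s, rfl⟩, -⟩ := hP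
  have hb : Bornology.IsBounded (convexHull ℝ (toPlane '' (s : Set (ℤ × ℤ)))) :=
    isBounded_convexHull.2 (s.finite_toSet.image _).isBounded
  obtain ⟨R, hR⟩ := hb.subset_closedBall 0
  refine ((finite_Icc (-⌈R⌉) ⌈R⌉).prod (finite_Icc (-⌈R⌉) ⌈R⌉)).subset fun a ha => ?_
  have h := hR ha
  rw [mem_closedBall_zero_iff, Prod.norm_def, sup_le_iff, Real.norm_eq_abs, Real.norm_eq_abs,
    abs_le, abs_le] at h
  obtain ⟨⟨h1, h2⟩, h3, h4⟩ := h
  simp only [toPlane] at h1 h2 h3 h4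
  have hc := Int.le_ceil R
  have key : ∀ n : ℤ, -R ≤ n → (n : ℝ) ≤ R → n ∈ Icc (-⌈R⌉) ⌈R⌉ := fun n h5 h6 => by
    constructor
    · have : ((-⌈R⌉ : ℤ) : ℝ) ≤ n := by
        push_cast
        linarith
      exact_mod_cast this
    · have : (n : ℝ) ≤ (⌈R⌉ : ℤ) := by linarith
      exact_mod_cast this
  exact ⟨key _ h1 h2, key _ h3 h4⟩

/-- An affine inequality satisfied by the lattice points is strict at the interior points. -/
theorem IsLatticePolygon.lt_of_mem_interior {P : Set (ℝ × ℝ)} (hP : IsLatticePolygon P)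
    {α β κ : ℝ} (hne : α ≠ 0 ∨ β ≠ 0)
    (h : ∀ a ∈ latticePoints P, κ ≤ α * a.1 + β * a.2) {c : ℝ × ℝ} (hc : c ∈ interior P) :
    κ < α * c.1 + β * c.2 := by
  have hsub : P ⊆ {q | κ ≤ α * q.1 + β * q.2} := by
    obtain ⟨⟨s, rfl⟩, -⟩ := hP
    refine convexHull_min ?_ ?_
    · rintro _ ⟨a, ha, rfl⟩
      exact h a (subset_convexHull ℝ _ (mem_image_of_mem _ ha))
    · intro q hq q' hq' u v hu hv huv
      simp only [Set.mem_ofPred_eq, Prod.fst_add, Prod.snd_add, Prod.smul_fst, Prod.smul_snd,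
        smul_eq_mul] at hq hq' ⊢
      have h1 := mul_le_mul_of_nonneg_left hq hu
      have h2 := mul_le_mul_of_nonneg_left hq' hv
      have h3 : κ = u * κ + v * κ := by rw [← add_mul, huv, one_mul]
      linarith
  have hcont : Continuous fun ε : ℝ => (c.1 - ε * α, c.2 - ε * β) := by fun_prop
  have hev : ∀ᶠ ε : ℝ in 𝓝 0, (c.1 - ε * α, c.2 - ε * β) ∈ interior P :=
    hcont.continuousAt.eventually_mem (isOpen_interior.mem_nhds (by simpa using hc))
  obtain ⟨ε, hε, hε0⟩ := ((hev.filter_mono nhdsWithin_le_nhds).and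
    (self_mem_nhdsWithin (s := Ioi (0 : ℝ)))).exists
  have h1 : κ ≤ α * (c.1 - ε * α) + β * (c.2 - ε * β) := hsub (interior_subset hε)
  have h2 : 0 < α ^ 2 + β ^ 2 := by
    rcases hne with h | h <;> positivity
  have h3 : 0 < ε * (α ^ 2 + β ^ 2) := mul_pos hε0 h2
  nlinarith

/-- A polygon whose interior lattice points are `(1, 0), …, (g, 0)`. -/
structure IsStandard (g : ℕ) (Q : Set (ℝ × ℝ)) : Prop where
  isLatticePolygon : IsLatticePolygon Q
  mem_interior_iff : ∀ a : ℤ × ℤ, toPlane a ∈ interior Q ↔ a.2 = 0 ∧ 1 ≤ a.1 ∧ a.1 ≤ g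

namespace IsStandard

variable {g : ℕ} {Q : Set (ℝ × ℝ)} (hQ : IsStandard g Q) (hg : 2 ≤ g)

include hQ hg

theorem row_mem_interior {x : ℝ} (h1 : 1 ≤ x) (h2 : x ≤ g) : (x, (0 : ℝ)) ∈ interior Q := by
  have hg' : (2 : ℝ) ≤ g := by exact_mod_cast hg
  have e1 := (hQ.mem_interior_iff (1, 0)).2 ⟨rfl, le_rfl, by simp; omega⟩
  have e2 := (hQ.mem_interior_iff (g, 0)).2 ⟨rfl, by simp; omega, le_rfl⟩
  have h3 : (0 : ℝ) < g - 1 := by linarith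
  have h := hQ.isLatticePolygon.convex.interior e1 e2 (a := (g - x) / (g - 1))
    (b := (x - 1) / (g - 1)) (div_nonneg (by linarith) h3.le) (div_nonneg (by linarith) h3.le)
    (by field_simp; ring)
  convert h using 1
  simp only [toPlane, Prod.smul_mk, smul_eq_mul, Prod.mk_add_mk]
  push_cast
  refine Prod.ext ?_ ?_
  · field_simp
    ring
  · simp

/-- Lattice points between a point of the polygon and the row of interior lattice points. -/
theorem interior_of_combination {y : ℝ × ℝ} (hy : y ∈ Q) {x k : ℝ} (h1 : 1 ≤ x) (h2 : x ≤ g)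
    (hk : 1 < k) {b : ℤ × ℤ} (hb1 : k * b.1 = y.1 + (k - 1) * x) (hb2 : k * b.2 = y.2) :
    b.2 = 0 ∧ 1 ≤ b.1 ∧ b.1 ≤ g := by
  rw [← hQ.mem_interior_iff]
  have h := hQ.isLatticePolygon.convex.combo_interior_self_mem_interior
    (hQ.row_mem_interior hg h1 h2) hy (a := (k - 1) / k) (b := 1 / k)
    (div_pos (by linarith) (by linarith)) (by positivity) (by field_simp; ring)
  convert h using 1
  simp only [toPlane, Prod.smul_mk, smul_eq_mul]
  refine Prod.ext ?_ ?_
  · simp only [Prod.smul_fst, Prod.fst_add, smul_eq_mul]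
    field_simp
    linarith
  · simp only [Prod.smul_snd, Prod.snd_add, smul_eq_mul]
    field_simp
    linarith

/-- Suppose the row has distance k ≥ 2. On the segment from the point to (x, 0), 1 ≤ x ≤ g, the
point at height ±1 has abscissa (a.1 + (k - 1)x)/k. As g ≥ 2, (k - 1)x can be any of the k
consecutive integers from k - 1 to 2k - 2, so some choice gives a lattice point. It is interior but
not in row 0. -/
theorem abs_row_le {a : ℤ × ℤ} (ha : a ∈ latticePoints Q) : |a.2| ≤ 1 := by
  by_contra! hlt
  set k := |a.2| with hk
  -- a representative of `-a.1` modulo `k`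
  set s := k - 1 + (-a.1 - (k - 1)) % k with hs
  have hk2 : 2 ≤ k := by omega
  have hs1 := Int.emod_nonneg (-a.1 - (k - 1)) (by omega : k ≠ 0)
  have hs2 := Int.emod_lt_of_pos (-a.1 - (k - 1)) (by omega : 0 < k)
  obtain ⟨m, hm⟩ : k ∣ s + a.1 := by
    refine ⟨-((-a.1 - (k - 1)) / k), ?_⟩
    have := Int.emod_add_mul_ediv (-a.1 - (k - 1)) k
    rw [hs]
    linear_combination this
  have hk2' : (2 : ℝ) ≤ k := by exact_mod_cast hk2
  have hkpos : (0 : ℝ) < k - 1 := by linarith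
  have hsl : ((k : ℝ) - 1) ≤ s := by
    have : k - 1 ≤ s := by omega
    exact_mod_cast this
  have hsu : (s : ℝ) ≤ g * (k - 1) := by
    have : s ≤ 2 * (k - 1) := by omega
    have h' : (s : ℝ) ≤ 2 * (k - 1) := by exact_mod_cast this
    have hg' : (2 : ℝ) ≤ g := by exact_mod_cast hg
    nlinarith
  have hm' : (s : ℝ) + a.1 = k * m := by exact_mod_cast hm
  have h := hQ.interior_of_combination hg ha (x := s / (k - 1)) (k := k) (b := (m, a.2.sign))
    ((one_le_div hkpos).2 hsl) ((div_le_iff₀ hkpos).2 hsu) (by linarith)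
    (by
      simp only [toPlane]
      rw [mul_div_cancel₀ _ hkpos.ne']
      linarith)
    (by
      simp only [toPlane]
      have : k * a.2.sign = a.2 := by rw [hk, mul_comm]; exact Int.sign_mul_abs a.2
      exact_mod_cast this)
  have h0 : a.2 = 0 := Int.sign_eq_zero_iff_zero.1 h.1
  rw [h0] at hk
  simp at hk
  omega

/-- A point of row 0 further out would make (0, 0) or (g + 1, 0) an interior point, strictly between
it and (1, 0) or (g, 0). -/
theorem row_zero_bounds {m : ℝ} (hm : (m, (0 : ℝ)) ∈ Q) : 0 ≤ m ∧ m ≤ g + 1 := by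
  have hg' : (2 : ℝ) ≤ g := by exact_mod_cast hg
  constructor
  · by_contra! hlt
    have := hQ.interior_of_combination hg hm (x := 1) (k := 1 - m) (b := (0, 0)) le_rfl
      (by linarith) (by linarith) (by push_cast; ring) (by simp)
    simp at this
  · by_contra! hlt
    have := hQ.interior_of_combination hg hm (x := g) (k := m - g) (b := (g + 1, 0)) (by linarith)
      le_rfl (by linarith) (by push_cast; ring) (by simp)
    simp at this

omit hg in
theorem midpoint_mem {t b : ℤ} (ht : (t, 1) ∈ latticePoints Q) (hb : (b, -1) ∈ latticePoints Q) :
    (((t : ℝ) + b) / 2, (0 : ℝ)) ∈ Q := by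
  have h := hQ.isLatticePolygon.convex ht hb (a := 1 / 2) (b := 1 / 2) (by norm_num) (by norm_num)
    (by norm_num)
  convert h using 1
  simp only [toPlane, Prod.smul_mk, smul_eq_mul, Prod.mk_add_mk]
  refine Prod.ext ?_ ?_
  · simp only
    ring
  · push_cast
    norm_num

theorem sum_bounds {t b : ℤ} (ht : (t, 1) ∈ latticePoints Q) (hb : (b, -1) ∈ latticePoints Q) :
    0 ≤ t + b ∧ t + b ≤ 2 * g + 2 := by
  obtain ⟨h1, h2⟩ := hQ.row_zero_bounds hg (hQ.midpoint_mem ht hb)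
  constructor
  · have : (0 : ℝ) ≤ ((t + b : ℤ) : ℝ) := by push_cast; linarith
    exact_mod_cast this
  · have : ((t + b : ℤ) : ℝ) ≤ ((2 * g + 2 : ℤ) : ℝ) := by push_cast; linarith
    exact_mod_cast this

theorem row_cases {a : ℤ × ℤ} (ha : a ∈ latticePoints Q) : a.2 = 1 ∨ a.2 = 0 ∨ a.2 = -1 := by
  have := abs_le.1 (hQ.abs_row_le hg ha)
  omega

theorem middle_bounds {i : ℤ} (hi : (i, 0) ∈ latticePoints Q) : 0 ≤ i ∧ i ≤ g + 1 := by
  have hi' : ((i : ℝ), (0 : ℝ)) ∈ Q := by simpa [latticePoints, toPlane] using hi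
  obtain ⟨h1, h2⟩ := hQ.row_zero_bounds hg hi'
  exact ⟨by exact_mod_cast h1, by exact_mod_cast h2⟩

omit hg in
theorem middle_mem {i : ℤ} (h1 : 1 ≤ i) (h2 : i ≤ g) : (i, 0) ∈ latticePoints Q :=
  interior_subset (s := Q) ((hQ.mem_interior_iff (i, 0)).2 ⟨rfl, h1, h2⟩)

theorem first_mem_interior : toPlane (1, 0) ∈ interior Q :=
  (hQ.mem_interior_iff (1, 0)).2 ⟨rfl, le_rfl, by simp; omega⟩

theorem last_mem_interior : toPlane (g, 0) ∈ interior Q :=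
  (hQ.mem_interior_iff (g, 0)).2 ⟨rfl, by simp; omega, le_rfl⟩

/-- Otherwise the polygon lies below row 0, and (1, 0) would be on its boundary. -/
theorem exists_upper : ∃ t : ℤ, (t, 1) ∈ latticePoints Q := by
  by_contra! hne
  have := hQ.isLatticePolygon.lt_of_mem_interior (α := 0) (β := -1) (κ := 0) (by simp) ?_
    (hQ.first_mem_interior hg)
  · simp [toPlane] at this
  · rintro ⟨x, y⟩ ha
    rcases hQ.row_cases hg ha with h | h | h <;> dsimp only at h <;> subst h
    · exact absurd ha (hne x)
    · simp
    · simp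

theorem exists_lower : ∃ b : ℤ, (b, -1) ∈ latticePoints Q := by
  by_contra! hne
  have := hQ.isLatticePolygon.lt_of_mem_interior (α := 0) (β := 1) (κ := 0) (by simp) ?_
    (hQ.first_mem_interior hg)
  · simp [toPlane] at this
  · rintro ⟨x, y⟩ ha
    rcases hQ.row_cases hg ha with h | h | h <;> dsimp only at h <;> subst h
    · simp
    · simp
    · exact absurd ha (hne x)

/-- The sum is at least 0, and if it is 0 the midpoint (0, 0) belongs to the polygon. If it is at
least 2, the functional x - ((t - b)/2) y is at least 1 on all lattice points, so (1, 0) would not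
be interior. The value 1 is what makes the triangle with the added point 0 unimodular. -/
theorem sum_of_minimal (h0 : (0, 0) ∉ latticePoints Q) {t b : ℤ} (ht : (t, 1) ∈ latticePoints Q)
    (hb : (b, -1) ∈ latticePoints Q) (htm : ∀ t', (t', 1) ∈ latticePoints Q → t ≤ t')
    (hbm : ∀ b', (b', -1) ∈ latticePoints Q → b ≤ b') : t + b = 1 := by
  have h1 := hQ.sum_bounds hg ht hb
  have h2 : t + b ≠ 0 := fun h => h0 (by
    have := hQ.midpoint_mem ht hb
    rw [show ((t : ℝ) + b) = 0 by exact_mod_cast h] at this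
    simpa [latticePoints, toPlane] using this)
  by_contra h3
  have h4 : (2 : ℝ) ≤ t + b := by
    have : 2 ≤ t + b := by omega
    exact_mod_cast this
  have := hQ.isLatticePolygon.lt_of_mem_interior (α := 1) (β := -((t - b) / 2)) (κ := 1)
    (by simp) ?_ (hQ.first_mem_interior hg)
  · simp [toPlane] at this
  · rintro ⟨x, y⟩ ha
    rcases hQ.row_cases hg ha with h | h | h <;> dsimp only at h <;> subst h
    · have : (t : ℝ) ≤ x := by exact_mod_cast htm x ha
      push_cast
      linarith
    · have hx := (hQ.middle_bounds hg ha).1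
      have hx0 : x ≠ 0 := by
        rintro rfl
        exact h0 ha
      have : (1 : ℝ) ≤ x := by exact_mod_cast (by omega : 1 ≤ x)
      push_cast
      linarith
    · have : (b : ℝ) ≤ x := by exact_mod_cast hbm x ha
      push_cast
      linarith

theorem sum_of_maximal (h0 : ((g : ℤ) + 1, 0) ∉ latticePoints Q) {t b : ℤ}
    (ht : (t, 1) ∈ latticePoints Q) (hb : (b, -1) ∈ latticePoints Q)
    (htm : ∀ t', (t', 1) ∈ latticePoints Q → t' ≤ t)
    (hbm : ∀ b', (b', -1) ∈ latticePoints Q → b' ≤ b) : t + b = 2 * g + 1 := by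
  have h1 := hQ.sum_bounds hg ht hb
  have h2 : t + b ≠ 2 * g + 2 := fun h => h0 (by
    have := hQ.midpoint_mem ht hb
    rw [show ((t : ℝ) + b) = 2 * (g + 1) by
      rw [show (2 * ((g : ℝ) + 1)) = 2 * g + 2 by ring]
      exact_mod_cast h] at this
    simpa [latticePoints, toPlane] using this)
  by_contra h3
  have h4 : (t : ℝ) + b ≤ 2 * g := by
    have : t + b ≤ 2 * g := by omega
    exact_mod_cast this
  have := hQ.isLatticePolygon.lt_of_mem_interior (α := -1) (β := (t - b) / 2) (κ := -g)
    (by simp) ?_ (hQ.last_mem_interior hg)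
  · simp [toPlane] at this
  · rintro ⟨x, y⟩ ha
    rcases hQ.row_cases hg ha with h | h | h <;> dsimp only at h <;> subst h
    · have : (x : ℝ) ≤ t := by exact_mod_cast htm x ha
      push_cast
      linarith
    · have hx := (hQ.middle_bounds hg ha).2
      have hx0 : x ≠ g + 1 := by
        rintro rfl
        exact h0 ha
      have : (x : ℝ) ≤ g := by exact_mod_cast (by omega : x ≤ g)
      push_cast
      linarith
    · have : (x : ℝ) ≤ b := by exact_mod_cast hbm x ha
      push_cast
      linarith

end IsStandard

/-! ### Completing the middle row -/

/-- The properties of the lattice points of a polygon whose interior lattice points are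
`(1, 0), …, (g, 0)` which are needed to complete the middle row. -/
structure Strip.IsStandard (S : Strip) (g : ℕ) : Prop where
  mem_middle : ∀ i : ℤ, 1 ≤ i → i ≤ g → i ∈ S.middle
  middle_bounds : ∀ i ∈ S.middle, 0 ≤ i ∧ i ≤ g + 1
  sum_bounds : ∀ t ∈ S.upper, ∀ b ∈ S.lower, 0 ≤ t + b ∧ t + b ≤ 2 * g + 2
  sum_of_minimal : 0 ∉ S.middle → ∀ t ∈ S.upper, ∀ b ∈ S.lower, (∀ t' ∈ S.upper, t ≤ t') →
    (∀ b' ∈ S.lower, b ≤ b') → t + b = 1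
  sum_of_maximal : (g : ℤ) + 1 ∉ S.middle → ∀ t ∈ S.upper, ∀ b ∈ S.lower, (∀ t' ∈ S.upper, t' ≤ t) →
    (∀ b' ∈ S.lower, b' ≤ b) → t + b = 2 * g + 1

namespace Strip

variable {S : Strip} {g : ℕ}

theorem IsStandard.extend (h : S.IsStandard g) {i : ℤ} (h1 : 0 ≤ i) (h2 : i ≤ g + 1) (H : ℝ) :
    (S.extend i H).IsStandard g where
  mem_middle j hj hj' := Finset.mem_insert_of_mem (h.mem_middle j hj hj')
  middle_bounds j hj := by
    rcases Finset.mem_insert.1 hj with rfl | hj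
    · exact ⟨h1, h2⟩
    · exact h.middle_bounds j hj
  sum_bounds := h.sum_bounds
  sum_of_minimal h0 := h.sum_of_minimal fun h' => h0 (Finset.mem_insert_of_mem h')
  sum_of_maximal h0 := h.sum_of_maximal fun h' => h0 (Finset.mem_insert_of_mem h')

/-- Far to the left the leftmost point of each row is its only maximum, and the outer two have sum 1
= 2 · 0 + 1, so `exists_extend` applies with i = 0 and δ = 1. -/
theorem IsStandard.exists_zero_mem (h : S.IsStandard g) (hg : 2 ≤ g) (hs : S.IsSmooth) (Y : ℝ) :
    ∃ S' : Strip, S'.IsStandard g ∧ S'.IsSmooth ∧ 0 ∈ S'.middle ∧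
      ∀ q ∈ maxCurve S.points S.height, Y ≤ q.1 → q ∈ maxCurve S'.points S'.height := by
  by_cases h0 : 0 ∈ S.middle
  · exact ⟨S, h, hs, h0, fun q hq _ => hq⟩
  obtain ⟨t, ht, htm, ht'⟩ := exists_rowArg_atBot S.upper_nonempty fun i => S.height (i, 1)
  obtain ⟨k, hk, hkm, hk'⟩ := exists_rowArg_atBot S.middle_nonempty fun i => S.height (i, 0)
  obtain ⟨b, hb, hbm, hb'⟩ := exists_rowArg_atBot S.lower_nonempty fun i => S.height (i, -1)
  have h1 : (0 : ℤ) + 1 ∈ S.middle := h.mem_middle _ (by norm_num) (by push_cast; omega)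
  obtain rfl : k = 0 + 1 := by
    have := hkm _ h1
    have := (h.middle_bounds k hk).1
    have : k ≠ 0 := by
      rintro rfl
      exact h0 hk
    omega
  obtain ⟨X, hX⟩ := eventually_atBot.1 (ht'.and (hk'.and hb'))
  obtain ⟨H, hH, hH'⟩ := exists_extend hs (i := 0) (δ := 1) (t := t) (b := b) (Or.inl rfl) h0 h1
    (by rw [h.sum_of_minimal h0 t ht b hb htm hbm]; norm_num) (X := X)
    (fun x hx => hX x (by simpa using hx)) Y
  exact ⟨_, h.extend le_rfl (by positivity) H, hH, Finset.mem_insert_self _ _,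
    fun q hq hY => hH' q hq (by simpa using hY)⟩

theorem IsStandard.exists_last_mem (h : S.IsStandard g) (hg : 2 ≤ g) (hs : S.IsSmooth) (Y : ℝ)
    (hz : 0 ∈ S.middle) :
    ∃ S' : Strip, S'.IsFull g ∧ S'.IsSmooth ∧
      ∀ q ∈ maxCurve S.points S.height, q.1 ≤ Y → q ∈ maxCurve S'.points S'.height := by
  have full : ∀ T : Strip, T.IsStandard g → 0 ∈ T.middle → (g : ℤ) + 1 ∈ T.middle →
      T.IsFull g := fun T hT h1 h2 => by
    refine ⟨?_, fun t ht b hb => (hT.sum_bounds t ht b hb).1,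
      fun t ht b hb => (hT.sum_bounds t ht b hb).2⟩
    ext i
    rw [Finset.mem_Icc]
    refine ⟨hT.middle_bounds i, fun hi => ?_⟩
    rcases eq_or_ne i 0 with rfl | hi0
    · exact h1
    rcases eq_or_ne i (g + 1) with rfl | hi1
    · exact h2
    exact hT.mem_middle i (by omega) (by omega)
  by_cases h0 : (g : ℤ) + 1 ∈ S.middle
  · exact ⟨S, full S h hz h0, hs, fun q hq _ => hq⟩
  obtain ⟨t, ht, htm, ht'⟩ := exists_rowArg_atTop S.upper_nonempty fun i => S.height (i, 1)
  obtain ⟨k, hk, hkm, hk'⟩ := exists_rowArg_atTop S.middle_nonempty fun i => S.height (i, 0)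
  obtain ⟨b, hb, hbm, hb'⟩ := exists_rowArg_atTop S.lower_nonempty fun i => S.height (i, -1)
  have h1 : (g : ℤ) + 1 + -1 ∈ S.middle := h.mem_middle _ (by omega) (by omega)
  obtain rfl : k = g + 1 + -1 := by
    have := hkm _ h1
    have := (h.middle_bounds k hk).2
    have : k ≠ g + 1 := by
      rintro rfl
      exact h0 hk
    omega
  obtain ⟨X, hX⟩ := eventually_atTop.1 (ht'.and (hk'.and hb'))
  obtain ⟨H, hH, hH'⟩ := exists_extend hs (i := g + 1) (δ := -1) (t := t) (b := b) (Or.inr rfl) h0 h1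
    (by rw [h.sum_of_maximal h0 t ht b hb htm hbm]; ring) (X := -X)
    (fun x hx => hX x (by simp at hx; linarith)) (-Y)
  exact ⟨_, full _ (h.extend (by positivity) le_rfl H) (Finset.mem_insert_of_mem hz)
    (Finset.mem_insert_self _ _), hH, fun q hq hY => hH' q hq (by simp; linarith)⟩

/-- The middle row can be completed without changing a given bounded part of the curve. -/
theorem IsStandard.exists_isFull (h : S.IsStandard g) (hg : 2 ≤ g) (hs : S.IsSmooth) (Y : ℝ) :
    ∃ S' : Strip, S'.IsFull g ∧ S'.IsSmooth ∧
      ∀ q ∈ maxCurve S.points S.height, |q.1| ≤ Y → q ∈ maxCurve S'.points S'.height := by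
  obtain ⟨S₁, h1, hs1, hz, hc1⟩ := h.exists_zero_mem hg hs (-Y)
  obtain ⟨S₂, h2, hs2, hc2⟩ := h1.exists_last_mem hg hs1 Y hz
  exact ⟨S₂, h2, hs2, fun q hq hY => hc2 q (hc1 q hq (abs_le.1 hY).1) (abs_le.1 hY).2⟩

end Strip

theorem IsStandard.exists_strip {g : ℕ} {Q : Set (ℝ × ℝ)} (hQ : IsStandard g Q) (hg : 2 ≤ g)
    (h : ℤ × ℤ → ℝ) :
    ∃ S : Strip, S.IsStandard g ∧ S.points = latticePoints Q ∧ S.height = h := by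
  have hfin := hQ.isLatticePolygon.finite_latticePoints
  have hrow : ∀ j : ℤ, ∃ R : Finset ℤ, ∀ i, i ∈ R ↔ (i, j) ∈ latticePoints Q := fun j => by
    have : ({i | (i, j) ∈ latticePoints Q} : Set ℤ).Finite :=
      hfin.preimage (f := fun i : ℤ => (i, j)) (fun a _ b _ hab => (Prod.mk.inj hab).1)
    exact ⟨this.toFinset, fun i => this.mem_toFinset⟩
  obtain ⟨A, hA⟩ := hrow 1
  obtain ⟨B, hB⟩ := hrow 0
  obtain ⟨C, hC⟩ := hrow (-1)
  obtain ⟨t, ht⟩ := hQ.exists_upper hg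
  obtain ⟨b, hb⟩ := hQ.exists_lower hg
  refine ⟨⟨A, B, C, ⟨t, (hA t).2 ht⟩, ⟨1, (hB 1).2 (hQ.middle_mem le_rfl (by omega))⟩,
    ⟨b, (hC b).2 hb⟩, h⟩, ⟨?_, ?_, ?_, ?_, ?_⟩, ?_, rfl⟩
  · exact fun i h1 h2 => (hB i).2 (hQ.middle_mem h1 h2)
  · exact fun i hi => hQ.middle_bounds hg ((hB i).1 hi)
  · exact fun t ht b hb => hQ.sum_bounds hg ((hA t).1 ht) ((hC b).1 hb)
  · exact fun h0 t ht b hb htm hbm => hQ.sum_of_minimal hg (fun h' => h0 ((hB 0).2 h'))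
      ((hA t).1 ht) ((hC b).1 hb) (fun t' h' => htm t' ((hA t').2 h'))
      (fun b' h' => hbm b' ((hC b').2 h'))
  · exact fun h0 t ht b hb htm hbm => hQ.sum_of_maximal hg (fun h' => h0 ((hB _).2 h'))
      ((hA t).1 ht) ((hC b).1 hb) (fun t' h' => htm t' ((hA t').2 h'))
      (fun b' h' => hbm b' ((hC b').2 h'))
  · ext ⟨x, y⟩
    simp only [Strip.points, Set.mem_ofPred_eq, hA, hB, hC]
    constructor
    · rintro (⟨rfl, h⟩ | ⟨rfl, h⟩ | ⟨rfl, h⟩) <;> exact h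
    · intro ha
      rcases hQ.row_cases hg ha with h | h | h <;> dsimp only at h <;> subst h
      · exact Or.inl ⟨rfl, ha⟩
      · exact Or.inr (Or.inl ⟨rfl, ha⟩)
      · exact Or.inr (Or.inr ⟨rfl, ha⟩)

/-! ### Normal form of hyperelliptic polygons -/

namespace UnimodularMap

variable (U : UnimodularMap)

/-- The action on the real plane. -/
noncomputable def onPlane : (ℝ × ℝ) ≃ₜ (ℝ × ℝ) where
  toFun x := (U.a * x.1 + U.b * x.2 + U.p, U.c * x.1 + U.d * x.2 + U.q)
  invFun x := (U.d * (x.1 - U.p) - U.b * (x.2 - U.q), U.a * (x.2 - U.q) - U.c * (x.1 - U.p))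
  left_inv x := by
    have h : (U.a : ℝ) * U.d - U.b * U.c = 1 := by exact_mod_cast U.det
    refine Prod.ext ?_ ?_ <;> dsimp only
    · linear_combination x.1 * h
    · linear_combination x.2 * h
  right_inv x := by
    have h : (U.a : ℝ) * U.d - U.b * U.c = 1 := by exact_mod_cast U.det
    refine Prod.ext ?_ ?_ <;> dsimp only
    · linear_combination (x.1 - U.p) * h
    · linear_combination (x.2 - U.q) * h
  continuous_toFun := by fun_prop
  continuous_invFun := by fun_prop

theorem toPlane_onLattice (x : ℤ × ℤ) : toPlane (U.onLattice x) = U.onPlane (toPlane x) := by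
  simp [toPlane, onLattice, onPlane]

theorem onPlane_image_convexHull (s : Set (ℝ × ℝ)) :
    U.onPlane '' convexHull ℝ s = convexHull ℝ (U.onPlane '' s) :=
  AffineMap.image_convexHull
    { toFun := U.onPlane
      linear :=
        { toFun := fun x => (U.a * x.1 + U.b * x.2, U.c * x.1 + U.d * x.2)
          map_add' := fun x y => by
            refine Prod.ext ?_ ?_ <;> simp only [Prod.fst_add, Prod.snd_add] <;> ring
          map_smul' := fun r x => by
            refine Prod.ext ?_ ?_ <;>
              simp only [Prod.smul_fst, Prod.smul_snd, smul_eq_mul, RingHom.id_apply] <;> ring }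
      map_vadd' := fun x y => by
        refine Prod.ext ?_ ?_ <;>
          simp [onPlane] <;> ring } s

theorem toPlane_onLattice_mem_image {P : Set (ℝ × ℝ)} {a : ℤ × ℤ} :
    toPlane (U.onLattice a) ∈ U.onPlane '' P ↔ toPlane a ∈ P := by
  rw [toPlane_onLattice]
  exact U.onPlane.injective.mem_set_image

theorem isLatticePolygon_image {P : Set (ℝ × ℝ)} (hP : IsLatticePolygon P) :
    IsLatticePolygon (U.onPlane '' P) := by
  classical
  obtain ⟨⟨s, hs⟩, hne⟩ := hP
  refine ⟨⟨s.image U.onLattice, ?_⟩, ?_⟩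
  · rw [hs, onPlane_image_convexHull, Finset.coe_image, image_image, image_image]
    simp only [toPlane_onLattice]
  · rw [← U.onPlane.image_interior]
    exact hne.image _

theorem mem_interior_image {P : Set (ℝ × ℝ)} {a : ℤ × ℤ} :
    toPlane (U.onLattice a) ∈ interior (U.onPlane '' P) ↔ a ∈ interiorLatticePoints P := by
  rw [← U.onPlane.image_interior]
  exact U.toPlane_onLattice_mem_image

end UnimodularMap

/-- The primitive direction of the interior segment is completed to a unimodular basis by Bézout,
which makes the segment horizontal with ends (1, 0) and (g, 0). -/
theorem IsHyperelliptic.exists_isStandard {g : ℕ} {P : Set (ℝ × ℝ)} (hP : IsHyperelliptic g P)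
    (hg : 2 ≤ g) : ∃ U : UnimodularMap, IsStandard g (U.onPlane '' P) := by
  obtain ⟨⟨hpoly, hcard⟩, p, q, hseg, hgcd⟩ := hP
  obtain ⟨u₁, u₂, hco, h1, h2⟩ := Int.exists_gcd_one (m := q.1 - p.1) (n := q.2 - p.2) (by omega)
  obtain ⟨r, s, hrs⟩ := Int.isCoprime_iff_gcd_eq_one.2 hco
  have hn : ((Int.gcd (q.1 - p.1) (q.2 - p.2) : ℕ) : ℤ) = g - 1 := by omega
  rw [hn] at h1 h2
  -- The rows (r, s) and (-u₂, u₁) send the direction (u₁, u₂) to (1, 0); the translation sends `p`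
  -- to (1, 0).
  set U : UnimodularMap :=
    ⟨r, s, -u₂, u₁, 1 - (r * p.1 + s * p.2), u₂ * p.1 - u₁ * p.2, by linear_combination hrs⟩ with hU
  have h1' : (q.1 : ℝ) - p.1 = u₁ * (g - 1) := by exact_mod_cast h1
  have h2' : (q.2 : ℝ) - p.2 = u₂ * (g - 1) := by exact_mod_cast h2
  have hrs' : (r : ℝ) * u₁ + s * u₂ = 1 := by exact_mod_cast hrs
  have hg' : (2 : ℝ) ≤ g := by exact_mod_cast hg
  have hsub : U.onLattice '' interiorLatticePoints P ⊆ {a : ℤ × ℤ | a.2 = 0 ∧ 1 ≤ a.1 ∧ a.1 ≤ g} := by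
    rintro _ ⟨a, ha, rfl⟩
    have hmem : toPlane a ∈ interiorHull P := subset_convexHull ℝ _ (mem_image_of_mem _ ha)
    rw [hseg, segment_eq_image'] at hmem
    obtain ⟨θ, ⟨hθ0, hθ1⟩, hθ⟩ := hmem
    have e1 := congrArg Prod.fst hθ
    have e2 := congrArg Prod.snd hθ
    simp only [toPlane, Prod.fst_add, Prod.snd_add, Prod.smul_fst, Prod.smul_snd, Prod.fst_sub,
      Prod.snd_sub, smul_eq_mul] at e1 e2
    rw [h1'] at e1
    rw [h2'] at e2
    have f1 : ((U.onLattice a).1 : ℝ) = 1 + θ * (g - 1) := by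
      simp only [UnimodularMap.onLattice, hU]
      push_cast
      linear_combination (-r) * e1 - s * e2 + θ * (g - 1) * hrs'
    have f2 : ((U.onLattice a).2 : ℝ) = 0 := by
      simp only [UnimodularMap.onLattice, hU]
      push_cast
      linear_combination u₂ * e1 - u₁ * e2
    have g1 : (1 : ℝ) ≤ (U.onLattice a).1 := by
      rw [f1]
      nlinarith
    have g2 : ((U.onLattice a).1 : ℝ) ≤ g := by
      rw [f1]
      nlinarith
    exact ⟨by exact_mod_cast f2, by exact_mod_cast g1, by exact_mod_cast g2⟩
  have hrow : {a : ℤ × ℤ | a.2 = 0 ∧ 1 ≤ a.1 ∧ a.1 ≤ g} =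
      (((Finset.Icc (1 : ℤ) g).image fun i => (i, (0 : ℤ)) : Finset (ℤ × ℤ)) : Set (ℤ × ℤ)) := by
    ext ⟨x, y⟩
    simp only [Set.mem_ofPred_eq, Finset.coe_image, Finset.coe_Icc, mem_image, mem_Icc,
      Prod.mk.injEq]
    constructor
    · rintro ⟨rfl, h⟩
      exact ⟨x, h, rfl, rfl⟩
    · rintro ⟨x, h, rfl, rfl⟩
      exact ⟨rfl, h⟩
  -- The row has exactly g lattice points and there are g interior points, so the inclusion is an
  -- equality.
  have heq : U.onLattice '' interiorLatticePoints P =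
      {a : ℤ × ℤ | a.2 = 0 ∧ 1 ≤ a.1 ∧ a.1 ≤ g} := by
    refine eq_of_subset_of_ncard_le hsub ?_ ?_
    · rw [ncard_image_of_injective _ U.injective, hcard, hrow, ncard_coe_finset]
      refine Finset.card_image_le.trans ?_
      simp
    · rw [hrow]
      exact Finset.finite_toSet _
  refine ⟨U, U.isLatticePolygon_image hpoly, fun x => ?_⟩
  obtain ⟨a, rfl⟩ := U.surjective x
  rw [U.mem_interior_image, ← U.injective.mem_set_image, heq]
  rfl

/-! ### Curves with hyperelliptic Newton polygons -/

theorem IsLatticeEmbedding.restrict {G : WeightedGraph} {ℓ : G.E → ℝ≥0} {C C' : Set (ℝ × ℝ)}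
    {φ : G.V → ℝ × ℝ} {γ : G.E → ℝ → ℝ × ℝ} (h : IsLatticeEmbedding G ℓ C φ γ)
    (hv : ∀ v, φ v ∈ C') (he : pathImage ℓ γ ⊆ C') : IsLatticeEmbedding G ℓ C' φ γ :=
  { h with
    vertex_mem := hv
    path_mem := fun e t ht => he (mem_iUnion.2 ⟨e, t, ht, rfl⟩) }

/-- The transported graph is compact, so the middle row can be completed without changing the curve
where the graph lies. In the full strip the graph has to be the chain. -/
theorem IsHyperelliptic.exists_strip_of_realized {g : ℕ} (hg : 2 ≤ g) {P : Set (ℝ × ℝ)}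
    (hP : IsHyperelliptic g P) {x : Moduli g} (hx : x ∈ realized g P) :
    ∃ S : Strip, S.IsFull g ∧ S.IsSmooth ∧
      x = Moduli.mk (chainType g hg (S.chainSplit g)) (S.stripLength g hg) := by
  obtain ⟨U, hU⟩ := hP.exists_isStandard hg
  obtain ⟨G, ℓ, rfl, hw, hℓ, h, hs, φ, γ, hemb⟩ := hx
  obtain ⟨S, hS, hpts, hheight⟩ := hU.exists_strip hg fun a => h (U.inverse a)
  have hiff : ∀ a, U.onLattice a ∈ S.points ↔ a ∈ latticePoints P := fun a => by
    rw [hpts]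
    exact U.toPlane_onLattice_mem_image
  have hh : ∀ a, S.height (U.onLattice a) = h a := fun a => by
    rw [hheight]
    exact congrArg h (U.inverse_onLattice a)
  have hSs : S.IsSmooth := (UnimodularMap.isMaxSmooth_iff hiff hh).2 hs
  have hemb' := hemb.map (a := -U.d) (b := U.c) (c := U.b) (d := -U.a) (L := U.dual)
    (by linear_combination U.det) (fun q => rfl)
    fun q hq => UnimodularMap.dual_mem_maxCurve hiff hh hq
  have hbdd : Bornology.IsBounded
      (range (fun v => U.dual (φ v)) ∪ pathImage ℓ fun e t => U.dual (γ e t)) :=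
    (finite_range _).isBounded.union hemb'.isCompact_pathImage.isBounded
  obtain ⟨Y, hY⟩ := hbdd.subset_closedBall 0
  have hY' : ∀ q ∈ range (fun v => U.dual (φ v)) ∪ pathImage ℓ fun e t => U.dual (γ e t),
      |q.1| ≤ Y := fun q hq => by
    have := hY hq
    rw [mem_closedBall_zero_iff, Prod.norm_def, sup_le_iff] at this
    exact this.1
  obtain ⟨S', hf', hs', hsub⟩ := hS.exists_isFull hg hSs Y
  refine ⟨S', hf', hs', Strip.mk_eq_chain hg hf' hs' (hemb'.restrict (fun v => ?_) ?_) hw hℓ⟩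
  · exact hsub _ (hemb'.vertex_mem v) (hY' _ (Or.inl (mem_range_self v)))
  · exact fun q hq => hsub q (hemb'.pathImage_subset hq) (hY' q (Or.inr hq))

theorem Strip.mk_chain_mem_moduliChain (S : Strip) {g : ℕ} (hg : 2 ≤ g) :
    Moduli.mk (chainType g hg (S.chainSplit g)) (S.stripLength g hg) ∈ moduliChain g hg :=
  ⟨_, _, _, _, rfl⟩

/-! ### The hyperelliptic triangle -/

theorem mem_hyperellipticTriangle_iff {g : ℕ} {q : ℝ × ℝ} :
    q ∈ hyperellipticPolygon g (g + 2) ↔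
      0 ≤ q.1 ∧ 0 ≤ q.2 ∧ q.1 + (g + 1) * q.2 ≤ 2 * g + 2 := by
  have hg0 : (0 : ℝ) ≤ g := Nat.cast_nonneg g
  constructor
  · suffices h : hyperellipticPolygon g (g + 2) ⊆
        {q | 0 ≤ q.1 ∧ 0 ≤ q.2 ∧ q.1 + (g + 1) * q.2 ≤ 2 * g + 2} from fun hq => h hq
    refine convexHull_min ?_ ?_
    · rintro q (rfl | rfl | rfl | rfl) <;> refine ⟨?_, ?_, ?_⟩ <;> push_cast <;> linarith
    · rintro q ⟨h1, h2, h3⟩ q' ⟨h1', h2', h3'⟩ u v hu hv huv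
      simp only [Set.mem_ofPred_eq, Prod.fst_add, Prod.snd_add, Prod.smul_fst, Prod.smul_snd,
        smul_eq_mul]
      refine ⟨by positivity, by positivity, ?_⟩
      have e1 := mul_le_mul_of_nonneg_left h3 hu
      have e2 := mul_le_mul_of_nonneg_left h3' hv
      have e3 : (2 * g + 2 : ℝ) = u * (2 * g + 2) + v * (2 * g + 2) := by
        rw [← add_mul, huv, one_mul]
      linarith
  · rintro ⟨h1, h2, h3⟩
    have hN : (0 : ℝ) < 2 * g + 2 := by linarith
    -- For k = g + 2 the fourth vertex coincides with (0, 2); the barycentric coordinates below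
    -- refer to the remaining triangle.
    have hmem : ∀ i : Fin 3, (![((0 : ℝ), (0 : ℝ)), (0, 2), ((2 * g + 2 : ℝ), 0)] : Fin 3 → ℝ × ℝ) i ∈
        hyperellipticPolygon g (g + 2) := by
      intro i
      refine subset_convexHull ℝ _ ?_
      fin_cases i
      · exact Or.inl rfl
      · exact Or.inr (Or.inl rfl)
      · refine Or.inr (Or.inr (Or.inl ?_))
        refine Prod.ext ?_ rfl
        simp
        ring
    have hconv : Convex ℝ (hyperellipticPolygon g (g + 2)) := convex_convexHull ℝ _
    have h := hconv.sum_mem (t := (Finset.univ : Finset (Fin 3)))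
      (w := ![1 - q.2 / 2 - q.1 / (2 * g + 2), q.2 / 2, q.1 / (2 * g + 2)]) ?_ ?_
      (fun i _ => hmem i)
    · convert h using 1
      rw [Fin.sum_univ_three]
      refine Prod.ext ?_ ?_
      · simp
        field_simp
      · simp
    · intro i _
      fin_cases i
      · have : 1 - q.2 / 2 - q.1 / (2 * g + 2) =
            (2 * g + 2 - (q.1 + (g + 1) * q.2)) / (2 * g + 2) := by
          field_simp
          ring
        change 0 ≤ 1 - q.2 / 2 - q.1 / (2 * g + 2)
        rw [this]
        exact div_nonneg (by linarith) hN.le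
      · change 0 ≤ q.2 / 2
        positivity
      · change 0 ≤ q.1 / (2 * g + 2)
        positivity
    · rw [Fin.sum_univ_three]
      simp only [Matrix.cons_val]
      ring

theorem mem_interior_of_strict {g : ℕ} {q : ℝ × ℝ} (h1 : 0 < q.1) (h2 : 0 < q.2)
    (h3 : q.1 + (g + 1) * q.2 < 2 * g + 2) : q ∈ interior (hyperellipticPolygon g (g + 2)) := by
  refine mem_interior.2 ⟨{q | 0 < q.1 ∧ 0 < q.2 ∧ q.1 + (g + 1) * q.2 < 2 * g + 2}, ?_, ?_,
    ⟨h1, h2, h3⟩⟩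
  · exact fun q hq => mem_hyperellipticTriangle_iff.2 ⟨hq.1.le, hq.2.1.le, hq.2.2.le⟩
  · exact (isOpen_lt continuous_const continuous_fst).inter
      ((isOpen_lt continuous_const continuous_snd).inter
        (isOpen_lt (continuous_fst.add (continuous_const.mul continuous_snd)) continuous_const))

theorem isLatticePolygon_hyperellipticTriangle {g : ℕ} (hg : 2 ≤ g) :
    IsLatticePolygon (hyperellipticPolygon g (g + 2)) := by
  refine ⟨⟨{(0, 0), (0, 2), ((g : ℤ) + (g + 2 : ℕ), 0), ((g : ℤ) + 2 - (g + 2 : ℕ), 2)}, ?_⟩,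
    (1, 1), ?_⟩
  · simp only [Finset.coe_insert, Finset.coe_singleton, image_insert_eq, image_singleton]
    simp [hyperellipticPolygon, toPlane]
  · have : (2 : ℝ) ≤ g := by exact_mod_cast hg
    exact mem_interior_of_strict (by norm_num) (by norm_num) (by norm_num; linarith)

theorem interiorLatticePoints_hyperellipticTriangle {g : ℕ} (hg : 2 ≤ g) :
    interiorLatticePoints (hyperellipticPolygon g (g + 2)) =
      (fun i : ℤ => (i, (1 : ℤ))) '' Icc 1 (g : ℤ) := by
  have hP := isLatticePolygon_hyperellipticTriangle hg
  ext ⟨x, y⟩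
  constructor
  · intro h
    have h1 := hP.lt_of_mem_interior (α := 1) (β := 0) (κ := 0) (by simp)
      (fun a ha => by
        have : (0 : ℝ) ≤ a.1 := (mem_hyperellipticTriangle_iff.1 ha).1
        linarith) h
    have h2 := hP.lt_of_mem_interior (α := 0) (β := 1) (κ := 0) (by simp)
      (fun a ha => by
        have : (0 : ℝ) ≤ a.2 := (mem_hyperellipticTriangle_iff.1 ha).2.1
        linarith) h
    have h3 := hP.lt_of_mem_interior (α := -1) (β := -(g + 1)) (κ := -(2 * g + 2)) (by simp)
      (fun a ha => by
        have : (a.1 : ℝ) + (g + 1) * a.2 ≤ 2 * g + 2 := (mem_hyperellipticTriangle_iff.1 ha).2.2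
        linarith) h
    simp only [toPlane] at h1 h2 h3
    have h1' : 0 < x := by
      have : (0 : ℝ) < x := by linarith
      exact_mod_cast this
    have h2' : 0 < y := by
      have : (0 : ℝ) < y := by linarith
      exact_mod_cast this
    have h3' : x + (g + 1) * y < 2 * g + 2 := by
      have : (x : ℝ) + (g + 1) * y < 2 * g + 2 := by linarith
      exact_mod_cast this
    obtain rfl : y = 1 := by
      by_contra hne
      have : 2 ≤ y := by omega
      nlinarith
    exact ⟨x, ⟨by omega, by linarith⟩, rfl⟩
  · rintro ⟨i, ⟨h1, h2⟩, heq⟩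
    rw [← heq]
    have h1' : (1 : ℝ) ≤ i := by exact_mod_cast h1
    have h2' : (i : ℝ) ≤ g := by exact_mod_cast h2
    refine mem_interior_of_strict ?_ ?_ ?_ <;> simp only [toPlane] <;> push_cast <;> linarith

theorem isHyperelliptic_hyperellipticTriangle {g : ℕ} (hg : 2 ≤ g) :
    IsHyperelliptic g (hyperellipticPolygon g (g + 2)) := by
  have hI := interiorLatticePoints_hyperellipticTriangle hg
  have hg' : (2 : ℝ) ≤ g := by exact_mod_cast hg
  refine ⟨⟨isLatticePolygon_hyperellipticTriangle hg, ?_⟩, (1, 1), (g, 1), ?_, ?_⟩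
  · rw [hI, ncard_image_of_injective _ fun a b h => (Prod.mk.inj h).1, ncard_eq_toFinset_card']
    simp
  · rw [interiorHull, hI]
    refine Subset.antisymm (convexHull_min ?_ (convex_segment _ _)) (segment_subset_convexHull ?_ ?_)
    · rintro _ ⟨_, ⟨i, ⟨h1, h2⟩, rfl⟩, rfl⟩
      have h1' : (1 : ℝ) ≤ i := by exact_mod_cast h1
      have h2' : (i : ℝ) ≤ g := by exact_mod_cast h2
      have h3 : (0 : ℝ) < g - 1 := by linarith
      refine ⟨(g - i) / (g - 1), (i - 1) / (g - 1), div_nonneg (by linarith) h3.le,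
        div_nonneg (by linarith) h3.le, by field_simp; ring, ?_⟩
      simp only [toPlane, Prod.smul_mk, smul_eq_mul, Prod.mk_add_mk]
      push_cast
      refine Prod.ext ?_ ?_ <;> dsimp only <;> field_simp <;> ring
    · exact ⟨_, ⟨1, ⟨le_rfl, by omega⟩, rfl⟩, rfl⟩
    · exact ⟨_, ⟨g, ⟨by omega, le_rfl⟩, rfl⟩, rfl⟩
  · simp only [sub_self, Int.gcd_zero_right]
    omega

/-- The translation from the hyperelliptic triangle to the triangular strip. -/
def shiftDown : UnimodularMap := ⟨1, 0, 0, 1, 0, -1, by norm_num⟩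

theorem shiftDown_mem_points_iff {g : ℕ} {c w : ℤ → ℝ} (a : ℤ × ℤ) :
    shiftDown.onLattice a ∈ (Strip.triangle g c w).points ↔
      a ∈ latticePoints (hyperellipticPolygon g (g + 2)) := by
  obtain ⟨x, y⟩ := a
  have h1 : (x, y) ∈ latticePoints (hyperellipticPolygon g (g + 2)) ↔
      0 ≤ x ∧ 0 ≤ y ∧ x + (g + 1) * y ≤ 2 * g + 2 := by
    refine mem_hyperellipticTriangle_iff.trans ?_
    simp only [toPlane]
    refine and_congr (by exact_mod_cast Iff.rfl) (and_congr (by exact_mod_cast Iff.rfl) ?_)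
    exact_mod_cast Iff.rfl
  have h2 : shiftDown.onLattice (x, y) = (x, y - 1) := by
    simp [UnimodularMap.onLattice, shiftDown, sub_eq_add_neg]
  rw [h1, h2]
  simp only [Strip.points, Strip.triangle, Set.mem_ofPred_eq, Finset.mem_singleton, Finset.mem_Icc]
  constructor
  · rintro (⟨h, rfl⟩ | ⟨h, h3, h4⟩ | ⟨h, h3, h4⟩)
    · obtain rfl : y = 2 := by omega
      exact ⟨le_rfl, by norm_num, by linarith⟩
    · obtain rfl : y = 1 := by omega
      exact ⟨h3, by norm_num, by linarith⟩
    · obtain rfl : y = 0 := by omega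
      exact ⟨h3, le_rfl, by linarith⟩
  · rintro ⟨h3, h4, h5⟩
    have h6 : y ≤ 2 := by
      by_contra! h
      have : 3 ≤ y := by omega
      nlinarith
    obtain rfl | rfl | rfl : y = 0 ∨ y = 1 ∨ y = 2 := by omega
    · exact Or.inr (Or.inr ⟨by norm_num, h3, by linarith⟩)
    · exact Or.inr (Or.inl ⟨by norm_num, h3, by linarith⟩)
    · exact Or.inl ⟨by norm_num, by linarith⟩

/-- The chains of smooth triangular strips are realized in the hyperelliptic triangle. -/
theorem triangle_chain_mem_realized {g : ℕ} (hg : 2 ≤ g) {c w : ℤ → ℝ}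
    (hs : (Strip.triangle g c w).IsSmooth) :
    Moduli.mk (chainType g hg ((Strip.triangle g c w).chainSplit g))
      ((Strip.triangle g c w).stripLength g hg) ∈
        realized g (hyperellipticPolygon g (g + 2)) := by
  have hf := Strip.triangle_isFull g c w
  have hh : ∀ a, (Strip.triangle g c w).height (shiftDown.onLattice a) =
      (Strip.triangle g c w).height (shiftDown.onLattice a) := fun _ => rfl
  exact ⟨_, _, rfl, fun _ => rfl, Strip.stripLength_pos hg hf hs,
    fun a => (Strip.triangle g c w).height (shiftDown.onLattice a),
    (UnimodularMap.isMaxSmooth_iff shiftDown_mem_points_iff hh).1 hs, _, _,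
    (Strip.isLatticeEmbedding_chain hg hf hs).map (a := -shiftDown.a) (b := -shiftDown.c)
      (c := -shiftDown.b) (d := -shiftDown.d) (L := shiftDown.dualInverse)
      (by linear_combination shiftDown.det) (fun q => rfl)
      fun q hq => UnimodularMap.dualInverse_mem_tropicalCurve shiftDown_mem_points_iff hh hq⟩

/-- The chain depends only on the walls and the gaps at them, and these are reproduced by a smooth
strip of the triangle. -/
theorem IsHyperelliptic.realized_subset {g : ℕ} (hg : 2 ≤ g) {P : Set (ℝ × ℝ)}
    (hP : IsHyperelliptic g P) : realized g P ⊆ realized g (hyperellipticPolygon g (g + 2)) := by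
  intro x hx
  obtain ⟨S, hf, hs, rfl⟩ := hP.exists_strip_of_realized hg hx
  obtain ⟨c, w, hT, hwall⟩ := Strip.exists_triangle hf hs
  rw [Strip.mk_chain_congr (S' := Strip.triangle g c w) hg (fun k h0 hk => ((hwall k h0 hk).1).symm)
    fun k h0 hk => by rw [(hwall k h0 hk).1, (hwall k h0 hk).2]]
  exact triangle_chain_mem_realized hg hT

theorem realized_hyperellipticTriangle_subset_moduliChain {g : ℕ} (hg : 2 ≤ g) :
    realized g (hyperellipticPolygon g (g + 2)) ⊆ moduliChain g hg := fun x hx => by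
  obtain ⟨S, -, -, rfl⟩ := (isHyperelliptic_hyperellipticTriangle hg).exists_strip_of_realized hg hx
  exact S.mk_chain_mem_moduliChain hg

end TropicalModuli

theorem theorem6p1 (g : ℕ) (hg : 2 ≤ g) :
    moduliOfPolygon g (hyperellipticPolygon g (g + 2)) = moduliPlanarHyp g ∧
    moduliPlanarHyp g ⊆ moduliChain g hg ∩ moduliPlanar g ∧
    realized g (hyperellipticPolygon g (g + 2)) =
      ⋃ (P : Set (ℝ × ℝ)) (_ : IsHyperelliptic g P), realized g P ∧
    dimension (moduliPlanarHyp g) = ((2 * g - 1 : ℕ) : ENNReal) ∧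
    dimension (moduliChain g hg ∩ moduliPlanar g) = ((2 * g - 1 : ℕ) : ENNReal) := by
  have hE := isHyperelliptic_hyperellipticTriangle hg
  have h1 : moduliOfPolygon g (hyperellipticPolygon g (g + 2)) = moduliPlanarHyp g :=
    Set.Subset.antisymm (Set.subset_iUnion₂_of_subset _ hE subset_rfl)
      (Set.iUnion₂_subset fun P hP => closure_mono (hP.realized_subset hg))
  have h2 : moduliPlanarHyp g ⊆ moduliChain g hg := by
    rw [← h1]
    exact closure_minimal (realized_hyperellipticTriangle_subset_moduliChain hg)
      (isClosed_moduliChain hg)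
  have h3 : moduliPlanarHyp g ⊆ moduliPlanar g :=
    Set.iUnion₂_subset fun P hP => Set.subset_iUnion₂_of_subset P hP.1 subset_rfl
  have h4 := Set.subset_inter h2 h3
  have hle : dimension (moduliChain g hg ∩ moduliPlanar g) ≤ ((2 * g - 1 : ℕ) : ENNReal) :=
    (dimension_mono Set.inter_subset_left).trans (dimension_moduliChain_le hg)
  -- The chains with positive lengths and all nodes split left/right already fill a set of full
  -- dimension 2g - 1, and all of them come from the triangle.
  have hge : ((2 * g - 1 : ℕ) : ENNReal) ≤ dimension (moduliPlanarHyp g) := by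
    refine le_dimension_of_chain hg _ fun a d m ha hd hm => ?_
    obtain ⟨c, w, hs, heq⟩ := Strip.exists_triangle_of_chain hg a d m ha hd hm
    rw [← heq, ← h1]
    exact subset_closure (triangle_chain_mem_realized hg hs)
  refine ⟨h1, h4, ?_, le_antisymm ((dimension_mono h4).trans hle) hge,
    le_antisymm hle (hge.trans (dimension_mono h4))⟩
  exact Set.Subset.antisymm (Set.subset_iUnion₂_of_subset _ hE subset_rfl)
    (Set.iUnion₂_subset fun P hP => hP.realized_subset hg)
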